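/- **Setting.** Let $(Y_i,T_i,X_i)$, $i=1,\dots,n$ ($n\ge 1$), be i.i.d. copies of $(Y,T,X)$, where $Y$ is a real outcome, $T\in\mathcal T=\{0,\dots,K-1\}$ ($K\ge 2$) a treatment and $X$ a vector of covariates. There are potential outcomes $Y^{(k)}$ with $Y=Y^{(T)}$ (consistency), and $R^{(k)}=1\{T=k\}$ and $Y^{(k)}$ are conditionally independent given $X$ for each $k$ (unconfoundedness). Fix $t\in\mathcal T$, measurable regressors $f=(f_0,\dots,f_p)^{\mathsf T}$ with $f_0\equiv1$, and a differentiable inverse link $\psi:\mathbb R\to\mathbb R$ with derivative $\psi_2$; put $\Psi(u)=\int_0^u\psi$. Neither of the models below is assumed to be correct. Coefficients are $(p+1)\times(K-1)$ matrices $b=(b_{jk})_{0\le j\le p,\,k\ne t}$ with columns $b_k$ and rows $b_{j\cdot}$; $\|b\|_{2,1}=\sum_{j=0}^p\|b_{j\cdot}\|_2$. With $\gamma_t=0$, let $\pi(k,X;\gamma)=e^{\gamma_k^{\mathsf T}f(X)}/\sum_{l\in\mathcal T}e^{\gamma_l^{\mathsf T}f(X)}$ be the propensity score (PS) model, $\omega(k,X;\gamma)=\pi(k,X;\gamma)/\pi(t,X;\gamma)$,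 and $m(X;a)=\psi(a^{\mathsf T}f(X))$ the outcome (GLM) model. Let $\tilde{\mathrm E}$ be the sample average and $$\ell_{\rm CAL}(\gamma)=\tilde{\mathrm E}\sum_{k\ne t}\{R^{(t)}e^{\gamma_k^{\mathsf T}f(X)}-R^{(k)}\gamma_k^{\mathsf T}f(X)\},$$ $$\ell_{\rm WL}(\alpha;\gamma)=\tilde{\mathrm E}\sum_{k\ne t}R^{(t)}e^{\gamma_k^{\mathsf T}f(X)}\big[-Y\,\alpha^{(k)\mathsf T}f(X)+\Psi\{\alpha^{(k)\mathsf T}f(X)\}\big],$$ $$\hat\mu_t(\alpha,\gamma)=\tilde{\mathrm E}\Big(R^{(t)}Y+\sum_{k\ne t}\big[R^{(t)}\omega(k,X;\gamma)Y-\{R^{(t)}\omega(k,X;\gamma)-R^{(k)}\}m(X;\alpha^{(k)})\big]\Big).$$ Let $\hat\gamma$ minimize $\ell_{\rm CAL}(\gamma)+A_1\tilde\lambda_1\sum_{j=1}^p\|\gamma_{j\cdot}\|_2$, let $\hat\alpha$ minimize $\ell_{\rm WL}(\alpha;\hat\gamma)+A_2\tilde\lambda_2\sum_{j=1}^p\|\alpha_{j\cdot}\|_2$,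 let $\bar\gamma$ minimize $\mathrm E\,\ell_{\rm CAL}(\gamma)$ and let $\bar\alpha$ minimize $\mathrm E\,\ell_{\rm WL}(\alpha;\bar\gamma)$. Let $0<\epsilon<1$ and, with $\rho=\sqrt{(K-1)/n+\log\{(p+1)/\epsilon\}/n}$, $$\tilde\lambda_1=4\sqrt2B_0^2B_1\rho,\qquad \tilde\lambda_2=\max\{\tilde\lambda_1,\ \sqrt3B_0(B_1-1)\sigma_0\rho\}.$$ Let $S_\gamma=\{0\}\cup\{j\ge1:\bar\gamma_{j\cdot}\ne0\}$, $S_\alpha=\{0\}\cup\{j\ge1:\bar\alpha_{j\cdot}\ne0\}$ (this is $S_{\alpha_t}$). For a set $S$ and constants $\nu,\xi$, the *compatibility condition* is: every matrix $b$ with $\sum_{j\notin S}\|b_{j\cdot}\|_2\le\xi\sum_{j\in S}\|b_{j\cdot}\|_2$ satisfies $\nu^2(\sum_{j\in S}\|b_{j\cdot}\|_2)^2\le|S|\sum_{k\ne t}b_k^{\mathsf T}\mathrm E\{R^{(t)}\omega(k,X;\bar\gamma)f(X)f(X)^{\mathsf T}\}b_k$. **Assumption 1.** (i) $\max_{1\le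 j\le p}|f_j(X)|\le B_0$ a.s., $B_0\ge1$; (ii) $\pi(t,X;\bar\gamma)^{-1}\le B_1$ a.s., $B_1>1$; (iii) the compatibility condition holds with $S_\gamma$, $\nu_1>0$, $\xi_1>1$; (iv) $(\xi_1+1)^2\nu_1^{-2}|S_\gamma|\tilde\lambda_1\le\eta_{1,1}$ and $B_0(\xi_1+1)^2(A_1-1)(1-\eta_{1,1})^{-1}\nu_1^{-2}|S_\gamma|\tilde\lambda_1\le\eta_{1,2}$, with $0<\eta_{1,1},\eta_{1,2}<1$. **Assumption 2.** (i) For each $k\ne t$, $\mathrm E[\exp\{(Y^{(t)}-m(X;\bar\alpha^{(k)}))^2/\sigma_0^2\}\mid X]\le2$ a.s., $\sigma_0>0$; (ii) the compatibility condition holds with $S_\alpha$, $\nu_2>0$, $\xi_2>1$; (iii), (iv) $C_2\le\psi_2\{\bar\alpha^{(k)\mathsf T}f(X)\}\le C_1$ a.s. for all $k\ne t$, with $C_1,C_2>0$; (v) $\psi_2(h)\le\psi_2(h')e^{C_3|h-h'|}$ for all $h,h'\in\mathbb R$, with $C_3\ge0$; (vi) $(1+\xi_2^2)\nu_2^{-2}|S_\alpha|\tilde\lambda_2\le\eta_2$,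 $\;e^{\eta_{1,3}}B_0C_3C_2^{-1}\nu_2^{-2}(\xi_2+1)^2(A_2-1)(1-\eta_2)^{-1}|S_\alpha|\tilde\lambda_2\le\eta_{2,1}$ and $e^{3\eta_{1,3}}B_0C_3C_2^{-1}\xi_{2,1}^{-2}(A_2-1)^{-1}M_{1,1}|S_\gamma|\tilde\lambda_1\le\eta_{2,2}$, with $0<\eta_2<1$ and $0\le\eta_{2,1},\eta_{2,2}<1$. Here $\eta_1$ is a constant with $|S_\gamma|\tilde\lambda_1\le\eta_1$, and $\xi_{1,1}=(\xi_1+1)(A_1-1)$, $\nu_{1,1}=\nu_1(1-\eta_{1,1})^{1/2}(1-\eta_{1,2})^{1/2}$, $M_1=\xi_{1,1}^2\nu_{1,1}^{-2}$, $\eta_{1,3}=(A_1-1)^{-1}M_1\eta_1B_0$, $M_{1,1}=3\sigma_0^2(A_1-1)^{-2}M_1^2\eta_1+2\sigma_0^2e^{\eta_{1,3}}M_1$, $\xi_{2,1}=1-2A_2/\{(\xi_2+1)(A_2-1)\}$, $\xi_{2,2}=(\xi_2+1)(A_2-1)$, $\xi_{2,3}=\xi_{2,1}(1-\eta_{2,2})^{1/2}C_2^{1/2}$,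 $\nu_{2,2}=\nu_2(1-\eta_2)^{1/2}(1-\eta_{2,1})^{1/2}C_2^{1/2}$. For $r\ge0$ let, with $g_k=R^{(t)}\omega(k,X;\bar\gamma)-R^{(k)}$, $$\Lambda(r)=\sup_{0\le j\le p,\ \|\alpha-\bar\alpha\|_{2,1}\le r}\Big\|\big(\mathrm E[\psi_2\{\alpha^{(k)\mathsf T}f(X)\}\,g_k\,f_j(X)]\big)_{k\ne t}\Big\|_2 .$$ **Theorem.** Let $A_1>(\xi_1+1)/(\xi_1-1)$ and $A_2>(\xi_2+1)/(\xi_2-1)$. There are positive constants $M_{3,1},M_{3,2},M_{3,3}$, depending only on $(B_0,B_1,A_1,\xi_1,\nu_1,\eta_1,\eta_{1,1},\eta_{1,2})$, $(\sigma_0,A_2,\xi_2,\nu_2,\eta_2)$ and $(C_1,C_2,C_3,\eta_{2,1},\eta_{2,2})$, such that the following holds whenever Assumptions 1 and 2 hold and $\{(K-1)+\log(p+1)/\epsilon\}/n\le1$. Let $M_3$ be any constant with $$e^{4\eta_{1,3}}\xi_{2,3}^{-2}M_{1,1}|S_\gamma|\tilde\lambda_1^2+e^{2\eta_{1,3}}\xi_{2,2}^2\nu_{2,2}^{-2}|S_\alpha|\tilde\lambda_2^2\le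 e^{\eta_{1,3}}M_3\big(|S_\gamma|\tilde\lambda_1\tilde\lambda_2+|S_\alpha|\tilde\lambda_2^2\big)$$ and put $\eta_3=(A_2-1)^{-1}M_3(|S_\gamma|\tilde\lambda_1+|S_\alpha|\tilde\lambda_2)$. Then, with probability at least $1-9\epsilon$, $$|\hat\mu_t(\hat\alpha,\hat\gamma)-\hat\mu_t(\bar\alpha,\bar\gamma)|\le M_{3,1}|S_\gamma|\tilde\lambda_1^2+M_{3,2}|S_\gamma|\tilde\lambda_1\tilde\lambda_2+M_{3,3}|S_\alpha|\tilde\lambda_1\tilde\lambda_2+\eta_3\Lambda(\eta_3)$$ (for every choice of the minimizers $\hat\gamma$, $\hat\alpha$). Moreover, if the PS model is correctly specified, that is, $\mathrm P(T=k\mid X)=\pi(k,X;\gamma^*)$ a.s. for all $k$ and some $\gamma^*$ with $\gamma^*_t=0$, then $\Lambda(r)=0$ for all $r\ge0$. -/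

import Mathlib

open MeasureTheory ProbabilityTheory

universe u v

noncomputable section

namespace RCAL

/-! ### Regressors, coefficient matrices, propensity scores -/

/-- Coefficient matrices `b = (b_{jk})` with `p + 1` rows `j = 0, …, p` and one column for each
treatment `k ≠ t`. For propensity score coefficients this encodes the constraint `γ_t = 0`. -/
abbrev Coef (p K : ℕ) (t : Fin K) : Type := Matrix (Fin (p + 1)) {k : Fin K // k ≠ t} ℝ

variable {p K : ℕ} {t : Fin K}

/-- The linear predictor `b_kᵀ v`. -/
def linPred (b : Coef p K t) (v : Fin (p + 1) → ℝ) (k : {k : Fin K // k ≠ t}) : ℝ :=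
  ∑ j, b j k * v j

/-- The Euclidean norm of the `j`-th row. -/
def rowNorm (b : Coef p K t) (j : Fin (p + 1)) : ℝ :=
  Real.sqrt (∑ k, b j k ^ 2)

/-- The group `L₁` norm: sum over all rows `j = 0, …, p` of the Euclidean row norms. -/
def norm21 (b : Coef p K t) : ℝ := ∑ j, rowNorm b j

/-- The group Lasso penalty: as `norm21`, but the intercept row `j = 0` is not penalized. -/
def penalty (b : Coef p K t) : ℝ := ∑ j : Fin p, rowNorm b j.succ

open Classical in
/-- The sparsity set: `0` together with the indices of the nonzero rows. -/
def sparsity (b : Coef p K t) : Finset (Fin (p + 1)) :=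
  Finset.univ.filter fun j => j = 0 ∨ ∃ k, b j k ≠ 0

/-- The index `γ_kᵀ v` for an arbitrary treatment `k`, with `γ_t = 0`. -/
def psIndex (γ : Coef p K t) (v : Fin (p + 1) → ℝ) (k : Fin K) : ℝ :=
  if h : k ≠ t then linPred γ v ⟨k, h⟩ else 0

/-- The multi-class logistic propensity score `π(k, x; γ)` at `v = f(x)`. -/
def ps (γ : Coef p K t) (v : Fin (p + 1) → ℝ) (k : Fin K) : ℝ :=
  Real.exp (psIndex γ v k) / ∑ l, Real.exp (psIndex γ v l)

/-- The probability ratio `ω(k, x; γ) = π(k, x; γ) / π(t, x; γ)` at `v = f(x)`. -/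
def psRatio (γ : Coef p K t) (v : Fin (p + 1) → ℝ) (k : Fin K) : ℝ :=
  ps γ v k / ps γ v t

/-- The treatment indicator `R^{(k)} = 1{s = k}` of a subject with treatment `s`. -/
def treatInd (s k : Fin K) : ℝ := if s = k then 1 else 0

/-! ### Losses and the augmented IPW function, for one observation `(y, s, v)`
with outcome `y`, treatment `s` and regressor vector `v = f(x)` -/

/-- Contribution of one observation to the calibration loss (with `γ_t = 0`). -/
def calLoss (γ : Coef p K t) (s : Fin K) (v : Fin (p + 1) → ℝ) : ℝ :=
  ∑ k : {k : Fin K // k ≠ t},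
    (treatInd s t * Real.exp (linPred γ v k) - treatInd s k * linPred γ v k)

/-- Contribution of one observation to the combined weighted likelihood loss in
`α = (α^{(k)} : k ≠ t)`, with inverse link `ψ` and weights determined by `γ`. -/
def wlLoss (ψ : ℝ → ℝ) (γ α : Coef p K t) (y : ℝ) (s : Fin K) (v : Fin (p + 1) → ℝ) : ℝ :=
  ∑ k : {k : Fin K // k ≠ t},
    treatInd s t * Real.exp (linPred γ v k) *
      (-(y * linPred α v k) + ∫ z in (0 : ℝ)..(linPred α v k), ψ z)

/-- The augmented IPW function `φ_t(y, s, x; α, γ)`. -/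
def phi (ψ : ℝ → ℝ) (α γ : Coef p K t) (y : ℝ) (s : Fin K) (v : Fin (p + 1) → ℝ) : ℝ :=
  treatInd s t * y + ∑ k : {k : Fin K // k ≠ t},
    (treatInd s t * y * psRatio γ v k
      - (treatInd s t * psRatio γ v k - treatInd s k) * ψ (linPred α v k))

/-! ### Sample quantities -/

variable {n : ℕ}

/-- The sample average. -/
def avg (h : Fin n → ℝ) : ℝ := (∑ i, h i) / n

/-- `γ` minimizes the calibration loss plus the group Lasso penalty with weight `lam`. -/
def IsRegCal (lam : ℝ) (s : Fin n → Fin K) (v : Fin n → Fin (p + 1) → ℝ)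
    (γ : Coef p K t) : Prop :=
  ∀ γ' : Coef p K t,
    avg (fun i => calLoss γ (s i) (v i)) + lam * penalty γ ≤
      avg (fun i => calLoss γ' (s i) (v i)) + lam * penalty γ'

/-- `α` minimizes the combined weighted likelihood loss, with weights given by `γ`, plus the
group Lasso penalty with weight `lam`. -/
def IsRegWL (ψ : ℝ → ℝ) (lam : ℝ) (y : Fin n → ℝ) (s : Fin n → Fin K)
    (v : Fin n → Fin (p + 1) → ℝ) (γ α : Coef p K t) : Prop :=
  ∀ α' : Coef p K t,
    avg (fun i => wlLoss ψ γ α (y i) (s i) (v i)) + lam * penalty α ≤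
      avg (fun i => wlLoss ψ γ α' (y i) (s i) (v i)) + lam * penalty α'

/-- The augmented IPW estimator of the treatment mean, at coefficients `α` and `γ`. -/
def aipw (ψ : ℝ → ℝ) (α γ : Coef p K t) (y : Fin n → ℝ) (s : Fin n → Fin K)
    (v : Fin n → Fin (p + 1) → ℝ) : ℝ :=
  avg fun i => phi ψ α γ (y i) (s i) (v i)

/-! ### Population quantities -/

section Population

variable {Ω : Type u} [MeasurableSpace Ω] {𝒳 : Type v} [MeasurableSpace 𝒳]

/-- `γ` minimizes the expected calibration loss; `V = f(X)`. -/
def IsCalTarget (μ : Measure Ω) (T : Ω → Fin K) (V : Ω → Fin (p + 1) → ℝ)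
    (γ : Coef p K t) : Prop :=
  ∀ γ' : Coef p K t, ∫ ω, calLoss γ (T ω) (V ω) ∂μ ≤ ∫ ω, calLoss γ' (T ω) (V ω) ∂μ

/-- `α` minimizes the expected combined weighted likelihood loss with weights given by `γ`. -/
def IsWLTarget (μ : Measure Ω) (ψ : ℝ → ℝ) (Y : Ω → ℝ) (T : Ω → Fin K)
    (V : Ω → Fin (p + 1) → ℝ) (γ α : Coef p K t) : Prop :=
  ∀ α' : Coef p K t,
    ∫ ω, wlLoss ψ γ α (Y ω) (T ω) (V ω) ∂μ ≤ ∫ ω, wlLoss ψ γ α' (Y ω) (T ω) (V ω) ∂μ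

/-- Unconfoundedness: for each treatment `k`, the indicator of `T = k` and the potential outcome
`Y^{(k)}` are conditionally independent given `X`. -/
def Unconfounded (μ : Measure Ω) (T : Ω → Fin K) (X : Ω → 𝒳) (Ypot : Fin K → Ω → ℝ) : Prop :=
  ∀ (k : Fin K) (B : Set ℝ), MeasurableSet B →
    μ⟦T ⁻¹' {k} ∩ Ypot k ⁻¹' B | MeasurableSpace.comap X inferInstance⟧ =ᵐ[μ] fun ω =>
      (μ⟦T ⁻¹' {k} | MeasurableSpace.comap X inferInstance⟧) ω *
        (μ⟦Ypot k ⁻¹' B | MeasurableSpace.comap X inferInstance⟧) ω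

/-- `Z` is uniformly sub-gaussian with parameter `σ²` given `X`:
`E[exp(Z² / σ²) | X] ≤ 2` almost surely. The conditional mean of `Z` need not vanish. -/
def CondSubGaussian (μ : Measure Ω) (X : Ω → 𝒳) (Z : Ω → ℝ) (σ : ℝ) : Prop :=
  Integrable (fun ω => Real.exp (Z ω ^ 2 / σ ^ 2)) μ ∧
    ∀ᵐ ω ∂μ, (μ[fun ω' => Real.exp (Z ω' ^ 2 / σ ^ 2) |
      MeasurableSpace.comap X inferInstance]) ω ≤ 2

/-- The theoretical compatibility condition with subset `S` and constants `ν`, `ξ`, for the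
matrices `E[R^{(t)} ω(k, X; γ) f(X) f(X)ᵀ]`, `k ≠ t`. -/
def Compat (μ : Measure Ω) (T : Ω → Fin K) (V : Ω → Fin (p + 1) → ℝ) (γ : Coef p K t)
    (S : Finset (Fin (p + 1))) (ν ξ : ℝ) : Prop :=
  ∀ b : Coef p K t,
    ∑ j ∈ Sᶜ, rowNorm b j ≤ ξ * ∑ j ∈ S, rowNorm b j →
      ν ^ 2 * (∑ j ∈ S, rowNorm b j) ^ 2 ≤
        (S.card : ℝ) * ∑ k : {k : Fin K // k ≠ t}, ∑ j, ∑ j',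
          b j k * (∫ ω, treatInd (T ω) t * psRatio γ (V ω) k * V ω j * V ω j' ∂μ) * b j' k

/-- The propensity score model is correctly specified: `P(T = k | X) = π(k, X; γ*)` almost surely
for all `k`, for some coefficient matrix `γ*` (normalized by `γ*_t = 0`). -/
def PSCorrect (μ : Measure Ω) (T : Ω → Fin K) (X : Ω → 𝒳) (V : Ω → Fin (p + 1) → ℝ)
    (t : Fin K) : Prop :=
  ∃ γ : Coef p K t, ∀ k : Fin K,
    μ⟦T ⁻¹' {k} | MeasurableSpace.comap X inferInstance⟧ =ᵐ[μ] fun ω => ps γ (V ω) k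

/-- `Λ(r)`: the supremum, over rows `j` and over `a` with `‖a - α‖_{2,1} ≤ r`, of the Euclidean
norm of the vector with entries `E[ψ'(a_kᵀ f(X)) g_k(X) f_j(X)]`, `k ≠ t`, where
`g_k = R^{(t)} ω(k, X; γ) - R^{(k)}`. -/
def Lam (μ : Measure Ω) (ψ : ℝ → ℝ) (T : Ω → Fin K) (V : Ω → Fin (p + 1) → ℝ)
    (γ α : Coef p K t) (r : ℝ) : ℝ :=
  sSup {z : ℝ | ∃ (j : Fin (p + 1)) (a : Coef p K t), norm21 (a - α) ≤ r ∧
    z = Real.sqrt (∑ k : {k : Fin K // k ≠ t},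
      (∫ ω, deriv ψ (linPred a (V ω) k) *
        (treatInd (T ω) t * psRatio γ (V ω) k - treatInd (T ω) k) * V ω j ∂μ) ^ 2)}

end Population

/-! ### Constants -/

/-- The numerical constants entering the assumptions. -/
structure Constants where
  (B0 B1 σ0 : ℝ)
  (A1 ξ1 ν1 η1 η11 η12 : ℝ)
  (A2 ξ2 ν2 η2 η21 η22 : ℝ)
  (C1 C2 C3 : ℝ)

namespace Constants

variable (c : Constants)

/-- The admissible ranges. -/
structure Valid : Prop where
  B0 : 1 ≤ c.B0
  B1 : 1 < c.B1
  σ0 : 0 < c.σ0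
  ξ1 : 1 < c.ξ1
  ν1 : 0 < c.ν1
  A1 : (c.ξ1 + 1) / (c.ξ1 - 1) < c.A1
  η11 : 0 < c.η11 ∧ c.η11 < 1
  η12 : 0 < c.η12 ∧ c.η12 < 1
  ξ2 : 1 < c.ξ2
  ν2 : 0 < c.ν2
  A2 : (c.ξ2 + 1) / (c.ξ2 - 1) < c.A2
  η2 : 0 < c.η2 ∧ c.η2 < 1
  η21 : 0 ≤ c.η21 ∧ c.η21 < 1
  η22 : 0 ≤ c.η22 ∧ c.η22 < 1
  C1 : 0 < c.C1
  C2 : 0 < c.C2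
  C3 : 0 ≤ c.C3

def ξ11 : ℝ := (c.ξ1 + 1) * (c.A1 - 1)
def ν11 : ℝ := c.ν1 * Real.sqrt (1 - c.η11) * Real.sqrt (1 - c.η12)
def M1 : ℝ := c.ξ11 ^ 2 / c.ν11 ^ 2
def η13 : ℝ := (c.A1 - 1)⁻¹ * c.M1 * c.η1 * c.B0
def M11 : ℝ :=
  3 * c.σ0 ^ 2 * c.M1 ^ 2 * c.η1 / (c.A1 - 1) ^ 2 + 2 * c.σ0 ^ 2 * Real.exp c.η13 * c.M1
def ξ21 : ℝ := 1 - 2 * c.A2 / ((c.ξ2 + 1) * (c.A2 - 1))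
def ξ22 : ℝ := (c.ξ2 + 1) * (c.A2 - 1)
def ξ23 : ℝ := c.ξ21 * Real.sqrt (1 - c.η22) * Real.sqrt c.C2
def ν21 : ℝ := c.ν2 * Real.sqrt (1 - c.η2)
def ν22 : ℝ := c.ν21 * Real.sqrt (1 - c.η21) * Real.sqrt c.C2

/-- `√((K - 1)/n + log((p + 1)/ε)/n)`. -/
def rate (K p n : ℕ) (ε : ℝ) : ℝ :=
  Real.sqrt (((K : ℝ) - 1) / n + Real.log (((p : ℝ) + 1) / ε) / n)

def lam1 (K p n : ℕ) (ε : ℝ) : ℝ :=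
  4 * Real.sqrt 2 * c.B0 ^ 2 * c.B1 * rate K p n ε

def lam2 (K p n : ℕ) (ε : ℝ) : ℝ :=
  max (c.lam1 K p n ε) (Real.sqrt 3 * c.B0 * (c.B1 - 1) * c.σ0 * rate K p n ε)

end Constants

/-! ### Assumptions -/

section Assumptions

variable {Ω : Type u} [MeasurableSpace Ω] {𝒳 : Type v} [MeasurableSpace 𝒳]

/-- The conditions for propensity score estimation; `V = f(X)`. -/
structure PSConditions (c : Constants) (n : ℕ) (ε : ℝ) (μ : Measure Ω) (T : Ω → Fin K)
    (V : Ω → Fin (p + 1) → ℝ) (γ : Coef p K t) : Prop where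
  bounded : ∀ᵐ ω ∂μ, ∀ j : Fin p, |V ω j.succ| ≤ c.B0
  overlap : ∀ᵐ ω ∂μ, (ps γ (V ω) t)⁻¹ ≤ c.B1
  compat : Compat μ T V γ (sparsity γ) c.ν1 c.ξ1
  small_a : (c.ξ1 + 1) ^ 2 / c.ν1 ^ 2 * (sparsity γ).card * c.lam1 K p n ε ≤ c.η11
  small_b : c.B0 * (c.ξ1 + 1) ^ 2 * (c.A1 - 1) * (1 - c.η11)⁻¹ / c.ν1 ^ 2 *
    (sparsity γ).card * c.lam1 K p n ε ≤ c.η12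

/-- The conditions for outcome regression; `V = f(X)`, and `Yt` is the potential outcome under
treatment `t`. -/
structure ORConditions (c : Constants) (n : ℕ) (ε : ℝ) (μ : Measure Ω) (ψ : ℝ → ℝ)
    (Yt : Ω → ℝ) (T : Ω → Fin K) (X : Ω → 𝒳) (V : Ω → Fin (p + 1) → ℝ)
    (γ α : Coef p K t) : Prop where
  subGaussian : ∀ k, CondSubGaussian μ X (fun ω => Yt ω - ψ (linPred α (V ω) k)) c.σ0
  compat : Compat μ T V γ (sparsity α) c.ν2 c.ξ2
  upper : ∀ᵐ ω ∂μ, ∀ k, deriv ψ (linPred α (V ω) k) ≤ c.C1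
  lower : ∀ᵐ ω ∂μ, ∀ k, c.C2 ≤ deriv ψ (linPred α (V ω) k)
  growth : ∀ h h' : ℝ, deriv ψ h ≤ deriv ψ h' * Real.exp (c.C3 * |h - h'|)
  small_a : (1 + c.ξ2 ^ 2) / c.ν2 ^ 2 * (sparsity α).card * c.lam2 K p n ε ≤ c.η2
  small_b : Real.exp c.η13 * c.B0 * c.C3 / c.C2 / c.ν2 ^ 2 * (c.ξ2 + 1) ^ 2 * (c.A2 - 1) *
    (1 - c.η2)⁻¹ * (sparsity α).card * c.lam2 K p n ε ≤ c.η21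
  small_c : Real.exp (3 * c.η13) * c.B0 * c.C3 / c.C2 / c.ξ21 ^ 2 * (c.A2 - 1)⁻¹ * c.M11 *
    (sparsity γ).card * c.lam1 K p n ε ≤ c.η22

end Assumptions

end RCAL

end

noncomputable section

namespace RCAL

/-! ### A Hilbert space moment inequality -/

/-! Write a = α̂ − ᾱ, b = γ̂ − γ̄, w_k = R^{(t)} exp(γ̄_kᵀf) and g_k = w_k − R^{(k)}. The augmented
IPW function is nearly orthogonal at the targets. Its derivative in γ is w_k (Y − ψ(ᾱ_kᵀf)) f, up to
sign the weighted likelihood score, so it has mean zero because ᾱ is a minimizer. Its derivative in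
α is −ψ'(ᾱ_kᵀf) g_k f, whose mean near ᾱ is what Λ measures. If the propensity model is correct,
γ̄_kᵀf is a.s. the true index, g_k has conditional mean zero given X, and Λ vanishes
(`Lam_eq_zero_of_correct`).

An exact expansion (`abs_aipw_sub_add_le`) therefore splits the error into the sample score paired
with b, at most λ₂‖b‖; second order remainders controlled by the sample quadratic forms of a and b;
and −Ẽ Σ_k g_k {ψ(α̂_kᵀf) − ψ(ᾱ_kᵀf)}. The last term is a population mean, at most ‖a‖Λ by a mean
value inequality (`LawBase.abs_integral_incrVal_le`), plus a fluctuation that has to be controlled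
uniformly over a ball, since α̂ depends on the sample.

The sizes of a and b come from the group Lasso argument (`cal_estimator_bound`,
`wl_estimator_bound`). Curvature is available only near the targets: the symmetrized Bregman
divergence dominates the quadratic form times (1 − e^{−H})/H, with H proportional to the unknown
error norm. `margin_bound` resolves this circularity. In the outcome regression the weights are
those of γ̂ and not of γ̄. They differ by factors in [e^{−η₁₃}, e^{η₁₃}], and the resulting cross
term either dominates everything or is small enough to leave a cone condition.

The probabilistic part has two tools, both integrating out one observation at a time. For sums of
Hilbert space vectors, cosh(s‖·‖) grows by a bounded factor per centred summand
(`measure_norm_sum_ge_le`), so no covering argument in the K − 1 treatment coordinates is needed.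
For the uniform fluctuation, a class of convex functions stable under averaging (`Contractive`)
allows symmetrization and contraction inside the recursion. The nonlinear sum over k is replaced by
one linear predictor with weight B₁, uniformly over `norm21 a ≤ r`
(`measure_exists_norm21_le_procVal_gt_le`).

The assumptions enter through the law of one observation (`LawBase`, `LawReg`): unconfoundedness
transfers the sub-gaussian bound to the treated, and minimality of γ̄ and ᾱ makes the scores
centred. Six exceptional events of probability at most ε each remain, and outside them the bound is
deterministic (`aipw_error_le`). -/

theorem cosh_norm_add_le_chord {E : Type*} [NormedAddCommGroup E] [InnerProductSpace ℝ E]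
    (x u : E) :
    Real.cosh ‖x + u‖ ≤ Real.cosh ‖x‖ * Real.cosh ‖u‖
      + inner ℝ x u * (Real.sinh ‖x‖ / ‖x‖) * (Real.sinh ‖u‖ / ‖u‖) := by
  rcases eq_or_ne x 0 with rfl | hx
  · simp
  rcases eq_or_ne u 0 with rfl | hu
  · simp
  have ha : 0 < ‖x‖ := norm_pos_iff.2 hx
  have hb : 0 < ‖u‖ := norm_pos_iff.2 hu
  set a := ‖x‖
  set b := ‖u‖
  set w : ℝ := inner ℝ x u / (a * b) with hw
  have hab : 0 < a * b := mul_pos ha hb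
  have hw1 : |w| ≤ 1 := by
    rw [hw, abs_div, abs_of_pos hab, div_le_one hab]
    exact abs_real_inner_le_norm x u
  have hin : inner ℝ x u = w * (a * b) := by
    rw [hw]; field_simp
  have hN : ‖x + u‖ ^ 2 = (1 + w) / 2 * (a + b) ^ 2 + (1 - w) / 2 * (a - b) ^ 2 := by
    rw [norm_add_sq_real, hin]; ring
  obtain ⟨hw2, hw3⟩ := abs_le.1 hw1
  -- With w the cosine of the angle, ‖x + u‖² is the convex combination `hN` of (a + b)² and (a −
  -- b)². The series of cosh has nonnegative coefficients in even powers, so convexity of y ↦ y^m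
  -- applies term by term.
  have key : Real.cosh ‖x + u‖ ≤
      (1 + w) / 2 * Real.cosh (a + b) + (1 - w) / 2 * Real.cosh (a - b) := by
    refine hasSum_le (fun m => ?_) (Real.hasSum_cosh ‖x + u‖)
      (((Real.hasSum_cosh (a + b)).mul_left _).add ((Real.hasSum_cosh (a - b)).mul_left _))
    rw [pow_mul, pow_mul, pow_mul, hN, mul_div_assoc', mul_div_assoc', ← add_div]
    gcongr
    have := (convexOn_pow (𝕜 := ℝ) m).2 (Set.mem_Ici.2 (sq_nonneg (a + b)))
      (Set.mem_Ici.2 (sq_nonneg (a - b)))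
      (by linarith : 0 ≤ (1 + w) / 2) (by linarith : 0 ≤ (1 - w) / 2) (by ring)
    simpa [smul_eq_mul] using this
  rw [Real.cosh_add, Real.cosh_sub] at key
  calc _ ≤ _ := key
    _ = _ := by rw [hin]; field_simp; ring

/-- The correction to cosh‖x‖ is linear in `u`, hence integrates to zero for a centred summand.
Replacing sinh‖u‖/‖u‖ by 1 in `cosh_norm_add_le_chord` costs at most cosh‖x‖ (sinh‖u‖ − ‖u‖),
because the cosine is at most 1; then cosh + sinh = exp. -/
theorem cosh_norm_add_le {E : Type*} [NormedAddCommGroup E] [InnerProductSpace ℝ E] (x u : E) :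
    Real.cosh ‖x + u‖ ≤ Real.cosh ‖x‖ * (Real.exp ‖u‖ - ‖u‖)
      + Real.sinh ‖x‖ / ‖x‖ * inner ℝ x u := by
  rcases eq_or_ne x 0 with rfl | hx
  · have h : ‖u‖ ≤ Real.sinh ‖u‖ := Real.self_le_sinh_iff.2 (norm_nonneg u)
    have := Real.cosh_add_sinh ‖u‖
    simp only [zero_add, norm_zero, Real.cosh_zero, inner_zero_left]
    linarith
  rcases eq_or_ne u 0 with rfl | hu
  · simp
  have ha : 0 < ‖x‖ := norm_pos_iff.2 hx
  have hb : 0 < ‖u‖ := norm_pos_iff.2 hu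
  have hc := cosh_norm_add_le_chord x u
  have h : ‖u‖ ≤ Real.sinh ‖u‖ := Real.self_le_sinh_iff.2 (norm_nonneg u)
  have hin : inner ℝ x u ≤ ‖x‖ * ‖u‖ := real_inner_le_norm x u
  have hs : Real.sinh ‖x‖ ≤ Real.cosh ‖x‖ := (Real.sinh_lt_cosh _).le
  have hs0 : 0 ≤ Real.sinh ‖x‖ := Real.sinh_nonneg_iff.2 ha.le
  have e1 : inner ℝ x u * (Real.sinh ‖x‖ / ‖x‖) * (Real.sinh ‖u‖ / ‖u‖)
      - Real.sinh ‖x‖ / ‖x‖ * inner ℝ x u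
      = inner ℝ x u / (‖x‖ * ‖u‖) * (Real.sinh ‖x‖ * (Real.sinh ‖u‖ - ‖u‖)) := by
    field_simp
  have e2 : inner ℝ x u / (‖x‖ * ‖u‖) * (Real.sinh ‖x‖ * (Real.sinh ‖u‖ - ‖u‖))
      ≤ 1 * (Real.cosh ‖x‖ * (Real.sinh ‖u‖ - ‖u‖)) := by
    apply mul_le_mul
    · rw [div_le_one (mul_pos ha hb)]; exact hin
    · apply mul_le_mul_of_nonneg_right hs; linarith
    · apply mul_nonneg hs0; linarith
    · norm_num
  have e3 := Real.cosh_add_sinh ‖u‖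
  rw [← e3]
  nlinarith

theorem cosh_norm_add_add_cosh_norm_sub_le {E : Type*} [NormedAddCommGroup E]
    [InnerProductSpace ℝ E] (x u : E) :
    Real.cosh ‖x + u‖ + Real.cosh ‖x - u‖ ≤ 2 * (Real.cosh ‖x‖ * Real.cosh ‖u‖) := by
  have h1 := cosh_norm_add_le_chord x u
  have h2 := cosh_norm_add_le_chord x (-u)
  rw [norm_neg, inner_neg_right, ← sub_eq_add_neg] at h2
  linarith

/-! ### Iterated integration over an i.i.d. sample -/

section Sample

variable {𝒵 : Type*} [MeasurableSpace 𝒵] {ν : Measure 𝒵} [IsProbabilityMeasure ν]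

open ENNReal in
-- A supermartingale argument without filtrations: `J m` bounds the expected final value when `m`
-- observations are still to come.
theorem lintegral_pi_add_sum_le {E : Type*} [AddCommMonoid E] [MeasurableSpace E]
    [MeasurableAdd₂ E] {g : 𝒵 → E} (hg : Measurable g) {J : ℕ → E → ℝ≥0∞}
    (hJ : ∀ m, Measurable (J m))
    (step : ∀ m x, ∫⁻ z, J m (x + g z) ∂ν ≤ J (m + 1) x) (n : ℕ) (x : E) :
    ∫⁻ z : Fin n → 𝒵, J 0 (x + ∑ i, g (z i)) ∂(Measure.pi fun _ => ν) ≤ J n x := by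
  induction n generalizing x with
  | zero => simp
  | succ n ih =>
    have hmp := (measurePreserving_piFinSuccAbove (fun _ : Fin (n + 1) => ν) 0).symm
    have hmeas : Measurable fun z : Fin (n + 1) → 𝒵 => J 0 (x + ∑ i, g (z i)) := by
      refine (hJ 0).comp (measurable_const.add ?_)
      exact Finset.measurable_sum _ fun i _ => hg.comp (measurable_pi_apply i)
    rw [← hmp.lintegral_comp hmeas]
    have hprod := lintegral_prod (μ := ν) (ν := Measure.pi fun _ : Fin n => ν) _
      (hmeas.comp hmp.measurable).aemeasurable
    simp only [Function.comp_apply] at hprod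
    refine hprod.le.trans ?_
    refine le_trans (lintegral_mono fun z0 => ?_) (step n x)
    refine le_trans (le_of_eq ?_) (ih (x + g z0))
    refine lintegral_congr fun z => ?_
    congr 1
    rw [Fin.sum_univ_succ, ← add_assoc]
    simp [MeasurableEquiv.piFinSuccAbove]

/-- With `m` observations to come, the bound is e^{cm} cosh(s‖x‖), since the linear term of
`cosh_norm_add_le` vanishes on integration. The estimate is free of the dimension of `E`; the factor
2 comes from cosh ≥ exp/2. -/
theorem measure_norm_sum_ge_le {E : Type*} [NormedAddCommGroup E] [InnerProductSpace ℝ E]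
    [MeasurableSpace E] [BorelSpace E] [SecondCountableTopology E] [CompleteSpace E]
    {U : 𝒵 → E} (hU : Measurable U) (hUi : Integrable U ν) (hU0 : ∫ z, U z ∂ν = 0)
    {s c : ℝ} (hs : 0 < s) (hexp : Integrable (fun z => Real.exp (s * ‖U z‖)) ν)
    (hc : ∫ z, (Real.exp (s * ‖U z‖) - s * ‖U z‖) ∂ν ≤ Real.exp c) (n : ℕ) (r : ℝ) :
    (Measure.pi fun _ : Fin n => ν) {z | r ≤ ‖∑ i, U (z i)‖} ≤
      ENNReal.ofReal (2 * Real.exp (-(s * r) + n * c)) := by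
  have hcosh : Measurable Real.cosh := Real.continuous_cosh.measurable
  have hmain := lintegral_pi_add_sum_le (ν := ν) hU
    (J := fun m x => ENNReal.ofReal (Real.exp c ^ m * Real.cosh (s * ‖x‖)))
    (fun m => ENNReal.measurable_ofReal.comp
      ((hcosh.comp (measurable_norm.const_mul s)).const_mul _)) (fun m x => by
      set G : E := (s * (Real.sinh ‖s • x‖ / ‖s • x‖)) • (s • x) with hG
      have hpt : ∀ z, Real.cosh (s * ‖x + U z‖) ≤
          Real.cosh (s * ‖x‖) * (Real.exp (s * ‖U z‖) - s * ‖U z‖) + inner ℝ G (U z) := by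
        intro z
        have h := cosh_norm_add_le (s • x) (s • U z)
        rw [← smul_add, norm_smul, norm_smul s x, norm_smul, Real.norm_of_nonneg hs.le,
          inner_smul_right] at h
        refine h.trans (le_of_eq ?_)
        rw [hG, real_inner_smul_left (s • x), norm_smul, Real.norm_of_nonneg hs.le]
        ring
      have hint1 : Integrable (fun z => Real.cosh (s * ‖x‖) *
          (Real.exp (s * ‖U z‖) - s * ‖U z‖)) ν := (hexp.sub (hUi.norm.const_mul s)).const_mul _
      have hint : Integrable (fun z => Real.exp c ^ m * (Real.cosh (s * ‖x‖) *
          (Real.exp (s * ‖U z‖) - s * ‖U z‖) + inner ℝ G (U z))) ν :=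
        (hint1.add (hUi.const_inner G)).const_mul _
      have hle : ∀ z, Real.exp c ^ m * Real.cosh (s * ‖x + U z‖) ≤
          Real.exp c ^ m * (Real.cosh (s * ‖x‖) *
          (Real.exp (s * ‖U z‖) - s * ‖U z‖) + inner ℝ G (U z)) := fun z =>
        mul_le_mul_of_nonneg_left (hpt z) (by positivity)
      calc ∫⁻ z, ENNReal.ofReal (Real.exp c ^ m * Real.cosh (s * ‖x + U z‖)) ∂ν
          ≤ ∫⁻ z, ENNReal.ofReal (Real.exp c ^ m * (Real.cosh (s * ‖x‖) *
              (Real.exp (s * ‖U z‖) - s * ‖U z‖) + inner ℝ G (U z))) ∂ν :=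
            lintegral_mono fun z => ENNReal.ofReal_le_ofReal (hle z)
        _ = ENNReal.ofReal (∫ z, Real.exp c ^ m * (Real.cosh (s * ‖x‖) *
              (Real.exp (s * ‖U z‖) - s * ‖U z‖) + inner ℝ G (U z)) ∂ν) := by
            rw [ofReal_integral_eq_lintegral_ofReal hint]
            refine Filter.Eventually.of_forall fun z => le_trans ?_ (hle z)
            have := Real.cosh_pos (s * ‖x + U z‖)
            simp only [Pi.zero_apply]
            positivity
        _ ≤ _ := by
            apply ENNReal.ofReal_le_ofReal
            rw [integral_const_mul, integral_add hint1 (hUi.const_inner G), integral_const_mul,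
              integral_inner hUi, hU0, inner_zero_right,
              add_zero, pow_succ, mul_assoc]
            have h1 : 0 < Real.cosh (s * ‖x‖) := Real.cosh_pos _
            have h2 : 0 < Real.exp c ^ m := by positivity
            rw [mul_comm (Real.exp c)]
            gcongr) n 0
  simp only [zero_add, pow_zero, one_mul, norm_zero, mul_zero, Real.cosh_zero, mul_one] at hmain
  have hmeasS : Measurable fun z : Fin n → 𝒵 => ∑ i, U (z i) :=
    Finset.measurable_sum _ fun i _ => hU.comp (measurable_pi_apply i)
  have hsub : {z : Fin n → 𝒵 | r ≤ ‖∑ i, U (z i)‖} ⊆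
      {z | ENNReal.ofReal (Real.exp (s * r) / 2) ≤
        ENNReal.ofReal (Real.cosh (s * ‖∑ i, U (z i)‖))} := by
    intro z hz
    apply ENNReal.ofReal_le_ofReal
    have h1 : Real.exp (s * r) ≤ Real.exp (s * ‖∑ i, U (z i)‖) :=
      Real.exp_le_exp.2 (mul_le_mul_of_nonneg_left hz hs.le)
    rw [Real.cosh_eq]
    have := Real.exp_pos (-(s * ‖∑ i, U (z i)‖))
    linarith
  have hmk := meas_ge_le_lintegral_div (μ := Measure.pi fun _ : Fin n => ν)
    (f := fun z => ENNReal.ofReal (Real.cosh (s * ‖∑ i, U (z i)‖)))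
    (ENNReal.measurable_ofReal.comp
      (hcosh.comp (hmeasS.norm.const_mul s))).aemeasurable
    (ε := ENNReal.ofReal (Real.exp (s * r) / 2))
    (by simp [Real.exp_pos]) ENNReal.ofReal_ne_top
  refine (measure_mono hsub).trans (hmk.trans ?_)
  refine (ENNReal.div_le_div_right hmain _).trans ?_
  rw [← ENNReal.ofReal_div_of_pos (by positivity)]
  apply ENNReal.ofReal_le_ofReal
  rw [← Real.exp_nat_mul, Real.exp_add, Real.exp_neg]
  apply le_of_eq
  field_simp

end Sample

/-! ### Elementary inequalities -/

theorem exp_sub_self_le_sq {x : ℝ} (hx : 0 ≤ x) :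
    Real.exp x - x ≤ 1 + x ^ 2 / 2 * Real.exp x := by
  have key : ∀ y : ℝ, 0 ≤ y → 0 ≤ 1 + y ^ 2 / 2 * Real.exp y - (Real.exp y - y) := by
    have hd : ∀ y : ℝ, HasDerivAt (fun y => 1 + y ^ 2 / 2 * Real.exp y - (Real.exp y - y))
        (y * Real.exp y + y ^ 2 / 2 * Real.exp y - (Real.exp y - 1)) y := by
      intro y
      have h1 : HasDerivAt (fun y : ℝ => y ^ 2 / 2) y y := by
        have := (hasDerivAt_pow 2 y).div_const 2
        simpa using this
      have h2 := Real.hasDerivAt_exp y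
      exact (((h1.mul h2).const_add 1).sub (h2.sub (hasDerivAt_id' y)))
    have hmono : MonotoneOn (fun y : ℝ => 1 + y ^ 2 / 2 * Real.exp y - (Real.exp y - y))
        (Set.Ici 0) := by
      refine monotoneOn_of_deriv_nonneg (convex_Ici 0)
        (fun y _ => (hd y).continuousAt.continuousWithinAt)
        (fun y _ => (hd y).differentiableAt.differentiableWithinAt) (fun y hy => ?_)
      rw [(hd y).deriv]
      rw [interior_Ici] at hy
      have hy0 : 0 < y := hy
      have h1 : 1 - y ≤ Real.exp (-y) := by linarith [Real.add_one_le_exp (-y)]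
      have h2 : Real.exp (-y) * Real.exp y = 1 := by rw [← Real.exp_add]; simp
      have h3 : (1 - y) * Real.exp y ≤ 1 := by
        calc _ ≤ Real.exp (-y) * Real.exp y := mul_le_mul_of_nonneg_right h1 (Real.exp_pos y).le
          _ = 1 := h2
      have h4 : 0 ≤ y ^ 2 / 2 * Real.exp y := by positivity
      linarith
    intro y hy
    have := hmono (Set.mem_Ici.2 le_rfl) (Set.mem_Ici.2 hy) hy
    simpa using this
  linarith [key x hx]

theorem exp_two_fifths_le : Real.exp (2 / 5) ≤ 3 / 2 := by
  have h := Real.exp_bound_div_one_sub_of_interval (x := 2 / 5) (by norm_num) (by norm_num)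
  have h2 := Real.exp_bound (x := 2 / 5) (by norm_num [abs_of_pos]) (n := 4) (by norm_num)
  rw [abs_le] at h2
  norm_num [Finset.sum_range_succ, Nat.factorial, abs_of_pos] at h2
  linarith

theorem exp_sub_self_le_of_le {x : ℝ} (hx : 0 ≤ x) (hx' : x ≤ 2 / 5) :
    Real.exp x - x ≤ 1 + 3 / 4 * x ^ 2 := by
  have h1 := exp_sub_self_le_sq hx
  have h2 : Real.exp x ≤ 3 / 2 := (Real.exp_le_exp.2 hx').trans exp_two_fifths_le
  nlinarith [sq_nonneg x]

/-- This is a/2 ≤ sinh(a/2), multiplied by 2e^{a/2}. -/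
theorem mul_exp_half_le {a : ℝ} (ha : 0 ≤ a) : a * Real.exp (a / 2) ≤ Real.exp a - 1 := by
  have h : a / 2 ≤ Real.sinh (a / 2) := Real.self_le_sinh_iff.2 (by linarith)
  rw [Real.sinh_eq] at h
  have h2 : Real.exp (a / 2) * Real.exp (-(a / 2)) = 1 := by rw [← Real.exp_add]; simp
  have h3 : Real.exp a = Real.exp (a / 2) * Real.exp (a / 2) := by rw [← Real.exp_add]; ring_nf
  have := Real.exp_pos (a / 2)
  nlinarith

/-- Meant for y² with exponential moment at most 2, so that the right side has mean at most 1 +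
3δ²/4. Young's inequality gives δy ≤ δ²/2 + y²/2, where δ²/2 ≤ 2/5, and 3/4 is half of the bound 3/2
for e^{2/5}. -/
theorem exp_mul_sub_self_le {δ y : ℝ} (hδ : 0 ≤ δ) (hδ' : δ ≤ 4 / 5) (hy : 0 ≤ y) :
    Real.exp (δ * y) - δ * y ≤ 1 + 3 / 4 * δ ^ 2 * (Real.exp (y ^ 2) - 1) := by
  have h1 := exp_sub_self_le_sq (mul_nonneg hδ hy)
  have h2 : Real.exp (δ * y) ≤ 3 / 2 * Real.exp (y ^ 2 / 2) := by
    calc Real.exp (δ * y) ≤ Real.exp (2 / 5 + y ^ 2 / 2) := by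
          apply Real.exp_le_exp.2; nlinarith [sq_nonneg (δ - y)]
      _ ≤ _ := by rw [Real.exp_add]; gcongr; exact exp_two_fifths_le
  have h3 := mul_exp_half_le (sq_nonneg y)
  have h4 : (δ * y) ^ 2 / 2 * Real.exp (δ * y) ≤
      3 / 4 * δ ^ 2 * (y ^ 2 * Real.exp (y ^ 2 / 2)) := by
    calc _ ≤ (δ * y) ^ 2 / 2 * (3 / 2 * Real.exp (y ^ 2 / 2)) := by gcongr
      _ = _ := by ring
  have h5 : 3 / 4 * δ ^ 2 * (y ^ 2 * Real.exp (y ^ 2 / 2)) ≤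
      3 / 4 * δ ^ 2 * (Real.exp (y ^ 2) - 1) := by gcongr
  linarith

/-- The sub-exponential analogue. The shift `y + 1` accounts for centring a variable dominated by
`y` whose mean is at most 1. -/
theorem exp_mul_add_one_sub_self_le {τ y : ℝ} (hτ : 0 ≤ τ) (hτ' : τ ≤ 1 / 5) (hy : 0 ≤ y) :
    Real.exp (τ * (y + 1)) - τ * (y + 1) ≤ 1 + 3 * τ ^ 2 * Real.exp y := by
  have h1 := exp_sub_self_le_sq (mul_nonneg hτ (by linarith : 0 ≤ y + 1))
  have h2 : y + 1 ≤ 2 * Real.exp (y / 4) := by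
    have := Real.quadratic_le_exp_of_nonneg (x := y / 4) (by positivity)
    nlinarith [sq_nonneg (1 - y / 4)]
  have h3 : (y + 1) ^ 2 ≤ 4 * Real.exp (y / 2) := by
    have : Real.exp (y / 2) = Real.exp (y / 4) * Real.exp (y / 4) := by
      rw [← Real.exp_add]; ring_nf
    rw [this]
    nlinarith [Real.exp_pos (y / 4)]
  have h4 : Real.exp (τ * (y + 1)) ≤ 3 / 2 * Real.exp (y / 2) := by
    calc Real.exp (τ * (y + 1)) ≤ Real.exp (2 / 5 + y / 2) := by
          apply Real.exp_le_exp.2; nlinarith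
      _ ≤ _ := by rw [Real.exp_add]; gcongr; exact exp_two_fifths_le
  have h5 : Real.exp y = Real.exp (y / 2) * Real.exp (y / 2) := by
    rw [← Real.exp_add]; ring_nf
  have h6 : (τ * (y + 1)) ^ 2 / 2 * Real.exp (τ * (y + 1)) ≤
      3 * τ ^ 2 * Real.exp y := by
    calc _ = τ ^ 2 / 2 * ((y + 1) ^ 2 * Real.exp (τ * (y + 1))) := by ring
      _ ≤ τ ^ 2 / 2 * ((4 * Real.exp (y / 2)) * (3 / 2 * Real.exp (y / 2))) := by gcongr
      _ = _ := by rw [h5]; ring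
  linarith

end RCAL

namespace RCAL

/-! ### Group norms -/

section Norms

variable {p K : ℕ} {t : Fin K}

theorem rowNorm_eq_norm (b : Coef p K t) (j : Fin (p + 1)) :
    rowNorm b j = ‖(WithLp.toLp 2 (b j) : EuclideanSpace ℝ {k : Fin K // k ≠ t})‖ := by
  simp [rowNorm, EuclideanSpace.norm_eq]

theorem rowNorm_nonneg (b : Coef p K t) (j : Fin (p + 1)) : 0 ≤ rowNorm b j := Real.sqrt_nonneg _

theorem norm21_nonneg (b : Coef p K t) : 0 ≤ norm21 b :=
  Finset.sum_nonneg fun j _ => rowNorm_nonneg b j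

theorem sum_row_mul_le (b : Coef p K t) (j : Fin (p + 1)) (c : {k : Fin K // k ≠ t} → ℝ) :
    ∑ k, b j k * c k ≤ rowNorm b j * Real.sqrt (∑ k, c k ^ 2) :=
  Real.sum_mul_le_sqrt_mul_sqrt _ _ _

theorem abs_sum_row_mul_le (b : Coef p K t) (j : Fin (p + 1)) (c : {k : Fin K // k ≠ t} → ℝ) :
    |∑ k, b j k * c k| ≤ rowNorm b j * Real.sqrt (∑ k, c k ^ 2) := by
  refine abs_le'.2 ⟨sum_row_mul_le b j c, ?_⟩
  have := sum_row_mul_le b j (fun k => - c k)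
  simpa using this

theorem abs_entry_le_rowNorm (b : Coef p K t) (j : Fin (p + 1)) (k : {k : Fin K // k ≠ t}) :
    |b j k| ≤ rowNorm b j := by
  rw [rowNorm, ← Real.sqrt_sq_eq_abs]
  exact Real.sqrt_le_sqrt (Finset.single_le_sum (f := fun k => b j k ^ 2)
    (fun k _ => sq_nonneg _) (Finset.mem_univ k))

theorem abs_linPred_le {B : ℝ} (b : Coef p K t) {v : Fin (p + 1) → ℝ} (hv : ∀ j, |v j| ≤ B)
    (k : {k : Fin K // k ≠ t}) : |linPred b v k| ≤ B * norm21 b := by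
  rw [linPred, norm21, Finset.mul_sum]
  refine (Finset.abs_sum_le_sum_abs _ _).trans (Finset.sum_le_sum fun j _ => ?_)
  rw [abs_mul, mul_comm]
  exact mul_le_mul (hv j) (abs_entry_le_rowNorm b j k) (abs_nonneg _)
    ((abs_nonneg _).trans (hv j))

theorem linPred_add (a b : Coef p K t) (v : Fin (p + 1) → ℝ) (k : {k : Fin K // k ≠ t}) :
    linPred (a + b) v k = linPred a v k + linPred b v k := by
  simp [linPred, add_mul, Finset.sum_add_distrib]

theorem linPred_sub (a b : Coef p K t) (v : Fin (p + 1) → ℝ) (k : {k : Fin K // k ≠ t}) :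
    linPred (a - b) v k = linPred a v k - linPred b v k := by
  simp [linPred, sub_mul, Finset.sum_sub_distrib]

theorem linPred_smul (u : ℝ) (a : Coef p K t) (v : Fin (p + 1) → ℝ) (k : {k : Fin K // k ≠ t}) :
    linPred (u • a) v k = u * linPred a v k := by
  simp [linPred, Finset.mul_sum, mul_assoc]

theorem measurable_linPred (a : Coef p K t) (k : {k : Fin K // k ≠ t}) :
    Measurable fun v : Fin (p + 1) → ℝ => linPred a v k := by
  unfold linPred
  fun_prop

end Norms

/-! ### Convex functions with a contraction property -/

section Contraction

variable {ι : Type*} [Fintype ι]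

/-- Convex functions for which symmetric perturbations obey a comparison principle. -/
structure Contractive (J : (ι → ℝ) → ℝ) : Prop where
  convex : ConvexOn ℝ Set.univ J
  contr : ∀ c φ τ : ι → ℝ, (∀ a, |φ a| ≤ |τ a|) → (∀ a b, |φ a - φ b| ≤ |τ a - τ b|) →
    J (c + φ) + J (c - φ) ≤ J (c + τ) + J (c - τ)

theorem exp_add_sub_exp_le {x y l l' : ℝ} (hxy : x ≤ y) (hl : 0 ≤ l) (hl' : l ≤ l') :
    Real.exp (x + l) - Real.exp x ≤ Real.exp (y + l') - Real.exp y := by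
  have h1 : Real.exp x ≤ Real.exp y := Real.exp_le_exp.2 hxy
  have h2 : Real.exp l ≤ Real.exp l' := Real.exp_le_exp.2 hl'
  have h3 : 1 ≤ Real.exp l := Real.one_le_exp hl
  rw [Real.exp_add, Real.exp_add]
  have h4 := Real.exp_pos x
  nlinarith

/-- The two-point core of the contraction principle: `p`, `q` are base values at maximizers of c + φ
and c − φ, and `h1`, `h2` express maximality. If u and v have opposite signs, p + f and q − g are
separately below M and N, or N and M. If they have the same sign, the inequality compares two
increments of exp, which grow with the starting point and the length. -/
theorem exp_add_exp_contract {p q f g u v M N : ℝ} (hf : |f| ≤ |u|) (hg : |g| ≤ |v|)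
    (hfg : |f - g| ≤ |u - v|) (h1 : q + g ≤ p + f) (h2 : p - f ≤ q - g)
    (hM1 : p + u ≤ M) (hM2 : q + v ≤ M) (hN1 : p - u ≤ N) (hN2 : q - v ≤ N) :
    Real.exp (p + f) + Real.exp (q - g) ≤ Real.exp M + Real.exp N := by
  have E : ∀ {x y : ℝ}, x ≤ y → Real.exp x ≤ Real.exp y := fun h => Real.exp_le_exp.2 h
  obtain ⟨hf1, hf2⟩ := abs_le.1 hf
  obtain ⟨hg1, hg2⟩ := abs_le.1 hg
  obtain ⟨hd1, hd2⟩ := abs_le.1 hfg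
  rcases le_total 0 u with hu | hu <;> rcases le_total 0 v with hv | hv
  · rw [abs_of_nonneg hu] at hf1 hf2
    rw [abs_of_nonneg hv] at hg1 hg2
    rcases le_total v u with huv | huv
    · rw [abs_of_nonneg (by linarith : 0 ≤ u - v)] at hd1 hd2
      have h := exp_add_sub_exp_le (x := q - v) (y := p + f) (l := v - g) (l' := u - f)
        (by linarith) (by linarith) (by linarith)
      have e1 := E hM1
      have e2 := E hN2
      ring_nf at h e1 e2 ⊢
      linarith
    · rw [abs_of_nonpos (by linarith : u - v ≤ 0)] at hd1 hd2
      have h := exp_add_sub_exp_le (x := p - u) (y := q - g) (l := u + f) (l' := v + g)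
        (by linarith) (by linarith) (by linarith)
      have e1 := E hM2
      have e2 := E hN1
      ring_nf at h e1 e2 ⊢
      linarith
  · rw [abs_of_nonneg hu] at hf1 hf2
    rw [abs_of_nonpos hv] at hg1 hg2
    have e1 := E (show p + f ≤ M by linarith)
    have e2 := E (show q - g ≤ N by linarith)
    linarith
  · rw [abs_of_nonpos hu] at hf1 hf2
    rw [abs_of_nonneg hv] at hg1 hg2
    have e1 := E (show p + f ≤ N by linarith)
    have e2 := E (show q - g ≤ M by linarith)
    linarith
  · rw [abs_of_nonpos hu] at hf1 hf2
    rw [abs_of_nonpos hv] at hg1 hg2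
    rcases le_total v u with huv | huv
    · rw [abs_of_nonneg (by linarith : 0 ≤ u - v)] at hd1 hd2
      have h := exp_add_sub_exp_le (x := p + u) (y := q - g) (l := f - u) (l' := g - v)
        (by linarith) (by linarith) (by linarith)
      have e1 := E hM1
      have e2 := E hN2
      ring_nf at h e1 e2 ⊢
      linarith
    · rw [abs_of_nonpos (by linarith : u - v ≤ 0)] at hd1 hd2
      have h := exp_add_sub_exp_le (x := q + v) (y := p + f) (l := -g - v) (l' := -f - u)
        (by linarith) (by linarith) (by linarith)
      have e1 := E hM2
      have e2 := E hN1
      ring_nf at h e1 e2 ⊢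
      linarith

theorem contractive_exp_sup' [Nonempty ι] :
    Contractive fun c : ι → ℝ => Real.exp (Finset.univ.sup' Finset.univ_nonempty c) := by
  have hle : ∀ (c : ι → ℝ) a, c a ≤ Finset.univ.sup' Finset.univ_nonempty c := fun c a =>
    Finset.le_sup' c (Finset.mem_univ a)
  refine ⟨⟨convex_univ, fun x _ y _ θ θ' hθ hθ' hsum => ?_⟩, fun c φ τ h1 h2 => ?_⟩
  · have := convexOn_exp.2 (Set.mem_univ (Finset.univ.sup' Finset.univ_nonempty x))
      (Set.mem_univ (Finset.univ.sup' Finset.univ_nonempty y)) hθ hθ' hsum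
    refine le_trans (Real.exp_le_exp.2 ?_) this
    refine Finset.sup'_le _ _ fun a _ => ?_
    simp only [Pi.add_apply, Pi.smul_apply, smul_eq_mul]
    exact add_le_add (mul_le_mul_of_nonneg_left (hle x a) hθ)
      (mul_le_mul_of_nonneg_left (hle y a) hθ')
  · obtain ⟨a, -, ha⟩ := Finset.exists_mem_eq_sup' Finset.univ_nonempty (c + φ)
    obtain ⟨b, -, hb⟩ := Finset.exists_mem_eq_sup' Finset.univ_nonempty (c - φ)
    have ha' := hle (c + φ) b
    have hb' := hle (c - φ) a
    rw [ha] at ha'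
    rw [hb] at hb'
    simp only [ha, hb]
    exact exp_add_exp_contract (h1 a) (h1 b) (h2 a b) ha' hb' (hle (c + τ) a) (hle (c + τ) b)
      (hle (c - τ) a) (hle (c - τ) b)

theorem Contractive.continuous {J : (ι → ℝ) → ℝ} (hJ : Contractive J) : Continuous J := by
  exact (ConvexOn.locallyLipschitz hJ.convex).continuous

theorem Contractive.two_mul_le {J : (ι → ℝ) → ℝ} (hJ : Contractive J) (c x : ι → ℝ) :
    2 * J c ≤ J (c + x) + J (c - x) := by
  have := hJ.contr c 0 x (by simp) (by simp)
  simp only [add_zero, sub_zero] at this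
  linarith

section Average

variable {𝒵 : Type*} [MeasurableSpace 𝒵] {ν : Measure 𝒵} [IsProbabilityMeasure ν]

theorem integrable_comp_of_bounded {J : (ι → ℝ) → ℝ} (hJ : Continuous J) {w : 𝒵 → ι → ℝ}
    (hw : AEStronglyMeasurable w ν) {C : ℝ} (hC : ∀ᵐ z ∂ν, ‖w z‖ ≤ C) :
    Integrable (fun z => J (w z)) ν := by
  obtain ⟨D, hD⟩ := (isCompact_closedBall (0 : ι → ℝ) C).exists_bound_of_continuousOn
    hJ.continuousOn
  refine Integrable.of_bound (hJ.comp_aestronglyMeasurable hw) D ?_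
  filter_upwards [hC] with z hz
  exact hD _ (by simpa using hz)

theorem Contractive.integrable_add {J : (ι → ℝ) → ℝ} (hJ : Contractive J) {w : 𝒵 → ι → ℝ}
    (hw : AEStronglyMeasurable w ν) {C : ℝ} (hC : ∀ᵐ z ∂ν, ‖w z‖ ≤ C) (c : ι → ℝ) :
    Integrable (fun z => J (c + w z)) ν := by
  refine integrable_comp_of_bounded hJ.continuous (C := ‖c‖ + C)
    (aestronglyMeasurable_const.add hw) ?_
  filter_upwards [hC] with z hz
  exact (norm_add_le _ _).trans (by linarith)

/-- Both properties are inherited from every translate of `J`, so the class is stable under the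
recursion `avgIter`. -/
theorem Contractive.average {J : (ι → ℝ) → ℝ} (hJ : Contractive J) {w : 𝒵 → ι → ℝ}
    (hw : AEStronglyMeasurable w ν) {C : ℝ} (hC : ∀ᵐ z ∂ν, ‖w z‖ ≤ C) :
    Contractive fun c => ∫ z, J (c + w z) ∂ν := by
  have hi := hJ.integrable_add hw hC
  refine ⟨⟨convex_univ, fun x _ y _ θ θ' hθ hθ' hsum => ?_⟩, fun c φ τ h1 h2 => ?_⟩
  · simp only [smul_eq_mul]
    rw [← integral_const_mul, ← integral_const_mul,
      ← integral_add ((hi x).const_mul _) ((hi y).const_mul _)]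
    refine integral_mono (hi _) (((hi x).const_mul _).add ((hi y).const_mul _)) fun z => ?_
    have := hJ.convex.2 (Set.mem_univ (x + w z)) (Set.mem_univ (y + w z)) hθ hθ' hsum
    have e : θ • (x + w z) + θ' • (y + w z) = θ • x + θ' • y + w z := by
      rw [smul_add, smul_add, add_add_add_comm, ← add_smul, hsum, one_smul]
    rw [e] at this
    simpa using this
  · rw [← integral_add (hi _) (hi _), ← integral_add (hi _) (hi _)]
    refine integral_mono ((hi _).add (hi _)) ((hi _).add (hi _)) fun z => ?_
    have := hJ.contr (c + w z) φ τ h1 h2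
    simp only [add_sub_right_comm, add_right_comm] at this ⊢
    exact this

/-- Symmetrization without an independent copy: c + (h − e), with e the mean of h, is the midpoint
of c + 2h and c − 2e, and Jensen replaces J(c − 2e) by the mean of J(c − 2h). Only the symmetric
pairs c ± 2h remain, to which the comparison principle applies. -/
theorem Contractive.integral_centered_le {J : (ι → ℝ) → ℝ} (hJ : Contractive J) {h : 𝒵 → ι → ℝ}
    (hm : AEStronglyMeasurable h ν) {C : ℝ} (hC : ∀ᵐ z ∂ν, ‖h z‖ ≤ C) {c : ι → ℝ} {W : ℝ}
    (hW : ∀ᵐ z ∂ν, J (c + (h z + h z)) + J (c - (h z + h z)) ≤ 2 * W) :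
    ∫ z, J (c + (h z - ∫ z', h z' ∂ν)) ∂ν ≤ W := by
  have hhi : Integrable h ν := Integrable.of_bound hm C hC
  generalize he : ∫ z', h z' ∂ν = e
  have hC2 : ∀ᵐ z ∂ν, ‖h z + h z‖ ≤ C + C := by
    filter_upwards [hC] with z hz
    exact (norm_add_le _ _).trans (add_le_add hz hz)
  have i1 : Integrable (fun z => J (c + (h z - e))) ν :=
    hJ.integrable_add (hm.sub aestronglyMeasurable_const) (C := C + ‖e‖) (by
      filter_upwards [hC] with z hz
      exact (norm_sub_le _ _).trans (by linarith)) c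
  have i2 : Integrable (fun z => J (c + (h z + h z))) ν := hJ.integrable_add (hm.add hm) hC2 c
  have i3 : Integrable (fun z => J (c - (h z + h z))) ν := by
    have := hJ.integrable_add (w := fun z => -(h z + h z)) (hm.add hm).neg (C := C + C) (by
      filter_upwards [hC2] with z hz
      rw [norm_neg]; exact hz) c
    simpa only [sub_eq_add_neg] using this
  have jensen : J (c - (e + e)) ≤ ∫ z, J (c - (h z + h z)) ∂ν := by
    have hint2 : Integrable (fun z => h z + h z) ν := hhi.add hhi
    have hint : Integrable (fun z => c - (h z + h z)) ν := (integrable_const c).sub hint2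
    have h1 := ConvexOn.map_integral_le (μ := ν) hJ.convex hJ.continuous.continuousOn isClosed_univ
      (f := fun z => c - (h z + h z)) (Filter.Eventually.of_forall fun _ => Set.mem_univ _) hint i3
    have h2 : ∫ z, (c - (h z + h z)) ∂ν = c - (e + e) := by
      rw [integral_sub (integrable_const c) hint2, integral_add hhi hhi, he, integral_const]
      simp
    rwa [h2] at h1
  have pt : ∀ z, J (c + (h z - e)) ≤ 1 / 2 * J (c + (h z + h z)) + 1 / 2 * J (c - (e + e)) := by
    intro z
    have := hJ.convex.2 (Set.mem_univ (c + (h z + h z))) (Set.mem_univ (c - (e + e)))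
      (by norm_num : (0 : ℝ) ≤ 1 / 2) (by norm_num : (0 : ℝ) ≤ 1 / 2) (by norm_num)
    have e1 : (1 / 2 : ℝ) • (c + (h z + h z)) + (1 / 2 : ℝ) • (c - (e + e))
        = c + (h z - e) := by
      funext a
      simp only [Pi.add_apply, Pi.smul_apply, Pi.sub_apply, smul_eq_mul]
      ring
    rwa [e1] at this
  calc ∫ z, J (c + (h z - e)) ∂ν
      ≤ ∫ z, (1 / 2 * J (c + (h z + h z)) + 1 / 2 * J (c - (e + e))) ∂ν :=
        integral_mono i1 ((i2.const_mul _).add (integrable_const _)) pt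
    _ = 1 / 2 * ∫ z, J (c + (h z + h z)) ∂ν + 1 / 2 * J (c - (e + e)) := by
        rw [integral_add (i2.const_mul _) (integrable_const _), integral_const_mul]; simp
    _ ≤ 1 / 2 * ∫ z, J (c + (h z + h z)) ∂ν + 1 / 2 * ∫ z, J (c - (h z + h z)) ∂ν := by
        gcongr
    _ = ∫ z, (1 / 2 * (J (c + (h z + h z)) + J (c - (h z + h z)))) ∂ν := by
        rw [integral_const_mul, integral_add i2 i3]; ring
    _ ≤ ∫ _, W ∂ν := by
        refine integral_mono_ae ((i2.add i3).const_mul _) (integrable_const _) ?_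
        filter_upwards [hW] with z hz
        linarith
    _ = W := by simp

end Average

/-- Mixtures of contractions, with signed weights of total mass at most `B`. -/
theorem Contractive.add_mixture_le {κ : Type*} [Fintype κ] [Nonempty κ]
    {J : (ι → ℝ) → ℝ} (hJ : Contractive J)
    {B : ℝ} (hB : 0 < B) {g : κ → ℝ} (hg : ∑ k, |g k| ≤ B) {φ τ : κ → ι → ℝ}
    (h1 : ∀ k a, |φ k a| ≤ |τ k a|) (h2 : ∀ k a b, |φ k a - φ k b| ≤ |τ k a - τ k b|)
    {c : ι → ℝ} {W : ℝ} (hW : ∀ k, J (c + B • τ k) + J (c - B • τ k) ≤ 2 * W) :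
    J (c + ∑ k, g k • φ k) + J (c - ∑ k, g k • φ k) ≤ 2 * W := by
  -- The point c ± Σ g_k φ_k is a convex combination of the points c ± B sign(g_k) φ_k with masses
  -- |g_k|/B; `none` carries the missing mass and sits at c itself.
  set wt : Option κ → ℝ := fun o => o.elim (1 - ∑ k, |g k| / B) fun k => |g k| / B
  set sg : κ → ℝ := fun k => SignType.sign (g k)
  set pt : ℝ → Option κ → ι → ℝ := fun e o => o.elim c fun k => c + (e * sg k * B) • φ k
  have hsum : ∑ k, |g k| / B ≤ 1 := by
    rw [← Finset.sum_div, div_le_one hB]; exact hg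
  have hw0 : ∀ o ∈ Finset.univ, 0 ≤ wt o := by
    rintro (_ | k) -
    · simp only [wt, Option.elim]; linarith
    · simp only [wt, Option.elim]; positivity
  have hw1 : ∑ o, wt o = 1 := by
    rw [Fintype.sum_option]; simp [wt]
  have hcomb : ∀ e : ℝ, ∑ o, wt o • pt e o = c + e • ∑ k, g k • φ k := by
    intro e
    rw [Fintype.sum_option]
    simp only [wt, pt, Option.elim, smul_add, Finset.sum_add_distrib, ← Finset.sum_smul,
      smul_smul, Finset.smul_sum, sub_smul, one_smul]
    rw [← add_assoc, sub_add_cancel]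
    congr 1
    refine Finset.sum_congr rfl fun k _ => ?_
    congr 1
    have : |g k| * sg k = g k := by
      simp only [sg]
      exact abs_mul_sign (g k)
    calc |g k| / B * (e * sg k * B) = e * (|g k| * sg k) := by field_simp
      _ = _ := by rw [this]
  have hj : ∀ e : ℝ, J (c + e • ∑ k, g k • φ k) ≤ ∑ o, wt o * J (pt e o) := by
    intro e
    have := hJ.convex.map_sum_le (t := Finset.univ) hw0 hw1 (p := pt e) (by simp)
    rw [hcomb] at this
    simpa using this
  have hk : ∀ k, J (c + (1 * sg k * B) • φ k) + J (c + (-1 * sg k * B) • φ k) ≤ 2 * W := by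
    intro k
    have hs : |sg k| ≤ 1 := by
      rcases lt_trichotomy (g k) 0 with h | h | h
      · simp [sg, h]
      · simp [sg, h]
      · simp [sg, h]
    have := hJ.contr c ((sg k * B) • φ k) (B • τ k) (fun a => by
      simp only [Pi.smul_apply, smul_eq_mul, abs_mul, abs_of_pos hB]
      calc |sg k| * B * |φ k a| ≤ 1 * B * |τ k a| :=
            mul_le_mul (mul_le_mul_of_nonneg_right hs hB.le) (h1 k a) (abs_nonneg _)
              (by positivity)
        _ = _ := by ring) (fun a b => by
      simp only [Pi.smul_apply, smul_eq_mul, ← mul_sub, abs_mul, abs_of_pos hB]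
      calc |sg k| * B * |φ k a - φ k b| ≤ 1 * B * |τ k a - τ k b| :=
            mul_le_mul (mul_le_mul_of_nonneg_right hs hB.le) (h2 k a b) (abs_nonneg _)
              (by positivity)
        _ = _ := by ring)
    refine le_trans (le_of_eq ?_) (this.trans (hW k))
    rw [one_mul, neg_one_mul, neg_mul, neg_smul, ← sub_eq_add_neg]
  have ho : ∀ o, J (pt 1 o) + J (pt (-1) o) ≤ 2 * W := by
    rintro (_ | k)
    · simp only [pt, Option.elim]
      obtain ⟨k⟩ := ‹Nonempty κ›
      linarith [hJ.two_mul_le c (B • τ k), hW k]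
    · exact hk k
  have a1 := hj 1
  have a2 := hj (-1)
  rw [one_smul] at a1
  rw [neg_one_smul, ← sub_eq_add_neg] at a2
  calc _ ≤ ∑ o, wt o * J (pt 1 o) + ∑ o, wt o * J (pt (-1) o) := add_le_add a1 a2
    _ = ∑ o, wt o * (J (pt 1 o) + J (pt (-1) o)) := by
        rw [← Finset.sum_add_distrib]; simp only [mul_add]
    _ ≤ ∑ o, wt o * (2 * W) := Finset.sum_le_sum fun o ho' =>
        mul_le_mul_of_nonneg_left (ho o) (hw0 o ho')
    _ = 2 * W := by rw [← Finset.sum_mul, hw1, one_mul]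

end Contraction

end RCAL

namespace RCAL

/-! ### A uniform deviation inequality for bounded coefficient sets -/

section ProcessBounds

variable {p K : ℕ} {t : Fin K} {𝒵 : Type*} [MeasurableSpace 𝒵] {ν : Measure 𝒵}

/-- The summand `∑_k g_k φ_k(a_kᵀ v)` of an empirical process indexed by coefficient matrices. -/
def procVal (V : 𝒵 → Fin (p + 1) → ℝ) (g : 𝒵 → {k : Fin K // k ≠ t} → ℝ)
    (φ : 𝒵 → {k : Fin K // k ≠ t} → ℝ → ℝ) (a : Coef p K t) (z : 𝒵) : ℝ :=
  ∑ k, g z k * φ z k (linPred a (V z) k)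

/-- Boundedness and Lipschitz conditions on the ingredients of the process. -/
structure ProcReg (ν : Measure 𝒵) (V : 𝒵 → Fin (p + 1) → ℝ) (g : 𝒵 → {k : Fin K // k ≠ t} → ℝ)
    (φ : 𝒵 → {k : Fin K // k ≠ t} → ℝ → ℝ) (B0 B1 L r : ℝ) : Prop where
  B0_pos : 0 < B0
  B1_pos : 0 < B1
  L_pos : 0 < L
  r_nonneg : 0 ≤ r
  bounded : ∀ᵐ z ∂ν, ∀ j, |V z j| ≤ B0
  weights : ∀ᵐ z ∂ν, ∑ k, |g z k| ≤ B1
  zero : ∀ z k, φ z k 0 = 0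
  lip : ∀ᵐ z ∂ν, ∀ k x y, |x| ≤ B0 * r → |y| ≤ B0 * r → |φ z k x - φ z k y| ≤ L * |x - y|
  meas : ∀ a, Measurable (procVal V g φ a)

variable {V : 𝒵 → Fin (p + 1) → ℝ} {g : 𝒵 → {k : Fin K // k ≠ t} → ℝ}
  {φ : 𝒵 → {k : Fin K // k ≠ t} → ℝ → ℝ} {B0 B1 L r : ℝ}

theorem ProcReg.abs_sub_le (H : ProcReg ν V g φ B0 B1 L r) :
    ∀ᵐ z ∂ν, ∀ a b : Coef p K t, norm21 a ≤ r → norm21 b ≤ r →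
      |procVal V g φ a z - procVal V g φ b z| ≤ B1 * L * B0 * norm21 (a - b) := by
  filter_upwards [H.bounded, H.weights, H.lip] with z h1 h2 h3 a b ha hb
  have hB0 := H.B0_pos
  have hB1 := H.B1_pos
  have hL := H.L_pos
  have hbd : ∀ c : Coef p K t, norm21 c ≤ r → ∀ k, |linPred c (V z) k| ≤ B0 * r := fun c hc k =>
    (abs_linPred_le c h1 k).trans (mul_le_mul_of_nonneg_left hc H.B0_pos.le)
  unfold procVal
  rw [← Finset.sum_sub_distrib]
  calc |∑ k, (g z k * φ z k (linPred a (V z) k) - g z k * φ z k (linPred b (V z) k))|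
      ≤ ∑ k, |g z k| * (L * (B0 * norm21 (a - b))) := by
        refine (Finset.abs_sum_le_sum_abs _ _).trans (Finset.sum_le_sum fun k _ => ?_)
        rw [← mul_sub, abs_mul]
        refine mul_le_mul_of_nonneg_left ((h3 k _ _ (hbd a ha k) (hbd b hb k)).trans ?_)
          (abs_nonneg _)
        rw [← linPred_sub]
        exact mul_le_mul_of_nonneg_left (abs_linPred_le _ h1 k) H.L_pos.le
    _ ≤ B1 * (L * (B0 * norm21 (a - b))) := by
        rw [← Finset.sum_mul]
        have := norm21_nonneg (a - b)
        exact mul_le_mul_of_nonneg_right h2 (by positivity)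
    _ = _ := by ring

theorem norm21_zero : norm21 (0 : Coef p K t) = 0 := by
  simp [norm21, rowNorm]

theorem linPred_zero (v : Fin (p + 1) → ℝ) (k : {k : Fin K // k ≠ t}) :
    linPred (0 : Coef p K t) v k = 0 := by
  simp [linPred]

theorem ProcReg.abs_le (H : ProcReg ν V g φ B0 B1 L r) :
    ∀ᵐ z ∂ν, ∀ a : Coef p K t, norm21 a ≤ r →
      |procVal V g φ a z| ≤ B1 * L * B0 * r := by
  filter_upwards [H.abs_sub_le] with z hz a ha
  have h0 : procVal V g φ 0 z = 0 := by simp [procVal, linPred_zero, H.zero]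
  have h1 := hz a 0 ha (by rw [norm21_zero]; exact H.r_nonneg)
  rw [h0, sub_zero, sub_zero] at h1
  have hB0 := H.B0_pos
  have hB1 := H.B1_pos
  have hL := H.L_pos
  exact h1.trans (mul_le_mul_of_nonneg_left ha (by positivity))

variable [IsProbabilityMeasure ν]

theorem ProcReg.integrable (H : ProcReg ν V g φ B0 B1 L r) {a : Coef p K t} (ha : norm21 a ≤ r) :
    Integrable (procVal V g φ a) ν := by
  refine Integrable.of_bound (H.meas a).aestronglyMeasurable (B1 * L * B0 * r) ?_
  filter_upwards [H.abs_le] with z hz using hz a ha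

variable {ι : Type*} [Fintype ι]

/-- The recursion obtained by integrating out one observation at a time. -/
def avgIter (ν : Measure 𝒵) (w : 𝒵 → ι → ℝ) (J : (ι → ℝ) → ℝ) : ℕ → (ι → ℝ) → ℝ
  | 0 => J
  | m + 1 => fun c => ∫ z, avgIter ν w J m (c + w z) ∂ν

theorem contractive_avgIter {w : 𝒵 → ι → ℝ} (hw : AEStronglyMeasurable w ν) {C : ℝ}
    (hC : ∀ᵐ z ∂ν, ‖w z‖ ≤ C) {J : (ι → ℝ) → ℝ} (hJ : Contractive J) (m : ℕ) :
    Contractive (avgIter ν w J m) := by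
  induction m with
  | zero => exact hJ
  | succ m ih => exact ih.average hw hC

theorem avgIter_nonneg {w : 𝒵 → ι → ℝ} {J : (ι → ℝ) → ℝ} (hJ : ∀ c, 0 ≤ J c) (m : ℕ)
    (c : ι → ℝ) : 0 ≤ avgIter ν w J m c := by
  induction m generalizing c with
  | zero => exact hJ c
  | succ m ih => exact integral_nonneg fun z => ih _

/-- The potential controlling the symmetrized linear process. -/
def potential (r : ℝ) (w : Fin (p + 1) → EuclideanSpace ℝ {k : Fin K // k ≠ t}) : ℝ :=
  ∑ j, 2 * Real.cosh (r * ‖w j‖)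

/-- The values of the linear functionals given by a family of coefficient matrices. -/
def pairing (A : ι → Coef p K t) (w : Fin (p + 1) → EuclideanSpace ℝ {k : Fin K // k ≠ t}) :
    ι → ℝ := fun i => ∑ j, ∑ k, A i j k * w j k

/-- The norm `norm21` is dual to the largest row norm, so every pairing is at most r max_j ‖w_j‖.
Replacing the maximum over rows by a sum is the only union bound of the uniform estimate and yields
its factor 2(p + 1); the number of matrices plays no role. -/
theorem exp_sup'_pairing_le [Nonempty ι] {A : ι → Coef p K t}
    (hA : ∀ i, norm21 (A i) ≤ r)
    (w : Fin (p + 1) → EuclideanSpace ℝ {k : Fin K // k ≠ t}) :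
    Real.exp (Finset.univ.sup' Finset.univ_nonempty (pairing A w)) ≤ potential r w := by
  obtain ⟨i, -, hi⟩ := Finset.exists_mem_eq_sup' Finset.univ_nonempty (pairing A w)
  obtain ⟨j0, -, hj0⟩ := Finset.exists_max_image Finset.univ (fun j => ‖w j‖)
    (Finset.univ_nonempty (α := Fin (p + 1)))
  rw [hi]
  have h1 : pairing A w i ≤ r * ‖w j0‖ := by
    calc pairing A w i ≤ ∑ j, rowNorm (A i) j * ‖w j0‖ := by
          refine Finset.sum_le_sum fun j _ => (sum_row_mul_le (A i) j _).trans ?_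
          refine mul_le_mul_of_nonneg_left ?_ (rowNorm_nonneg _ _)
          have := hj0 j (Finset.mem_univ j)
          rw [EuclideanSpace.norm_eq] at this
          simpa using this
      _ = norm21 (A i) * ‖w j0‖ := by rw [norm21, Finset.sum_mul]
      _ ≤ _ := mul_le_mul_of_nonneg_right (hA i) (norm_nonneg _)
  calc Real.exp (pairing A w i) ≤ Real.exp (r * ‖w j0‖) := Real.exp_le_exp.2 h1
    _ ≤ 2 * Real.cosh (r * ‖w j0‖) := by
        rw [Real.cosh_eq]; have := Real.exp_pos (-(r * ‖w j0‖)); linarith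
    _ ≤ potential r w := Finset.single_le_sum (f := fun j => 2 * Real.cosh (r * ‖w j‖))
        (fun j _ => by have := Real.cosh_pos (r * ‖w j‖); positivity) (Finset.mem_univ j0)

theorem potential_add_potential_sub_le {q : ℝ} (hr : 0 ≤ r)
    (w u : Fin (p + 1) → EuclideanSpace ℝ {k : Fin K // k ≠ t}) (hu : ∀ j, r * ‖u j‖ ≤ q) :
    potential r (w + u) + potential r (w - u) ≤ 2 * (Real.exp (q ^ 2 / 2) * potential r w) := by
  unfold potential
  rw [← Finset.sum_add_distrib, Finset.mul_sum, Finset.mul_sum]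
  refine Finset.sum_le_sum fun j _ => ?_
  have h := cosh_norm_add_add_cosh_norm_sub_le (r • w j) (r • u j)
  rw [← smul_add, ← smul_sub] at h
  simp only [norm_smul, Real.norm_of_nonneg hr] at h
  have h2 : Real.cosh (r * ‖u j‖) ≤ Real.exp (q ^ 2 / 2) := by
    refine (Real.cosh_le_exp_half_sq _).trans (Real.exp_le_exp.2 ?_)
    have : 0 ≤ r * ‖u j‖ := by positivity
    have := hu j
    gcongr
  have h3 := Real.cosh_pos (r * ‖w j‖)
  have h4 : Real.cosh (r * ‖w j‖) * Real.cosh (r * ‖u j‖) ≤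
      Real.cosh (r * ‖w j‖) * Real.exp (q ^ 2 / 2) := by gcongr
  simp only [Pi.add_apply, Pi.sub_apply]
  nlinarith

/-- Shifting `w` in the single column `k`, proportionally to `v`, moves the pairings by the linear
predictors of column `k`. This keeps the recursion inside the image of `pairing`. -/
theorem pairing_add_smul (A : ι → Coef p K t)
    (w : Fin (p + 1) → EuclideanSpace ℝ {k : Fin K // k ≠ t}) (k : {k : Fin K // k ≠ t}) (x : ℝ)
    (v : Fin (p + 1) → ℝ) :
    pairing A (w + fun j => EuclideanSpace.single k (x * v j)) =
      pairing A w + fun i => x * linPred (A i) v k := by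
  classical
  funext i
  simp only [pairing, Pi.add_apply, PiLp.add_apply, mul_add, Finset.sum_add_distrib]
  congr 1
  simp only [PiLp.single_apply, mul_ite, mul_zero, Finset.sum_ite_eq', Finset.mem_univ,
    if_true, linPred,
    Finset.mul_sum]
  refine Finset.sum_congr rfl fun j _ => ?_
  ring

theorem measurable_pi_procVal (H : ProcReg ν V g φ B0 B1 L r) (A : ι → Coef p K t) (s : ℝ) :
    Measurable fun z i => s * procVal V g φ (A i) z :=
  measurable_pi_lambda _ fun i => (H.meas (A i)).const_mul s

/-- Induction on the number of observations integrated out. `Contractive.integral_centered_le`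
reduces to symmetric perturbations by 2s Σ_k g_k φ_k. Convexity over k together with the Lipschitz
bound replaces these by ±2sLB₁ times the linear predictor of one column. That is a shift of `w`, so
the induction hypothesis applies, followed by the growth bound for `potential`. The weights enter
only through Σ_k |g_k| ≤ B₁. -/
theorem avgIter_pairing_le [Nonempty ι] [Nonempty {k : Fin K // k ≠ t}]
    (H : ProcReg ν V g φ B0 B1 L r)
    {A : ι → Coef p K t} (hA : ∀ i, norm21 (A i) ≤ r) {s : ℝ} (hs : 0 < s) (m : ℕ)
    (w : Fin (p + 1) → EuclideanSpace ℝ {k : Fin K // k ≠ t}) :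
    avgIter ν (fun z => (fun i => s * procVal V g φ (A i) z)
        - ∫ z', (fun i => s * procVal V g φ (A i) z') ∂ν)
      (fun c => Real.exp (Finset.univ.sup' Finset.univ_nonempty c)) m (pairing A w) ≤
      Real.exp (m * ((2 * s * L * B1 * B0 * r) ^ 2 / 2)) * potential r w := by
  set h : 𝒵 → ι → ℝ := fun z i => s * procVal V g φ (A i) z with hh
  have hB0 := H.B0_pos
  have hB1 := H.B1_pos
  have hL := H.L_pos
  have hr := H.r_nonneg
  have hm : AEStronglyMeasurable h ν := (measurable_pi_procVal H A s).aestronglyMeasurable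
  have hC : ∀ᵐ z ∂ν, ‖h z‖ ≤ s * (B1 * L * B0 * r) := by
    filter_upwards [H.abs_le] with z hz
    refine (pi_norm_le_iff_of_nonneg (by positivity)).2 fun i => ?_
    rw [hh, Real.norm_eq_abs, abs_mul, abs_of_pos hs]
    exact mul_le_mul_of_nonneg_left (hz _ (hA i)) hs.le
  have hC' : ∀ᵐ z ∂ν, ‖h z - ∫ z', h z' ∂ν‖ ≤ s * (B1 * L * B0 * r) + ‖∫ z', h z' ∂ν‖ := by
    filter_upwards [hC] with z hz
    exact (norm_sub_le _ _).trans (by linarith)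
  induction m generalizing w with
  | zero =>
    simp only [avgIter, Nat.cast_zero, zero_mul, Real.exp_zero, one_mul]
    exact exp_sup'_pairing_le hA w
  | succ m ih =>
    have hJ := contractive_avgIter (hm.sub aestronglyMeasurable_const) hC' contractive_exp_sup' m
    refine hJ.integral_centered_le hm hC ?_
    filter_upwards [H.bounded, H.weights, H.lip] with z h1 h2 h3
    have hbd : ∀ i k, |linPred (A i) (V z) k| ≤ B0 * r := fun i k =>
      (abs_linPred_le (A i) h1 k).trans (mul_le_mul_of_nonneg_left (hA i) hB0.le)
    have hB0r : |(0 : ℝ)| ≤ B0 * r := by rw [abs_zero]; positivity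
    have e : h z + h z = ∑ k, g z k • fun i => 2 * s * φ z k (linPred (A i) (V z) k) := by
      funext i
      simp only [hh, procVal, Pi.add_apply, Finset.sum_apply, Pi.smul_apply, smul_eq_mul,
        ← two_mul, Finset.mul_sum]
      refine Finset.sum_congr rfl fun k _ => ?_
      ring
    rw [e]
    refine hJ.add_mixture_le (τ := fun k i => 2 * s * L * linPred (A i) (V z) k) hB1 h2
      (fun k i => ?_) (fun k i i' => ?_) (fun k => ?_)
    · have := h3 k (linPred (A i) (V z) k) 0 (hbd i k) hB0r
      rw [H.zero, sub_zero, sub_zero] at this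
      simp only [abs_mul, abs_of_pos hs, abs_of_pos hL, abs_two]
      rw [mul_assoc (2 * s)]
      exact mul_le_mul_of_nonneg_left this (by positivity)
    · have := h3 k _ _ (hbd i k) (hbd i' k)
      simp only [← mul_sub]
      simp only [abs_mul, abs_of_pos hs, abs_of_pos hL, abs_two]
      rw [mul_assoc (2 * s)]
      exact mul_le_mul_of_nonneg_left this (by positivity)
    · set x := B1 * (2 * s * L) with hx
      have e1 : pairing A w + B1 • (fun i => 2 * s * L * linPred (A i) (V z) k) =
          pairing A (w + fun j => EuclideanSpace.single k (x * V z j)) := by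
        rw [pairing_add_smul]
        congr 1
        funext i
        simp only [Pi.smul_apply, smul_eq_mul, hx]
        ring
      have e2 : pairing A w - B1 • (fun i => 2 * s * L * linPred (A i) (V z) k) =
          pairing A (w - fun j => EuclideanSpace.single k (x * V z j)) := by
        have e3 : (w - fun j => EuclideanSpace.single k (x * V z j)) =
            w + fun j => EuclideanSpace.single k (-x * V z j) := by
          rw [sub_eq_add_neg]
          congr 1
          funext j
          ext k'
          simp [PiLp.single_apply]
          split_ifs <;> simp
        rw [e3, pairing_add_smul, sub_eq_add_neg]
        congr 1
        funext i
        simp only [Pi.smul_apply, Pi.neg_apply, smul_eq_mul, hx]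
        ring
      rw [e1, e2]
      refine (add_le_add (ih _) (ih _)).trans ?_
      rw [← mul_add]
      have hp := potential_add_potential_sub_le (q := 2 * s * L * B1 * B0 * r) hr w
        (fun j => EuclideanSpace.single k (x * V z j)) (fun j => by
          rw [PiLp.norm_single, Real.norm_eq_abs, abs_mul,
            abs_of_pos (by positivity : 0 < x)]
          calc r * (x * |V z j|) ≤ r * (x * B0) := by
                have := h1 j
                have : 0 < x := by positivity
                gcongr
            _ = _ := by rw [hx]; ring)
      refine (mul_le_mul_of_nonneg_left hp (Real.exp_pos _).le).trans (le_of_eq ?_)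
      push_cast
      rw [add_mul, one_mul, Real.exp_add]
      ring

theorem measure_exists_procVal_ge_le [Nonempty ι] [Nonempty {k : Fin K // k ≠ t}]
    (H : ProcReg ν V g φ B0 B1 L r)
    {A : ι → Coef p K t} (hA : ∀ i, norm21 (A i) ≤ r) {s : ℝ} (hs : 0 < s) (n : ℕ) (δ : ℝ) :
    (Measure.pi fun _ : Fin n => ν)
      {z | ∃ i, δ ≤ ∑ m, (procVal V g φ (A i) (z m) - ∫ z', procVal V g φ (A i) z' ∂ν)} ≤
      ENNReal.ofReal (2 * (p + 1) *
        Real.exp (-(s * δ) + n * ((2 * s * L * B1 * B0 * r) ^ 2 / 2))) := by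
  set h : 𝒵 → ι → ℝ := fun z i => s * procVal V g φ (A i) z with hh
  have hB0 := H.B0_pos
  have hB1 := H.B1_pos
  have hL := H.L_pos
  have hr := H.r_nonneg
  have hmeas : Measurable h := measurable_pi_procVal H A s
  have hC : ∀ᵐ z ∂ν, ‖h z‖ ≤ s * (B1 * L * B0 * r) := by
    filter_upwards [H.abs_le] with z hz
    refine (pi_norm_le_iff_of_nonneg (by positivity)).2 fun i => ?_
    rw [hh, Real.norm_eq_abs, abs_mul, abs_of_pos hs]
    exact mul_le_mul_of_nonneg_left (hz _ (hA i)) hs.le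
  have hC' : ∀ᵐ z ∂ν, ‖h z - ∫ z', h z' ∂ν‖ ≤ s * (B1 * L * B0 * r) + ‖∫ z', h z' ∂ν‖ := by
    filter_upwards [hC] with z hz
    exact (norm_sub_le _ _).trans (by linarith)
  have hwm : Measurable fun z => h z - ∫ z', h z' ∂ν := hmeas.sub measurable_const
  set Φ : (ι → ℝ) → ℝ := fun c => Real.exp (Finset.univ.sup' Finset.univ_nonempty c) with hΦ
  set J := avgIter ν (fun z => h z - ∫ z', h z' ∂ν) Φ with hJdef
  have hcontr : ∀ m, Contractive (J m) := fun m =>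
    contractive_avgIter hwm.aestronglyMeasurable hC' contractive_exp_sup' m
  have hJ0 : ∀ m c, 0 ≤ J m c := fun m c => avgIter_nonneg (fun c => (Real.exp_pos _).le) m c
  have hmain := lintegral_pi_add_sum_le (ν := ν) hwm
    (J := fun m c => ENNReal.ofReal (J m c))
    (fun m => ENNReal.measurable_ofReal.comp (hcontr m).continuous.measurable) (fun m c => by
      rw [← ofReal_integral_eq_lintegral_ofReal
        ((hcontr m).integrable_add hwm.aestronglyMeasurable hC' c)
        (Filter.Eventually.of_forall fun z => hJ0 m _)]
      exact le_rfl) n 0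
  have hfin : J n 0 ≤ Real.exp (n * ((2 * s * L * B1 * B0 * r) ^ 2 / 2)) * (2 * (p + 1)) := by
    have := avgIter_pairing_le H hA hs n 0
    have e0 : pairing A 0 = 0 := by funext i; simp [pairing]
    have e1 : potential r (0 : Fin (p + 1) → EuclideanSpace ℝ {k : Fin K // k ≠ t}) =
        2 * (p + 1) := by
      simp [potential]; ring
    rw [e0, e1] at this
    exact this
  have hcoord : ∀ i, (∫ z', h z' ∂ν) i = s * ∫ z', procVal V g φ (A i) z' ∂ν := by
    intro i
    rw [eval_integral (fun i => (H.integrable (hA i)).const_mul s), integral_const_mul]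
  have hsub : {z : Fin n → 𝒵 | ∃ i, δ ≤ ∑ m, (procVal V g φ (A i) (z m)
      - ∫ z', procVal V g φ (A i) z' ∂ν)} ⊆
      {z | ENNReal.ofReal (Real.exp (s * δ)) ≤
        ENNReal.ofReal (J 0 (0 + ∑ m, (h (z m) - ∫ z', h z' ∂ν)))} := by
    rintro z ⟨i, hi⟩
    apply ENNReal.ofReal_le_ofReal
    refine Real.exp_le_exp.2 (le_trans ?_ (Finset.le_sup' _ (Finset.mem_univ i)))
    simp only [zero_add, Finset.sum_apply, Pi.sub_apply, hcoord]
    simp only [hh, ← mul_sub, ← Finset.mul_sum]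
    exact mul_le_mul_of_nonneg_left hi hs.le
  have hmeasS : Measurable fun z : Fin n → 𝒵 => (0 : ι → ℝ) + ∑ m, (h (z m) - ∫ z', h z' ∂ν) :=
    measurable_const.add (Finset.measurable_sum _ fun i _ => hwm.comp (measurable_pi_apply i))
  have hmk := meas_ge_le_lintegral_div (μ := Measure.pi fun _ : Fin n => ν)
    (f := fun z => ENNReal.ofReal (J 0 (0 + ∑ m, (h (z m) - ∫ z', h z' ∂ν))))
    (ENNReal.measurable_ofReal.comp
      ((hcontr 0).continuous.measurable.comp hmeasS)).aemeasurable
    (ε := ENNReal.ofReal (Real.exp (s * δ)))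
    (by simp [Real.exp_pos]) ENNReal.ofReal_ne_top
  refine (measure_mono hsub).trans (hmk.trans ?_)
  refine (ENNReal.div_le_div_right hmain _).trans ?_
  rw [← ENNReal.ofReal_div_of_pos (by positivity)]
  apply ENNReal.ofReal_le_ofReal
  refine (div_le_div_of_nonneg_right hfin (Real.exp_pos _).le).trans (le_of_eq ?_)
  rw [Real.exp_add, Real.exp_neg]
  field_simp

theorem continuous_norm21 : Continuous (norm21 : Coef p K t → ℝ) := by
  unfold norm21 rowNorm
  refine continuous_finsetSum _ fun j _ => Real.continuous_sqrt.comp ?_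
  exact continuous_finsetSum _ fun k _ => (continuous_id.matrix_elem j k).pow 2

/-- The bound for finite families does not depend on their size, so it passes to the increasing
union along a dense sequence of the ball. Almost sure Lipschitz dependence on the matrix then
reaches the whole ball, the strict inequality leaving room for the approximation. -/
theorem measure_exists_norm21_le_procVal_gt_le [Nonempty {k : Fin K // k ≠ t}]
    (H : ProcReg ν V g φ B0 B1 L r) {s : ℝ} (hs : 0 < s) (n : ℕ) (δ : ℝ) :
    (Measure.pi fun _ : Fin n => ν)
      {z | ∃ a : Coef p K t, norm21 a ≤ r ∧
        δ < ∑ m, (procVal V g φ a (z m) - ∫ z', procVal V g φ a z' ∂ν)} ≤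
      ENNReal.ofReal (2 * (p + 1) *
        Real.exp (-(s * δ) + n * ((2 * s * L * B1 * B0 * r) ^ 2 / 2))) := by
  have hB0 := H.B0_pos
  have hB1 := H.B1_pos
  have hL := H.L_pos
  set F : Coef p K t → (Fin n → 𝒵) → ℝ := fun a z =>
    ∑ m, (procVal V g φ a (z m) - ∫ z', procVal V g φ a z' ∂ν) with hF
  have : SecondCountableTopology (Coef p K t) :=
    inferInstanceAs (SecondCountableTopology (Fin (p + 1) → {k : Fin K // k ≠ t} → ℝ))
  have : SecondCountableTopology {a : Coef p K t // norm21 a ≤ r} :=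
    TopologicalSpace.Subtype.secondCountableTopology {a : Coef p K t | norm21 a ≤ r}
  have : TopologicalSpace.SeparableSpace {a : Coef p K t // norm21 a ≤ r} :=
    TopologicalSpace.SecondCountableTopology.to_separableSpace
  have : Nonempty {a : Coef p K t // norm21 a ≤ r} :=
    ⟨⟨0, by rw [norm21_zero]; exact H.r_nonneg⟩⟩
  set A : ℕ → {a : Coef p K t // norm21 a ≤ r} := TopologicalSpace.denseSeq _ with hA
  set bad : ℕ → Set (Fin n → 𝒵) := fun l => {z | ∃ i : Fin (l + 1), δ ≤ F (A i).1 z} with hbad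
  have hmono : Monotone bad := by
    rintro l l' hl z ⟨i, hi⟩
    exact ⟨⟨i.1, by omega⟩, hi⟩
  have hle : ∀ l, (Measure.pi fun _ : Fin n => ν) (bad l) ≤ _ := fun l =>
    measure_exists_procVal_ge_le H (A := fun i : Fin (l + 1) => (A i).1) (fun i => (A i).2) hs n δ
  have hU : (Measure.pi fun _ : Fin n => ν) (⋃ l, bad l) ≤ ENNReal.ofReal (2 * (p + 1) *
        Real.exp (-(s * δ) + n * ((2 * s * L * B1 * B0 * r) ^ 2 / 2))) := by
    rw [hmono.measure_iUnion]
    exact iSup_le hle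
  refine (measure_mono_ae ?_).trans hU
  have hgood : ∀ᵐ z ∂(Measure.pi fun _ : Fin n => ν), ∀ m, ∀ a b : Coef p K t,
      norm21 a ≤ r → norm21 b ≤ r →
      |procVal V g φ a (z m) - procVal V g φ b (z m)| ≤ B1 * L * B0 * norm21 (a - b) :=
    ae_all_iff.2 fun m =>
      (measurePreserving_eval (fun _ : Fin n => ν) m).quasiMeasurePreserving.ae H.abs_sub_le
  filter_upwards [hgood] with z hz
  rintro ⟨a, ha, hda⟩
  have hLip : ∀ b : Coef p K t, norm21 b ≤ r →
      F a z - F b z ≤ n * (2 * (B1 * L * B0 * norm21 (a - b))) := by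
    intro b hb
    simp only [hF]
    rw [← Finset.sum_sub_distrib]
    have hint : |(∫ z', procVal V g φ a z' ∂ν) - ∫ z', procVal V g φ b z' ∂ν| ≤
        B1 * L * B0 * norm21 (a - b) := by
      rw [← integral_sub (H.integrable ha) (H.integrable hb)]
      have := norm_integral_le_of_norm_le_const (μ := ν)
        (f := fun z' => procVal V g φ a z' - procVal V g φ b z')
        (C := B1 * L * B0 * norm21 (a - b))
        (by filter_upwards [H.abs_sub_le] with z' hz' using hz' a b ha hb)
      simpa using this
    calc _ ≤ ∑ _m : Fin n, 2 * (B1 * L * B0 * norm21 (a - b)) := by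
          refine Finset.sum_le_sum fun m _ => ?_
          have h1 := abs_le.1 (hz m a b ha hb)
          have h2 := abs_le.1 hint
          linarith [h1.2, h2.1]
      _ = _ := by simp
  set D : ℝ := n * (2 * (B1 * L * B0)) with hD
  have hD0 : 0 ≤ D := by positivity
  have hopen : IsOpen {b : {a : Coef p K t // norm21 a ≤ r} | D * norm21 (a - b.1) < F a z - δ} :=
    isOpen_lt (continuous_const.mul (continuous_norm21.comp
      (continuous_const.sub continuous_subtype_val))) continuous_const
  obtain ⟨l, hb⟩ : ∃ l, D * norm21 (a - (A l).1) < F a z - δ :=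
    (TopologicalSpace.denseRange_denseSeq
      {a : Coef p K t // norm21 a ≤ r}).exists_mem_open hopen ⟨⟨a, ha⟩, by
        simp only [Set.mem_ofPred_eq, sub_self, norm21_zero, mul_zero]
        linarith⟩
  refine Set.mem_iUnion.2 ⟨l, ⟨⟨l, by omega⟩, ?_⟩⟩
  have := hLip (A l).1 (A l).2
  have e : (n : ℝ) * (2 * (B1 * L * B0 * norm21 (a - (A l).1))) = D * norm21 (a - (A l).1) := by
    rw [hD]; ring
  simp only
  linarith

end ProcessBounds

end RCAL

namespace RCAL

/-! ### Lower bounds for symmetrized Bregman divergences -/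

/-- The function `(1 - e^{-H}) / H`, extended by `1` at `0`. -/
def expRatio (H : ℝ) : ℝ := if H = 0 then 1 else (1 - Real.exp (-H)) / H

theorem mul_expRatio (H : ℝ) : H * expRatio H = 1 - Real.exp (-H) := by
  unfold expRatio
  split_ifs with h
  · simp [h]
  · field_simp

theorem exp_neg_le_expRatio {H : ℝ} (hH : 0 ≤ H) : Real.exp (-H) ≤ expRatio H := by
  rcases hH.eq_or_lt with rfl | h
  · simp [expRatio]
  · have h1 := mul_expRatio H
    have h2 : H * Real.exp (-H) ≤ 1 - Real.exp (-H) := by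
      have h3 := Real.add_one_le_exp H
      have h4 : Real.exp H * Real.exp (-H) = 1 := by rw [← Real.exp_add]; simp
      have h5 := Real.exp_pos (-H)
      nlinarith
    rw [← h1] at h2
    exact le_of_mul_le_mul_left h2 h

theorem expRatio_pos {H : ℝ} (hH : 0 ≤ H) : 0 < expRatio H :=
  (Real.exp_pos _).trans_le (exp_neg_le_expRatio hH)

/-- Differentiable functions with nonnegative derivative of bounded logarithmic growth. -/
structure LogLip (ψ : ℝ → ℝ) (C : ℝ) : Prop where
  diff : Differentiable ℝ ψ
  nonneg : ∀ x, 0 ≤ deriv ψ x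
  C_nonneg : 0 ≤ C
  growth : ∀ h h' : ℝ, deriv ψ h ≤ deriv ψ h' * Real.exp (C * |h - h'|)

theorem logLip_exp : LogLip Real.exp 1 where
  diff := Real.differentiable_exp
  nonneg x := by rw [Real.deriv_exp]; exact (Real.exp_pos x).le
  C_nonneg := zero_le_one
  growth h h' := by
    rw [Real.deriv_exp, ← Real.exp_add]
    exact Real.exp_le_exp.2 (by linarith [le_abs_self (h - h')])

theorem LogLip.reflect {ψ : ℝ → ℝ} {C : ℝ} (h : LogLip ψ C) : LogLip (fun x => - ψ (-x)) C := by
  have hd : ∀ x, deriv (fun x => - ψ (-x)) x = deriv ψ (-x) := by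
    intro x
    have h1 : HasDerivAt (fun x => - ψ (-x)) (deriv ψ (-x)) x :=
      ((h.diff (-x)).hasDerivAt.comp x (hasDerivAt_neg x)).neg.congr_deriv (by ring)
    exact h1.deriv
  refine ⟨fun x => ?_, fun x => ?_, h.C_nonneg, fun x x' => ?_⟩
  · exact ((h.diff (-x)).comp x differentiable_neg.differentiableAt).neg
  · rw [hd]; exact h.nonneg _
  · rw [hd, hd]
    have := h.growth (-x) (-x')
    rwa [neg_sub_neg, abs_sub_comm] at this

/-- Integrate ψ'(u + y) ≥ ψ'(u) e^{−Cy} over [0, x]. Enlarging the decay rate from C to H/x makes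
the integral exactly ψ'(u) x (1 − e^{−H})/H. The case H = 0 forces C = 0 and is treated apart. -/
theorem LogLip.sub_ge_of_pos {ψ : ℝ → ℝ} {C : ℝ} (h : LogLip ψ C) {u x H : ℝ} (hx : 0 < x)
    (hH : C * x ≤ H) : deriv ψ u * expRatio H * x ≤ ψ (u + x) - ψ u := by
  have hlow : ∀ y, 0 ≤ y → deriv ψ u * Real.exp (-(C * y)) ≤ deriv ψ (u + y) := by
    intro y hy
    have h1 := h.growth u (u + y)
    rw [sub_add_cancel_left, abs_neg, abs_of_nonneg hy] at h1
    have h2 : Real.exp (C * y) * Real.exp (-(C * y)) = 1 := by rw [← Real.exp_add]; simp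
    calc _ ≤ deriv ψ (u + y) * Real.exp (C * y) * Real.exp (-(C * y)) :=
          mul_le_mul_of_nonneg_right h1 (Real.exp_pos _).le
      _ = _ := by rw [mul_assoc, h2, mul_one]
  have hH0 : 0 ≤ H := (mul_nonneg h.C_nonneg hx.le).trans hH
  have hψd : ∀ y, HasDerivAt (fun y => ψ (u + y)) (deriv ψ (u + y)) y := fun y =>
    (h.diff (u + y)).hasDerivAt.comp_const_add u y
  rcases hH0.eq_or_lt with rfl | hHpos
  · have hC : C = 0 := by
      have := h.C_nonneg
      nlinarith
    have hd : ∀ y, HasDerivAt (fun y => ψ (u + y) - deriv ψ u * y)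
        (deriv ψ (u + y) - deriv ψ u) y := fun y =>
      ((hψd y).sub ((hasDerivAt_id y).const_mul (deriv ψ u))).congr_deriv (by ring)
    have hmono : MonotoneOn (fun y => ψ (u + y) - deriv ψ u * y) (Set.Ici 0) := by
      refine monotoneOn_of_deriv_nonneg (convex_Ici 0)
        (fun y _ => (hd y).continuousAt.continuousWithinAt)
        (fun y _ => (hd y).differentiableAt.differentiableWithinAt) (fun y hy => ?_)
      rw [(hd y).deriv]
      rw [interior_Ici] at hy
      have := hlow y (le_of_lt hy)
      rw [hC] at this
      simp at this
      linarith
    have := hmono (Set.mem_Ici.2 le_rfl) (Set.mem_Ici.2 hx.le) hx.le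
    simp [expRatio] at this ⊢
    linarith
  · set c := H / x with hc
    have hcpos : 0 < c := div_pos hHpos hx
    have hCc : C ≤ c := by rw [hc, le_div_iff₀ hx]; exact hH
    have hd : ∀ y, HasDerivAt (fun y => ψ (u + y) + deriv ψ u * (Real.exp (-(c * y)) / c))
        (deriv ψ (u + y) - deriv ψ u * Real.exp (-(c * y))) y := fun y => by
      have h1 : HasDerivAt (fun y => Real.exp (-(c * y))) (Real.exp (-(c * y)) * (-(c * 1))) y :=
        (((hasDerivAt_id y).const_mul c).neg).exp
      have h2 := (hψd y).add ((h1.div_const c).const_mul (deriv ψ u))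
      refine h2.congr_deriv ?_
      field_simp
      ring
    have hmono : MonotoneOn (fun y => ψ (u + y) + deriv ψ u * (Real.exp (-(c * y)) / c))
        (Set.Ici 0) := by
      refine monotoneOn_of_deriv_nonneg (convex_Ici 0)
        (fun y _ => (hd y).continuousAt.continuousWithinAt)
        (fun y _ => (hd y).differentiableAt.differentiableWithinAt) (fun y hy => ?_)
      rw [(hd y).deriv]
      rw [interior_Ici] at hy
      have hy0 : 0 < y := hy
      have h1 := hlow y hy0.le
      have h2 : deriv ψ u * Real.exp (-(c * y)) ≤ deriv ψ u * Real.exp (-(C * y)) :=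
        mul_le_mul_of_nonneg_left (Real.exp_le_exp.2 (by nlinarith)) (h.nonneg u)
      linarith
    have h1 := hmono (Set.mem_Ici.2 le_rfl) (Set.mem_Ici.2 hx.le) hx.le
    have hcx : c * x = H := by rw [hc]; field_simp
    simp only [add_zero, mul_zero, neg_zero, Real.exp_zero, hcx] at h1
    have h2 : expRatio H * x = 1 / c - Real.exp (-H) / c := by
      rw [← sub_div, ← mul_expRatio H, hc]; field_simp
    rw [mul_assoc, h2, mul_sub]
    linarith

/-- A quadratic lower bound for one summand of a symmetrized Bregman divergence. Negative increments
reduce to positive ones through `LogLip.reflect`. -/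
theorem LogLip.mul_sq_le {ψ : ℝ → ℝ} {C : ℝ} (h : LogLip ψ C) {u x H : ℝ}
    (hH : C * |x| ≤ H) : deriv ψ u * expRatio H * x ^ 2 ≤ (ψ (u + x) - ψ u) * x := by
  rcases lt_trichotomy x 0 with hx | rfl | hx
  · have h1 := h.reflect.sub_ge_of_pos (u := -u) (x := -x) (H := H) (by linarith)
      (by rwa [abs_of_neg hx] at hH)
    have hd : deriv (fun x => - ψ (-x)) (-u) = deriv ψ u := by
      have h1 : HasDerivAt (fun x => - ψ (-x)) (deriv ψ u) (-u) := by
        have h2 : HasDerivAt ψ (deriv ψ u) (- -u) := by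
          rw [neg_neg]; exact (h.diff u).hasDerivAt
        exact (h2.comp (-u) (hasDerivAt_neg (-u))).neg.congr_deriv (by ring)
      exact h1.deriv
    rw [hd] at h1
    simp only [neg_add_rev, neg_neg] at h1
    rw [add_comm x u] at h1
    nlinarith
  · simp
  · rw [abs_of_pos hx] at hH
    have h1 := h.sub_ge_of_pos (u := u) hx hH
    nlinarith

theorem LogLip.abs_sub_le {ψ : ℝ → ℝ} {C : ℝ} (h : LogLip ψ C) {u x y R : ℝ}
    (hx : |x| ≤ R) (hy : |y| ≤ R) :
    |ψ (u + x) - ψ (u + y)| ≤ deriv ψ u * Real.exp (C * R) * |x - y| := by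
  have hd : ∀ y, HasDerivAt (fun y => ψ (u + y)) (deriv ψ (u + y)) y := fun y =>
    (h.diff (u + y)).hasDerivAt.comp_const_add u y
  have := Convex.norm_image_sub_le_of_norm_hasDerivWithin_le (s := Set.Icc (-R) R)
    (f := fun y => ψ (u + y)) (C := deriv ψ u * Real.exp (C * R)) (x := y) (y := x)
    (fun z _ => (hd z).hasDerivWithinAt) (fun z hz => by
      rw [Real.norm_of_nonneg (h.nonneg _)]
      have h1 := h.growth (u + z) u
      rw [add_sub_cancel_left] at h1
      refine h1.trans (mul_le_mul_of_nonneg_left (Real.exp_le_exp.2 ?_) (h.nonneg u))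
      exact mul_le_mul_of_nonneg_left (abs_le.2 hz) h.C_nonneg)
    (convex_Icc _ _) (abs_le.1 hy) (abs_le.1 hx)
  simpa using this

/-- The localization argument for penalized estimators with self-concordant-type losses. -/
theorem margin_bound {e m B F κ η D N Q X : ℝ} (he : 0 < e) (hm : 0 < m) (hB : 0 < B)
    (hF : 0 ≤ F) (hκ : 0 ≤ κ) (hη : η < 1) (hN : 0 ≤ N) (hQ : 0 ≤ Q)
    (h1 : e * D + B * N ≤ X) (h2 : X ^ 2 ≤ F * Q) (h3 : m * expRatio (κ * N) * Q ≤ D)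
    (h4 : κ * F ≤ η * (e * m * B)) : e * D + B * N ≤ F / (e * m * (1 - η)) := by
  have hκN : 0 ≤ κ * N := mul_nonneg hκ hN
  have hq := expRatio_pos hκN
  have hD : 0 ≤ D := le_trans (by positivity) h3
  have hη1 : 0 < 1 - η := by linarith
  have hBN : 0 ≤ B * N := by positivity
  have heD : 0 ≤ e * D := by positivity
  set S := e * D + B * N with hS
  have hS0 : 0 ≤ S := by positivity
  rcases hS0.eq_or_lt with h0 | hpos
  · rw [← h0]; positivity
  have h5 : S ^ 2 ≤ F * Q := (pow_le_pow_left₀ hS0 h1 2).trans h2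
  set q := expRatio (κ * N) with hqdef
  -- S² is at most FQ, and the curvature bound `h3` gives e m q Q ≤ S; eliminating Q bounds S, but
  -- with a factor q that still depends on N.
  have h6 : e * m * q * S ≤ F := by
    have h7 : e * (m * q * Q) ≤ S := (mul_le_mul_of_nonneg_left h3 he.le).trans (by linarith)
    have h8 : (e * m * q * S) * S ≤ F * S := by
      calc (e * m * q * S) * S = e * m * q * S ^ 2 := by ring
        _ ≤ e * m * q * (F * Q) := by gcongr
        _ = F * (e * (m * q * Q)) := by ring
        _ ≤ F * S := by gcongr
    exact le_of_mul_le_mul_right h8 hpos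
  -- Since BN ≤ S and κN·q = 1 − e^{−κN}, the bound `h6` multiplied by κ controls e^{−κN} itself.
  -- Hence q ≥ e^{−κN} ≥ 1 − η with no prior bound on N.
  have h9 : 1 - Real.exp (-(κ * N)) ≤ η := by
    rw [← mul_expRatio, ← hqdef]
    have h10 : κ * N * q * (e * m * B) ≤ η * (e * m * B) := by
      calc κ * N * q * (e * m * B) = κ * (e * m * q * (B * N)) := by ring
        _ ≤ κ * (e * m * q * S) := by gcongr; linarith
        _ ≤ κ * F := by gcongr
        _ ≤ _ := h4
    exact le_of_mul_le_mul_right h10 (by positivity)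
  have h11 : 1 - η ≤ q := by linarith [exp_neg_le_expRatio hκN]
  rw [le_div_iff₀ (by positivity)]
  calc S * (e * m * (1 - η)) ≤ S * (e * m * q) := by gcongr
    _ = e * m * q * S := by ring
    _ ≤ F := h6

/-! ### Sample averages -/

section Avg

variable {n : ℕ}

theorem avg_add (f g : Fin n → ℝ) : avg (fun i => f i + g i) = avg f + avg g := by
  simp [avg, Finset.sum_add_distrib, add_div]

theorem avg_sub (f g : Fin n → ℝ) : avg (fun i => f i - g i) = avg f - avg g := by
  simp [avg, Finset.sum_sub_distrib, sub_div]

theorem avg_mul_left (x : ℝ) (f : Fin n → ℝ) : avg (fun i => x * f i) = x * avg f := by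
  simp [avg, ← Finset.mul_sum, mul_div_assoc]

theorem avg_mono {f g : Fin n → ℝ} (h : ∀ i, f i ≤ g i) : avg f ≤ avg g :=
  div_le_div_of_nonneg_right (Finset.sum_le_sum fun i _ => h i) (Nat.cast_nonneg n)

theorem avg_nonneg {f : Fin n → ℝ} (h : ∀ i, 0 ≤ f i) : 0 ≤ avg f :=
  div_nonneg (Finset.sum_nonneg fun i _ => h i) (Nat.cast_nonneg n)

theorem avg_sum {ι : Type*} (s : Finset ι) (f : ι → Fin n → ℝ) :
    avg (fun i => ∑ k ∈ s, f k i) = ∑ k ∈ s, avg (f k) := by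
  simp only [avg]
  rw [Finset.sum_comm, Finset.sum_div]

theorem abs_avg_le (f : Fin n → ℝ) : |avg f| ≤ avg fun i => |f i| := by
  unfold avg
  rw [abs_div, Nat.abs_cast]
  exact div_le_div_of_nonneg_right (Finset.abs_sum_le_sum_abs _ _) (Nat.cast_nonneg n)

/-- The weighted Cauchy-Schwarz inequality for averages of finite sums. -/
theorem avg_sum_mul_le {κ : Type*} [Fintype κ] {w x y : Fin n → κ → ℝ} (hw : ∀ i k, 0 ≤ w i k) :
    avg (fun i => ∑ k, w i k * (x i k * y i k)) ≤
      Real.sqrt (avg fun i => ∑ k, w i k * x i k ^ 2) *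
        Real.sqrt (avg fun i => ∑ k, w i k * y i k ^ 2) := by
  have h := Real.sum_mul_le_sqrt_mul_sqrt (Finset.univ : Finset (Fin n × κ))
    (fun q => Real.sqrt (w q.1 q.2) * x q.1 q.2) (fun q => Real.sqrt (w q.1 q.2) * y q.1 q.2)
  simp only [mul_pow, Real.sq_sqrt (hw _ _)] at h
  have e : ∀ q : Fin n × κ, Real.sqrt (w q.1 q.2) * x q.1 q.2 * (Real.sqrt (w q.1 q.2) * y q.1 q.2)
      = w q.1 q.2 * (x q.1 q.2 * y q.1 q.2) := fun q => by
    calc _ = (Real.sqrt (w q.1 q.2) * Real.sqrt (w q.1 q.2)) * (x q.1 q.2 * y q.1 q.2) := by ring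
      _ = _ := by rw [Real.mul_self_sqrt (hw _ _)]
  simp only [e, Fintype.sum_prod_type] at h
  unfold avg
  rw [Real.sqrt_div (Finset.sum_nonneg fun i _ => Finset.sum_nonneg fun k _ =>
      mul_nonneg (hw i k) (sq_nonneg _)),
    Real.sqrt_div (Finset.sum_nonneg fun i _ => Finset.sum_nonneg fun k _ =>
      mul_nonneg (hw i k) (sq_nonneg _)), div_mul_div_comm,
    Real.mul_self_sqrt (Nat.cast_nonneg n)]
  exact div_le_div_of_nonneg_right h (Nat.cast_nonneg n)

end Avg

/-! ### Group Lasso -/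

section Lasso

variable {p K : ℕ} {t : Fin K} {n : ℕ}

theorem rowNorm_add_le (a b : Coef p K t) (j : Fin (p + 1)) :
    rowNorm (a + b) j ≤ rowNorm a j + rowNorm b j := by
  simp only [rowNorm_eq_norm]
  exact norm_add_le (WithLp.toLp 2 (a j) : EuclideanSpace ℝ {k : Fin K // k ≠ t})
    (WithLp.toLp 2 (b j))

theorem rowNorm_smul (x : ℝ) (a : Coef p K t) (j : Fin (p + 1)) :
    rowNorm (x • a) j = |x| * rowNorm a j := by
  simp only [rowNorm_eq_norm]
  exact norm_smul x (WithLp.toLp 2 (a j) : EuclideanSpace ℝ {k : Fin K // k ≠ t})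

theorem rowNorm_neg (a : Coef p K t) (j : Fin (p + 1)) : rowNorm (-a) j = rowNorm a j := by
  simp [rowNorm]

theorem penalty_segment_le (a b : Coef p K t) {u : ℝ} (hu : 0 ≤ u) (hu' : u ≤ 1) :
    penalty (a + u • (b - a)) ≤ penalty a + u * (penalty b - penalty a) := by
  unfold penalty
  rw [← Finset.sum_sub_distrib, Finset.mul_sum, ← Finset.sum_add_distrib]
  refine Finset.sum_le_sum fun j _ => ?_
  have e : a + u • (b - a) = (1 - u) • a + u • b := by
    rw [smul_sub, sub_smul, one_smul]; abel
  rw [e]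
  refine (rowNorm_add_le _ _ _).trans (le_of_eq ?_)
  rw [rowNorm_smul, rowNorm_smul, abs_of_nonneg hu, abs_of_nonneg (by linarith : 0 ≤ 1 - u)]
  ring

theorem zero_mem_sparsity (b : Coef p K t) : 0 ∈ sparsity b := by
  simp [sparsity]

theorem one_le_card_sparsity (b : Coef p K t) : (1 : ℝ) ≤ (sparsity b).card := by
  exact_mod_cast Finset.card_pos.2 ⟨0, zero_mem_sparsity b⟩

theorem row_eq_zero_of_notMem {b : Coef p K t} {j : Fin (p + 1)} (hj : j ∉ sparsity b)
    (k : {k : Fin K // k ≠ t}) : b j k = 0 := by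
  by_contra h
  exact hj (by simpa [sparsity] using Or.inr ⟨k, k.2, h⟩)

theorem sum_add_sum_compl_rowNorm (S : Finset (Fin (p + 1))) (b : Coef p K t) :
    ∑ j ∈ S, rowNorm b j + ∑ j ∈ Sᶜ, rowNorm b j = norm21 b :=
  Finset.sum_add_sum_compl S _

/-- The intercept row is not penalized, but 0 lies in `sparsity b`, so that row contributes
nonnegatively on the right and may be added for free. -/
theorem penalty_sub_penalty_le (a b : Coef p K t) :
    penalty b - penalty a ≤
      ∑ j ∈ sparsity b, rowNorm (a - b) j - ∑ j ∈ (sparsity b)ᶜ, rowNorm (a - b) j := by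
  classical
  have hrow : ∀ j, rowNorm b j - rowNorm a j ≤
      if j ∈ sparsity b then rowNorm (a - b) j else - rowNorm (a - b) j := by
    intro j
    split_ifs with h
    · have := rowNorm_add_le a (-(a - b)) j
      rw [rowNorm_neg] at this
      have e : a + -(a - b) = b := by abel
      rw [e] at this
      linarith
    · have h0 := row_eq_zero_of_notMem h
      have e1 : rowNorm b j = 0 := by simp [rowNorm, h0]
      have e2 : rowNorm (a - b) j = rowNorm a j := by simp [rowNorm, h0]
      rw [e1, e2]; linarith
  have hsplit : ∑ j, (if j ∈ sparsity b then rowNorm (a - b) j else - rowNorm (a - b) j) =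
      ∑ j ∈ sparsity b, rowNorm (a - b) j - ∑ j ∈ (sparsity b)ᶜ, rowNorm (a - b) j := by
    rw [← Finset.sum_add_sum_compl (sparsity b),
      sub_eq_add_neg (∑ j ∈ sparsity b, rowNorm (a - b) j), ← Finset.sum_neg_distrib]
    congr 1
    · exact Finset.sum_congr rfl fun j hj => if_pos hj
    · exact Finset.sum_congr rfl fun j hj => if_neg (Finset.mem_compl.1 hj)
  rw [← hsplit, Fin.sum_univ_succ, if_pos (zero_mem_sparsity b)]
  unfold penalty
  rw [← Finset.sum_sub_distrib]
  have h1 := Finset.sum_le_sum fun (j : Fin p) (_ : j ∈ Finset.univ) => hrow j.succ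
  have h2 := rowNorm_nonneg (a - b) 0
  linarith

theorem lasso_cone_bound {a b : Coef p K t} {A lam D E : ℝ} (hA : 0 ≤ A) (hlam : 0 ≤ lam)
    (h : D + A * lam * (penalty a - penalty b) ≤ lam * norm21 (a - b) + E) :
    D + (A - 1) * lam * norm21 (a - b) ≤ 2 * A * lam * ∑ j ∈ sparsity b, rowNorm (a - b) j + E := by
  have h1 := mul_le_mul_of_nonneg_left (penalty_sub_penalty_le a b) (mul_nonneg hA hlam)
  have h2 := sum_add_sum_compl_rowNorm (sparsity b) (a - b)
  rw [← h2] at h ⊢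
  linarith

/-- A penalized empirical loss with weights `W`, responses `R` and cumulant function `Ψ`. -/
def glmLoss (Ψ : ℝ → ℝ) (W R : Fin n → {k : Fin K // k ≠ t} → ℝ) (v : Fin n → Fin (p + 1) → ℝ)
    (α : Coef p K t) : ℝ :=
  avg fun i => ∑ k, (W i k * Ψ (linPred α (v i) k) - R i k * linPred α (v i) k)

/-- Compare `a` with a + u(b − a) and let u decrease to 0. Only the penalty has to be convex. The
gradient is taken at the estimator, so subtracting the one at the target produces the symmetrized
Bregman divergence. -/
theorem glmLoss_basic_inequality {Ψ ψ : ℝ → ℝ} (hΨ : ∀ x, HasDerivAt Ψ (ψ x) x)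
    {W R : Fin n → {k : Fin K // k ≠ t} → ℝ} {v : Fin n → Fin (p + 1) → ℝ} {lam : ℝ}
    (hlam : 0 ≤ lam) {a : Coef p K t}
    (hmin : ∀ a', glmLoss Ψ W R v a + lam * penalty a ≤ glmLoss Ψ W R v a' + lam * penalty a')
    (b : Coef p K t) :
    avg (fun i => ∑ k, (W i k * ψ (linPred a (v i) k) - R i k) * linPred (a - b) (v i) k)
      + lam * (penalty a - penalty b) ≤ 0 := by
  set G : ℝ → ℝ := fun u => glmLoss Ψ W R v (a + u • (b - a)) with hG
  have hd : HasDerivAt G (avg fun i => ∑ k, (W i k * ψ (linPred a (v i) k) - R i k) *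
      linPred (b - a) (v i) k) 0 := by
    simp only [hG, glmLoss, avg, linPred_add, linPred_smul]
    refine HasDerivAt.div_const (HasDerivAt.fun_sum fun i _ => HasDerivAt.fun_sum fun k _ => ?_) _
    have h1 : HasDerivAt (fun u : ℝ => linPred a (v i) k + u * linPred (b - a) (v i) k)
        (linPred (b - a) (v i) k) 0 := by
      simpa using ((hasDerivAt_id (0 : ℝ)).mul_const (linPred (b - a) (v i) k)).const_add
        (linPred a (v i) k)
    have h2 : HasDerivAt Ψ (ψ (linPred a (v i) k))
        (linPred a (v i) k + 0 * linPred (b - a) (v i) k) := by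
      simpa using hΨ (linPred a (v i) k)
    have h3 := ((h2.comp 0 h1).const_mul (W i k)).sub (h1.const_mul (R i k))
    exact h3.congr_deriv (by ring)
  have hslope := hd.hasDerivWithinAt (s := Set.Ioi 0)
  rw [hasDerivWithinAt_iff_tendsto_slope' (by simp)] at hslope
  have hge : lam * (penalty a - penalty b) ≤ avg fun i => ∑ k,
      (W i k * ψ (linPred a (v i) k) - R i k) * linPred (b - a) (v i) k := by
    refine ge_of_tendsto hslope ?_
    filter_upwards [Ioc_mem_nhdsGT (zero_lt_one' ℝ)] with u hu
    rw [slope_def_field, sub_zero, le_div_iff₀ hu.1]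
    have h1 := hmin (a + u • (b - a))
    have h2 := mul_le_mul_of_nonneg_left (penalty_segment_le a b hu.1.le hu.2) hlam
    have h3 : G 0 = glmLoss Ψ W R v a := by simp [hG]
    rw [h3]
    simp only [hG]
    nlinarith
  have hneg : avg (fun i => ∑ k, (W i k * ψ (linPred a (v i) k) - R i k) *
      linPred (a - b) (v i) k) = - avg (fun i => ∑ k, (W i k * ψ (linPred a (v i) k) - R i k) *
      linPred (b - a) (v i) k) := by
    rw [← neg_one_mul, ← avg_mul_left]
    congr 1
    funext i
    rw [Finset.mul_sum]
    refine Finset.sum_congr rfl fun k _ => ?_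
    rw [linPred_sub, linPred_sub]
    ring
  linarith

theorem abs_avg_pairing_le {x : Fin n → {k : Fin K // k ≠ t} → ℝ} {v : Fin n → Fin (p + 1) → ℝ}
    {lam : ℝ} (h : ∀ j, Real.sqrt (∑ k, (avg fun i => x i k * v i j) ^ 2) ≤ lam)
    (b : Coef p K t) :
    |avg fun i => ∑ k, x i k * linPred b (v i) k| ≤ lam * norm21 b := by
  have e : (avg fun i => ∑ k, x i k * linPred b (v i) k) =
      ∑ j, ∑ k, b j k * avg fun i => x i k * v i j := by
    simp only [← avg_mul_left, ← avg_sum]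
    congr 1
    funext i
    rw [Finset.sum_comm]
    refine Finset.sum_congr rfl fun k _ => ?_
    rw [linPred, Finset.mul_sum]
    refine Finset.sum_congr rfl fun j _ => ?_
    ring
  rw [e, norm21, Finset.mul_sum]
  refine (Finset.abs_sum_le_sum_abs _ _).trans (Finset.sum_le_sum fun j _ => ?_)
  refine (abs_sum_row_mul_le b j _).trans ?_
  rw [mul_comm]
  exact mul_le_mul_of_nonneg_right (h j) (rowNorm_nonneg b j)

/-- The quadratic form with coefficient arrays `E`. -/
def quadForm (E : {k : Fin K // k ≠ t} → Fin (p + 1) → Fin (p + 1) → ℝ) (b : Coef p K t) : ℝ :=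
  ∑ k, ∑ j, ∑ j', b j k * E k j j' * b j' k

/-- Entrywise control is enough: by Cauchy–Schwarz over k, Σ_k |b_jk b_j'k| is at most the product
of two row norms, and these products sum to `norm21 b ^ 2`. -/
theorem abs_avg_sub_quadForm_le {x : Fin n → {k : Fin K // k ≠ t} → ℝ}
    {v : Fin n → Fin (p + 1) → ℝ} {E : {k : Fin K // k ≠ t} → Fin (p + 1) → Fin (p + 1) → ℝ}
    {δ : ℝ} (h : ∀ k j j', |(avg fun i => x i k * v i j * v i j') - E k j j'| ≤ δ)
    (b : Coef p K t) :
    |(avg fun i => ∑ k, x i k * linPred b (v i) k ^ 2) - quadForm E b| ≤ δ * norm21 b ^ 2 := by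
  have e : (avg fun i => ∑ k, x i k * linPred b (v i) k ^ 2) =
      quadForm (fun k j j' => avg fun i => x i k * v i j * v i j') b := by
    unfold quadForm
    rw [avg_sum]
    refine Finset.sum_congr rfl fun k _ => ?_
    have e1 : ∀ j j', b j k * (avg fun i => x i k * v i j * v i j') * b j' k =
        avg fun i => b j k * b j' k * (x i k * v i j * v i j') := fun j j' => by
      rw [avg_mul_left]; ring
    simp only [e1]
    simp only [← avg_sum]
    congr 1
    funext i
    rw [sq, linPred, Finset.sum_mul_sum, Finset.mul_sum]
    refine Finset.sum_congr rfl fun j _ => ?_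
    rw [Finset.mul_sum]
    refine Finset.sum_congr rfl fun j' _ => ?_
    ring
  rw [e]
  unfold quadForm
  simp only [← Finset.sum_sub_distrib]
  -- The hypothesis forces δ ≥ 0 as soon as some column exists; without columns both sides vanish.
  have hδ : 0 ≤ δ ∨ IsEmpty {k : Fin K // k ≠ t} := by
    rcases isEmpty_or_nonempty {k : Fin K // k ≠ t} with hk | ⟨⟨k⟩⟩
    · exact Or.inr hk
    · exact Or.inl ((abs_nonneg _).trans (h k 0 0))
  rcases hδ with hδ | hk
  swap
  · simp [norm21, rowNorm]
  calc |∑ k, ∑ j, ∑ j', (b j k * (avg fun i => x i k * v i j * v i j') * b j' k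
        - b j k * E k j j' * b j' k)|
      ≤ ∑ k, ∑ j, ∑ j', δ * (|b j k| * |b j' k|) := by
        refine (Finset.abs_sum_le_sum_abs _ _).trans (Finset.sum_le_sum fun k _ => ?_)
        refine (Finset.abs_sum_le_sum_abs _ _).trans (Finset.sum_le_sum fun j _ => ?_)
        refine (Finset.abs_sum_le_sum_abs _ _).trans (Finset.sum_le_sum fun j' _ => ?_)
        rw [← sub_mul, ← mul_sub, abs_mul, abs_mul]
        calc _ ≤ |b j k| * δ * |b j' k| := by
              have := h k j j'
              have h1 := abs_nonneg (b j k)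
              have h2 := abs_nonneg (b j' k)
              exact mul_le_mul_of_nonneg_right (mul_le_mul_of_nonneg_left this h1) h2
          _ = _ := by ring
    _ = δ * ∑ j, ∑ j', ∑ k, |b j k| * |b j' k| := by
        simp only [Finset.mul_sum]
        rw [Finset.sum_comm]
        refine Finset.sum_congr rfl fun j _ => ?_
        rw [Finset.sum_comm]
    _ ≤ δ * ∑ j, ∑ j', rowNorm b j * rowNorm b j' := by
        refine mul_le_mul_of_nonneg_left (Finset.sum_le_sum fun j _ =>
          Finset.sum_le_sum fun j' _ => ?_) hδ
        have := Real.sum_mul_le_sqrt_mul_sqrt (Finset.univ) (fun k => |b j k|) (fun k => |b j' k|)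
        simpa [rowNorm] using this
    _ = δ * norm21 b ^ 2 := by
        rw [sq, norm21, Finset.sum_mul_sum]

/-- On the cone the squared norm is at most (1 + ξ)² times the squared partial norm, so entrywise
deviations consume only the fraction η of the population compatibility constant. -/
theorem compat_sample {S : Finset (Fin (p + 1))} {b : Coef p K t} {ν ξ η δ P Q : ℝ} (hν : 0 < ν)
    (hS : 0 < (S.card : ℝ)) (hδ : 0 ≤ δ)
    (hc : ν ^ 2 * (∑ j ∈ S, rowNorm b j) ^ 2 ≤ (S.card : ℝ) * P)
    (hPQ : P - δ * norm21 b ^ 2 ≤ Q)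
    (hcone : norm21 b ≤ (1 + ξ) * ∑ j ∈ S, rowNorm b j)
    (hη : (1 + ξ) ^ 2 / ν ^ 2 * S.card * δ ≤ η) :
    ν ^ 2 * (1 - η) * (∑ j ∈ S, rowNorm b j) ^ 2 ≤ (S.card : ℝ) * Q := by
  set σ := ∑ j ∈ S, rowNorm b j
  have h1 : norm21 b ^ 2 ≤ ((1 + ξ) * σ) ^ 2 := pow_le_pow_left₀ (norm21_nonneg b) hcone 2
  have h2 : (1 + ξ) ^ 2 * S.card * δ ≤ η * ν ^ 2 := by
    have := mul_le_mul_of_nonneg_right hη (sq_nonneg ν)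
    calc _ = (1 + ξ) ^ 2 / ν ^ 2 * S.card * δ * ν ^ 2 := by field_simp
      _ ≤ _ := this
  have h3 : (S.card : ℝ) * (P - δ * ((1 + ξ) * σ) ^ 2) ≤ S.card * Q := by
    refine mul_le_mul_of_nonneg_left (le_trans ?_ hPQ) hS.le
    have := mul_le_mul_of_nonneg_left h1 hδ
    linarith
  have h4 := mul_le_mul_of_nonneg_right h2 (sq_nonneg σ)
  nlinarith

end Lasso

end RCAL

namespace RCAL

/-! ### Ranges of the derived constants -/

namespace Constants

variable {c : Constants}

theorem Valid.one_lt_A1 (hc : c.Valid) : 1 < c.A1 := by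
  have h := hc.A1
  have h1 := hc.ξ1
  refine lt_trans ?_ h
  rw [lt_div_iff₀ (by linarith)]
  linarith

theorem Valid.one_lt_A2 (hc : c.Valid) : 1 < c.A2 := by
  have h := hc.A2
  have h1 := hc.ξ2
  refine lt_trans ?_ h
  rw [lt_div_iff₀ (by linarith)]
  linarith

/-- This is the lower bound on A₁ in another form, since (ξ₁ + 1)(A₁ − 1) − 2A₁ = A₁(ξ₁ − 1) − (ξ₁ +
1). It lets the Lasso inequality imply the cone condition with constant ξ₁. -/
theorem Valid.two_A1_le (hc : c.Valid) : 2 * c.A1 ≤ c.ξ11 := by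
  have h := hc.A1
  have h1 := hc.ξ1
  rw [div_lt_iff₀ (by linarith)] at h
  unfold ξ11
  nlinarith

theorem Valid.two_A2_lt (hc : c.Valid) : 2 * c.A2 < c.ξ22 := by
  have h := hc.A2
  have h1 := hc.ξ2
  rw [div_lt_iff₀ (by linarith)] at h
  unfold ξ22
  nlinarith

theorem Valid.ξ22_pos (hc : c.Valid) : 0 < c.ξ22 := by
  linarith [hc.two_A2_lt, hc.one_lt_A2]

theorem Valid.ξ21_eq (_ : c.Valid) : c.ξ21 = 1 - 2 * c.A2 / c.ξ22 := rfl

theorem Valid.ξ21_pos (hc : c.Valid) : 0 < c.ξ21 := by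
  rw [hc.ξ21_eq, sub_pos, div_lt_one hc.ξ22_pos]
  exact hc.two_A2_lt

theorem Valid.ν11_sq (hc : c.Valid) : c.ν11 ^ 2 = c.ν1 ^ 2 * (1 - c.η11) * (1 - c.η12) := by
  unfold ν11
  rw [mul_pow, mul_pow, Real.sq_sqrt (by linarith [hc.η11.2]),
    Real.sq_sqrt (by linarith [hc.η12.2])]

theorem Valid.ν22_sq (hc : c.Valid) :
    c.ν22 ^ 2 = c.ν2 ^ 2 * (1 - c.η2) * (1 - c.η21) * c.C2 := by
  unfold ν22 ν21
  rw [mul_pow, mul_pow, mul_pow, Real.sq_sqrt (by linarith [hc.η2.2]),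
    Real.sq_sqrt (by linarith [hc.η21.2]), Real.sq_sqrt hc.C2.le]

theorem Valid.ξ23_sq (hc : c.Valid) : c.ξ23 ^ 2 = c.ξ21 ^ 2 * (1 - c.η22) * c.C2 := by
  unfold ξ23
  rw [mul_pow, mul_pow, Real.sq_sqrt (by linarith [hc.η22.2]), Real.sq_sqrt hc.C2.le]

theorem Valid.M1_nonneg (_ : c.Valid) : 0 ≤ c.M1 := by
  unfold M1; positivity

theorem Valid.η13_nonneg (hc : c.Valid) (h : 0 ≤ c.η1) : 0 ≤ c.η13 := by
  have h1 := hc.one_lt_A1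
  have h2 := hc.B0
  have h3 := hc.M1_nonneg
  have h4 : 0 ≤ (c.A1 - 1)⁻¹ := inv_nonneg.2 (by linarith)
  unfold η13
  positivity

theorem Valid.M11_nonneg (hc : c.Valid) (h : 0 ≤ c.η1) : 0 ≤ c.M11 := by
  have h3 := hc.M1_nonneg
  unfold M11
  positivity

/-- The bound for the penalized symmetrized Bregman divergence of the outcome regression. -/
def wlBound (c : Constants) (sg sa l1 l2 : ℝ) : ℝ :=
  Real.exp (3 * c.η13) * (c.M11 * sg * l1 ^ 2) / c.ξ23 ^ 2
    + Real.exp c.η13 * c.ξ22 ^ 2 * (sa * l2 ^ 2) / c.ν22 ^ 2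

end Constants

/-! ### Deterministic error bounds on a good sample -/

section Deterministic

variable {p K : ℕ} {t : Fin K} {n : ℕ}

/-- The calibration weight `R^{(t)} exp(γ_kᵀ v)`. -/
def calWt (γ : Coef p K t) (s : Fin K) (v : Fin (p + 1) → ℝ) (k : {k : Fin K // k ≠ t}) : ℝ :=
  treatInd s t * Real.exp (linPred γ v k)

theorem treatInd_nonneg (s k : Fin K) : 0 ≤ treatInd s k := by
  unfold treatInd; split_ifs <;> norm_num

theorem treatInd_le_one (s k : Fin K) : treatInd s k ≤ 1 := by
  unfold treatInd; split_ifs <;> norm_num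

theorem calWt_nonneg (γ : Coef p K t) (s : Fin K) (v : Fin (p + 1) → ℝ)
    (k : {k : Fin K // k ≠ t}) : 0 ≤ calWt γ s v k :=
  mul_nonneg (treatInd_nonneg s t) (Real.exp_pos _).le

theorem psIndex_base (γ : Coef p K t) (v : Fin (p + 1) → ℝ) : psIndex γ v t = 0 := by
  simp [psIndex]

theorem psIndex_coe (γ : Coef p K t) (v : Fin (p + 1) → ℝ) (k : {k : Fin K // k ≠ t}) :
    psIndex γ v k = linPred γ v k := by
  simp [psIndex, k.2]

theorem psRatio_eq_exp (γ : Coef p K t) (v : Fin (p + 1) → ℝ) (k : {k : Fin K // k ≠ t}) :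
    psRatio γ v k = Real.exp (linPred γ v k) := by
  have h : 0 < ∑ l, Real.exp (psIndex γ v l) :=
    Finset.sum_pos (fun l _ => Real.exp_pos _) ⟨t, Finset.mem_univ t⟩
  unfold psRatio ps
  rw [psIndex_base, psIndex_coe, Real.exp_zero]
  field_simp

/-- The empirical quadratic form `Ẽ ∑_k w_k (b_kᵀ v)²`. -/
def sampleQuad (x : Fin n → {k : Fin K // k ≠ t} → ℝ) (v : Fin n → Fin (p + 1) → ℝ)
    (b : Coef p K t) : ℝ :=
  avg fun i => ∑ k, x i k * linPred b (v i) k ^ 2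

theorem sampleQuad_nonneg {x : Fin n → {k : Fin K // k ≠ t} → ℝ} (hx : ∀ i k, 0 ≤ x i k)
    (v : Fin n → Fin (p + 1) → ℝ) (b : Coef p K t) : 0 ≤ sampleQuad x v b :=
  avg_nonneg fun i => Finset.sum_nonneg fun k _ => mul_nonneg (hx i k) (sq_nonneg _)

/-- The properties of a sample on which the error bounds hold. -/
structure SampleGood (c : Constants) (ψ : ℝ → ℝ) (y : Fin n → ℝ) (s : Fin n → Fin K)
    (v : Fin n → Fin (p + 1) → ℝ) (γ α : Coef p K t) (l1 l2 : ℝ)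
    (E EZ : {k : Fin K // k ≠ t} → Fin (p + 1) → Fin (p + 1) → ℝ) : Prop where
  bounded : ∀ i j, |v i j| ≤ c.B0
  upper : ∀ i k, deriv ψ (linPred α (v i) k) ≤ c.C1
  lower : ∀ i k, c.C2 ≤ deriv ψ (linPred α (v i) k)
  cal : ∀ j, Real.sqrt (∑ k : {k : Fin K // k ≠ t},
    (avg fun i => (calWt γ (s i) (v i) k - treatInd (s i) k) * v i j) ^ 2) ≤ l1
  wl : ∀ j, Real.sqrt (∑ k : {k : Fin K // k ≠ t},
    (avg fun i => calWt γ (s i) (v i) k * (y i - ψ (linPred α (v i) k)) * v i j) ^ 2) ≤ l2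
  quad : ∀ k j j', |(avg fun i => calWt γ (s i) (v i) k * v i j * v i j') - E k j j'| ≤ l1 / 2
  quadZ : ∀ k j j', |(avg fun i => calWt γ (s i) (v i) k * (y i - ψ (linPred α (v i) k)) ^ 2
    * v i j * v i j') - EZ k j j'| ≤ 2 * c.σ0 ^ 2 * l1

/-- The compatibility condition for a quadratic form. -/
def CompatForm (E : {k : Fin K // k ≠ t} → Fin (p + 1) → Fin (p + 1) → ℝ)
    (S : Finset (Fin (p + 1))) (ν ξ : ℝ) : Prop :=
  ∀ b : Coef p K t, ∑ j ∈ Sᶜ, rowNorm b j ≤ ξ * ∑ j ∈ S, rowNorm b j →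
    ν ^ 2 * (∑ j ∈ S, rowNorm b j) ^ 2 ≤ (S.card : ℝ) * quadForm E b

variable {c : Constants} {ψ : ℝ → ℝ} {y : Fin n → ℝ} {s : Fin n → Fin K}
  {v : Fin n → Fin (p + 1) → ℝ} {γb αb γh αh : Coef p K t} {l1 l2 : ℝ}
  {E EZ : {k : Fin K // k ≠ t} → Fin (p + 1) → Fin (p + 1) → ℝ}

theorem compat_of_norm21_le {S : Finset (Fin (p + 1))} {ν ξ η : ℝ} (hν : 0 < ν)
    (hS : 0 < (S.card : ℝ)) (hl1 : 0 ≤ l1) (hE : CompatForm E S ν ξ)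
    (hG : SampleGood c ψ y s v γb αb l1 l2 E EZ)
    (hη : (1 + ξ) ^ 2 / ν ^ 2 * S.card * (l1 / 2) ≤ η) {b : Coef p K t}
    (hcone : norm21 b ≤ (1 + ξ) * ∑ j ∈ S, rowNorm b j) :
    ν ^ 2 * (1 - η) * (∑ j ∈ S, rowNorm b j) ^ 2 ≤
      (S.card : ℝ) * sampleQuad (fun i k => calWt γb (s i) (v i) k) v b := by
  refine compat_sample hν hS (by positivity) (hE b ?_) ?_ hcone hη
  · have := sum_add_sum_compl_rowNorm S b
    linarith
  · have := abs_le.1 (abs_avg_sub_quadForm_le hG.quad b)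
    simp only [sampleQuad]
    linarith [this.1]

theorem avg_calLoss (s : Fin n → Fin K) (v : Fin n → Fin (p + 1) → ℝ) (γ : Coef p K t) :
    (avg fun i => calLoss γ (s i) (v i)) = glmLoss Real.exp (fun i _ => treatInd (s i) t)
      (fun i k => treatInd (s i) k) v γ := rfl

set_option maxHeartbeats 400000 in
-- D is the symmetrized Bregman divergence of the calibration loss between γ̂ and γ̄. As the score
-- at γ̄ is at most l1, the basic inequality gives D + (A₁ − 1) l1 N ≤ ξ₁₁ l1 σ and thereby the cone
-- condition. Compatibility turns σ² into the quadratic form Q, and `margin_bound` with e = m = 1, κ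
-- = B₀ closes the circle. The two conclusions are this bound read for N and for D, the latter using
-- e^{−η₁₃} ≤ `expRatio (c.B0 * N)`.
theorem cal_estimator_bound (hc : c.Valid) (hl1 : 0 < l1)
    (hG : SampleGood c ψ y s v γb αb l1 l2 E EZ)
    (hE : CompatForm E (sparsity γb) c.ν1 c.ξ1)
    (hsa : (c.ξ1 + 1) ^ 2 / c.ν1 ^ 2 * (sparsity γb).card * l1 ≤ c.η11)
    (hsb : c.B0 * (c.ξ1 + 1) ^ 2 * (c.A1 - 1) * (1 - c.η11)⁻¹ / c.ν1 ^ 2 *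
      (sparsity γb).card * l1 ≤ c.η12)
    (hη1 : (sparsity γb).card * l1 ≤ c.η1)
    (hγ : IsRegCal (c.A1 * l1) s v γh) :
    norm21 (γh - γb) ≤ (c.A1 - 1)⁻¹ * c.M1 * ((sparsity γb).card * l1) ∧
      sampleQuad (fun i k => calWt γb (s i) (v i) k) v (γh - γb) ≤
        Real.exp c.η13 * (c.M1 * ((sparsity γb).card * l1 ^ 2)) := by
  set b := γh - γb with hb
  set sg : ℝ := ((sparsity γb).card : ℝ) with hsg
  have hsg1 : 1 ≤ sg := one_le_card_sparsity γb
  set Q := sampleQuad (fun i k => calWt γb (s i) (v i) k) v b with hQ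
  set N := norm21 b with hN
  have hN0 : 0 ≤ N := norm21_nonneg b
  have hQ0 : 0 ≤ Q := sampleQuad_nonneg (fun i k => calWt_nonneg _ _ _ _) v b
  have hA1 := hc.one_lt_A1
  have hB0 := hc.B0
  have hν1 := hc.ν1
  have hη11 := hc.η11
  have hη12 := hc.η12
  have hξ1 := hc.ξ1
  set D := avg fun i => ∑ k : {k : Fin K // k ≠ t}, treatInd (s i) t *
    ((Real.exp (linPred γb (v i) k + linPred b (v i) k) - Real.exp (linPred γb (v i) k))
      * linPred b (v i) k) with hD
  have hγh : ∀ i k, linPred γh (v i) k = linPred γb (v i) k + linPred b (v i) k := by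
    intro i k; rw [hb, linPred_sub]; ring
  have hbasic := glmLoss_basic_inequality (Ψ := Real.exp) (ψ := Real.exp) Real.hasDerivAt_exp
    (W := fun i _ => treatInd (s i) t) (R := fun i k => treatInd (s i) k) (v := v)
    (lam := c.A1 * l1) (by positivity) (a := γh)
    (fun a' => by rw [← avg_calLoss, ← avg_calLoss]; exact hγ a') γb
  have hscore := abs_le.1 (abs_avg_pairing_le hG.cal b)
  have hsplit : (avg fun i => ∑ k : {k : Fin K // k ≠ t},
      (treatInd (s i) t * Real.exp (linPred γh (v i) k) - treatInd (s i) k) *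
        linPred (γh - γb) (v i) k) = D + avg fun i => ∑ k : {k : Fin K // k ≠ t},
        (calWt γb (s i) (v i) k - treatInd (s i) k) * linPred b (v i) k := by
    rw [hD, ← avg_add]
    congr 1
    funext i
    rw [← Finset.sum_add_distrib]
    refine Finset.sum_congr rfl fun k _ => ?_
    rw [hγh, calWt]
    ring
  rw [hsplit] at hbasic
  have hlow : 1 * expRatio (c.B0 * N) * Q ≤ D := by
    rw [one_mul, hQ, sampleQuad, ← avg_mul_left, hD]
    refine avg_mono fun i => ?_
    rw [Finset.mul_sum]
    refine Finset.sum_le_sum fun k _ => ?_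
    have h := logLip_exp.mul_sq_le (u := linPred γb (v i) k) (x := linPred b (v i) k)
      (H := c.B0 * N) (by rw [one_mul]; exact abs_linPred_le b (hG.bounded i) k)
    rw [Real.deriv_exp] at h
    calc _ = treatInd (s i) t * (Real.exp (linPred γb (v i) k) * expRatio (c.B0 * N)
          * linPred b (v i) k ^ 2) := by rw [calWt]; ring
      _ ≤ _ := mul_le_mul_of_nonneg_left h (treatInd_nonneg _ _)
  have hq := expRatio_pos (H := c.B0 * N) (by positivity)
  have hD0 : 0 ≤ D := le_trans (by positivity) hlow
  set σ := ∑ j ∈ sparsity γb, rowNorm b j with hσ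
  have hσ0 : 0 ≤ σ := Finset.sum_nonneg fun j _ => rowNorm_nonneg b j
  have hcone1 := lasso_cone_bound (a := γh) (b := γb) (A := c.A1) (lam := l1) (D := D) (E := 0)
    (by linarith) hl1.le (by linarith [hscore.1])
  have hX : D + (c.A1 - 1) * l1 * N ≤ c.ξ11 * l1 * σ := by
    have h1 := hc.two_A1_le
    have h2 : 2 * c.A1 * l1 * σ ≤ c.ξ11 * l1 * σ := by gcongr
    linarith
  have hcone : N ≤ (1 + c.ξ1) * σ := by
    have h1 : (c.A1 - 1) * l1 * N ≤ (c.A1 - 1) * l1 * ((1 + c.ξ1) * σ) := by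
      calc _ ≤ c.ξ11 * l1 * σ := by linarith
        _ = _ := by unfold Constants.ξ11; ring
    exact le_of_mul_le_mul_left h1 (mul_pos (by linarith) hl1)
  have hcompat := compat_of_norm21_le (η := c.η11) hν1 (by linarith : 0 < sg) hl1.le hE hG (by
    refine le_trans ?_ hsa
    rw [add_comm 1 c.ξ1]
    have : 0 ≤ (c.ξ1 + 1) ^ 2 / c.ν1 ^ 2 * sg := by positivity
    nlinarith) hcone
  have h11 : 0 < 1 - c.η11 := by linarith
  have h12 : 0 < 1 - c.η12 := by linarith
  have hmar := margin_bound (e := 1) (m := 1) (B := (c.A1 - 1) * l1)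
    (F := c.ξ11 ^ 2 * l1 ^ 2 * sg / (c.ν1 ^ 2 * (1 - c.η11))) (κ := c.B0) (η := c.η12)
    (D := D) (N := N) (Q := Q) (X := c.ξ11 * l1 * σ) one_pos one_pos
    (mul_pos (by linarith) hl1) (by positivity) (by linarith) hη12.2 hN0 hQ0
    (by linarith) (by
      rw [div_mul_eq_mul_div, le_div_iff₀ (by positivity)]
      calc (c.ξ11 * l1 * σ) ^ 2 * (c.ν1 ^ 2 * (1 - c.η11))
          = c.ξ11 ^ 2 * l1 ^ 2 * (c.ν1 ^ 2 * (1 - c.η11) * σ ^ 2) := by ring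
        _ ≤ c.ξ11 ^ 2 * l1 ^ 2 * (sg * Q) := by gcongr
        _ = _ := by ring) hlow (by
      have h := mul_le_mul_of_nonneg_right hsb (by nlinarith : 0 ≤ (c.A1 - 1) * l1)
      calc _ = c.B0 * (c.ξ1 + 1) ^ 2 * (c.A1 - 1) * (1 - c.η11)⁻¹ / c.ν1 ^ 2 *
            sg * l1 * ((c.A1 - 1) * l1) := by
            unfold Constants.ξ11; field_simp
        _ ≤ _ := by linarith)
  have hM : c.ξ11 ^ 2 * l1 ^ 2 * sg / (c.ν1 ^ 2 * (1 - c.η11)) / (1 * 1 * (1 - c.η12)) =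
      c.M1 * (sg * l1 ^ 2) := by
    unfold Constants.M1
    rw [hc.ν11_sq]
    field_simp
  rw [hM, one_mul] at hmar
  have hNle : N ≤ (c.A1 - 1)⁻¹ * c.M1 * (sg * l1) := by
    have hpos : 0 < (c.A1 - 1) * l1 := mul_pos (by linarith) hl1
    have h1 : (c.A1 - 1) * l1 * N ≤ (c.A1 - 1) * l1 * ((c.A1 - 1)⁻¹ * c.M1 * (sg * l1)) := by
      have hA : c.A1 - 1 ≠ 0 := by linarith
      calc _ ≤ c.M1 * (sg * l1 ^ 2) := by linarith
        _ = _ := by field_simp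
    exact le_of_mul_le_mul_left h1 hpos
  refine ⟨hNle, ?_⟩
  have hBN : c.B0 * N ≤ c.η13 := by
    have hA : 0 ≤ (c.A1 - 1)⁻¹ := inv_nonneg.2 (by linarith)
    have hM1 := hc.M1_nonneg
    calc c.B0 * N ≤ c.B0 * ((c.A1 - 1)⁻¹ * c.M1 * (sg * l1)) := by gcongr
      _ ≤ c.B0 * ((c.A1 - 1)⁻¹ * c.M1 * c.η1) := by gcongr
      _ = _ := by unfold Constants.η13; ring
  have h1 : Real.exp (-c.η13) * Q ≤ c.M1 * (sg * l1 ^ 2) := by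
    have h2 : Real.exp (-c.η13) ≤ expRatio (c.B0 * N) :=
      (Real.exp_le_exp.2 (by linarith)).trans (exp_neg_le_expRatio (by positivity))
    have h3 : Real.exp (-c.η13) * Q ≤ expRatio (c.B0 * N) * Q := by gcongr
    have h4 : 0 ≤ (c.A1 - 1) * l1 * N := mul_nonneg (by nlinarith) hN0
    linarith
  have h2 : Real.exp c.η13 * Real.exp (-c.η13) = 1 := by rw [← Real.exp_add]; simp
  calc Q = Real.exp c.η13 * (Real.exp (-c.η13) * Q) := by rw [← mul_assoc, h2, one_mul]
    _ ≤ _ := mul_le_mul_of_nonneg_left h1 (Real.exp_pos _).le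

/-- Three comparisons: the residual-weighted form with its mean, that mean with σ₀² times the mean
of the unweighted form, and the latter with its sample version. The deviations cost 2σ₀² l1 N² and
σ₀² l1 N²/2, for which the constants of `M11` leave room. -/
theorem sampleQuad_resid_le (hc : c.Valid) (hl1 : 0 < l1)
    (hG : SampleGood c ψ y s v γb αb l1 l2 E EZ)
    (hEZ : ∀ b, quadForm EZ b ≤ c.σ0 ^ 2 * quadForm E b)
    (hη1 : (sparsity γb).card * l1 ≤ c.η1)
    (hN : norm21 (γh - γb) ≤ (c.A1 - 1)⁻¹ * c.M1 * ((sparsity γb).card * l1))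
    (hQ : sampleQuad (fun i k => calWt γb (s i) (v i) k) v (γh - γb) ≤
        Real.exp c.η13 * (c.M1 * ((sparsity γb).card * l1 ^ 2))) :
    sampleQuad (fun i k => calWt γb (s i) (v i) k * (y i - ψ (linPred αb (v i) k)) ^ 2) v (γh - γb)
      ≤ c.M11 * (sparsity γb).card * l1 ^ 2 := by
  set b := γh - γb
  set sg : ℝ := ((sparsity γb).card : ℝ)
  have hsg1 : 1 ≤ sg := one_le_card_sparsity γb
  have h1 := abs_le.1 (abs_avg_sub_quadForm_le hG.quadZ b)
  have h2 := abs_le.1 (abs_avg_sub_quadForm_le hG.quad b)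
  have h3 := hEZ b
  unfold sampleQuad at hQ ⊢
  have hσ := hc.σ0
  have hA1 := hc.one_lt_A1
  have hM1 := hc.M1_nonneg
  have h4 : norm21 b ^ 2 ≤ ((c.A1 - 1)⁻¹ * c.M1 * (sg * l1)) ^ 2 :=
    pow_le_pow_left₀ (norm21_nonneg b) hN 2
  have h5 : l1 * norm21 b ^ 2 ≤ c.M1 ^ 2 * c.η1 / (c.A1 - 1) ^ 2 * (sg * l1 ^ 2) := by
    have hA : c.A1 - 1 ≠ 0 := by linarith
    calc l1 * norm21 b ^ 2 ≤ l1 * ((c.A1 - 1)⁻¹ * c.M1 * (sg * l1)) ^ 2 := by gcongr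
      _ = c.M1 ^ 2 * (sg * l1) / (c.A1 - 1) ^ 2 * (sg * l1 ^ 2) := by field_simp
      _ ≤ _ := by gcongr
  have h6 : quadForm E b ≤ Real.exp c.η13 * (c.M1 * (sg * l1 ^ 2)) + l1 / 2 * norm21 b ^ 2 := by
    linarith [h2.1]
  have h7 := mul_le_mul_of_nonneg_left h6 (sq_nonneg c.σ0)
  have h8 := mul_le_mul_of_nonneg_left h5 (sq_nonneg c.σ0)
  have h9 : 0 ≤ c.σ0 ^ 2 * (l1 * norm21 b ^ 2) := by positivity
  have h10 : 0 ≤ c.σ0 ^ 2 * (Real.exp c.η13 * (c.M1 * (sg * l1 ^ 2))) := by positivity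
  have h11 : c.M11 * sg * l1 ^ 2 = 3 * (c.σ0 ^ 2 * (c.M1 ^ 2 * c.η1 / (c.A1 - 1) ^ 2 *
      (sg * l1 ^ 2))) + 2 * (c.σ0 ^ 2 * (Real.exp c.η13 * (c.M1 * (sg * l1 ^ 2)))) := by
    unfold Constants.M11; ring
  rw [h11]
  linarith [h1.2]

theorem abs_exp_sub_one_le {x η : ℝ} (hx : |x| ≤ η) : |Real.exp x - 1| ≤ Real.exp η * |x| := by
  have := logLip_exp.abs_sub_le (u := 0) (x := x) (y := 0) (R := η) hx
    (by rw [abs_zero]; exact (abs_nonneg x).trans hx)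
  simpa using this

set_option maxHeartbeats 1000000 in
-- D is the divergence of the weighted likelihood with the weights of γ̄, although α̂ was computed
-- with those of γ̂. The discrepancy costs a factor e^{−η₁₃} in front of D and a cross term between
-- b and the residuals.
theorem wl_estimator_bound (hc : c.Valid) (hl1 : 0 < l1) (hl12 : l1 ≤ l2)
    (hψ : LogLip ψ c.C3)
    (hG : SampleGood c ψ y s v γb αb l1 l2 E EZ)
    (hE : CompatForm E (sparsity αb) c.ν2 c.ξ2)
    (hη1 : 0 ≤ c.η1)
    (hsa : (1 + c.ξ2 ^ 2) / c.ν2 ^ 2 * (sparsity αb).card * l2 ≤ c.η2)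
    (hsb : Real.exp c.η13 * c.B0 * c.C3 / c.C2 / c.ν2 ^ 2 * (c.ξ2 + 1) ^ 2 * (c.A2 - 1) *
      (1 - c.η2)⁻¹ * (sparsity αb).card * l2 ≤ c.η21)
    (hsc : Real.exp (3 * c.η13) * c.B0 * c.C3 / c.C2 / c.ξ21 ^ 2 * (c.A2 - 1)⁻¹ * c.M11 *
      (sparsity γb).card * l1 ≤ c.η22)
    (hb : ∀ i k, |linPred (γh - γb) (v i) k| ≤ c.η13)
    (hQZ : sampleQuad (fun i k => calWt γb (s i) (v i) k * (y i - ψ (linPred αb (v i) k)) ^ 2) v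
      (γh - γb) ≤ c.M11 * (sparsity γb).card * l1 ^ 2)
    (hα : IsRegWL ψ (c.A2 * l2) y s v γh αh) :
    ∃ D, c.C2 * expRatio (c.C3 * c.B0 * norm21 (αh - αb)) *
        sampleQuad (fun i k => calWt γb (s i) (v i) k) v (αh - αb) ≤ D ∧
      Real.exp (-c.η13) * D + (c.A2 - 1) * l2 * norm21 (αh - αb) ≤
        c.wlBound (sparsity γb).card (sparsity αb).card l1 l2 := by
  set b := γh - γb with hbdef
  set a := αh - αb with hadef
  set sg : ℝ := ((sparsity γb).card : ℝ) with hsg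
  set sa : ℝ := ((sparsity αb).card : ℝ) with hsadef
  have hsg1 : 1 ≤ sg := one_le_card_sparsity γb
  have hsa1 : 1 ≤ sa := one_le_card_sparsity αb
  set w : Fin n → {k : Fin K // k ≠ t} → ℝ := fun i k => calWt γb (s i) (v i) k with hw
  have hw0 : ∀ i k, 0 ≤ w i k := fun i k => calWt_nonneg _ _ _ _
  set Z : Fin n → {k : Fin K // k ≠ t} → ℝ := fun i k => y i - ψ (linPred αb (v i) k) with hZ
  set Q := sampleQuad w v a with hQ
  set N := norm21 a with hN
  have hN0 : 0 ≤ N := norm21_nonneg a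
  have hQ0 : 0 ≤ Q := sampleQuad_nonneg hw0 v a
  have hl2 : 0 < l2 := hl1.trans_le hl12
  have hA2 := hc.one_lt_A2
  have hB0 := hc.B0
  have hν2 := hc.ν2
  have hη2 := hc.η2
  have hη21 := hc.η21
  have hη22 := hc.η22
  have hξ2 := hc.ξ2
  have hC2 := hc.C2
  have hC3 := hc.C3
  have hξ22 := hc.ξ22_pos
  have hξ21 := hc.ξ21_pos
  have hM11 := hc.M11_nonneg hη1
  have hη13 := hc.η13_nonneg hη1
  set d : Fin n → {k : Fin K // k ≠ t} → ℝ := fun i k =>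
    (ψ (linPred αb (v i) k + linPred a (v i) k) - ψ (linPred αb (v i) k)) * linPred a (v i) k
    with hd
  have hdlow : ∀ i k, c.C2 * expRatio (c.C3 * c.B0 * N) * linPred a (v i) k ^ 2 ≤ d i k := by
    intro i k
    have h := hψ.mul_sq_le (u := linPred αb (v i) k) (x := linPred a (v i) k)
      (H := c.C3 * c.B0 * N) (by
        rw [mul_assoc]
        exact mul_le_mul_of_nonneg_left (abs_linPred_le a (hG.bounded i) k) hC3)
    have hq := expRatio_pos (H := c.C3 * c.B0 * N) (by positivity)
    refine le_trans ?_ h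
    have := hG.lower i k
    gcongr
  have hq := expRatio_pos (H := c.C3 * c.B0 * N) (by positivity)
  have hd0 : ∀ i k, 0 ≤ d i k := fun i k => le_trans (by positivity) (hdlow i k)
  set D := avg fun i => ∑ k, w i k * d i k with hD
  have hlow : c.C2 * expRatio (c.C3 * c.B0 * N) * Q ≤ D := by
    rw [hQ, sampleQuad, ← avg_mul_left, hD]
    refine avg_mono fun i => ?_
    rw [Finset.mul_sum]
    refine Finset.sum_le_sum fun k _ => ?_
    calc _ = w i k * (c.C2 * expRatio (c.C3 * c.B0 * N) * linPred a (v i) k ^ 2) := by ring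
      _ ≤ _ := mul_le_mul_of_nonneg_left (hdlow i k) (hw0 i k)
  refine ⟨D, hlow, ?_⟩
  have hαh : ∀ i k, linPred αh (v i) k = linPred αb (v i) k + linPred a (v i) k := by
    intro i k; rw [hadef, linPred_sub]; ring
  -- The estimate γ̂ enters only through exp(b_kᵀv), which lies between e^{−η₁₃} and e^{η₁₃} by
  -- `hb`.
  have hwh : ∀ i k, calWt γh (s i) (v i) k = w i k * Real.exp (linPred b (v i) k) := by
    intro i k
    rw [hw, hbdef, linPred_sub]
    simp only [calWt]
    rw [mul_assoc, ← Real.exp_add]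
    congr 2; ring
  have hloss : ∀ α' : Coef p K t, (avg fun i => wlLoss ψ γh α' (y i) (s i) (v i)) =
      glmLoss (fun x => ∫ z in (0 : ℝ)..x, ψ z) (fun i k => calWt γh (s i) (v i) k)
        (fun i k => calWt γh (s i) (v i) k * y i) v α' := by
    intro α'
    unfold glmLoss wlLoss
    congr 1
    funext i
    refine Finset.sum_congr rfl fun k _ => ?_
    simp only [calWt]; ring
  have hbasic := glmLoss_basic_inequality (Ψ := fun x => ∫ z in (0 : ℝ)..x, ψ z) (ψ := ψ)
    (fun x => (hψ.diff.continuous.integral_hasStrictDerivAt 0 x).hasDerivAt)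
    (W := fun i k => calWt γh (s i) (v i) k) (R := fun i k => calWt γh (s i) (v i) k * y i)
    (v := v) (lam := c.A2 * l2) (by positivity) (a := αh)
    (fun a' => by rw [← hloss, ← hloss]; exact hα a') αb
  have hscore := abs_le.1 (abs_avg_pairing_le hG.wl a)
  have hsplit : (avg fun i => ∑ k : {k : Fin K // k ≠ t},
      (calWt γh (s i) (v i) k * ψ (linPred αh (v i) k) - calWt γh (s i) (v i) k * y i) *
        linPred (αh - αb) (v i) k) =
      (avg fun i => ∑ k, calWt γh (s i) (v i) k * d i k)
        - (avg fun i => ∑ k, w i k * Z i k * linPred a (v i) k)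
        - (avg fun i => ∑ k, w i k * ((Real.exp (linPred b (v i) k) - 1) * Z i k *
            linPred a (v i) k)) := by
    rw [← avg_sub, ← avg_sub]
    congr 1
    funext i
    rw [← Finset.sum_sub_distrib, ← Finset.sum_sub_distrib]
    refine Finset.sum_congr rfl fun k _ => ?_
    rw [hαh, hwh]
    simp only [hd, hZ]
    ring
  rw [hsplit] at hbasic
  have hDh : Real.exp (-c.η13) * D ≤ avg fun i => ∑ k, calWt γh (s i) (v i) k * d i k := by
    rw [hD, ← avg_mul_left]
    refine avg_mono fun i => ?_
    rw [Finset.mul_sum]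
    refine Finset.sum_le_sum fun k _ => ?_
    rw [hwh]
    have h1 : Real.exp (-c.η13) ≤ Real.exp (linPred b (v i) k) :=
      Real.exp_le_exp.2 (abs_le.1 (hb i k)).1
    have h2 := mul_nonneg (hw0 i k) (hd0 i k)
    calc Real.exp (-c.η13) * (w i k * d i k) ≤ Real.exp (linPred b (v i) k) * (w i k * d i k) :=
          mul_le_mul_of_nonneg_right h1 h2
      _ = _ := by ring
  -- The cross term after Cauchy–Schwarz: one factor is the residual-weighted form of b, already
  -- bounded, the other the form Q of a.
  set Err := Real.exp c.η13 * (Real.sqrt (c.M11 * sg * l1 ^ 2) * Real.sqrt Q) with hErr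
  have hcross : (avg fun i => ∑ k, w i k * ((Real.exp (linPred b (v i) k) - 1) * Z i k *
      linPred a (v i) k)) ≤ Err := by
    have h1 : (avg fun i => ∑ k, w i k * ((Real.exp (linPred b (v i) k) - 1) * Z i k *
        linPred a (v i) k)) ≤ Real.exp c.η13 * avg fun i => ∑ k, w i k *
          ((|Z i k| * |linPred b (v i) k|) * |linPred a (v i) k|) := by
      rw [← avg_mul_left]
      refine avg_mono fun i => ?_
      rw [Finset.mul_sum]
      refine Finset.sum_le_sum fun k _ => ?_
      have h2 := abs_exp_sub_one_le (hb i k)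
      calc _ ≤ w i k * |(Real.exp (linPred b (v i) k) - 1) * Z i k * linPred a (v i) k| :=
            mul_le_mul_of_nonneg_left (le_abs_self _) (hw0 i k)
        _ = w i k * (|Real.exp (linPred b (v i) k) - 1| * (|Z i k| * |linPred a (v i) k|)) := by
            rw [abs_mul, abs_mul, mul_assoc]
        _ ≤ w i k * ((Real.exp c.η13 * |linPred b (v i) k|) * (|Z i k| * |linPred a (v i) k|)) := by
            refine mul_le_mul_of_nonneg_left (mul_le_mul_of_nonneg_right h2 ?_) (hw0 i k)
            positivity
        _ = _ := by ring
    refine h1.trans (mul_le_mul_of_nonneg_left ((avg_sum_mul_le hw0).trans ?_)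
      (Real.exp_pos _).le)
    simp only [mul_pow, sq_abs]
    refine mul_le_mul (Real.sqrt_le_sqrt ?_) le_rfl (Real.sqrt_nonneg _) (Real.sqrt_nonneg _)
    refine le_trans (le_of_eq ?_) hQZ
    unfold sampleQuad
    simp only [hZ, hw, mul_assoc]
  have hcone1 := lasso_cone_bound (a := αh) (b := αb) (A := c.A2) (lam := l2)
    (D := Real.exp (-c.η13) * D) (E := Err) (by linarith) hl2.le (by linarith [hscore.2])
  set σ := ∑ j ∈ sparsity αb, rowNorm a j with hσ
  have hσ0 : 0 ≤ σ := Finset.sum_nonneg fun j _ => rowNorm_nonneg a j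
  set S := Real.exp (-c.η13) * D + (c.A2 - 1) * l2 * N with hS
  have hD0 : 0 ≤ D := le_trans (by positivity) hlow
  have h22 : 0 < 1 - c.η22 := by linarith
  have h21 : 0 < 1 - c.η21 := by linarith
  have h2 : 0 < 1 - c.η2 := by linarith
  have hApos : 0 < c.A2 - 1 := by linarith
  have hexp : Real.exp c.η13 * Real.exp (-c.η13) = 1 := by rw [← Real.exp_add]; simp
  have hexp3 : Real.exp (3 * c.η13) = Real.exp c.η13 ^ 3 := by rw [← Real.exp_nat_mul]; norm_num
  have hexpn : Real.exp (-c.η13) = (Real.exp c.η13)⁻¹ := Real.exp_neg _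
  have hepos := Real.exp_pos c.η13
  set e := Real.exp c.η13 with hedef
  -- If the cross term dominates, S ≤ Err/ξ₂₁ and Err² is a multiple of Q, so the margin argument
  -- needs no cone condition. Otherwise 1 − ξ₂₁ = 2A₂/ξ₂₂ turns the Lasso inequality into S ≤ ξ₂₂ l2
  -- σ, which yields the cone condition with ξ₂. The final bound is the sum of the two cases.
  rcases le_or_gt (c.ξ21 * S) Err with hcase | hcase
  · have hmar := margin_bound (e := Real.exp (-c.η13)) (m := c.C2) (B := (c.A2 - 1) * l2)
      (F := e ^ 2 * (c.M11 * sg * l1 ^ 2) / c.ξ21 ^ 2) (κ := c.C3 * c.B0) (η := c.η22)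
      (D := D) (N := N) (Q := Q) (X := Err / c.ξ21) (Real.exp_pos _) hC2 (by positivity)
      (by positivity) (by positivity) hη22.2 hN0 hQ0
      (by rw [le_div_iff₀ hξ21]; linarith) (by
        rw [hErr, div_pow, mul_pow, mul_pow, Real.sq_sqrt (by positivity), Real.sq_sqrt hQ0]
        apply le_of_eq; ring) hlow (by
        have h := mul_le_mul_of_nonneg_right hsc
          (by positivity : 0 ≤ e⁻¹ * c.C2 * ((c.A2 - 1) * l1))
        rw [hexpn]
        calc _ = Real.exp (3 * c.η13) * c.B0 * c.C3 / c.C2 / c.ξ21 ^ 2 * (c.A2 - 1)⁻¹ * c.M11 *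
              sg * l1 * (e⁻¹ * c.C2 * ((c.A2 - 1) * l1)) := by
              rw [hexp3]; field_simp
          _ ≤ c.η22 * (e⁻¹ * c.C2 * ((c.A2 - 1) * l1)) := h
          _ ≤ _ := by
              refine mul_le_mul_of_nonneg_left ?_ hη22.1
              gcongr)
    have hM : e ^ 2 * (c.M11 * sg * l1 ^ 2) / c.ξ21 ^ 2 /
        (Real.exp (-c.η13) * c.C2 * (1 - c.η22)) =
        Real.exp (3 * c.η13) * (c.M11 * sg * l1 ^ 2) / c.ξ23 ^ 2 := by
      rw [hc.ξ23_sq, hexpn, hexp3]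
      field_simp
    rw [hM] at hmar
    unfold Constants.wlBound
    have : 0 ≤ e * c.ξ22 ^ 2 * (sa * l2 ^ 2) / c.ν22 ^ 2 := by positivity
    linarith
  · have hX : S ≤ c.ξ22 * l2 * σ := by
      have h1 : (1 - c.ξ21) * S ≤ 2 * c.A2 * l2 * σ := by linarith
      rw [hc.ξ21_eq] at h1
      have h3 : 2 * c.A2 / c.ξ22 * S ≤ 2 * c.A2 * l2 * σ := by linarith
      have h4 : 2 * c.A2 / c.ξ22 * S ≤ 2 * c.A2 / c.ξ22 * (c.ξ22 * l2 * σ) := by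
        refine h3.trans (le_of_eq ?_)
        field_simp
      exact le_of_mul_le_mul_left h4 (by positivity)
    have hcone : N ≤ (1 + c.ξ2) * σ := by
      have h1 : (c.A2 - 1) * l2 * N ≤ (c.A2 - 1) * l2 * ((1 + c.ξ2) * σ) := by
        have h3 : 0 ≤ Real.exp (-c.η13) * D := by positivity
        calc _ ≤ c.ξ22 * l2 * σ := by linarith
          _ = _ := by unfold Constants.ξ22; ring
      exact le_of_mul_le_mul_left h1 (by positivity)
    have hcompat := compat_of_norm21_le (η := c.η2) hν2 (by linarith : 0 < sa) hl1.le hE hG (by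
      refine le_trans ?_ hsa
      -- The factor 2 is absorbed by the deviation level l1/2, which is how the assumption gets by
      -- with 1 + ξ₂².
      have h1 : (1 + c.ξ2) ^ 2 ≤ 2 * (1 + c.ξ2 ^ 2) := by nlinarith [sq_nonneg (1 - c.ξ2)]
      calc (1 + c.ξ2) ^ 2 / c.ν2 ^ 2 * sa * (l1 / 2)
          ≤ 2 * (1 + c.ξ2 ^ 2) / c.ν2 ^ 2 * sa * (l2 / 2) := by gcongr
        _ = _ := by ring) hcone
    have hmar := margin_bound (e := Real.exp (-c.η13)) (m := c.C2) (B := (c.A2 - 1) * l2)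
      (F := c.ξ22 ^ 2 * l2 ^ 2 * sa / (c.ν2 ^ 2 * (1 - c.η2))) (κ := c.C3 * c.B0) (η := c.η21)
      (D := D) (N := N) (Q := Q) (X := c.ξ22 * l2 * σ) (Real.exp_pos _) hC2 (by positivity)
      (by positivity) (by positivity) hη21.2 hN0 hQ0 hX (by
        rw [div_mul_eq_mul_div, le_div_iff₀ (by positivity)]
        calc (c.ξ22 * l2 * σ) ^ 2 * (c.ν2 ^ 2 * (1 - c.η2))
            = c.ξ22 ^ 2 * l2 ^ 2 * (c.ν2 ^ 2 * (1 - c.η2) * σ ^ 2) := by ring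
          _ ≤ c.ξ22 ^ 2 * l2 ^ 2 * (sa * Q) := by gcongr
          _ = _ := by ring) hlow (by
        have h := mul_le_mul_of_nonneg_right hsb
          (by positivity : 0 ≤ e⁻¹ * c.C2 * ((c.A2 - 1) * l2))
        rw [hexpn]
        calc _ = e * c.B0 * c.C3 / c.C2 / c.ν2 ^ 2 * (c.ξ2 + 1) ^ 2 * (c.A2 - 1) *
              (1 - c.η2)⁻¹ * sa * l2 * (e⁻¹ * c.C2 * ((c.A2 - 1) * l2)) := by
              unfold Constants.ξ22; field_simp
          _ ≤ _ := h)
    have hM : c.ξ22 ^ 2 * l2 ^ 2 * sa / (c.ν2 ^ 2 * (1 - c.η2)) /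
        (Real.exp (-c.η13) * c.C2 * (1 - c.η21)) =
        e * c.ξ22 ^ 2 * (sa * l2 ^ 2) / c.ν22 ^ 2 := by
      rw [hc.ν22_sq, hexpn]
      field_simp
    rw [hM] at hmar
    unfold Constants.wlBound
    have : 0 ≤ Real.exp (3 * c.η13) * (c.M11 * sg * l1 ^ 2) / c.ξ23 ^ 2 := by positivity
    linarith

set_option maxHeartbeats 1000000 in
/-- The decomposition of the augmented IPW estimator around the target values. -/
theorem abs_aipw_sub_add_le (hσ : 0 < c.σ0) {L : ℝ}
    (hwl : ∀ j, Real.sqrt (∑ k : {k : Fin K // k ≠ t},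
      (avg fun i => calWt γb (s i) (v i) k * (y i - ψ (linPred αb (v i) k)) * v i j) ^ 2) ≤ l2)
    (hb : ∀ i k, |linPred (γh - γb) (v i) k| ≤ c.η13) (hL : 0 ≤ L)
    (ha : ∀ i k, |ψ (linPred αh (v i) k) - ψ (linPred αb (v i) k)| ≤
      L * |linPred (αh - αb) (v i) k|) :
    |aipw ψ αh γh y s v - aipw ψ αb γb y s v
        + avg fun i => ∑ k : {k : Fin K // k ≠ t}, (calWt γb (s i) (v i) k - treatInd (s i) k) *
          (ψ (linPred αh (v i) k) - ψ (linPred αb (v i) k))| ≤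
      l2 * norm21 (γh - γb) + Real.exp c.η13 * (
        c.σ0 * sampleQuad (fun i k => calWt γb (s i) (v i) k) v (γh - γb)
        + c.σ0⁻¹ * sampleQuad (fun i k => calWt γb (s i) (v i) k *
            (y i - ψ (linPred αb (v i) k)) ^ 2) v (γh - γb)
        + L * (sampleQuad (fun i k => calWt γb (s i) (v i) k) v (γh - γb)
          + sampleQuad (fun i k => calWt γb (s i) (v i) k) v (αh - αb))) := by
  set b := γh - γb with hbdef
  set a := αh - αb with hadef
  set w : Fin n → {k : Fin K // k ≠ t} → ℝ := fun i k => calWt γb (s i) (v i) k with hw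
  have hw0 : ∀ i k, 0 ≤ w i k := fun i k => calWt_nonneg _ _ _ _
  set Z : Fin n → {k : Fin K // k ≠ t} → ℝ := fun i k => y i - ψ (linPred αb (v i) k) with hZ
  set Δ : Fin n → {k : Fin K // k ≠ t} → ℝ := fun i k =>
    ψ (linPred αh (v i) k) - ψ (linPred αb (v i) k) with hΔ
  -- Exact expansion: the part linear in b is the weighted likelihood score, the part linear in the
  -- link increments has been moved to the left side, and what is left is of second order.
  have hid : aipw ψ αh γh y s v - aipw ψ αb γb y s v
        + avg (fun i => ∑ k : {k : Fin K // k ≠ t}, (calWt γb (s i) (v i) k - treatInd (s i) k) *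
          (ψ (linPred αh (v i) k) - ψ (linPred αb (v i) k))) =
      avg (fun i => ∑ k, w i k * Z i k * linPred b (v i) k)
        + avg (fun i => ∑ k, w i k * ((Real.exp (linPred b (v i) k) - 1 - linPred b (v i) k) * Z i k
          - (Real.exp (linPred b (v i) k) - 1) * Δ i k)) := by
    unfold aipw
    rw [← avg_sub, ← avg_add, ← avg_add]
    congr 1
    funext i
    unfold phi
    rw [add_sub_add_left_eq_sub, ← Finset.sum_sub_distrib, ← Finset.sum_add_distrib,
      ← Finset.sum_add_distrib]
    refine Finset.sum_congr rfl fun k _ => ?_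
    have h1 : Real.exp (linPred γh (v i) k) =
        Real.exp (linPred γb (v i) k) * Real.exp (linPred b (v i) k) := by
      rw [← Real.exp_add, hbdef, linPred_sub]; congr 1; ring
    rw [psRatio_eq_exp, psRatio_eq_exp, h1]
    simp only [hw, hZ, hΔ, calWt]
    ring
  rw [hid]
  have hscore := abs_avg_pairing_le hwl b
  refine (abs_add_le _ _).trans (add_le_add hscore ?_)
  refine (abs_avg_le _).trans ?_
  unfold sampleQuad
  rw [← avg_mul_left, ← avg_mul_left, ← avg_add, ← avg_add, ← avg_mul_left, ← avg_add,
    ← avg_mul_left]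
  refine avg_mono fun i => ?_
  refine (Finset.abs_sum_le_sum_abs _ _).trans ?_
  rw [Finset.mul_sum, Finset.mul_sum, ← Finset.sum_add_distrib, ← Finset.sum_add_distrib,
    Finset.mul_sum, ← Finset.sum_add_distrib, Finset.mul_sum]
  refine Finset.sum_le_sum fun k _ => ?_
  set x := linPred b (v i) k with hx
  set x' := linPred a (v i) k with hx'
  set e := Real.exp c.η13
  have hepos : 0 < e := Real.exp_pos _
  have h1 : |Real.exp x - 1| ≤ e * |x| := abs_exp_sub_one_le (hb i k)
  have h2 : |Real.exp x - 1 - x| ≤ e * x ^ 2 := by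
    have h3 : 0 ≤ Real.exp x - 1 - x := by linarith [Real.add_one_le_exp x]
    rw [abs_of_nonneg h3]
    have h4 : Real.exp x * (1 - x) ≤ 1 := by
      have h5 := Real.add_one_le_exp (-x)
      have h6 : Real.exp x * Real.exp (-x) = 1 := by rw [← Real.exp_add]; simp
      have := mul_le_mul_of_nonneg_left h5 (Real.exp_pos x).le
      rw [h6] at this
      linarith
    calc Real.exp x - 1 - x ≤ x * (Real.exp x - 1) := by linarith
      _ ≤ |x| * |Real.exp x - 1| := by rw [← abs_mul]; exact le_abs_self _
      _ ≤ |x| * (e * |x|) := mul_le_mul_of_nonneg_left h1 (abs_nonneg x)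
      _ = e * |x| ^ 2 := by ring
      _ = _ := by rw [sq_abs]
  -- This splits the remainder b² |Z| between the plain and the residual-weighted quadratic forms,
  -- both of which are controlled.
  have h3 : |Z i k| ≤ c.σ0 + c.σ0⁻¹ * Z i k ^ 2 := by
    rw [← sq_abs (Z i k)]
    have h4 : 0 ≤ c.σ0⁻¹ * (|Z i k| - c.σ0) ^ 2 := by positivity
    have h5 : c.σ0⁻¹ * (|Z i k| - c.σ0) ^ 2 = c.σ0⁻¹ * |Z i k| ^ 2 - 2 * |Z i k| + c.σ0 := by
      field_simp; ring
    have := abs_nonneg (Z i k)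
    linarith
  have h4 := ha i k
  have h5 : |x| * |x'| ≤ x ^ 2 + x' ^ 2 := by
    rw [← sq_abs x, ← sq_abs x']
    nlinarith [sq_nonneg (|x| - |x'|), abs_nonneg x, abs_nonneg x']
  rw [abs_mul, abs_of_nonneg (hw0 i k)]
  calc w i k * |(Real.exp x - 1 - x) * Z i k - (Real.exp x - 1) * Δ i k|
      ≤ w i k * (e * x ^ 2 * (c.σ0 + c.σ0⁻¹ * Z i k ^ 2) + e * |x| * (L * |x'|)) := by
        refine mul_le_mul_of_nonneg_left ((abs_sub _ _).trans ?_) (hw0 i k)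
        rw [abs_mul, abs_mul]
        exact add_le_add (mul_le_mul h2 h3 (abs_nonneg _) (by positivity))
          (mul_le_mul h1 h4 (abs_nonneg _) (by positivity))
    _ ≤ w i k * (e * x ^ 2 * (c.σ0 + c.σ0⁻¹ * Z i k ^ 2) + e * L * (x ^ 2 + x' ^ 2)) := by
        refine mul_le_mul_of_nonneg_left (add_le_add le_rfl ?_) (hw0 i k)
        calc _ = e * L * (|x| * |x'|) := by ring
          _ ≤ _ := mul_le_mul_of_nonneg_left h5 (by positivity)
    _ = _ := by simp only [hw, hZ]; ring

end Deterministic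

end RCAL

namespace RCAL

/-! ### Tail bounds for bounded and sub-gaussian vectors -/

section Tails

variable {𝒵 : Type*} [MeasurableSpace 𝒵] {ν : Measure 𝒵} [IsProbabilityMeasure ν]
  {E : Type*} [NormedAddCommGroup E] [InnerProductSpace ℝ E]
    [MeasurableSpace E] [BorelSpace E] [SecondCountableTopology E] [CompleteSpace E]

/-- With s = 2ρ/V each observation contributes (3/4)(sV)² = 3ρ² to the exponent. The sup bound M
enters only through sM ≤ 2/5. -/
theorem measure_norm_sum_ge_le_of_bounded {U : 𝒵 → E} (hU : Measurable U)
    (hU0 : ∫ z, U z ∂ν = 0) {M V ρ : ℝ} (hM : ∀ᵐ z ∂ν, ‖U z‖ ≤ M) (hV : 0 < V)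
    (hV2 : ∫ z, ‖U z‖ ^ 2 ∂ν ≤ V ^ 2) (hρ : 0 < ρ) (hρM : 2 * ρ / V * M ≤ 2 / 5)
    (n : ℕ) (r : ℝ) :
    (Measure.pi fun _ : Fin n => ν) {z | r ≤ ‖∑ i, U (z i)‖} ≤
      ENNReal.ofReal (2 * Real.exp (-(2 * ρ / V * r) + n * (3 * ρ ^ 2))) := by
  have hs : 0 < 2 * ρ / V := by positivity
  have hUi : Integrable U ν := Integrable.of_bound hU.aestronglyMeasurable M hM
  have hexp : Integrable (fun z => Real.exp (2 * ρ / V * ‖U z‖)) ν := by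
    refine Integrable.of_bound (Real.measurable_exp.comp
      (hU.norm.const_mul _)).aestronglyMeasurable (Real.exp (2 / 5)) ?_
    filter_upwards [hM] with z hz
    rw [Real.norm_of_nonneg (Real.exp_pos _).le]
    exact Real.exp_le_exp.2 ((mul_le_mul_of_nonneg_left hz hs.le).trans hρM)
  have hsq : Integrable (fun z => ‖U z‖ ^ 2) ν := by
    refine Integrable.of_bound (hU.norm.pow_const 2).aestronglyMeasurable (M ^ 2) ?_
    filter_upwards [hM] with z hz
    rw [norm_pow, norm_norm]
    exact pow_le_pow_left₀ (norm_nonneg _) hz 2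
  refine measure_norm_sum_ge_le hU hUi hU0 hs hexp ?_ n r
  calc ∫ z, (Real.exp (2 * ρ / V * ‖U z‖) - 2 * ρ / V * ‖U z‖) ∂ν
      ≤ ∫ z, (1 + 3 / 4 * (2 * ρ / V) ^ 2 * ‖U z‖ ^ 2) ∂ν := by
        refine integral_mono_ae (hexp.sub (hUi.norm.const_mul _))
          ((integrable_const _).add (hsq.const_mul _)) ?_
        filter_upwards [hM] with z hz
        have := exp_sub_self_le_of_le (x := 2 * ρ / V * ‖U z‖) (by positivity)
          ((mul_le_mul_of_nonneg_left hz hs.le).trans hρM)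
        rw [mul_pow] at this
        linarith
    _ = 1 + 3 / 4 * (2 * ρ / V) ^ 2 * ∫ z, ‖U z‖ ^ 2 ∂ν := by
        rw [integral_add (integrable_const _) (hsq.const_mul _), integral_const_mul]
        simp
    _ ≤ 1 + 3 / 4 * (2 * ρ / V) ^ 2 * V ^ 2 := by gcongr
    _ = 3 * ρ ^ 2 + 1 := by field_simp; ring
    _ ≤ Real.exp (3 * ρ ^ 2) := Real.add_one_le_exp _

/-- Centring may double the sup norm, but the variance stays below the second moment, hence below
M²; so the exponent is governed by M. -/
theorem measure_norm_sum_centered_ge_le {U : 𝒵 → E} (hU : Measurable U) {M ρ : ℝ} (hM0 : 0 < M)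
    (hM : ∀ᵐ z ∂ν, ‖U z‖ ≤ M) (hρ : 0 < ρ) (hρ' : ρ ≤ 1 / 20) (n : ℕ) (r : ℝ) :
    (Measure.pi fun _ : Fin n => ν) {z | r ≤ ‖∑ i, (U (z i) - ∫ z', U z' ∂ν)‖} ≤
      ENNReal.ofReal (2 * Real.exp (-(2 * ρ / M * r) + n * (3 * ρ ^ 2))) := by
  have hUi : Integrable U ν := Integrable.of_bound hU.aestronglyMeasurable M hM
  set m := ∫ z', U z' ∂ν with hm
  have hmM : ‖m‖ ≤ M := by
    have := norm_integral_le_of_norm_le_const (μ := ν) hM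
    simpa using this
  have hsq : Integrable (fun z => ‖U z‖ ^ 2) ν := by
    refine Integrable.of_bound (hU.norm.pow_const 2).aestronglyMeasurable (M ^ 2) ?_
    filter_upwards [hM] with z hz
    rw [norm_pow, norm_norm]
    exact pow_le_pow_left₀ (norm_nonneg _) hz 2
  refine measure_norm_sum_ge_le_of_bounded (hU.sub_const m) ?_ (M := 2 * M) ?_ hM0 ?_ hρ ?_ n r
  · rw [integral_sub hUi (integrable_const _), integral_const]; simp [hm]
  · filter_upwards [hM] with z hz
    exact (norm_sub_le _ _).trans (by linarith)
  · have e : ∀ z, ‖U z - m‖ ^ 2 = ‖U z‖ ^ 2 - 2 * inner ℝ m (U z) + ‖m‖ ^ 2 := fun z => by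
      rw [norm_sub_sq_real, real_inner_comm]
    have hi : Integrable (fun z => 2 * inner ℝ m (U z)) ν := (hUi.const_inner m).const_mul 2
    have hsub : Integrable (fun z => ‖U z‖ ^ 2 - 2 * inner ℝ m (U z)) ν := hsq.sub hi
    simp only [e]
    rw [integral_add hsub (integrable_const _), integral_sub hsq hi, integral_const_mul,
      integral_inner hUi, ← hm, real_inner_self_eq_norm_sq]
    have h1 : ∫ z, ‖U z‖ ^ 2 ∂ν ≤ M ^ 2 := by
      have h2 : ∫ z, ‖U z‖ ^ 2 ∂ν ≤ ∫ _, M ^ 2 ∂ν := by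
        refine integral_mono_ae hsq (integrable_const _) ?_
        filter_upwards [hM] with z hz
        exact pow_le_pow_left₀ (norm_nonneg _) hz 2
      simpa using h2
    simp only [integral_const, probReal_univ, one_smul]
    nlinarith [sq_nonneg ‖m‖]
  · calc 2 * ρ / M * (2 * M) = 4 * ρ := by field_simp; ring
      _ ≤ _ := by linarith

/-- With s = δ/σ and δ = 2ρ/√3, each observation contributes 3δ²/4 = ρ²; at the level n√3σρ the
total exponent is −2nρ² + nρ². -/
theorem measure_norm_sum_ge_le_of_subGaussian {U : 𝒵 → E} (hU : Measurable U)
    (hU0 : ∫ z, U z ∂ν = 0) {σ ρ : ℝ} {q : 𝒵 → ℝ} (hσ : 0 < σ)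
    (hq : ∀ᵐ z ∂ν, ‖U z‖ ^ 2 ≤ σ ^ 2 * q z) (hqi : Integrable (fun z => Real.exp (q z)) ν)
    (hq2 : ∫ z, Real.exp (q z) ∂ν ≤ 2) (hρ : 0 < ρ) (hρ' : ρ ≤ 1 / 20) (n : ℕ) :
    (Measure.pi fun _ : Fin n => ν) {z | n * (Real.sqrt 3 * σ * ρ) ≤ ‖∑ i, U (z i)‖} ≤
      ENNReal.ofReal (2 * Real.exp (-(n * ρ ^ 2))) := by
  have h3 : 0 < Real.sqrt 3 := by positivity
  have h3' : Real.sqrt 3 ^ 2 = 3 := Real.sq_sqrt (by norm_num)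
  have h31 : 1 ≤ Real.sqrt 3 := by nlinarith
  set δ := 2 * ρ / Real.sqrt 3 with hδ
  have hδ0 : 0 < δ := by positivity
  have hδ1 : δ ≤ 4 / 5 := by
    rw [hδ, div_le_iff₀ h3]; nlinarith
  have hδ2 : 3 / 4 * δ ^ 2 = ρ ^ 2 := by
    rw [hδ, div_pow, h3']; ring
  have hpt : ∀ᵐ z ∂ν, Real.exp (δ / σ * ‖U z‖) - δ / σ * ‖U z‖ ≤
      1 + ρ ^ 2 * (Real.exp (q z) - 1) := by
    filter_upwards [hq] with z hz
    have h1 := exp_mul_sub_self_le (y := ‖U z‖ / σ) hδ0.le hδ1 (by positivity)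
    have h2 : (‖U z‖ / σ) ^ 2 ≤ q z := by
      rw [div_pow, div_le_iff₀ (by positivity)]; linarith
    have h4 := Real.exp_le_exp.2 h2
    rw [hδ2] at h1
    have e : δ * (‖U z‖ / σ) = δ / σ * ‖U z‖ := by ring
    rw [e] at h1
    nlinarith [sq_nonneg ρ]
  have hUi : Integrable U ν := by
    refine Integrable.mono' (hqi.const_mul σ) hU.aestronglyMeasurable ?_
    filter_upwards [hq] with z hz
    have h1 : q z + 1 ≤ Real.exp (q z) := Real.add_one_le_exp _
    have h2 : (2 * σ * ‖U z‖) ≤ σ ^ 2 + ‖U z‖ ^ 2 :=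
      two_mul_le_add_sq σ ‖U z‖ |>.trans (by ring_nf; rfl)
    have h4 : σ * (2 * ‖U z‖) ≤ σ * (σ * (1 + q z)) := by nlinarith
    have h5 : 2 * ‖U z‖ ≤ σ * (1 + q z) := le_of_mul_le_mul_left h4 hσ
    have h6 : σ * (1 + q z) ≤ σ * Real.exp (q z) := by gcongr; linarith
    linarith [norm_nonneg (U z)]
  have hqs : Integrable (fun z => ρ ^ 2 * (Real.exp (q z) - 1)) ν :=
    (hqi.sub (integrable_const _)).const_mul _
  have hb : Integrable (fun z => 1 + ρ ^ 2 * (Real.exp (q z) - 1)) ν :=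
    (integrable_const _).add hqs
  have hexp : Integrable (fun z => Real.exp (δ / σ * ‖U z‖)) ν := by
    refine Integrable.mono' (hb.add (hUi.norm.const_mul (δ / σ))) (Real.measurable_exp.comp
      (hU.norm.const_mul _)).aestronglyMeasurable ?_
    filter_upwards [hpt] with z hz
    rw [Real.norm_of_nonneg (Real.exp_pos _).le]
    simp only [Pi.add_apply]
    linarith
  have hmain := measure_norm_sum_ge_le hU hUi hU0 (s := δ / σ) (c := ρ ^ 2) (by positivity) hexp (by
    calc ∫ z, (Real.exp (δ / σ * ‖U z‖) - δ / σ * ‖U z‖) ∂ν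
        ≤ ∫ z, (1 + ρ ^ 2 * (Real.exp (q z) - 1)) ∂ν :=
          integral_mono_ae (hexp.sub (hUi.norm.const_mul _)) hb hpt
      _ = 1 + ρ ^ 2 * (∫ z, Real.exp (q z) ∂ν - 1) := by
          rw [integral_add (integrable_const _) hqs,
            integral_const_mul, integral_sub hqi (integrable_const _)]
          simp
      _ ≤ ρ ^ 2 + 1 := by nlinarith [sq_nonneg ρ]
      _ ≤ Real.exp (ρ ^ 2) := Real.add_one_le_exp _) n (n * (Real.sqrt 3 * σ * ρ))
  refine hmain.trans (le_of_eq ?_)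
  congr 3
  rw [hδ]
  field_simp
  ring

theorem exp_sub_self_mono {x x' : ℝ} (hx : 0 ≤ x) (h : x ≤ x') :
    Real.exp x - x ≤ Real.exp x' - x' := by
  have h1 : Real.exp x' = Real.exp x * Real.exp (x' - x) := by rw [← Real.exp_add]; ring_nf
  have h2 := Real.add_one_le_exp (x' - x)
  have h3 := Real.one_le_exp hx
  nlinarith

/-- From q + 1 ≤ e^q the mean of q is at most 1, so the mean of U has norm at most B and the centred
variable is dominated by B(q + 1). -/
theorem measure_norm_sum_centered_ge_le_of_subExp {U : 𝒵 → E} (hU : Measurable U)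
    {B ρ : ℝ} {q : 𝒵 → ℝ} (hB : 0 < B) (hq0 : ∀ z, 0 ≤ q z)
    (hq : ∀ᵐ z ∂ν, ‖U z‖ ≤ B * q z) (hqm : Measurable q)
    (hqi : Integrable (fun z => Real.exp (q z)) ν)
    (hq2 : ∫ z, Real.exp (q z) ∂ν ≤ 2) (hρ : 0 < ρ) (hρ' : ρ ≤ 1 / 20) (n : ℕ) (r : ℝ) :
    (Measure.pi fun _ : Fin n => ν) {z | r ≤ ‖∑ i, (U (z i) - ∫ z', U z' ∂ν)‖} ≤
      ENNReal.ofReal (2 * Real.exp (-(ρ / B * r) + n * (6 * ρ ^ 2))) := by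
  have hqint : Integrable q ν := by
    refine Integrable.mono' hqi hqm.aestronglyMeasurable (Filter.Eventually.of_forall fun z => ?_)
    rw [Real.norm_of_nonneg (hq0 z)]
    linarith [Real.add_one_le_exp (q z)]
  have hq1 : ∫ z, q z ∂ν ≤ 1 := by
    have h1 : ∫ z, (q z + 1) ∂ν ≤ ∫ z, Real.exp (q z) ∂ν :=
      integral_mono (hqint.add (integrable_const _)) hqi fun z => Real.add_one_le_exp _
    rw [integral_add hqint (integrable_const _)] at h1
    simp at h1
    linarith
  have hUi : Integrable U ν := Integrable.mono' (hqint.const_mul B) hU.aestronglyMeasurable hq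
  set m := ∫ z', U z' ∂ν with hm
  have hmB : ‖m‖ ≤ B := by
    calc ‖m‖ ≤ ∫ z, B * q z ∂ν := norm_integral_le_of_norm_le (hqint.const_mul B) hq
      _ = B * ∫ z, q z ∂ν := integral_const_mul _ _
      _ ≤ B * 1 := by gcongr
      _ = B := mul_one B
  have hs : 0 < ρ / B := by positivity
  have hpt : ∀ᵐ z ∂ν, Real.exp (ρ / B * ‖U z - m‖) - ρ / B * ‖U z - m‖ ≤
      1 + 3 * ρ ^ 2 * Real.exp (q z) := by
    filter_upwards [hq] with z hz
    refine le_trans (exp_sub_self_mono (x' := ρ * (q z + 1)) (by positivity) ?_)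
      (exp_mul_add_one_sub_self_le hρ.le (by linarith) (hq0 z))
    calc ρ / B * ‖U z - m‖ ≤ ρ / B * (B * q z + B) := by
          gcongr
          exact (norm_sub_le _ _).trans (add_le_add hz hmB)
      _ = _ := by field_simp
  have hb : Integrable (fun z => 1 + 3 * ρ ^ 2 * Real.exp (q z)) ν :=
    (integrable_const _).add (hqi.const_mul _)
  have hci : Integrable (fun z => U z - m) ν := hUi.sub (integrable_const _)
  have hexp : Integrable (fun z => Real.exp (ρ / B * ‖U z - m‖)) ν := by
    refine Integrable.mono' (hb.add (hci.norm.const_mul (ρ / B))) (Real.measurable_exp.comp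
      ((hU.sub_const m).norm.const_mul _)).aestronglyMeasurable ?_
    filter_upwards [hpt] with z hz
    rw [Real.norm_of_nonneg (Real.exp_pos _).le]
    simp only [Pi.add_apply]
    linarith
  refine measure_norm_sum_ge_le (hU.sub_const m) hci ?_ hs hexp ?_ n r
  · rw [integral_sub hUi (integrable_const _), integral_const]; simp [hm]
  · calc ∫ z, (Real.exp (ρ / B * ‖U z - m‖) - ρ / B * ‖U z - m‖) ∂ν
        ≤ ∫ z, (1 + 3 * ρ ^ 2 * Real.exp (q z)) ∂ν :=
          integral_mono_ae (hexp.sub (hci.norm.const_mul _)) hb hpt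
      _ = 1 + 3 * ρ ^ 2 * ∫ z, Real.exp (q z) ∂ν := by
          rw [integral_add (integrable_const _) (hqi.const_mul _), integral_const_mul]
          simp
      _ ≤ 6 * ρ ^ 2 + 1 := by nlinarith [sq_nonneg ρ]
      _ ≤ Real.exp (6 * ρ ^ 2) := Real.add_one_le_exp _

end Tails

end RCAL

namespace RCAL

/-! ### Tail bounds for vectors of sample averages -/

section AvgTails

variable {𝒵 : Type*} [MeasurableSpace 𝒵] {ν : Measure 𝒵} {κ : Type*} [Fintype κ] {n : ℕ}
  {u : 𝒵 → κ → ℝ}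

theorem sqrt_sum_avg_sub_sq (hn : 0 < n) (x : Fin n → κ → ℝ) (m : κ → ℝ) :
    n * Real.sqrt (∑ k, ((avg fun i => x i k) - m k) ^ 2) =
      ‖∑ i, ((WithLp.toLp 2 (x i) : EuclideanSpace ℝ κ) - WithLp.toLp 2 m)‖ := by
  have hn' : (0 : ℝ) < n := Nat.cast_pos.2 hn
  rw [EuclideanSpace.norm_eq, ← Real.sqrt_sq hn'.le, ← Real.sqrt_mul (by positivity),
    Finset.mul_sum]
  congr 1
  refine Finset.sum_congr rfl fun k _ => ?_
  rw [Real.norm_eq_abs, sq_abs, ← mul_pow]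
  congr 1
  simp only [WithLp.ofLp_sum, Finset.sum_apply, PiLp.sub_apply, Finset.sum_sub_distrib,
    Finset.sum_const, Finset.card_univ, Fintype.card_fin, avg]
  rw [PiLp.smul_apply, nsmul_eq_mul]
  field_simp

theorem measurable_toLp_of_eval (hu : ∀ k, Measurable fun z => u z k) :
    Measurable fun z => (WithLp.toLp 2 (u z) : EuclideanSpace ℝ κ) :=
  (WithLp.measurable_toLp 2 _).comp (measurable_pi_lambda _ hu)

theorem norm_toLp_le_sum_abs (x : κ → ℝ) :
    ‖(WithLp.toLp 2 x : EuclideanSpace ℝ κ)‖ ≤ ∑ k, |x k| := by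
  rw [EuclideanSpace.norm_eq]
  refine Real.sqrt_le_iff.2 ⟨Finset.sum_nonneg fun k _ => abs_nonneg _, ?_⟩
  exact Finset.sum_sq_le_sq_sum_of_nonneg fun k _ => abs_nonneg _

theorem integral_toLp_eq (hu : ∀ k, Integrable (fun z => u z k) ν) :
    ∫ z, (WithLp.toLp 2 (u z) : EuclideanSpace ℝ κ) ∂ν =
      WithLp.toLp 2 fun k => ∫ z, u z k ∂ν := by
  ext k
  rw [eval_integral_piLp (f := fun z => (WithLp.toLp 2 (u z) : EuclideanSpace ℝ κ)) hu k]

variable [IsProbabilityMeasure ν]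

theorem measure_avg_dev_gt_le_of_bounded (hn : 0 < n) (hu : ∀ k, Measurable fun z => u z k)
    {M ρ δ : ℝ} (hM0 : 0 < M) (hM : ∀ᵐ z ∂ν, ∑ k, |u z k| ≤ M) (hρ : 0 < ρ) (hρ' : ρ ≤ 1 / 20) :
    (Measure.pi fun _ : Fin n => ν)
      {z | δ < Real.sqrt (∑ k, ((avg fun i => u (z i) k) - ∫ z', u z' k ∂ν) ^ 2)} ≤
      ENNReal.ofReal (2 * Real.exp (-(2 * ρ / M * (n * δ)) + n * (3 * ρ ^ 2))) := by
  have hn' : (0 : ℝ) < n := Nat.cast_pos.2 hn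
  refine (measure_mono fun z hz => ?_).trans
    (measure_norm_sum_centered_ge_le (measurable_toLp_of_eval hu) hM0
      (hM.mono fun z hz => (norm_toLp_le_sum_abs _).trans hz) hρ hρ' n (n * δ))
  have hi : ∀ k, Integrable (fun z => u z k) ν := fun k =>
    Integrable.of_bound (hu k).aestronglyMeasurable M (hM.mono fun z hz =>
      (Finset.single_le_sum (f := fun k => |u z k|) (fun _ _ => abs_nonneg _)
        (Finset.mem_univ k)).trans hz)
  simp only [Set.mem_ofPred_eq] at hz ⊢
  rw [integral_toLp_eq hi, ← sqrt_sum_avg_sub_sq hn (fun i => u (z i))]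
  exact mul_le_mul_of_nonneg_left hz.le hn'.le

theorem measure_avg_dev_gt_le_of_subExp (hn : 0 < n) (hu : ∀ k, Measurable fun z => u z k)
    {B ρ δ : ℝ} {q : 𝒵 → ℝ} (hB : 0 < B) (hq0 : ∀ z, 0 ≤ q z)
    (hq : ∀ᵐ z ∂ν, ∑ k, |u z k| ≤ B * q z) (hqm : Measurable q)
    (hqi : Integrable (fun z => Real.exp (q z)) ν)
    (hq2 : ∫ z, Real.exp (q z) ∂ν ≤ 2) (hρ : 0 < ρ) (hρ' : ρ ≤ 1 / 20) :
    (Measure.pi fun _ : Fin n => ν)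
      {z | δ < Real.sqrt (∑ k, ((avg fun i => u (z i) k) - ∫ z', u z' k ∂ν) ^ 2)} ≤
      ENNReal.ofReal (2 * Real.exp (-(ρ / B * (n * δ)) + n * (6 * ρ ^ 2))) := by
  have hn' : (0 : ℝ) < n := Nat.cast_pos.2 hn
  refine (measure_mono fun z hz => ?_).trans
    (measure_norm_sum_centered_ge_le_of_subExp (measurable_toLp_of_eval hu) hB hq0
      (hq.mono fun z hz => (norm_toLp_le_sum_abs _).trans hz) hqm hqi hq2 hρ hρ' n (n * δ))
  have hi : ∀ k, Integrable (fun z => u z k) ν := fun k => by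
    refine Integrable.mono' (hqi.const_mul B) (hu k).aestronglyMeasurable ?_
    filter_upwards [hq] with z hz
    refine ((Finset.single_le_sum (f := fun k => |u z k|) (fun _ _ => abs_nonneg _)
        (Finset.mem_univ k)).trans hz).trans ?_
    exact mul_le_mul_of_nonneg_left (by linarith [Real.add_one_le_exp (q z)]) hB.le
  simp only [Set.mem_ofPred_eq] at hz ⊢
  rw [integral_toLp_eq hi, ← sqrt_sum_avg_sub_sq hn (fun i => u (z i))]
  exact mul_le_mul_of_nonneg_left hz.le hn'.le

theorem measure_avg_gt_le_of_subGaussian (hn : 0 < n) (hu : ∀ k, Measurable fun z => u z k)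
    (hu0 : ∀ k, ∫ z, u z k ∂ν = 0) {σ ρ : ℝ} {q : 𝒵 → ℝ} (hσ : 0 < σ)
    (hq : ∀ᵐ z ∂ν, ∑ k, u z k ^ 2 ≤ σ ^ 2 * q z) (hqi : Integrable (fun z => Real.exp (q z)) ν)
    (hq2 : ∫ z, Real.exp (q z) ∂ν ≤ 2) (hρ : 0 < ρ) (hρ' : ρ ≤ 1 / 20) :
    (Measure.pi fun _ : Fin n => ν)
      {z | Real.sqrt 3 * σ * ρ < Real.sqrt (∑ k, (avg fun i => u (z i) k) ^ 2)} ≤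
      ENNReal.ofReal (2 * Real.exp (-(n * ρ ^ 2))) := by
  have hn' : (0 : ℝ) < n := Nat.cast_pos.2 hn
  have hi : ∀ k, Integrable (fun z => u z k) ν := fun k => by
    refine Integrable.mono' ((hqi.const_mul (σ ^ 2)).add (integrable_const 1))
      (hu k).aestronglyMeasurable ?_
    filter_upwards [hq] with z hz
    have h1 := (Finset.single_le_sum (f := fun k => u z k ^ 2) (fun _ _ => sq_nonneg _)
        (Finset.mem_univ k)).trans hz
    have h2 : σ ^ 2 * q z ≤ σ ^ 2 * Real.exp (q z) :=
      mul_le_mul_of_nonneg_left (by linarith [Real.add_one_le_exp (q z)]) (sq_nonneg σ)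
    have h3 : |u z k| ^ 2 = u z k ^ 2 := sq_abs _
    simp only [Pi.add_apply, Real.norm_eq_abs]
    nlinarith [sq_nonneg (|u z k| - 1)]
  refine (measure_mono fun z hz => ?_).trans
    (measure_norm_sum_ge_le_of_subGaussian (q := q) (σ := σ) (measurable_toLp_of_eval hu) ?_ hσ
      ?_ hqi hq2 hρ hρ' n)
  · have h := sqrt_sum_avg_sub_sq hn (fun i => u (z i)) 0
    simp only [Set.mem_ofPred_eq, Pi.zero_apply, sub_zero, WithLp.toLp_zero] at hz h ⊢
    rw [← h]
    exact mul_le_mul_of_nonneg_left hz.le hn'.le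
  · rw [integral_toLp_eq hi]
    simp only [hu0]
    rfl
  · filter_upwards [hq] with z hz
    rw [EuclideanSpace.norm_sq_eq]
    simpa only [Real.norm_eq_abs, sq_abs] using hz

end AvgTails

/-! ### The law of one observation -/

/-- Outcome, treatment and regressors of one subject. -/
abbrev Obs (p K : ℕ) : Type := ℝ × Fin K × (Fin (p + 1) → ℝ)

section Law

variable {p K : ℕ} {t : Fin K}

/-- The residual `y - ψ(α_kᵀ v)`. -/
def resid (ψ : ℝ → ℝ) (α : Coef p K t) (z : Obs p K) (k : {k : Fin K // k ≠ t}) : ℝ :=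
  z.1 - ψ (linPred α z.2.2 k)

/-- The calibration weight of one observation. -/
def obsWt (γ : Coef p K t) (z : Obs p K) (k : {k : Fin K // k ≠ t}) : ℝ := calWt γ z.2.1 z.2.2 k

/-- Boundedness, overlap and tail properties of the law of one observation. -/
structure LawBase (c : Constants) (ψ : ℝ → ℝ) (γ α : Coef p K t) (ν : Measure (Obs p K)) :
    Prop where
  bounded : ∀ᵐ z ∂ν, ∀ j, |z.2.2 j| ≤ c.B0
  overlap : ∀ᵐ z ∂ν, ∑ k, Real.exp (linPred γ z.2.2 k) ≤ c.B1 - 1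
  upper : ∀ᵐ z ∂ν, ∀ k, deriv ψ (linPred α z.2.2 k) ≤ c.C1
  lower : ∀ᵐ z ∂ν, ∀ k, c.C2 ≤ deriv ψ (linPred α z.2.2 k)
  subGaussian : ∀ (k : {k : Fin K // k ≠ t}) (h : (Fin (p + 1) → ℝ) → ENNReal), Measurable h →
    ∫⁻ z, ENNReal.ofReal (treatInd z.2.1 t) * h z.2.2 *
        ENNReal.ofReal (Real.exp (resid ψ α z k ^ 2 / c.σ0 ^ 2)) ∂ν ≤
      2 * ∫⁻ z, ENNReal.ofReal (treatInd z.2.1 t) * h z.2.2 ∂ν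

/-- The properties of the law of one observation that enter the error bounds: moreover the scores
at the target values have mean zero. -/
structure LawReg (c : Constants) (ψ : ℝ → ℝ) (γ α : Coef p K t) (ν : Measure (Obs p K)) : Prop
    extends LawBase c ψ γ α ν where
  cal_mean : ∀ k j, ∫ z, (obsWt γ z k - treatInd z.2.1 k) * z.2.2 j ∂ν = 0
  wl_mean : ∀ k j, ∫ z, obsWt γ z k * resid ψ α z k * z.2.2 j ∂ν = 0

/-- The mean of `w_k v_j v_j'`. -/
def meanQuad (γ : Coef p K t) (ν : Measure (Obs p K)) (k : {k : Fin K // k ≠ t})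
    (j j' : Fin (p + 1)) : ℝ :=
  ∫ z, obsWt γ z k * z.2.2 j * z.2.2 j' ∂ν

/-- The mean of `w_k (y - ψ(α_kᵀ v))² v_j v_j'`. -/
def meanQuadResid (ψ : ℝ → ℝ) (γ α : Coef p K t) (ν : Measure (Obs p K))
    (k : {k : Fin K // k ≠ t}) (j j' : Fin (p + 1)) : ℝ :=
  ∫ z, obsWt γ z k * resid ψ α z k ^ 2 * z.2.2 j * z.2.2 j' ∂ν

theorem measurable_treatInd (k : Fin K) : Measurable fun s : Fin K => treatInd s k :=
  measurable_of_finite _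

theorem measurable_obsWt (γ : Coef p K t) (k : {k : Fin K // k ≠ t}) :
    Measurable fun z : Obs p K => obsWt γ z k :=
  ((measurable_treatInd t).comp (measurable_fst.comp measurable_snd)).mul
    (Real.measurable_exp.comp ((measurable_linPred γ k).comp
      (measurable_snd.comp measurable_snd)))

theorem measurable_resid {ψ : ℝ → ℝ} (hψ : Measurable ψ) (α : Coef p K t)
    (k : {k : Fin K // k ≠ t}) : Measurable fun z : Obs p K => resid ψ α z k :=
  measurable_fst.sub (hψ.comp ((measurable_linPred α k).comp
      (measurable_snd.comp measurable_snd)))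

theorem measurable_regressor (j : Fin (p + 1)) : Measurable fun z : Obs p K => z.2.2 j :=
  (measurable_pi_apply j).comp (measurable_snd.comp measurable_snd)

theorem obsWt_nonneg (γ : Coef p K t) (z : Obs p K) (k : {k : Fin K // k ≠ t}) :
    0 ≤ obsWt γ z k := calWt_nonneg _ _ _ _

variable {c : Constants} {ψ : ℝ → ℝ} {γ α : Coef p K t} {ν : Measure (Obs p K)}

theorem LawBase.sum_obsWt_le (H : LawBase c ψ γ α ν) (hB1 : 1 < c.B1) :
    ∀ᵐ z ∂ν, ∑ k, obsWt γ z k ≤ c.B1 - 1 := by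
  filter_upwards [H.overlap] with z hz
  simp only [obsWt, calWt, ← Finset.mul_sum]
  have h0 : 0 ≤ ∑ k, Real.exp (linPred γ z.2.2 k) :=
    Finset.sum_nonneg fun k _ => (Real.exp_pos _).le
  nlinarith [treatInd_le_one z.2.1 t, treatInd_nonneg z.2.1 t]

theorem sum_abs_treatInd_le (s : Fin K) :
    ∑ k : {k : Fin K // k ≠ t}, |treatInd s k| ≤ 1 - treatInd s t := by
  have h : ∑ k : Fin K, treatInd s k = 1 := by simp [treatInd]
  rw [Fintype.sum_eq_add_sum_subtype_ne (fun k => treatInd s k) t] at h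
  simp only [abs_of_nonneg (treatInd_nonneg s _)]
  linarith

theorem LawBase.sum_abs_sub_le (H : LawBase c ψ γ α ν) (hB1 : 1 < c.B1) :
    ∀ᵐ z ∂ν, ∑ k : {k : Fin K // k ≠ t}, |obsWt γ z k - treatInd z.2.1 k| ≤ c.B1 := by
  filter_upwards [H.sum_obsWt_le hB1] with z hz
  calc ∑ k : {k : Fin K // k ≠ t}, |obsWt γ z k - treatInd z.2.1 k|
      ≤ ∑ k : {k : Fin K // k ≠ t}, (obsWt γ z k + |treatInd z.2.1 k|) :=
        Finset.sum_le_sum fun k _ => (abs_sub _ _).trans (by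
          rw [abs_of_nonneg (obsWt_nonneg γ z k)])
    _ = ∑ k, obsWt γ z k + ∑ k : {k : Fin K // k ≠ t}, |treatInd z.2.1 k| :=
        Finset.sum_add_distrib
    _ ≤ (c.B1 - 1) + 1 := by
        have := sum_abs_treatInd_le (t := t) z.2.1
        linarith [treatInd_nonneg z.2.1 t]
    _ = c.B1 := by ring

/-- The weighted sum of squared standardized residuals. -/
def residSq (c : Constants) (ψ : ℝ → ℝ) (γ α : Coef p K t) (z : Obs p K) : ℝ :=
  ∑ k, obsWt γ z k / (c.B1 - 1) * (resid ψ α z k ^ 2 / c.σ0 ^ 2)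

theorem residSq_nonneg (hB1 : 1 < c.B1) (z : Obs p K) : 0 ≤ residSq c ψ γ α z :=
  Finset.sum_nonneg fun k _ => mul_nonneg (div_nonneg (obsWt_nonneg _ _ _) (by linarith))
    (by positivity)

theorem measurable_residSq (hψ : Measurable ψ) : Measurable (residSq c ψ γ α) :=
  Finset.measurable_sum _ fun k _ => ((measurable_obsWt γ k).div_const _).mul
    (((measurable_resid hψ α k).pow_const 2).div_const _)

/-- Jensen's inequality for the exponential with weights of total mass at most one. -/
theorem exp_sum_mul_add_sum_le {κ : Type*} [Fintype κ] {w x : κ → ℝ} (hw : ∀ k, 0 ≤ w k)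
    (hw1 : ∑ k, w k ≤ 1) :
    Real.exp (∑ k, w k * x k) + ∑ k, w k ≤ 1 + ∑ k, w k * Real.exp (x k) := by
  have h := convexOn_exp.map_sum_le (t := (Finset.univ : Finset (Option κ)))
    (w := fun o => o.elim (1 - ∑ k, w k) w) (p := fun o => o.elim 0 x)
    (by rintro (_ | k) _ <;> simp [hw, hw1]) (by rw [Fintype.sum_option]; simp)
    (fun _ _ => Set.mem_univ _)
  simp only [Fintype.sum_option, Option.elim, smul_eq_mul, mul_zero, zero_add, Real.exp_zero,
    mul_one] at h
  linarith

/-- Jensen with the weights w_k/(B₁ − 1), whose deficit from total mass one is placed at 0. With S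
the mean total weight, the exponential moment plus S is at most 1 + 2S, and S ≤ 1. All K − 1
residuals together thus obey the moment bound of a single one. -/
theorem LawBase.lintegral_exp_residSq_le [IsProbabilityMeasure ν] (H : LawBase c ψ γ α ν)
    (hB1 : 1 < c.B1) (hψ : Measurable ψ) :
    ∫⁻ z, ENNReal.ofReal (Real.exp (residSq c ψ γ α z)) ∂ν ≤ 2 := by
  set w : {k : Fin K // k ≠ t} → Obs p K → ℝ := fun k z => obsWt γ z k / (c.B1 - 1) with hw
  have hB : 0 < c.B1 - 1 := by linarith
  have hw0 : ∀ z k, 0 ≤ w k z := fun z k => div_nonneg (obsWt_nonneg γ z k) hB.le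
  have hwm : ∀ k, Measurable (w k) := fun k => (measurable_obsWt γ k).div_const _
  have hw1 : ∀ᵐ z ∂ν, ∑ k, w k z ≤ 1 := by
    filter_upwards [H.sum_obsWt_le hB1] with z hz
    simp only [hw, ← Finset.sum_div]
    rwa [div_le_one hB]
  have hrm : ∀ k, Measurable fun z : Obs p K => Real.exp (resid ψ α z k ^ 2 / c.σ0 ^ 2) :=
    fun k => Real.measurable_exp.comp (((measurable_resid hψ α k).pow_const 2).div_const _)
  have hpt : ∀ᵐ z ∂ν, ENNReal.ofReal (Real.exp (residSq c ψ γ α z)) +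
      ∑ k, ENNReal.ofReal (w k z) ≤
      1 + ∑ k, ENNReal.ofReal (w k z) *
        ENNReal.ofReal (Real.exp (resid ψ α z k ^ 2 / c.σ0 ^ 2)) := by
    filter_upwards [hw1] with z hz
    have h := exp_sum_mul_add_sum_le (x := fun k => resid ψ α z k ^ 2 / c.σ0 ^ 2) (hw0 z) hz
    simp_rw [← ENNReal.ofReal_mul (hw0 z _)]
    rw [← ENNReal.ofReal_sum_of_nonneg fun k _ => hw0 z k,
      ← ENNReal.ofReal_sum_of_nonneg fun k _ => mul_nonneg (hw0 z k) (Real.exp_pos _).le,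
      ← ENNReal.ofReal_add (Real.exp_pos _).le (Finset.sum_nonneg fun k _ => hw0 z k),
      ← ENNReal.ofReal_one, ← ENNReal.ofReal_add zero_le_one
        (Finset.sum_nonneg fun k _ => mul_nonneg (hw0 z k) (Real.exp_pos _).le)]
    exact ENNReal.ofReal_le_ofReal h
  have hwr : ∀ k ∈ Finset.univ, Measurable fun z => ENNReal.ofReal (w k z) *
      ENNReal.ofReal (Real.exp (resid ψ α z k ^ 2 / c.σ0 ^ 2)) := fun k _ =>
    (hwm k).ennreal_ofReal.mul (hrm k).ennreal_ofReal
  set S := ∑ k, ∫⁻ z, ENNReal.ofReal (w k z) ∂ν with hS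
  have hS1 : S ≤ 1 := by
    rw [hS, ← lintegral_finsetSum _ fun k _ => (hwm k).ennreal_ofReal]
    calc _ ≤ ∫⁻ _, 1 ∂ν := lintegral_mono_ae (by
          filter_upwards [hw1] with z hz
          rw [← ENNReal.ofReal_sum_of_nonneg fun k _ => hw0 z k]
          exact ENNReal.ofReal_le_one.2 hz)
      _ = 1 := by simp
  have hk : ∀ k, ∫⁻ z, ENNReal.ofReal (w k z) *
      ENNReal.ofReal (Real.exp (resid ψ α z k ^ 2 / c.σ0 ^ 2)) ∂ν ≤
      2 * ∫⁻ z, ENNReal.ofReal (w k z) ∂ν := by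
    intro k
    have h := H.subGaussian k (fun v => ENNReal.ofReal (Real.exp (linPred γ v k) / (c.B1 - 1)))
      ((Real.measurable_exp.comp (measurable_linPred γ k)).div_const _).ennreal_ofReal
    have e : ∀ z : Obs p K, ENNReal.ofReal (treatInd z.2.1 t) *
        ENNReal.ofReal (Real.exp (linPred γ z.2.2 k) / (c.B1 - 1)) = ENNReal.ofReal (w k z) := by
      intro z
      rw [← ENNReal.ofReal_mul (treatInd_nonneg _ _)]
      simp only [hw, obsWt, calWt, mul_div_assoc]
    simpa only [e] using h
  have hmain : ∫⁻ z, ENNReal.ofReal (Real.exp (residSq c ψ γ α z)) ∂ν + S ≤ 1 + 2 * S := by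
    rw [hS, ← lintegral_finsetSum _ fun k _ => (hwm k).ennreal_ofReal,
      ← lintegral_add_right _ (Finset.measurable_sum _ fun k _ => (hwm k).ennreal_ofReal)]
    refine (lintegral_mono_ae hpt).trans ?_
    rw [lintegral_add_left measurable_const,
      lintegral_finsetSum _ hwr,
      lintegral_finsetSum _ fun k _ => (hwm k).ennreal_ofReal]
    simp only [lintegral_const, measure_univ, mul_one, Finset.mul_sum]
    gcongr with k
    exact hk k
  have hSt : S ≠ ⊤ := ne_top_of_le_ne_top ENNReal.one_ne_top hS1
  have h2 : ∫⁻ z, ENNReal.ofReal (Real.exp (residSq c ψ γ α z)) ∂ν + S ≤ (1 + S) + S := by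
    refine hmain.trans (le_of_eq ?_)
    ring
  refine ((ENNReal.add_le_add_iff_right hSt).1 h2).trans ?_
  calc 1 + S ≤ 1 + 1 := by gcongr
    _ = 2 := by norm_num

theorem LawBase.integrable_exp_residSq [IsProbabilityMeasure ν] (H : LawBase c ψ γ α ν)
    (hB1 : 1 < c.B1) (hψ : Measurable ψ) :
    Integrable (fun z => Real.exp (residSq c ψ γ α z)) ν := by
  refine ⟨(Real.measurable_exp.comp (measurable_residSq hψ)).aestronglyMeasurable, ?_⟩
  rw [hasFiniteIntegral_iff_ofReal (Filter.Eventually.of_forall fun z => (Real.exp_pos _).le)]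
  exact (H.lintegral_exp_residSq_le hB1 hψ).trans_lt (by norm_num)

theorem LawBase.integral_exp_residSq_le [IsProbabilityMeasure ν] (H : LawBase c ψ γ α ν)
    (hB1 : 1 < c.B1) (hψ : Measurable ψ) :
    ∫ z, Real.exp (residSq c ψ γ α z) ∂ν ≤ 2 := by
  rw [integral_eq_lintegral_of_nonneg_ae (Filter.Eventually.of_forall fun z => (Real.exp_pos _).le)
    (Real.measurable_exp.comp (measurable_residSq hψ)).aestronglyMeasurable]
  exact ENNReal.toReal_le_of_le_ofReal (by norm_num)
    (by simpa using H.lintegral_exp_residSq_le hB1 hψ)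

theorem sum_obsWt_mul_resid_sq (hB1 : 1 < c.B1) (hσ : 0 < c.σ0) (z : Obs p K) :
    ∑ k, obsWt γ z k * resid ψ α z k ^ 2 = (c.B1 - 1) * c.σ0 ^ 2 * residSq c ψ γ α z := by
  have : c.B1 - 1 ≠ 0 := by linarith
  rw [residSq, Finset.mul_sum]
  refine Finset.sum_congr rfl fun k _ => ?_
  field_simp

end Law

end RCAL

namespace RCAL

/-! ### The rate -/

section Rate

variable {K p n : ℕ} {ε : ℝ}

theorem log_ratio_nonneg (hε : 0 < ε) (hε1 : ε < 1) : 0 ≤ Real.log (((p : ℝ) + 1) / ε) := by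
  apply Real.log_nonneg
  rw [le_div_iff₀ hε]
  have : (0 : ℝ) ≤ p := Nat.cast_nonneg p
  linarith

theorem mul_rate_sq (hK : 2 ≤ K) (hn : 0 < n) (hε : 0 < ε) (hε1 : ε < 1) :
    n * Constants.rate K p n ε ^ 2 = ((K : ℝ) - 1) + Real.log (((p : ℝ) + 1) / ε) := by
  have hn' : (0 : ℝ) < n := Nat.cast_pos.2 hn
  have hK' : (2 : ℝ) ≤ K := by exact_mod_cast hK
  have h := log_ratio_nonneg (p := p) hε hε1
  unfold Constants.rate
  rw [Real.sq_sqrt (add_nonneg (div_nonneg (by linarith) hn'.le) (div_nonneg h hn'.le))]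
  field_simp

theorem rate_pos (hK : 2 ≤ K) (hn : 0 < n) (hε : 0 < ε) (hε1 : ε < 1) :
    0 < Constants.rate K p n ε := by
  have hn' : (0 : ℝ) < n := Nat.cast_pos.2 hn
  have hK' : (2 : ℝ) ≤ K := by exact_mod_cast hK
  have h := log_ratio_nonneg (p := p) hε hε1
  exact Real.sqrt_pos.2 (add_pos_of_pos_of_nonneg (div_pos (by linarith) hn')
    (div_nonneg h hn'.le))

/-- In nρ² = (K − 1) + log((p + 1)/ε) the logarithm pays for the union over rows, and K ≥ 2 gives
e^{−(K−1)} ≤ 1/2, which pays for the factor 2. -/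
theorem mul_two_exp_neg_le (hK : 2 ≤ K) (hn : 0 < n) (hε : 0 < ε) (hε1 : ε < 1) :
    ((p : ℝ) + 1) * (2 * Real.exp (-(n * Constants.rate K p n ε ^ 2))) ≤ ε := by
  have hK' : (2 : ℝ) ≤ K := by exact_mod_cast hK
  have hp : (0 : ℝ) < (p : ℝ) + 1 := by positivity
  rw [mul_rate_sq hK hn hε hε1, neg_add, Real.exp_add, ← Real.log_inv,
    Real.exp_log (by positivity), inv_div]
  have h1 : Real.exp (-((K : ℝ) - 1)) ≤ 1 / 2 := by
    have h2 : Real.exp (-((K : ℝ) - 1)) ≤ Real.exp (-1) := Real.exp_le_exp.2 (by linarith)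
    have h3 : (2 : ℝ) ≤ Real.exp 1 := by linarith [Real.add_one_le_exp (1 : ℝ)]
    have h4 : Real.exp (-1) ≤ 1 / 2 := by
      rw [Real.exp_neg, inv_eq_one_div]
      exact one_div_le_one_div_of_le (by norm_num) h3
    exact h2.trans h4
  calc ((p : ℝ) + 1) * (2 * (Real.exp (-((K : ℝ) - 1)) * (ε / ((p : ℝ) + 1))))
      = 2 * Real.exp (-((K : ℝ) - 1)) * ε := by field_simp
    _ ≤ 2 * (1 / 2) * ε := by gcongr
    _ = ε := by ring

/-- Doubling the exponent squares the previous bound, which pays for a union over pairs of rows. -/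
theorem mul_mul_two_exp_neg_le (hK : 2 ≤ K) (hn : 0 < n) (hε : 0 < ε) (hε1 : ε < 1) :
    ((p : ℝ) + 1) * ((p : ℝ) + 1) *
      (2 * Real.exp (-(2 * (n * Constants.rate K p n ε ^ 2)))) ≤ ε := by
  have h := mul_two_exp_neg_le (p := p) hK hn hε hε1
  set y := Real.exp (-(n * Constants.rate K p n ε ^ 2)) with hy
  have e : Real.exp (-(2 * (n * Constants.rate K p n ε ^ 2))) = y * y := by
    rw [hy, ← Real.exp_add]; congr 1; ring
  have hy0 : 0 < y := Real.exp_pos _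
  have h0 : 0 ≤ ((p : ℝ) + 1) * (2 * y) := by positivity
  rw [e]
  calc _ = ((p : ℝ) + 1) * (2 * y) * (((p : ℝ) + 1) * (2 * y)) / 2 := by ring
    _ ≤ ε * ε / 2 := by gcongr
    _ ≤ ε := by nlinarith

end Rate

theorem measure_exists_mem_le {Ω ι : Type*} [MeasurableSpace Ω] [Fintype ι] {μ : Measure Ω}
    {S : ι → Set Ω} {x : ℝ} (h : ∀ i, μ (S i) ≤ ENNReal.ofReal x) :
    μ {z | ∃ i, z ∈ S i} ≤ ENNReal.ofReal (Fintype.card ι * x) := by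
  have e : {z | ∃ i, z ∈ S i} = ⋃ i, S i := by ext; simp
  rw [e]
  refine (measure_iUnion_fintype_le μ S).trans ((Finset.sum_le_sum fun i _ => h i).trans ?_)
  rw [Finset.sum_const, nsmul_eq_mul, Finset.card_univ, ENNReal.ofReal_mul (Nat.cast_nonneg _),
    ENNReal.ofReal_natCast]

/-! ### Population moments -/

section Moments

variable {p K : ℕ} {t : Fin K} {c : Constants} {ψ : ℝ → ℝ} {γ α : Coef p K t}
  {ν : Measure (Obs p K)}

theorem quadForm_integral {x : Obs p K → {k : Fin K // k ≠ t} → ℝ}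
    (hx : ∀ k j j', Integrable (fun z => x z k * z.2.2 j * z.2.2 j') ν) (b : Coef p K t) :
    quadForm (fun k j j' => ∫ z, x z k * z.2.2 j * z.2.2 j' ∂ν) b =
      ∑ k, ∫ z, x z k * linPred b z.2.2 k ^ 2 ∂ν := by
  unfold quadForm
  refine Finset.sum_congr rfl fun k _ => ?_
  have e : ∀ z : Obs p K, x z k * linPred b z.2.2 k ^ 2 =
      ∑ j, ∑ j', b j k * (x z k * z.2.2 j * z.2.2 j') * b j' k := by
    intro z
    rw [sq, linPred, Finset.sum_mul_sum, Finset.mul_sum]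
    refine Finset.sum_congr rfl fun j _ => ?_
    rw [Finset.mul_sum]
    exact Finset.sum_congr rfl fun j' _ => by ring
  have hi : ∀ j j', Integrable (fun z => b j k * (x z k * z.2.2 j * z.2.2 j') * b j' k) ν :=
    fun j j' => ((hx k j j').const_mul _).mul_const _
  simp only [e]
  rw [integral_finsetSum _ fun j _ => integrable_finsetSum _ fun j' _ => hi j j']
  refine Finset.sum_congr rfl fun j _ => ?_
  rw [integral_finsetSum _ fun j' _ => hi j j']
  refine Finset.sum_congr rfl fun j' _ => ?_
  rw [integral_mul_const, integral_const_mul]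

variable [IsProbabilityMeasure ν]

theorem LawBase.sum_abs_quad_le (H : LawBase c ψ γ α ν) (hB0 : 1 ≤ c.B0) (hB1 : 1 < c.B1)
    (j j' : Fin (p + 1)) :
    ∀ᵐ z ∂ν, ∑ k, |obsWt γ z k * z.2.2 j * z.2.2 j'| ≤ c.B0 ^ 2 * c.B1 := by
  filter_upwards [H.sum_obsWt_le hB1, H.bounded] with z hz hv
  calc ∑ k, |obsWt γ z k * z.2.2 j * z.2.2 j'| ≤ ∑ k, obsWt γ z k * (c.B0 * c.B0) := by
        refine Finset.sum_le_sum fun k _ => ?_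
        rw [mul_assoc, abs_mul, abs_of_nonneg (obsWt_nonneg γ z k), abs_mul]
        exact mul_le_mul_of_nonneg_left (mul_le_mul (hv j) (hv j') (abs_nonneg _) (by linarith))
          (obsWt_nonneg γ z k)
    _ = (∑ k, obsWt γ z k) * (c.B0 * c.B0) := by rw [Finset.sum_mul]
    _ ≤ c.B1 * (c.B0 * c.B0) := by
        apply mul_le_mul_of_nonneg_right _ (by positivity); linarith
    _ = _ := by ring

theorem LawBase.sum_abs_quadResid_le (H : LawBase c ψ γ α ν) (hB0 : 1 ≤ c.B0) (hB1 : 1 < c.B1)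
    (hσ : 0 < c.σ0) (j j' : Fin (p + 1)) :
    ∀ᵐ z ∂ν, ∑ k, |obsWt γ z k * resid ψ α z k ^ 2 * z.2.2 j * z.2.2 j'| ≤
      c.B0 ^ 2 * c.B1 * c.σ0 ^ 2 * residSq c ψ γ α z := by
  filter_upwards [H.bounded] with z hv
  have hw : ∀ k, 0 ≤ obsWt γ z k * resid ψ α z k ^ 2 := fun k =>
    mul_nonneg (obsWt_nonneg γ z k) (sq_nonneg _)
  have hq := residSq_nonneg (c := c) (ψ := ψ) (γ := γ) (α := α) hB1 z
  calc ∑ k, |obsWt γ z k * resid ψ α z k ^ 2 * z.2.2 j * z.2.2 j'|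
      ≤ ∑ k, obsWt γ z k * resid ψ α z k ^ 2 * (c.B0 * c.B0) := by
        refine Finset.sum_le_sum fun k _ => ?_
        rw [mul_assoc (obsWt γ z k * _), abs_mul, abs_of_nonneg (hw k), abs_mul]
        exact mul_le_mul_of_nonneg_left (mul_le_mul (hv j) (hv j') (abs_nonneg _) (by linarith))
          (hw k)
    _ = (c.B1 - 1) * c.σ0 ^ 2 * residSq c ψ γ α z * (c.B0 * c.B0) := by
        rw [← Finset.sum_mul, sum_obsWt_mul_resid_sq hB1 hσ]
    _ ≤ c.B1 * c.σ0 ^ 2 * residSq c ψ γ α z * (c.B0 * c.B0) := by gcongr; linarith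
    _ = _ := by ring

theorem measurable_quad (k : {k : Fin K // k ≠ t}) (j j' : Fin (p + 1)) :
    Measurable fun z : Obs p K => obsWt γ z k * z.2.2 j * z.2.2 j' :=
  ((measurable_obsWt γ k).mul (measurable_regressor j)).mul (measurable_regressor j')

theorem measurable_quadResid (hψ : Measurable ψ) (k : {k : Fin K // k ≠ t}) (j j' : Fin (p + 1)) :
    Measurable fun z : Obs p K => obsWt γ z k * resid ψ α z k ^ 2 * z.2.2 j * z.2.2 j' :=
  (((measurable_obsWt γ k).mul ((measurable_resid hψ α k).pow_const 2)).mul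
    (measurable_regressor j)).mul (measurable_regressor j')

theorem LawBase.integrable_quad (H : LawBase c ψ γ α ν) (hB0 : 1 ≤ c.B0) (hB1 : 1 < c.B1)
    (k : {k : Fin K // k ≠ t}) (j j' : Fin (p + 1)) :
    Integrable (fun z => obsWt γ z k * z.2.2 j * z.2.2 j') ν :=
  Integrable.of_bound (measurable_quad k j j').aestronglyMeasurable _
    ((H.sum_abs_quad_le hB0 hB1 j j').mono fun z hz =>
      (Finset.single_le_sum (f := fun k => |obsWt γ z k * z.2.2 j * z.2.2 j'|)
        (fun _ _ => abs_nonneg _) (Finset.mem_univ k)).trans hz)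

theorem LawBase.integrable_quadResid (H : LawBase c ψ γ α ν) (hB0 : 1 ≤ c.B0) (hB1 : 1 < c.B1)
    (hσ : 0 < c.σ0) (hψ : Measurable ψ) (k : {k : Fin K // k ≠ t}) (j j' : Fin (p + 1)) :
    Integrable (fun z => obsWt γ z k * resid ψ α z k ^ 2 * z.2.2 j * z.2.2 j') ν := by
  refine Integrable.mono' ((H.integrable_exp_residSq hB1 hψ).const_mul
    (c.B0 ^ 2 * c.B1 * c.σ0 ^ 2)) (measurable_quadResid hψ k j j').aestronglyMeasurable ?_
  filter_upwards [H.sum_abs_quadResid_le hB0 hB1 hσ j j'] with z hz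
  refine ((Finset.single_le_sum (f := fun k => |obsWt γ z k * resid ψ α z k ^ 2 * z.2.2 j
    * z.2.2 j'|) (fun _ _ => abs_nonneg _) (Finset.mem_univ k)).trans hz).trans ?_
  exact mul_le_mul_of_nonneg_left (by linarith [Real.add_one_le_exp (residSq c ψ γ α z)])
    (by positivity)

/-- Use x ≤ e^x − 1 at x = resid²/σ₀². The weight R^{(t)} e^{γ_kᵀv} (b_kᵀv)² is R^{(t)} times a
function of the regressors, so the mean of weight times e^x is at most twice the mean weight;
subtracting leaves one copy. -/
theorem LawBase.quadForm_meanQuadResid_le (H : LawBase c ψ γ α ν) (hB0 : 1 ≤ c.B0) (hB1 : 1 < c.B1)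
    (hσ : 0 < c.σ0) (hψ : Measurable ψ) (b : Coef p K t) :
    quadForm (meanQuadResid ψ γ α ν) b ≤ c.σ0 ^ 2 * quadForm (meanQuad γ ν) b := by
  have e1 := quadForm_integral (H.integrable_quad hB0 hB1) b
  have e2 := quadForm_integral (x := fun z k => obsWt γ z k * resid ψ α z k ^ 2)
    (H.integrable_quadResid hB0 hB1 hσ hψ) b
  unfold meanQuadResid meanQuad
  rw [e1, e2, Finset.mul_sum]
  refine Finset.sum_le_sum fun k _ => ?_
  set w : Obs p K → ℝ := fun z => obsWt γ z k * linPred b z.2.2 k ^ 2 with hw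
  set e : Obs p K → ℝ := fun z => Real.exp (resid ψ α z k ^ 2 / c.σ0 ^ 2) with he
  have hlm : Measurable fun z : Obs p K => linPred b z.2.2 k :=
    (measurable_linPred b k).comp (measurable_snd.comp measurable_snd)
  have hwm : Measurable w := (measurable_obsWt γ k).mul (hlm.pow_const 2)
  have hem : Measurable e :=
    Real.measurable_exp.comp (((measurable_resid hψ α k).pow_const 2).div_const _)
  have hw0 : ∀ z, 0 ≤ w z := fun z => mul_nonneg (obsWt_nonneg γ z k) (sq_nonneg _)
  have hwi : Integrable w ν := by
    refine Integrable.of_bound hwm.aestronglyMeasurable (c.B1 * (c.B0 * norm21 b) ^ 2) ?_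
    filter_upwards [H.bounded, H.sum_obsWt_le hB1] with z hz1 hz2
    rw [Real.norm_of_nonneg (hw0 z)]
    have h1 : obsWt γ z k ≤ c.B1 := by
      have : obsWt γ z k ≤ ∑ k, obsWt γ z k := Finset.single_le_sum
        (f := fun k => obsWt γ z k) (fun k _ => obsWt_nonneg γ z k) (Finset.mem_univ k)
      linarith
    have h2 : linPred b z.2.2 k ^ 2 ≤ (c.B0 * norm21 b) ^ 2 :=
      sq_le_sq' (by linarith [(abs_le.1 (abs_linPred_le b hz1 k)).1])
        (abs_le.1 (abs_linPred_le b hz1 k)).2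
    exact mul_le_mul h1 h2 (sq_nonneg _) (by linarith)
  have hsub : ∫⁻ z, ENNReal.ofReal (w z * e z) ∂ν ≤ ENNReal.ofReal (2 * ∫ z, w z ∂ν) := by
    have h := H.subGaussian k
      (fun v => ENNReal.ofReal (Real.exp (linPred γ v k) * linPred b v k ^ 2))
      ((Real.measurable_exp.comp (measurable_linPred γ k)).mul
        ((measurable_linPred b k).pow_const 2)).ennreal_ofReal
    have e0 : ∀ z : Obs p K, ENNReal.ofReal (treatInd z.2.1 t) *
        ENNReal.ofReal (Real.exp (linPred γ z.2.2 k) * linPred b z.2.2 k ^ 2) =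
        ENNReal.ofReal (w z) := by
      intro z
      rw [← ENNReal.ofReal_mul (treatInd_nonneg _ _)]
      simp only [hw, obsWt, calWt, mul_assoc]
    simp only [e0] at h
    rw [← ofReal_integral_eq_lintegral_ofReal hwi (Filter.Eventually.of_forall hw0)] at h
    rw [ENNReal.ofReal_mul (by norm_num), ENNReal.ofReal_ofNat]
    simpa only [ENNReal.ofReal_mul (hw0 _)] using h
  have hwe0 : ∀ z, 0 ≤ w z * e z := fun z => mul_nonneg (hw0 z) (Real.exp_pos _).le
  have hwei : Integrable (fun z => w z * e z) ν := by
    refine ⟨(hwm.mul hem).aestronglyMeasurable, ?_⟩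
    rw [hasFiniteIntegral_iff_ofReal (Filter.Eventually.of_forall hwe0)]
    exact hsub.trans_lt ENNReal.ofReal_lt_top
  have hle : ∫ z, w z * e z ∂ν ≤ 2 * ∫ z, w z ∂ν := by
    rw [← ofReal_integral_eq_lintegral_ofReal hwei (Filter.Eventually.of_forall hwe0)] at hsub
    exact (ENNReal.ofReal_le_ofReal_iff
      (mul_nonneg (by norm_num) (integral_nonneg hw0))).1 hsub
  have hpt : ∀ z, obsWt γ z k * resid ψ α z k ^ 2 * linPred b z.2.2 k ^ 2 ≤
      c.σ0 ^ 2 * (w z * e z - w z) := by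
    intro z
    have h1 := Real.add_one_le_exp (resid ψ α z k ^ 2 / c.σ0 ^ 2)
    have h2 : resid ψ α z k ^ 2 = c.σ0 ^ 2 * (resid ψ α z k ^ 2 / c.σ0 ^ 2) := by field_simp
    calc _ = w z * (c.σ0 ^ 2 * (resid ψ α z k ^ 2 / c.σ0 ^ 2)) := by rw [← h2]; ring
      _ ≤ w z * (c.σ0 ^ 2 * (e z - 1)) := by
          have := hw0 z
          have h3 : resid ψ α z k ^ 2 / c.σ0 ^ 2 ≤ e z - 1 := by simp only [he]; linarith
          gcongr
      _ = _ := by ring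
  have hdi : Integrable (fun z => w z * e z - w z) ν := hwei.sub hwi
  calc ∫ z, obsWt γ z k * resid ψ α z k ^ 2 * linPred b z.2.2 k ^ 2 ∂ν
      ≤ ∫ z, c.σ0 ^ 2 * (w z * e z - w z) ∂ν := by
        refine integral_mono_of_nonneg (Filter.Eventually.of_forall fun z => ?_)
          (hdi.const_mul _) (Filter.Eventually.of_forall hpt)
        exact mul_nonneg (mul_nonneg (obsWt_nonneg γ z k) (sq_nonneg _)) (sq_nonneg _)
    _ = c.σ0 ^ 2 * (∫ z, w z * e z ∂ν - ∫ z, w z ∂ν) := by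
        rw [integral_const_mul, integral_sub hwei hwi]
    _ ≤ c.σ0 ^ 2 * ∫ z, w z ∂ν := by gcongr; linarith

end Moments

end RCAL

namespace RCAL

/-! ### Probabilities of the exceptional events -/

section Events

variable {p K n : ℕ} {t : Fin K} {c : Constants} {ψ : ℝ → ℝ} {γ α : Coef p K t}
  {ν : Measure (Obs p K)} {ε : ℝ}

theorem one_le_sqrt_two : (7 / 5 : ℝ) ≤ Real.sqrt 2 := by
  apply Real.le_sqrt_of_sq_le; norm_num

theorem ae_pi_forall [IsProbabilityMeasure ν] {P : Obs p K → Prop} (h : ∀ᵐ z ∂ν, P z) :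
    ∀ᵐ z ∂(Measure.pi fun _ : Fin n => ν), ∀ i, P (z i) := by
  rw [ae_all_iff]
  intro i
  exact (Measure.quasiMeasurePreserving_eval (μ := fun _ : Fin n => ν) i).ae h

variable [IsProbabilityMeasure ν]

/-- The exponent is −(4√2 − 3)nρ², and √2 ≥ 7/5 makes 4√2 − 3 at least 2. This is strong enough for
unions over pairs of rows. -/
theorem measure_avg_dev_gt_lam1_le (hc : c.Valid) (hK : 2 ≤ K) (hn : 0 < n) (hε : 0 < ε)
    (hε1 : ε < 1) (hρ : Constants.rate K p n ε ≤ 1 / 20)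
    {u : Obs p K → {k : Fin K // k ≠ t} → ℝ} (hu : ∀ k, Measurable fun z => u z k)
    (hM : ∀ᵐ z ∂ν, ∑ k, |u z k| ≤ c.B0 ^ 2 * c.B1) :
    (Measure.pi fun _ : Fin n => ν)
      {z | c.lam1 K p n ε / 2 <
        Real.sqrt (∑ k, ((avg fun i => u (z i) k) - ∫ z', u z' k ∂ν) ^ 2)} ≤
      ENNReal.ofReal (2 * Real.exp (-(2 * (n * Constants.rate K p n ε ^ 2)))) := by
  have hρ0 := rate_pos (p := p) hK hn hε hε1
  have hB0 := hc.B0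
  have hB1 := hc.B1
  refine (measure_avg_dev_gt_le_of_bounded (δ := c.lam1 K p n ε / 2) hn hu
    (M := c.B0 ^ 2 * c.B1) (by positivity) hM hρ0 hρ).trans ?_
  apply ENNReal.ofReal_le_ofReal
  refine mul_le_mul_of_nonneg_left (Real.exp_le_exp.2 ?_) (by norm_num)
  set ρ := Constants.rate K p n ε with hρdef
  have e : 2 * ρ / (c.B0 ^ 2 * c.B1) * (n * (c.lam1 K p n ε / 2)) =
      4 * Real.sqrt 2 * (n * ρ ^ 2) := by
    unfold Constants.lam1
    rw [← hρdef]
    field_simp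
  have h0 : 0 ≤ n * ρ ^ 2 := by positivity
  rw [e]
  nlinarith [one_le_sqrt_two]

theorem LawReg.measure_cal_gt_le (H : LawReg c ψ γ α ν) (hc : c.Valid) (hK : 2 ≤ K) (hn : 0 < n)
    (hε : 0 < ε) (hε1 : ε < 1) (hρ : Constants.rate K p n ε ≤ 1 / 20) :
    (Measure.pi fun _ : Fin n => ν) {z | ∃ j, c.lam1 K p n ε <
      Real.sqrt (∑ k : {k : Fin K // k ≠ t}, (avg fun i =>
        (calWt γ (z i).2.1 (z i).2.2 k - treatInd (z i).2.1 k) * (z i).2.2 j) ^ 2)} ≤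
      ENNReal.ofReal ε := by
  have hB0 := hc.B0
  have hB1 := hc.B1
  have hl : 0 ≤ c.lam1 K p n ε := by
    have := rate_pos (p := p) hK hn hε hε1
    unfold Constants.lam1; positivity
  have hj : ∀ j : Fin (p + 1), (Measure.pi fun _ : Fin n => ν) {z | c.lam1 K p n ε <
      Real.sqrt (∑ k : {k : Fin K // k ≠ t}, (avg fun i =>
        (calWt γ (z i).2.1 (z i).2.2 k - treatInd (z i).2.1 k) * (z i).2.2 j) ^ 2)} ≤
      ENNReal.ofReal (2 * Real.exp (-(2 * (n * Constants.rate K p n ε ^ 2)))) := by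
    intro j
    refine (measure_mono fun z hz => ?_).trans
      (measure_avg_dev_gt_lam1_le (t := t) (ν := ν) hc hK hn hε hε1 hρ
        (u := fun z k => (obsWt γ z k - treatInd z.2.1 k) * z.2.2 j) (fun k => ?_) ?_)
    · simp only [Set.mem_ofPred_eq, H.cal_mean, sub_zero] at hz ⊢
      exact lt_of_le_of_lt (by linarith) hz
    · exact ((measurable_obsWt γ k).sub ((measurable_treatInd _).comp
        (measurable_fst.comp measurable_snd))).mul (measurable_regressor j)
    · filter_upwards [H.bounded, H.sum_abs_sub_le hB1] with z h1 h2
      simp only [abs_mul]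
      rw [← Finset.sum_mul]
      calc _ ≤ c.B1 * c.B0 := mul_le_mul h2 (h1 j) (abs_nonneg _) (by linarith)
        _ ≤ c.B0 ^ 2 * c.B1 := by
          nlinarith [mul_pos (by linarith : 0 < c.B0) (by linarith : 0 < c.B1)]
  refine (measure_exists_mem_le hj).trans (ENNReal.ofReal_le_ofReal ?_)
  refine le_trans ?_ (mul_two_exp_neg_le (p := p) hK hn hε hε1)
  rw [Fintype.card_fin, Nat.cast_add, Nat.cast_one]
  refine mul_le_mul_of_nonneg_left (mul_le_mul_of_nonneg_left (Real.exp_le_exp.2 ?_)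
    (by norm_num)) (by positivity)
  have : 0 ≤ n * Constants.rate K p n ε ^ 2 := by positivity
  linarith

theorem abs_le_sqrt_sum_sq {κ : Type*} [Fintype κ] (x : κ → ℝ) (k : κ) :
    |x k| ≤ Real.sqrt (∑ k, x k ^ 2) :=
  Real.abs_le_sqrt (Finset.single_le_sum (f := fun k => x k ^ 2) (fun _ _ => sq_nonneg _)
    (Finset.mem_univ k))

theorem LawReg.measure_quad_gt_le (H : LawReg c ψ γ α ν) (hc : c.Valid) (hK : 2 ≤ K) (hn : 0 < n)
    (hε : 0 < ε) (hε1 : ε < 1) (hρ : Constants.rate K p n ε ≤ 1 / 20) :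
    (Measure.pi fun _ : Fin n => ν) {z | ∃ jj : Fin (p + 1) × Fin (p + 1), ∃ k,
      c.lam1 K p n ε / 2 < |(avg fun i => calWt γ (z i).2.1 (z i).2.2 k * (z i).2.2 jj.1
        * (z i).2.2 jj.2) - meanQuad γ ν k jj.1 jj.2|} ≤
      ENNReal.ofReal ε := by
  have hj : ∀ jj : Fin (p + 1) × Fin (p + 1), (Measure.pi fun _ : Fin n => ν) {z | ∃ k,
      c.lam1 K p n ε / 2 < |(avg fun i => calWt γ (z i).2.1 (z i).2.2 k * (z i).2.2 jj.1
        * (z i).2.2 jj.2) - meanQuad γ ν k jj.1 jj.2|} ≤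
      ENNReal.ofReal (2 * Real.exp (-(2 * (n * Constants.rate K p n ε ^ 2)))) := by
    intro jj
    refine (measure_mono fun z hz => ?_).trans
      (measure_avg_dev_gt_lam1_le (t := t) (ν := ν) hc hK hn hε hε1 hρ
        (fun k => measurable_quad k jj.1 jj.2) (H.sum_abs_quad_le hc.B0 hc.B1 jj.1 jj.2))
    obtain ⟨k, hk⟩ := hz
    exact hk.trans_le (abs_le_sqrt_sum_sq (fun k => (avg fun i => obsWt γ (z i) k *
      (z i).2.2 jj.1 * (z i).2.2 jj.2) - meanQuad γ ν k jj.1 jj.2) k)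
  refine (measure_exists_mem_le hj).trans (ENNReal.ofReal_le_ofReal ?_)
  refine le_trans (le_of_eq ?_) (mul_mul_two_exp_neg_le (p := p) hK hn hε hε1)
  simp

/-- Squared residuals are only sub-exponential. The level 2σ₀²λ₁ gives the exponent −(8√2 − 6)nρ² ≤
−2nρ², again enough for pairs of rows. -/
theorem LawReg.measure_quadResid_gt_le (H : LawReg c ψ γ α ν) (hc : c.Valid) (hK : 2 ≤ K)
    (hn : 0 < n) (hε : 0 < ε) (hε1 : ε < 1) (hρ : Constants.rate K p n ε ≤ 1 / 20)
    (hψ : Measurable ψ) :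
    (Measure.pi fun _ : Fin n => ν) {z | ∃ jj : Fin (p + 1) × Fin (p + 1), ∃ k,
      2 * c.σ0 ^ 2 * c.lam1 K p n ε < |(avg fun i => calWt γ (z i).2.1 (z i).2.2 k *
        ((z i).1 - ψ (linPred α (z i).2.2 k)) ^ 2 * (z i).2.2 jj.1 * (z i).2.2 jj.2)
        - meanQuadResid ψ γ α ν k jj.1 jj.2|} ≤
      ENNReal.ofReal ε := by
  have hB0 := hc.B0
  have hB1 := hc.B1
  have hσ := hc.σ0
  have hρ0 := rate_pos (p := p) hK hn hε hε1
  have hj : ∀ jj : Fin (p + 1) × Fin (p + 1), (Measure.pi fun _ : Fin n => ν) {z | ∃ k,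
      2 * c.σ0 ^ 2 * c.lam1 K p n ε < |(avg fun i => calWt γ (z i).2.1 (z i).2.2 k *
        ((z i).1 - ψ (linPred α (z i).2.2 k)) ^ 2 * (z i).2.2 jj.1 * (z i).2.2 jj.2)
        - meanQuadResid ψ γ α ν k jj.1 jj.2|} ≤
      ENNReal.ofReal (2 * Real.exp (-(2 * (n * Constants.rate K p n ε ^ 2)))) := by
    intro jj
    refine (measure_mono fun z hz => ?_).trans
      ((measure_avg_dev_gt_le_of_subExp (ν := ν) (δ := 2 * c.σ0 ^ 2 * c.lam1 K p n ε) hn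
        (fun k => measurable_quadResid hψ k jj.1 jj.2) (B := c.B0 ^ 2 * c.B1 * c.σ0 ^ 2)
        (by positivity) (residSq_nonneg hB1) (H.sum_abs_quadResid_le hB0 hB1 hσ jj.1 jj.2)
        (measurable_residSq hψ) (H.integrable_exp_residSq hB1 hψ)
        (H.integral_exp_residSq_le hB1 hψ) hρ0 hρ).trans ?_)
    · obtain ⟨k, hk⟩ := hz
      exact hk.trans_le (abs_le_sqrt_sum_sq (fun k => (avg fun i => obsWt γ (z i) k *
        resid ψ α (z i) k ^ 2 * (z i).2.2 jj.1 * (z i).2.2 jj.2)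
        - meanQuadResid ψ γ α ν k jj.1 jj.2) k)
    · apply ENNReal.ofReal_le_ofReal
      refine mul_le_mul_of_nonneg_left (Real.exp_le_exp.2 ?_) (by norm_num)
      set ρ := Constants.rate K p n ε with hρdef
      have e : ρ / (c.B0 ^ 2 * c.B1 * c.σ0 ^ 2) * (n * (2 * c.σ0 ^ 2 * c.lam1 K p n ε)) =
          8 * Real.sqrt 2 * (n * ρ ^ 2) := by
        unfold Constants.lam1
        rw [← hρdef]
        field_simp
        ring
      have h0 : 0 ≤ n * ρ ^ 2 := by positivity
      rw [e]
      nlinarith [one_le_sqrt_two]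
  refine (measure_exists_mem_le hj).trans (ENNReal.ofReal_le_ofReal ?_)
  refine le_trans (le_of_eq ?_) (mul_mul_two_exp_neg_le (p := p) hK hn hε hε1)
  simp

/-- Since w_k² ≤ (B₁ − 1) w_k, the squared norm of the score vector is at most σ² times `residSq`
with σ = B₀(B₁ − 1)σ₀. The resulting level √3σρ is the second entry in the maximum defining λ₂. -/
theorem LawReg.measure_wl_gt_le (H : LawReg c ψ γ α ν) (hc : c.Valid) (hK : 2 ≤ K) (hn : 0 < n)
    (hε : 0 < ε) (hε1 : ε < 1) (hρ : Constants.rate K p n ε ≤ 1 / 20) (hψ : Measurable ψ) :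
    (Measure.pi fun _ : Fin n => ν) {z | ∃ j, c.lam2 K p n ε <
      Real.sqrt (∑ k : {k : Fin K // k ≠ t}, (avg fun i => calWt γ (z i).2.1 (z i).2.2 k *
        ((z i).1 - ψ (linPred α (z i).2.2 k)) * (z i).2.2 j) ^ 2)} ≤
      ENNReal.ofReal ε := by
  have hB0 := hc.B0
  have hB1 := hc.B1
  have hσ := hc.σ0
  have hB : 0 < c.B1 - 1 := by linarith
  have hρ0 := rate_pos (p := p) hK hn hε hε1
  have hj : ∀ j : Fin (p + 1), (Measure.pi fun _ : Fin n => ν) {z | c.lam2 K p n ε <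
      Real.sqrt (∑ k : {k : Fin K // k ≠ t}, (avg fun i => calWt γ (z i).2.1 (z i).2.2 k *
        ((z i).1 - ψ (linPred α (z i).2.2 k)) * (z i).2.2 j) ^ 2)} ≤
      ENNReal.ofReal (2 * Real.exp (-(n * Constants.rate K p n ε ^ 2))) := by
    intro j
    refine (measure_mono fun z hz => ?_).trans
      (measure_avg_gt_le_of_subGaussian (ν := ν) hn
        (u := fun z k => obsWt γ z k * resid ψ α z k * z.2.2 j) (fun k => ?_)
        (fun k => H.wl_mean k j) (σ := c.B0 * (c.B1 - 1) * c.σ0) (by positivity)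
        (q := residSq c ψ γ α) ?_
        (H.integrable_exp_residSq hB1 hψ) (H.integral_exp_residSq_le hB1 hψ) hρ0 hρ)
    · rw [Set.mem_ofPred_eq] at hz ⊢
      refine lt_of_le_of_lt ?_ hz
      refine le_trans (le_of_eq ?_) (le_max_right _ _)
      ring
    · exact ((measurable_obsWt γ k).mul (measurable_resid hψ α k)).mul (measurable_regressor j)
    · filter_upwards [H.bounded, H.sum_obsWt_le hB1] with z h1 h2
      have h3 : ∀ k, obsWt γ z k ≤ c.B1 - 1 := fun k => (Finset.single_le_sum
        (f := fun k => obsWt γ z k) (fun k _ => obsWt_nonneg γ z k) (Finset.mem_univ k)).trans h2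
      have h4 : z.2.2 j ^ 2 ≤ c.B0 ^ 2 :=
        sq_le_sq' (by linarith [(abs_le.1 (h1 j)).1]) (abs_le.1 (h1 j)).2
      calc ∑ k, (obsWt γ z k * resid ψ α z k * z.2.2 j) ^ 2
          ≤ ∑ k, obsWt γ z k * resid ψ α z k ^ 2 * ((c.B1 - 1) * c.B0 ^ 2) := by
            refine Finset.sum_le_sum fun k _ => ?_
            calc (obsWt γ z k * resid ψ α z k * z.2.2 j) ^ 2
                = obsWt γ z k * resid ψ α z k ^ 2 * (obsWt γ z k * z.2.2 j ^ 2) := by ring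
              _ ≤ _ := mul_le_mul_of_nonneg_left
                  (mul_le_mul (h3 k) h4 (sq_nonneg _) hB.le)
                  (mul_nonneg (obsWt_nonneg γ z k) (sq_nonneg _))
        _ = (c.B0 * (c.B1 - 1) * c.σ0) ^ 2 * residSq c ψ γ α z := by
            rw [← Finset.sum_mul, sum_obsWt_mul_resid_sq hB1 hσ]
            ring
  refine (measure_exists_mem_le hj).trans (ENNReal.ofReal_le_ofReal ?_)
  refine le_trans (le_of_eq ?_) (mul_two_exp_neg_le (p := p) hK hn hε hε1)
  simp

/-- The weights `R^{(t)} ω_k - R^{(k)}`. -/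
def obsDiff (γ : Coef p K t) (z : Obs p K) (k : {k : Fin K // k ≠ t}) : ℝ :=
  obsWt γ z k - treatInd z.2.1 k

/-- The increments of the inverse link at the target. -/
def linkIncr (ψ : ℝ → ℝ) (α : Coef p K t) (z : Obs p K) (k : {k : Fin K // k ≠ t}) (x : ℝ) : ℝ :=
  ψ (linPred α z.2.2 k + x) - ψ (linPred α z.2.2 k)

/-- The sum over `k` of the weighted increments of the inverse link. -/
def incrVal (ψ : ℝ → ℝ) (γ α a : Coef p K t) (z : Obs p K) : ℝ :=
  procVal (fun z : Obs p K => z.2.2) (obsDiff γ) (linkIncr ψ α) a z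

theorem measurable_obsDiff (γ : Coef p K t) (k : {k : Fin K // k ≠ t}) :
    Measurable fun z : Obs p K => obsDiff γ z k :=
  (measurable_obsWt γ k).sub ((measurable_treatInd _).comp (measurable_fst.comp measurable_snd))

theorem measurable_linPred_obs (a : Coef p K t) (k : {k : Fin K // k ≠ t}) :
    Measurable fun z : Obs p K => linPred a z.2.2 k :=
  (measurable_linPred a k).comp (measurable_snd.comp measurable_snd)

/-- The sign σ is carried by the weights so that both one-sided deviations are covered. On the ball
of radius r the link increments are Lipschitz with constant C₁ e^{C₃B₀r}. -/
theorem LawBase.procReg (H : LawBase c ψ γ α ν) (hc : c.Valid) (hψ : LogLip ψ c.C3) {σ : ℝ}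
    (hσ : |σ| = 1) {r : ℝ} (hr : 0 ≤ r) :
    ProcReg ν (fun z : Obs p K => z.2.2) (fun z k => σ * obsDiff γ z k) (linkIncr ψ α) c.B0 c.B1
      (c.C1 * Real.exp (c.C3 * (c.B0 * r))) r where
  B0_pos := by linarith [hc.B0]
  B1_pos := by linarith [hc.B1]
  L_pos := mul_pos hc.C1 (Real.exp_pos _)
  r_nonneg := hr
  bounded := H.bounded
  weights := by
    simpa only [abs_mul, hσ, one_mul, obsDiff] using H.sum_abs_sub_le hc.B1
  zero z k := by simp [linkIncr]
  lip := by
    filter_upwards [H.upper] with z hz k x y hx hy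
    rw [linkIncr, linkIncr, sub_sub_sub_cancel_right]
    refine (hψ.abs_sub_le hx hy).trans ?_
    have := hz k
    gcongr
  meas a := by
    have hm := hψ.diff.continuous.measurable
    unfold procVal linkIncr
    refine Finset.measurable_sum _ fun k _ => ((measurable_obsDiff γ k).const_mul σ).mul ?_
    exact (hm.comp ((measurable_linPred_obs α k).add (measurable_linPred_obs a k))).sub
      (hm.comp (measurable_linPred_obs α k))

/-- The choice s = ρ/(L B₁ B₀ r) makes the quadratic term of the exponent 2nρ², while the linear
term is 4√2 B₀ nρ² ≥ 5nρ². -/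
theorem LawReg.measure_incr_gt_le (H : LawReg c ψ γ α ν) (hc : c.Valid) (hK : 2 ≤ K) (hn : 0 < n)
    (hε : 0 < ε) (hε1 : ε < 1) (hψ : LogLip ψ c.C3) {σ : ℝ} (hσ : |σ| = 1) {r : ℝ} (hr : 0 < r) :
    (Measure.pi fun _ : Fin n => ν) {z | ∃ a, norm21 a ≤ r ∧
      c.C1 * Real.exp (c.C3 * (c.B0 * r)) * r * c.lam1 K p n ε <
        σ * ((avg fun i => incrVal ψ γ α a (z i)) - ∫ z', incrVal ψ γ α a z' ∂ν)} ≤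
      ENNReal.ofReal ε := by
  have hB0 := hc.B0
  have hB1 := hc.B1
  have hC1 := hc.C1
  have hn' : (0 : ℝ) < n := Nat.cast_pos.2 hn
  have hρ0 := rate_pos (p := p) hK hn hε hε1
  have : Nonempty {k : Fin K // k ≠ t} := by
    have : Nontrivial (Fin K) := Fin.nontrivial_iff_two_le.2 hK
    obtain ⟨k, hk⟩ := exists_ne t
    exact ⟨⟨k, hk⟩⟩
  set L := c.C1 * Real.exp (c.C3 * (c.B0 * r)) with hL
  have hL0 : 0 < L := mul_pos hC1 (Real.exp_pos _)
  set ρ := Constants.rate K p n ε with hρdef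
  have hs : 0 < ρ / (L * c.B1 * c.B0 * r) := by positivity
  refine (measure_mono fun z hz => ?_).trans ((measure_exists_norm21_le_procVal_gt_le
    (H.procReg hc hψ hσ hr.le) hs n (n * (L * r * c.lam1 K p n ε))).trans ?_)
  · obtain ⟨a, ha, haz⟩ := hz
    refine ⟨a, ha, ?_⟩
    have e : ∀ z : Obs p K, procVal (fun z : Obs p K => z.2.2) (fun z k => σ * obsDiff γ z k)
        (linkIncr ψ α) a z = σ * incrVal ψ γ α a z := by
      intro z
      simp only [incrVal, procVal, Finset.mul_sum, mul_assoc]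
    simp only [e, integral_const_mul, ← mul_sub]
    rw [← Finset.mul_sum, Finset.sum_sub_distrib]
    have h := mul_lt_mul_of_pos_left haz hn'
    refine h.trans_le (le_of_eq ?_)
    unfold avg
    simp only [Finset.sum_const, Finset.card_univ, Fintype.card_fin, nsmul_eq_mul]
    field_simp
  · refine (ENNReal.ofReal_le_ofReal ?_)
    refine le_trans (le_trans (b := 2 * ((p : ℝ) + 1) * Real.exp (-(n * ρ ^ 2))) ?_
      (le_of_eq ?_)) (mul_two_exp_neg_le (p := p) hK hn hε hε1)
    · refine mul_le_mul_of_nonneg_left (Real.exp_le_exp.2 ?_) (by positivity)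
      have e1 : ρ / (L * c.B1 * c.B0 * r) * (n * (L * r * c.lam1 K p n ε)) =
          4 * Real.sqrt 2 * c.B0 * (n * ρ ^ 2) := by
        unfold Constants.lam1
        rw [← hρdef]
        field_simp
      have e2 : n * ((2 * (ρ / (L * c.B1 * c.B0 * r)) * (c.C1 * Real.exp (c.C3 * (c.B0 * r))) *
            c.B1 * c.B0 * r) ^ 2 / 2) =
          2 * (n * ρ ^ 2) := by
        rw [← hL]
        field_simp
      rw [e1, e2]
      have h0 : 0 ≤ n * ρ ^ 2 := by positivity
      have h1 := one_le_sqrt_two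
      have h2 : 5 ≤ 4 * Real.sqrt 2 * c.B0 := by nlinarith
      nlinarith
    · ring

/-- Apart from a null set, the bad set lies in six events: two scores, two families of quadratic
moments, and the two signs of the link increment process. -/
theorem LawReg.measure_not_sampleGood_le (H : LawReg c ψ γ α ν) (hc : c.Valid) (hK : 2 ≤ K)
    (hn : 0 < n) (hε : 0 < ε) (hε1 : ε < 1) (hρ : Constants.rate K p n ε ≤ 1 / 20)
    (hψ : LogLip ψ c.C3) {r : ℝ} (hr : 0 < r) :
    (Measure.pi fun _ : Fin n => ν) {z | ¬ (SampleGood c ψ (fun i => (z i).1)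
      (fun i => (z i).2.1) (fun i => (z i).2.2) γ α (c.lam1 K p n ε) (c.lam2 K p n ε)
      (meanQuad γ ν) (meanQuadResid ψ γ α ν) ∧ ∀ a, norm21 a ≤ r →
        |(avg fun i => incrVal ψ γ α a (z i)) - ∫ z', incrVal ψ γ α a z' ∂ν| ≤
          c.C1 * Real.exp (c.C3 * (c.B0 * r)) * r * c.lam1 K p n ε)} ≤
      ENNReal.ofReal (6 * ε) := by
  have hm := hψ.diff.continuous.measurable
  have h0 : (Measure.pi fun _ : Fin n => ν) {z | ¬ ∀ i, ((∀ j, |(z i).2.2 j| ≤ c.B0) ∧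
      (∀ k, deriv ψ (linPred α (z i).2.2 k) ≤ c.C1) ∧
      (∀ k, c.C2 ≤ deriv ψ (linPred α (z i).2.2 k)))} = 0 := by
    refine ae_iff.1 (ae_pi_forall (P := fun z : Obs p K => (∀ j, |z.2.2 j| ≤ c.B0) ∧
      (∀ k, deriv ψ (linPred α z.2.2 k) ≤ c.C1) ∧
      (∀ k, c.C2 ≤ deriv ψ (linPred α z.2.2 k))) ?_)
    filter_upwards [H.bounded, H.upper, H.lower] with z h1 h2 h3 using ⟨h1, h2, h3⟩
  have h1 := H.measure_cal_gt_le (n := n) (ε := ε) hc hK hn hε hε1 hρ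
  have h2 := H.measure_quad_gt_le (n := n) (ε := ε) hc hK hn hε hε1 hρ
  have h3 := H.measure_wl_gt_le (n := n) (ε := ε) hc hK hn hε hε1 hρ hm
  have h4 := H.measure_quadResid_gt_le (n := n) (ε := ε) hc hK hn hε hε1 hρ hm
  have h5 := H.measure_incr_gt_le (n := n) (ε := ε) hc hK hn hε hε1 hψ (σ := 1) (by simp) hr
  have h6 := H.measure_incr_gt_le (n := n) (ε := ε) hc hK hn hε hε1 hψ (σ := -1) (by simp) hr
  have hsum : ENNReal.ofReal (6 * ε) = 0 + ENNReal.ofReal ε + ENNReal.ofReal ε +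
      ENNReal.ofReal ε + ENNReal.ofReal ε + ENNReal.ofReal ε + ENNReal.ofReal ε := by
    rw [ENNReal.ofReal_mul (by norm_num), ENNReal.ofReal_ofNat]; ring
  rw [hsum]
  refine le_trans (measure_mono fun z hz => ?_) ((measure_union_le _ _).trans
    (add_le_add ((measure_union_le _ _).trans (add_le_add ((measure_union_le _ _).trans
      (add_le_add ((measure_union_le _ _).trans (add_le_add ((measure_union_le _ _).trans
        (add_le_add ((measure_union_le _ _).trans (add_le_add h0.le h1)) h2)) h3)) h4)) h5)) h6))
  by_contra hcon
  simp only [Set.mem_union, not_or] at hcon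
  obtain ⟨⟨⟨⟨⟨⟨n0, n1⟩, n2⟩, n3⟩, n4⟩, n5⟩, n6⟩ := hcon
  apply hz
  simp only [Set.mem_ofPred_eq, not_not] at n0
  simp only [Set.mem_ofPred_eq, not_exists, not_lt, not_and] at n1 n2 n3 n4 n5 n6
  refine ⟨⟨fun i => (n0 i).1, fun i => (n0 i).2.1, fun i => (n0 i).2.2, n1, n3,
    fun k j j' => n2 (j, j') k, fun k j j' => n4 (j, j') k⟩, fun a ha => ?_⟩
  have h5 := n5 a ha
  have h6 := n6 a ha
  rw [abs_le]
  constructor <;> linarith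

end Events

end RCAL

namespace RCAL

/-! ### Constants of the final bound -/

namespace Constants

variable (c : Constants)

/-- The coefficient of `|S_γ| λ₁²` in `wlBound`. -/
def wlCoefγ : ℝ := Real.exp (3 * c.η13) * c.M11 / c.ξ23 ^ 2

/-- The coefficient of `|S_α| λ₂²` in `wlBound`. -/
def wlCoefα : ℝ := Real.exp c.η13 * c.ξ22 ^ 2 / c.ν22 ^ 2

/-- A bound for the estimation error of the outcome regression in the group `L₁` norm. -/
def radius : ℝ :=
  (c.A2 - 1)⁻¹ * (c.wlCoefγ * c.η1 + c.wlCoefα * (c.η2 * c.ν2 ^ 2 / (1 + c.ξ2 ^ 2)))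

/-- A bound for the derivative of the inverse link near the target. -/
def linkBound : ℝ := c.C1 * Real.exp (c.C3 * (c.B0 * c.radius))

/-- The constant in the error bound for the augmented IPW estimator. -/
def aipwConst : ℝ :=
  (c.A1 - 1)⁻¹ * c.M1 + Real.exp c.η13 * (c.σ0 * (Real.exp c.η13 * c.M1) + c.σ0⁻¹ * c.M11 +
    c.linkBound * (Real.exp c.η13 * c.M1 + Real.exp (c.C3 * (c.B0 * c.radius)) / c.C2 *
      (Real.exp c.η13 * (c.wlCoefγ + c.wlCoefα * max 1 c.σ0)))) +
  c.linkBound * ((c.A2 - 1)⁻¹ * (c.wlCoefγ + c.wlCoefα))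

variable {c}

theorem wlBound_eq (sg sa l1 l2 : ℝ) :
    c.wlBound sg sa l1 l2 = c.wlCoefγ * (sg * l1 ^ 2) + c.wlCoefα * (sa * l2 ^ 2) := by
  unfold wlBound wlCoefγ wlCoefα; ring

theorem Valid.wlCoefγ_nonneg (hc : c.Valid) (h : 0 ≤ c.η1) : 0 ≤ c.wlCoefγ := by
  have := hc.M11_nonneg h
  unfold wlCoefγ; positivity

theorem wlCoefα_pos (hc : c.Valid) : 0 < c.wlCoefα := by
  have h1 := hc.ξ22_pos
  have h2 : 0 < c.ν22 ^ 2 := by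
    rw [hc.ν22_sq]
    have h3 := hc.ν2
    have h4 := hc.C2
    have h5 : 0 < 1 - c.η2 := by linarith [hc.η2.2]
    have h6 : 0 < 1 - c.η21 := by linarith [hc.η21.2]
    positivity
  unfold wlCoefα; positivity

end Constants

/-! ### Combination of the deterministic bounds -/

section FinalBound

variable {p K n : ℕ} {t : Fin K} {c : Constants} {ψ : ℝ → ℝ} {γb αb γh αh : Coef p K t}
  {ν : Measure (Obs p K)} {l1 l2 Λ η3 : ℝ} {z : Fin n → Obs p K}

set_option maxHeartbeats 1000000 in
-- All terms except the population drift are compared with the single quantity `U`. The process is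
-- controlled on the ball of radius `r0`, which is fixed by the constants and tuning levels and
-- contains α̂ − ᾱ.
theorem aipw_error_le (hc : c.Valid) (hl1 : 0 < l1) (hl12 : l1 ≤ l2)
    (hl21 : l2 ≤ max 1 c.σ0 * l1) (hψ : LogLip ψ c.C3)
    (hG : SampleGood c ψ (fun i => (z i).1) (fun i => (z i).2.1) (fun i => (z i).2.2) γb αb
      l1 l2 (meanQuad γb ν) (meanQuadResid ψ γb αb ν))
    (hinc : ∀ a, norm21 a ≤ c.wlBound (sparsity γb).card (sparsity αb).card l1 l2 /
        ((c.A2 - 1) * l2) →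
      |(avg fun i => incrVal ψ γb αb a (z i)) - ∫ z', incrVal ψ γb αb a z' ∂ν| ≤
        c.C1 * Real.exp (c.C3 * (c.B0 * (c.wlBound (sparsity γb).card (sparsity αb).card l1 l2 /
        ((c.A2 - 1) * l2)))) * (c.wlBound (sparsity γb).card (sparsity αb).card l1 l2 /
        ((c.A2 - 1) * l2)) * l1)
    (hE1 : CompatForm (meanQuad γb ν) (sparsity γb) c.ν1 c.ξ1)
    (hE2 : CompatForm (meanQuad γb ν) (sparsity αb) c.ν2 c.ξ2)
    (hEZ : ∀ b, quadForm (meanQuadResid ψ γb αb ν) b ≤ c.σ0 ^ 2 * quadForm (meanQuad γb ν) b)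
    (h1a : (c.ξ1 + 1) ^ 2 / c.ν1 ^ 2 * (sparsity γb).card * l1 ≤ c.η11)
    (h1b : c.B0 * (c.ξ1 + 1) ^ 2 * (c.A1 - 1) * (1 - c.η11)⁻¹ / c.ν1 ^ 2 *
      (sparsity γb).card * l1 ≤ c.η12)
    (hη1 : (sparsity γb).card * l1 ≤ c.η1)
    (h2a : (1 + c.ξ2 ^ 2) / c.ν2 ^ 2 * (sparsity αb).card * l2 ≤ c.η2)
    (h2b : Real.exp c.η13 * c.B0 * c.C3 / c.C2 / c.ν2 ^ 2 * (c.ξ2 + 1) ^ 2 * (c.A2 - 1) *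
      (1 - c.η2)⁻¹ * (sparsity αb).card * l2 ≤ c.η21)
    (h2c : Real.exp (3 * c.η13) * c.B0 * c.C3 / c.C2 / c.ξ21 ^ 2 * (c.A2 - 1)⁻¹ * c.M11 *
      (sparsity γb).card * l1 ≤ c.η22)
    (hη3 : c.wlBound (sparsity γb).card (sparsity αb).card l1 l2 / ((c.A2 - 1) * l2) ≤ η3)
    (hΛ0 : 0 ≤ Λ)
    (hΛ : ∀ a, norm21 a ≤ η3 → |∫ z', incrVal ψ γb αb a z' ∂ν| ≤ norm21 a * Λ)
    (hγ : IsRegCal (c.A1 * l1) (fun i => (z i).2.1) (fun i => (z i).2.2) γh)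
    (hα : IsRegWL ψ (c.A2 * l2) (fun i => (z i).1) (fun i => (z i).2.1) (fun i => (z i).2.2)
      γh αh) :
    |aipw ψ αh γh (fun i => (z i).1) (fun i => (z i).2.1) (fun i => (z i).2.2)
      - aipw ψ αb γb (fun i => (z i).1) (fun i => (z i).2.1) (fun i => (z i).2.2)| ≤
      c.aipwConst * ((sparsity γb).card * l1 ^ 2 + (sparsity γb).card * l1 * l2
        + (sparsity αb).card * l1 * l2) + η3 * Λ := by
  obtain ⟨hNb, hQb⟩ := cal_estimator_bound hc hl1 hG hE1 h1a h1b hη1 hγ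
  have hQZ := sampleQuad_resid_le hc hl1 hG hEZ hη1 hNb hQb
  set sg : ℝ := ((sparsity γb).card : ℝ) with hsg
  set sa : ℝ := ((sparsity αb).card : ℝ) with hsadef
  have hsg1 : 1 ≤ sg := one_le_card_sparsity γb
  have hsa1 : 1 ≤ sa := one_le_card_sparsity αb
  have hη1' : 0 ≤ c.η1 := le_trans (by positivity) hη1
  have hl2 : 0 < l2 := hl1.trans_le hl12
  have hA1 := hc.one_lt_A1
  have hA2 := hc.one_lt_A2
  have hB0 := hc.B0
  have hC1 := hc.C1
  have hC2 := hc.C2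
  have hC3 := hc.C3
  have hσ := hc.σ0
  have hM1 := hc.M1_nonneg
  have hM11 := hc.M11_nonneg hη1'
  have hη13 := hc.η13_nonneg hη1'
  have hwγ := hc.wlCoefγ_nonneg hη1'
  have hwα := (Constants.wlCoefα_pos hc).le
  have hA1i : 0 ≤ (c.A1 - 1)⁻¹ := inv_nonneg.2 (by linarith)
  have hA2i : 0 ≤ (c.A2 - 1)⁻¹ := inv_nonneg.2 (by linarith)
  have hA2p : 0 < c.A2 - 1 := by linarith
  set b := γh - γb with hbdef
  set a := αh - αb with hadef
  have hb : ∀ i k, |linPred b (z i).2.2 k| ≤ c.η13 := by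
    intro i k
    calc _ ≤ c.B0 * norm21 b := abs_linPred_le b (hG.bounded i) k
      _ ≤ c.B0 * ((c.A1 - 1)⁻¹ * c.M1 * (sg * l1)) := by gcongr
      _ ≤ c.B0 * ((c.A1 - 1)⁻¹ * c.M1 * c.η1) := by gcongr
      _ = _ := by unfold Constants.η13; ring
  obtain ⟨D, hD1, hD2⟩ := wl_estimator_bound hc hl1 hl12 hψ hG hE2 hη1' h2a h2b h2c hb hQZ hα
  set W := c.wlBound sg sa l1 l2 with hW
  have hWeq : W = c.wlCoefγ * (sg * l1 ^ 2) + c.wlCoefα * (sa * l2 ^ 2) :=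
    Constants.wlBound_eq sg sa l1 l2
  have hW0 : 0 ≤ W := by rw [hWeq]; positivity
  set N := norm21 a with hN
  have hN0 : 0 ≤ N := norm21_nonneg a
  set Q := sampleQuad (fun i k => calWt γb (z i).2.1 (z i).2.2 k) (fun i => (z i).2.2) a with hQ
  have hQ0 : 0 ≤ Q := sampleQuad_nonneg (fun i k => calWt_nonneg _ _ _ _) _ a
  set r0 := W / ((c.A2 - 1) * l2) with hr0
  have hq := expRatio_pos (H := c.C3 * c.B0 * N) (by positivity)
  have hD0 : 0 ≤ D := le_trans (by positivity) hD1
  have hNr : N ≤ r0 := by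
    rw [hr0, le_div_iff₀ (by positivity)]
    have : 0 ≤ Real.exp (-c.η13) * D := by positivity
    linarith
  have hDW : D ≤ Real.exp c.η13 * W := by
    have h1 : 0 ≤ (c.A2 - 1) * l2 * N := by positivity
    have h2 : Real.exp c.η13 * Real.exp (-c.η13) = 1 := by rw [← Real.exp_add]; simp
    calc D = Real.exp c.η13 * (Real.exp (-c.η13) * D) := by rw [← mul_assoc, h2, one_mul]
      _ ≤ _ := by gcongr; linarith
  set U := sg * l1 ^ 2 + sg * l1 * l2 + sa * l1 * l2 with hU
  have hU1 : sg * l1 ^ 2 + sa * l1 * l2 ≤ U := by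
    have : 0 ≤ sg * l1 * l2 := by positivity
    rw [hU]; linarith
  have hsgl : 0 ≤ sg * l1 ^ 2 := by positivity
  have hsal : 0 ≤ sa * l1 * l2 := by positivity
  have hsgU : sg * l1 ^ 2 ≤ U := by linarith
  have hsaU : sa * l1 * l2 ≤ U := by linarith
  have hsgU' : sg * l1 * l2 ≤ U := by rw [hU]; linarith
  have hκ : 1 ≤ max 1 c.σ0 := le_max_left _ _
  -- The levels l1 and l2 are comparable up to `max 1 c.σ0`, which trades |S_α| l2² for |S_α| l1 l2.
  have hWU : W ≤ (c.wlCoefγ + c.wlCoefα * max 1 c.σ0) * U := by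
    have h1 : sa * l2 ^ 2 ≤ max 1 c.σ0 * (sa * l1 * l2) := by
      calc sa * l2 ^ 2 = sa * l2 * l2 := by ring
        _ ≤ sa * l2 * (max 1 c.σ0 * l1) := by gcongr
        _ = _ := by ring
    calc W ≤ c.wlCoefγ * U + c.wlCoefα * (max 1 c.σ0 * U) := by
          have h2 : sa * l2 ^ 2 ≤ max 1 c.σ0 * U := h1.trans (by gcongr)
          rw [hWeq]
          exact add_le_add (mul_le_mul_of_nonneg_left hsgU hwγ) (mul_le_mul_of_nonneg_left h2 hwα)
      _ = _ := by ring
  -- The fluctuation is of order r0 l1. Dividing W by l2 turns |S_α| l2² l1 into |S_α| l1 l2, and l1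
  -- ≤ l2 handles the other term.
  have hr0l : r0 * l1 ≤ (c.A2 - 1)⁻¹ * (c.wlCoefγ + c.wlCoefα) * U := by
    have h1 : W * l1 / l2 ≤ c.wlCoefγ * U + c.wlCoefα * U := by
      rw [div_le_iff₀ hl2, hWeq]
      calc (c.wlCoefγ * (sg * l1 ^ 2) + c.wlCoefα * (sa * l2 ^ 2)) * l1
          = c.wlCoefγ * (sg * l1 ^ 2) * l1 + c.wlCoefα * (sa * l1 * l2) * l2 := by ring
        _ ≤ c.wlCoefγ * U * l2 + c.wlCoefα * U * l2 := by gcongr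
        _ = _ := by ring
    calc r0 * l1 = (c.A2 - 1)⁻¹ * (W * l1 / l2) := by
          rw [hr0]; field_simp
      _ ≤ (c.A2 - 1)⁻¹ * (c.wlCoefγ * U + c.wlCoefα * U) := by gcongr
      _ = _ := by ring
  -- A bound by the constants alone, from `hη1` and `h2a`; it makes the link derivative bound
  -- `linkBound` independent of the sample size and the dimensions.
  have hr0R : r0 ≤ c.radius := by
    have hξ := hc.ξ2
    have hν := hc.ν2
    have h1 : sa * l2 ≤ c.η2 * c.ν2 ^ 2 / (1 + c.ξ2 ^ 2) := by
      rw [le_div_iff₀ (by positivity)]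
      calc sa * l2 * (1 + c.ξ2 ^ 2) = (1 + c.ξ2 ^ 2) / c.ν2 ^ 2 * sa * l2 * c.ν2 ^ 2 := by
            field_simp
        _ ≤ c.η2 * c.ν2 ^ 2 := by gcongr
    have h2 : W / l2 ≤ c.wlCoefγ * c.η1 + c.wlCoefα * (c.η2 * c.ν2 ^ 2 / (1 + c.ξ2 ^ 2)) := by
      rw [div_le_iff₀ hl2, hWeq]
      calc c.wlCoefγ * (sg * l1 ^ 2) + c.wlCoefα * (sa * l2 ^ 2)
          = c.wlCoefγ * (sg * l1) * l1 + c.wlCoefα * (sa * l2) * l2 := by ring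
        _ ≤ c.wlCoefγ * c.η1 * l2 + c.wlCoefα * (c.η2 * c.ν2 ^ 2 / (1 + c.ξ2 ^ 2)) * l2 := by
            gcongr
        _ = _ := by ring
    calc r0 = (c.A2 - 1)⁻¹ * (W / l2) := by rw [hr0]; field_simp
      _ ≤ _ := by unfold Constants.radius; gcongr
  have hr00 : 0 ≤ r0 := hN0.trans hNr
  set R := c.radius with hR
  set L := c.linkBound with hL
  have hL0 : 0 ≤ L := by rw [hL, Constants.linkBound]; positivity
  have hLr : c.C1 * Real.exp (c.C3 * (c.B0 * r0)) ≤ L := by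
    rw [hL, Constants.linkBound]; gcongr
  have hQa : Q ≤ Real.exp (c.C3 * (c.B0 * R)) / c.C2 *
      (Real.exp c.η13 * (c.wlCoefγ + c.wlCoefα * max 1 c.σ0)) * U := by
    have h1 : Real.exp (-(c.C3 * (c.B0 * R))) ≤ expRatio (c.C3 * c.B0 * N) := by
      refine le_trans (Real.exp_le_exp.2 ?_) (exp_neg_le_expRatio (by positivity))
      rw [mul_assoc c.C3]
      have : c.C3 * (c.B0 * N) ≤ c.C3 * (c.B0 * R) := by gcongr; linarith
      linarith
    have h2 : c.C2 * Real.exp (-(c.C3 * (c.B0 * R))) * Q ≤ D := by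
      refine le_trans ?_ hD1
      gcongr
    have h3 : Real.exp (c.C3 * (c.B0 * R)) * Real.exp (-(c.C3 * (c.B0 * R))) = 1 := by
      rw [← Real.exp_add]; simp
    calc Q = Real.exp (c.C3 * (c.B0 * R)) * Real.exp (-(c.C3 * (c.B0 * R))) * Q := by
          rw [h3, one_mul]
      _ = Real.exp (c.C3 * (c.B0 * R)) / c.C2 *
          (c.C2 * Real.exp (-(c.C3 * (c.B0 * R))) * Q) := by field_simp
      _ ≤ Real.exp (c.C3 * (c.B0 * R)) / c.C2 * (Real.exp c.η13 *
          ((c.wlCoefγ + c.wlCoefα * max 1 c.σ0) * U)) := by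
          exact mul_le_mul_of_nonneg_left ((h2.trans hDW).trans
            (mul_le_mul_of_nonneg_left hWU (Real.exp_pos _).le)) (by positivity)
      _ = _ := by ring
  have hmain := abs_aipw_sub_add_le (γh := γh) (αh := αh) hσ hG.wl hb hL0 (fun i k => by
    have hla : linPred αh (z i).2.2 k = linPred αb (z i).2.2 k + linPred a (z i).2.2 k := by
      rw [hadef, linPred_sub]; ring
    have h1 := hψ.abs_sub_le (u := linPred αb (z i).2.2 k) (x := linPred a (z i).2.2 k) (y := 0)
      (R := c.B0 * R) ((abs_linPred_le a (hG.bounded i) k).trans (by gcongr; linarith))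
      (by rw [abs_zero]; have := hr00.trans hr0R; positivity)
    rw [add_zero, sub_zero, ← hla] at h1
    refine h1.trans ?_
    have := hG.upper i k
    rw [hL, Constants.linkBound]
    gcongr)
  have hincr : (avg fun i => ∑ k : {k : Fin K // k ≠ t},
      (calWt γb (z i).2.1 (z i).2.2 k - treatInd (z i).2.1 k) *
        (ψ (linPred αh (z i).2.2 k) - ψ (linPred αb (z i).2.2 k))) =
      avg fun i => incrVal ψ γb αb a (z i) := by
    congr 1
    funext i
    unfold incrVal procVal
    refine Finset.sum_congr rfl fun k _ => ?_
    have hla : linPred αh (z i).2.2 k = linPred αb (z i).2.2 k + linPred a (z i).2.2 k := by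
      rw [hadef, linPred_sub]; ring
    rw [hla]
    rfl
  rw [hincr] at hmain
  have hdev := hinc a hNr
  have hpop := hΛ a (hNr.trans hη3)
  have hη30 : N * Λ ≤ η3 * Λ := mul_le_mul_of_nonneg_right (hNr.trans hη3) hΛ0
  have hdev' : c.C1 * Real.exp (c.C3 * (c.B0 * r0)) * r0 * l1 ≤
      L * ((c.A2 - 1)⁻¹ * (c.wlCoefγ + c.wlCoefα) * U) := by
    rw [mul_assoc]
    exact mul_le_mul hLr hr0l (by positivity) hL0
  have hT1 : l2 * norm21 b ≤ (c.A1 - 1)⁻¹ * c.M1 * U := by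
    calc l2 * norm21 b ≤ l2 * ((c.A1 - 1)⁻¹ * c.M1 * (sg * l1)) := by gcongr
      _ = (c.A1 - 1)⁻¹ * c.M1 * (sg * l1 * l2) := by ring
      _ ≤ _ := by gcongr
  have hQb' : sampleQuad (fun i k => calWt γb (z i).2.1 (z i).2.2 k) (fun i => (z i).2.2) b ≤
      Real.exp c.η13 * c.M1 * U := by
    refine hQb.trans ?_
    rw [← mul_assoc]
    gcongr
  have hQZ' : sampleQuad (fun i k => calWt γb (z i).2.1 (z i).2.2 k *
      ((z i).1 - ψ (linPred αb (z i).2.2 k)) ^ 2) (fun i => (z i).2.2) b ≤ c.M11 * U := by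
    refine hQZ.trans ?_
    rw [mul_assoc]
    gcongr
  have hT2 : Real.exp c.η13 * (
      c.σ0 * sampleQuad (fun i k => calWt γb (z i).2.1 (z i).2.2 k) (fun i => (z i).2.2) b
      + c.σ0⁻¹ * sampleQuad (fun i k => calWt γb (z i).2.1 (z i).2.2 k *
          ((z i).1 - ψ (linPred αb (z i).2.2 k)) ^ 2) (fun i => (z i).2.2) b
      + L * (sampleQuad (fun i k => calWt γb (z i).2.1 (z i).2.2 k) (fun i => (z i).2.2) b + Q)) ≤
      Real.exp c.η13 * (c.σ0 * (Real.exp c.η13 * c.M1 * U) + c.σ0⁻¹ * (c.M11 * U) +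
        L * (Real.exp c.η13 * c.M1 * U + Real.exp (c.C3 * (c.B0 * R)) / c.C2 *
          (Real.exp c.η13 * (c.wlCoefγ + c.wlCoefα * max 1 c.σ0)) * U)) := by
    have := inv_pos.2 hσ
    gcongr
  have hfin : c.aipwConst * U = (c.A1 - 1)⁻¹ * c.M1 * U +
      Real.exp c.η13 * (c.σ0 * (Real.exp c.η13 * c.M1 * U) + c.σ0⁻¹ * (c.M11 * U) +
        L * (Real.exp c.η13 * c.M1 * U + Real.exp (c.C3 * (c.B0 * R)) / c.C2 *
          (Real.exp c.η13 * (c.wlCoefγ + c.wlCoefα * max 1 c.σ0)) * U)) +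
      L * ((c.A2 - 1)⁻¹ * (c.wlCoefγ + c.wlCoefα) * U) := by
    rw [Constants.aipwConst, ← hR, ← hL]; ring
  rw [hfin]
  have h1 := abs_le.1 hmain
  have h2 := abs_le.1 hdev
  have h3 := abs_le.1 hpop
  rw [abs_le]
  constructor <;> linarith [h1.1, h1.2, h2.1, h2.2, h3.1, h3.2]

end FinalBound

end RCAL

namespace RCAL

/-! ### Conditional independence -/

section CondIndep

variable {Ω : Type u} {m m0 : MeasurableSpace Ω} {μ : Measure Ω} [IsProbabilityMeasure μ]

/-- On sets of m, the measure with density W is dominated by Cμ, because set integrals of W equal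
those of its conditional expectation. Comparing the trimmed measures then allows every m-measurable
g, integrable or not. -/
theorem lintegral_mul_ofReal_le_of_condExp_le (hm : m ≤ m0) {W : Ω → ℝ}
    (hW : Integrable W μ) (hWm : Measurable W) (hW0 : ∀ ω, 0 ≤ W ω) {C : ℝ} (hC0 : 0 ≤ C)
    (hC : ∀ᵐ ω ∂μ, (μ[W | m]) ω ≤ C) {g : Ω → ENNReal} (hg : Measurable[m] g) :
    ∫⁻ ω, g ω * ENNReal.ofReal (W ω) ∂μ ≤ ENNReal.ofReal C * ∫⁻ ω, g ω ∂μ := by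
  set μW := μ.withDensity fun ω => ENNReal.ofReal (W ω) with hμW
  have h1 : ∫⁻ ω, g ω * ENNReal.ofReal (W ω) ∂μ = ∫⁻ ω, g ω ∂μW := by
    rw [hμW, lintegral_withDensity_eq_lintegral_mul _ hWm.ennreal_ofReal (hg.mono hm le_rfl)]
    simp only [Pi.mul_apply, mul_comm]
  have h2 : μW.trim hm ≤ (ENNReal.ofReal C • μ).trim hm := by
    refine (@Measure.le_iff _ m _ _).2 fun s hs => ?_
    rw [trim_measurableSet_eq hm hs, trim_measurableSet_eq hm hs, hμW,
      withDensity_apply _ (hm s hs), ← ofReal_integral_eq_lintegral_ofReal hW.integrableOn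
        (Filter.Eventually.of_forall hW0), ← setIntegral_condExp hm hW hs]
    calc ENNReal.ofReal (∫ ω in s, (μ[W | m]) ω ∂μ) ≤ ENNReal.ofReal (∫ _ in s, C ∂μ) := by
          apply ENNReal.ofReal_le_ofReal
          exact setIntegral_mono_ae integrable_condExp.integrableOn
            (integrable_const C).integrableOn hC
      _ = ENNReal.ofReal (μ.real s * C) := by simp
      _ = (ENNReal.ofReal C • μ) s := by
          rw [mul_comm, ENNReal.ofReal_mul hC0, ofReal_measureReal, Measure.smul_apply,
            smul_eq_mul]
  calc ∫⁻ ω, g ω * ENNReal.ofReal (W ω) ∂μ = ∫⁻ ω, g ω ∂(μW.trim hm) := by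
        rw [h1, lintegral_trim hm hg]
    _ ≤ ∫⁻ ω, g ω ∂((ENNReal.ofReal C • μ).trim hm) := lintegral_mono' h2 le_rfl
    _ = ENNReal.ofReal C * ∫⁻ ω, g ω ∂μ := by
        rw [lintegral_trim hm hg, lintegral_smul_measure, smul_eq_mul]

variable {𝒳 : Type v} [m𝒳 : MeasurableSpace 𝒳]

theorem condProb_nonneg (A : Set Ω) : ∀ᵐ ω ∂μ, 0 ≤ (μ⟦A | m⟧) ω :=
  condExp_nonneg (Filter.Eventually.of_forall fun ω => Set.indicator_nonneg (by simp) ω)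

/-- For events determined by (X, Z), restricting to A amounts to weighting by the conditional
probability of A. Rectangles suffice, and on them the claim is conditional independence combined
with pulling out an m-measurable factor. -/
theorem map_restrict_eq_map_withDensity (hm : m ≤ m0) {A : Set Ω} (hA : MeasurableSet A)
    {X : Ω → 𝒳} (hX : Measurable[m] X) {Z : Ω → ℝ} (hZ : Measurable Z)
    (h : ∀ B : Set ℝ, MeasurableSet B → μ⟦A ∩ Z ⁻¹' B | m⟧
      =ᵐ[μ] fun ω => (μ⟦A | m⟧) ω *
        (μ⟦Z ⁻¹' B | m⟧) ω) :
    (μ.restrict A).map (fun ω => (X ω, Z ω)) =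
      (μ.withDensity fun ω => ENNReal.ofReal
        ((μ⟦A | m⟧) ω)).map fun ω => (X ω, Z ω) := by
  set π := μ⟦A | m⟧ with hπ
  have hπi : Integrable π μ := integrable_condExp
  have hXZ : Measurable fun ω => (X ω, Z ω) := (hX.mono hm le_rfl).prodMk hZ
  refine Measure.ext_prod fun {S B} hS hB => ?_
  have hpre : (fun ω => (X ω, Z ω)) ⁻¹' S ×ˢ B = X ⁻¹' S ∩ Z ⁻¹' B := rfl
  have hSm : MeasurableSet[m] (X ⁻¹' S) := hX hS
  have hS' := hm _ hSm
  have hB' := hZ hB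
  rw [Measure.map_apply hXZ (hS.prod hB), Measure.map_apply hXZ (hS.prod hB), hpre,
    Measure.restrict_apply (hS'.inter hB'), withDensity_apply _ (hS'.inter hB'),
    ← ofReal_integral_eq_lintegral_ofReal hπi.integrableOn (ae_restrict_of_ae (condProb_nonneg A))]
  have hind : Integrable ((Z ⁻¹' B).indicator fun _ => (1 : ℝ)) μ :=
    (integrable_const 1).indicator hB'
  have hprod : π * (Z ⁻¹' B).indicator (fun _ => (1 : ℝ)) = (Z ⁻¹' B).indicator π := by
    funext ω
    by_cases hω : ω ∈ Z ⁻¹' B <;> simp [hω]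
  have hpi : Integrable (π * (Z ⁻¹' B).indicator fun _ => (1 : ℝ)) μ := by
    rw [hprod]; exact hπi.indicator hB'
  have e1 : ∫ ω in X ⁻¹' S ∩ Z ⁻¹' B, π ω ∂μ =
      ∫ ω in X ⁻¹' S, (π * (Z ⁻¹' B).indicator fun _ => (1 : ℝ)) ω ∂μ := by
    rw [hprod, setIntegral_indicator hB']
  have e2 : ∫ ω in X ⁻¹' S, (π * (Z ⁻¹' B).indicator fun _ => (1 : ℝ)) ω ∂μ =
      ∫ ω in X ⁻¹' S, (μ⟦A ∩ Z ⁻¹' B | m⟧) ω ∂μ := by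
    rw [← setIntegral_condExp hm hpi hSm]
    refine setIntegral_congr_ae hS' ?_
    filter_upwards [condExp_mul_of_stronglyMeasurable_left (m := m) stronglyMeasurable_condExp
      hpi hind, h B hB] with ω h1 h2 _
    rw [h1, h2]
    rfl
  rw [e1, e2, setIntegral_condExp hm ((integrable_const 1).indicator (hA.inter hB')) hSm,
    setIntegral_indicator (hA.inter hB')]
  rw [setIntegral_const, smul_eq_mul, mul_one, ofReal_measureReal]
  congr 1
  ext ω
  simp only [Set.mem_inter_iff]
  tauto

theorem setLIntegral_eq_lintegral_condProb_mul (hm : m ≤ m0) {A : Set Ω} (hA : MeasurableSet A)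
    {X : Ω → 𝒳} (hX : Measurable[m] X) {Z : Ω → ℝ} (hZ : Measurable Z)
    (h : ∀ B : Set ℝ, MeasurableSet B → μ⟦A ∩ Z ⁻¹' B | m⟧
      =ᵐ[μ] fun ω => (μ⟦A | m⟧) ω *
        (μ⟦Z ⁻¹' B | m⟧) ω)
    {F : 𝒳 × ℝ → ENNReal} (hF : Measurable F) :
    ∫⁻ ω in A, F (X ω, Z ω) ∂μ =
      ∫⁻ ω, ENNReal.ofReal ((μ⟦A | m⟧) ω) *
        F (X ω, Z ω) ∂μ := by
  have hXZ : Measurable fun ω => (X ω, Z ω) := (hX.mono hm le_rfl).prodMk hZ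
  have hπm : Measurable (μ⟦A | m⟧) :=
    (stronglyMeasurable_condExp.mono hm).measurable
  rw [← lintegral_map hF hXZ, map_restrict_eq_map_withDensity hm hA hX hZ h, lintegral_map hF hXZ]
  rw [lintegral_withDensity_eq_lintegral_mul _ hπm.ennreal_ofReal (g := fun ω => F (X ω, Z ω))
    (hF.comp hXZ)]
  rfl

variable {p K : ℕ} {t : Fin K}

theorem lintegral_treatInd_mul {T : Ω → Fin K} (hT : Measurable T) (k : Fin K)
    (F : Ω → ENNReal) :
    ∫⁻ ω, ENNReal.ofReal (treatInd (T ω) k) * F ω ∂μ = ∫⁻ ω in T ⁻¹' {k}, F ω ∂μ := by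
  rw [← lintegral_indicator (hT (measurableSet_singleton k))]
  refine lintegral_congr fun ω => ?_
  by_cases hω : T ω = k <;> simp [treatInd, hω, Set.indicator]

/-- Under unconfoundedness the conditional sub-gaussian property is inherited by the treated. -/
theorem Unconfounded.lintegral_le {T : Ω → Fin K} (hT : Measurable T) {X : Ω → 𝒳}
    (hX : Measurable X) {Ypot : Fin K → Ω → ℝ} (hY : ∀ k, Measurable (Ypot k))
    (hU : Unconfounded μ T X Ypot) {r : 𝒳 → ℝ} (hr : Measurable r) {σ : ℝ}
    (hσ : CondSubGaussian μ X (fun ω => Ypot t ω - r (X ω)) σ) {h : 𝒳 → ENNReal}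
    (hh : Measurable h) :
    ∫⁻ ω, ENNReal.ofReal (treatInd (T ω) t) * (h (X ω) *
        ENNReal.ofReal (Real.exp ((Ypot t ω - r (X ω)) ^ 2 / σ ^ 2))) ∂μ ≤
      2 * ∫⁻ ω, ENNReal.ofReal (treatInd (T ω) t) * h (X ω) ∂μ := by
  have hA : MeasurableSet (T ⁻¹' {t}) := hT (measurableSet_singleton t)
  have hm : MeasurableSpace.comap X m𝒳 ≤ m0 := hX.comap_le
  have hXm : Measurable[MeasurableSpace.comap X m𝒳] X := comap_measurable X
  have hπm : Measurable[MeasurableSpace.comap X m𝒳]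
      (μ⟦T ⁻¹' {t} | MeasurableSpace.comap X m𝒳⟧) := stronglyMeasurable_condExp.measurable
  have hWm : Measurable fun ω => Real.exp ((Ypot t ω - r (X ω)) ^ 2 / σ ^ 2) :=
    Real.measurable_exp.comp ((((hY t).sub (hr.comp hX)).pow_const 2).div_const _)
  rw [lintegral_treatInd_mul hT, lintegral_treatInd_mul hT,
    setLIntegral_eq_lintegral_condProb_mul hm hA hXm (hY t) (hU t) (F := fun q => h q.1 *
      ENNReal.ofReal (Real.exp ((q.2 - r q.1) ^ 2 / σ ^ 2)))
      ((hh.comp measurable_fst).mul (Real.measurable_exp.comp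
        (((measurable_snd.sub (hr.comp measurable_fst)).pow_const 2).div_const _)).ennreal_ofReal),
    setLIntegral_eq_lintegral_condProb_mul hm hA hXm (hY t) (hU t) (F := fun q => h q.1)
      (hh.comp measurable_fst)]
  have hmain := lintegral_mul_ofReal_le_of_condExp_le hm hσ.1 hWm
    (fun ω => (Real.exp_pos _).le) (C := 2) (by norm_num) hσ.2
    (g := fun ω => ENNReal.ofReal ((μ⟦T ⁻¹' {t} | MeasurableSpace.comap X m𝒳⟧) ω) * h (X ω))
    (hπm.ennreal_ofReal.mul (hh.comp hXm))
  rw [ENNReal.ofReal_ofNat] at hmain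
  refine le_trans (le_of_eq ?_) hmain
  exact lintegral_congr fun ω => by rw [mul_assoc]

theorem integral_treatInd_mul {T : Ω → Fin K} (hT : Measurable T) (k : Fin K)
    (hm : m ≤ m0) {H : Ω → ℝ} (hH : StronglyMeasurable[m] H) {C : ℝ}
    (hC : ∀ᵐ ω ∂μ, |H ω| ≤ C) :
    ∫ ω, treatInd (T ω) k * H ω ∂μ = ∫ ω, (μ⟦T ⁻¹' {k} | m⟧) ω * H ω ∂μ := by
  have hA : MeasurableSet (T ⁻¹' {k}) := hT (measurableSet_singleton k)
  have e : (fun ω => treatInd (T ω) k * H ω) = (T ⁻¹' {k}).indicator (fun _ => (1 : ℝ)) * H := by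
    funext ω
    by_cases hω : T ω = k <;> simp [treatInd, hω, Set.indicator]
  have hHm : AEStronglyMeasurable H μ := (hH.mono hm).aestronglyMeasurable
  have hi : Integrable ((T ⁻¹' {k}).indicator fun _ => (1 : ℝ)) μ :=
    (integrable_const 1).indicator hA
  have hpi : Integrable ((T ⁻¹' {k}).indicator (fun _ => (1 : ℝ)) * H) μ :=
    hi.mul_bdd hHm hC
  rw [e, ← integral_condExp hm]
  exact integral_congr_ae (condExp_mul_of_stronglyMeasurable_right hH hpi hi)

end CondIndep

end RCAL

namespace RCAL

/-! ### Scores at the target values -/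

section Scores

theorem nonpos_of_forall_le_mul {G C δ : ℝ} (hδ : 0 < δ) (hC : 0 ≤ C)
    (h : ∀ s, 0 < s → s ≤ δ → G ≤ C * s) : G ≤ 0 := by
  by_contra hG
  push Not at hG
  have hs : 0 < min δ (G / (2 * (C + 1))) := lt_min hδ (by positivity)
  have h1 := h _ hs (min_le_left _ _)
  have h2 : C * min δ (G / (2 * (C + 1))) ≤ C * (G / (2 * (C + 1))) :=
    mul_le_mul_of_nonneg_left (min_le_right _ _) hC
  have h3 : C * (G / (2 * (C + 1))) < G := by
    rw [mul_div_assoc', div_lt_iff₀ (by positivity)]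
    nlinarith
  linarith

/-- A first order condition: the mean of the derivative vanishes at a minimizer of the mean. -/
theorem integral_eq_zero_of_forall_integral_le {𝒵 : Type*} [MeasurableSpace 𝒵] {ν : Measure 𝒵}
    [IsProbabilityMeasure ν] {h : ℝ → 𝒵 → ℝ} {g : 𝒵 → ℝ} {C δ : ℝ} (hδ : 0 < δ) (hC : 0 ≤ C)
    (hi : ∀ u, Integrable (h u) ν) (hg : Integrable g ν)
    (hle : ∀ u, |u| ≤ δ → ∀ᵐ z ∂ν, h u z ≤ h 0 z + u * g z + C * u ^ 2)
    (hmin : ∀ u, ∫ z, h 0 z ∂ν ≤ ∫ z, h u z ∂ν) : ∫ z, g z ∂ν = 0 := by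
  have key : ∀ u, |u| ≤ δ → 0 ≤ u * ∫ z, g z ∂ν + C * u ^ 2 := by
    intro u hu
    have h1 : Integrable (fun z => h 0 z + u * g z) ν := (hi 0).add (hg.const_mul u)
    have h2 := integral_mono_ae (hi u) (h1.add (integrable_const (C * u ^ 2))) (hle u hu)
    have h3 : ∫ z, (h 0 z + u * g z + C * u ^ 2) ∂ν =
        ∫ z, h 0 z ∂ν + u * ∫ z, g z ∂ν + C * u ^ 2 := by
      rw [integral_add h1 (integrable_const _), integral_add (hi 0) (hg.const_mul u),
        integral_const_mul]
      simp
    have h4 : ∫ z, h u z ∂ν ≤ ∫ z, (h 0 z + u * g z + C * u ^ 2) ∂ν := h2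
    linarith [hmin u]
  refine le_antisymm (nonpos_of_forall_le_mul hδ hC fun s hs hsδ => ?_)
    (neg_nonpos.1 (nonpos_of_forall_le_mul hδ hC fun s hs hsδ => ?_))
  · have h1 := key (-s) (by rwa [abs_neg, abs_of_pos hs])
    refine le_of_mul_le_mul_left (a := s) ?_ hs
    nlinarith
  · have h1 := key s (by rwa [abs_of_pos hs])
    refine le_of_mul_le_mul_left (a := s) ?_ hs
    nlinarith

/-- A quadratic upper bound for the cumulant function; |x| ≤ 1 keeps the growth factor of the
derivative below e^C. -/
theorem LogLip.integral_sub_le {ψ : ℝ → ℝ} {C : ℝ} (h : LogLip ψ C) {u x : ℝ} (hx : |x| ≤ 1) :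
    ∫ s in u..(u + x), ψ s ≤ ψ u * x + deriv ψ u * Real.exp C * x ^ 2 := by
  have hc := h.diff.continuous
  have h1 : ∫ s in u..(u + x), (ψ s - ψ u) = (∫ s in u..(u + x), ψ s) - ψ u * x := by
    rw [intervalIntegral.integral_sub (hc.intervalIntegrable _ _)
      (continuous_const.intervalIntegrable _ _), intervalIntegral.integral_const]
    simp [mul_comm]
  have h2 : ‖∫ s in u..(u + x), (ψ s - ψ u)‖ ≤
      deriv ψ u * Real.exp C * |x| * |u + x - u| := by
    refine intervalIntegral.norm_integral_le_of_norm_le_const fun s hs => ?_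
    have hsu : |s - u| ≤ |x| := by
      rcases le_total 0 x with h0 | h0
      · rw [Set.uIoc_of_le (by linarith)] at hs
        rw [abs_of_nonneg h0, abs_of_pos (by linarith [hs.1])]
        linarith [hs.2]
      · rw [Set.uIoc_of_ge (by linarith)] at hs
        rw [abs_of_nonpos h0, abs_of_nonpos (by linarith [hs.2])]
        linarith [hs.1]
    have h3 := h.abs_sub_le (u := u) (x := s - u) (y := 0) (R := 1) (hsu.trans hx) (by simp)
    rw [add_zero, sub_zero, mul_one, add_sub_cancel] at h3
    refine h3.trans ?_
    have := h.nonneg u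
    gcongr
  rw [h1, add_sub_cancel_left, mul_assoc, abs_mul_abs_self] at h2
  have h3 := (le_abs_self _).trans h2
  nlinarith

variable {p K : ℕ} {t : Fin K}

theorem linPred_single (j : Fin (p + 1)) (k k' : {k : Fin K // k ≠ t}) (x : ℝ)
    (w : Fin (p + 1) → ℝ) :
    linPred (Matrix.single j k x : Coef p K t) w k' = if k = k' then x * w j else 0 := by
  unfold linPred
  rw [Finset.sum_eq_single j]
  · by_cases h : k = k' <;> simp [h]
  · intro j' _ hj'
    simp [hj'.symm]
  · simp

variable {c : Constants} {ψ : ℝ → ℝ} {γ α : Coef p K t} {ν : Measure (Obs p K)}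

theorem measurable_calLoss (γ' : Coef p K t) :
    Measurable fun z : Obs p K => calLoss γ' z.2.1 z.2.2 := by
  unfold calLoss
  have hT : ∀ k : Fin K, Measurable fun z : Obs p K => treatInd z.2.1 k := fun k =>
    (measurable_treatInd k).comp (measurable_fst.comp measurable_snd)
  exact Finset.measurable_sum _ fun k _ => ((hT t).mul (Real.measurable_exp.comp
    (measurable_linPred_obs γ' k))).sub ((hT k).mul (measurable_linPred_obs γ' k))

theorem measurable_wlLoss (hψ : Continuous ψ) (γ α' : Coef p K t) :
    Measurable fun z : Obs p K => wlLoss ψ γ α' z.1 z.2.1 z.2.2 := by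
  unfold wlLoss
  have hΨ : Continuous fun x => ∫ s in (0 : ℝ)..x, ψ s :=
    intervalIntegral.continuous_primitive (fun a b => hψ.intervalIntegrable a b) 0
  exact Finset.measurable_sum _ fun k _ => (measurable_obsWt γ k).mul
    ((measurable_fst.mul (measurable_linPred_obs α' k)).neg.add
      (hΨ.measurable.comp (measurable_linPred_obs α' k)))

theorem exists_abs_le_of_continuous {g : ℝ → ℝ} (hg : Continuous g) (R : ℝ) :
    ∃ C, ∀ x, |x| ≤ R → |g x| ≤ C := by
  obtain ⟨C, hC⟩ := (isCompact_Icc (a := -R) (b := R)).exists_bound_of_continuousOn hg.continuousOn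
  exact ⟨C, fun x hx => hC x (abs_le.1 hx)⟩

/-- A continuous function of a linear predictor is almost surely bounded. -/
theorem LawBase.exists_abs_comp_linPred_le (H : LawBase c ψ γ α ν) {g : ℝ → ℝ} (hg : Continuous g)
    (a : Coef p K t) : ∃ C, ∀ᵐ z ∂ν, ∀ k, |g (linPred a z.2.2 k)| ≤ C := by
  obtain ⟨C, hC⟩ := exists_abs_le_of_continuous hg (c.B0 * norm21 a)
  exact ⟨C, H.bounded.mono fun z hz k => hC _ (abs_linPred_le a hz k)⟩

variable [IsProbabilityMeasure ν]

theorem LawBase.integrable_calLoss (H : LawBase c ψ γ α ν) (γ' : Coef p K t) :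
    Integrable (fun z => calLoss γ' z.2.1 z.2.2) ν := by
  obtain ⟨C, hC⟩ := H.exists_abs_comp_linPred_le Real.continuous_exp γ'
  obtain ⟨C', hC'⟩ := H.exists_abs_comp_linPred_le continuous_id γ'
  refine Integrable.of_bound (measurable_calLoss γ').aestronglyMeasurable
    (∑ _k : {k : Fin K // k ≠ t}, (C + C')) ?_
  filter_upwards [hC, hC'] with z h1 h2
  refine (norm_sum_le _ _).trans (Finset.sum_le_sum fun k _ => ?_)
  refine (norm_sub_le _ _).trans (add_le_add ?_ ?_)
  · rw [norm_mul, Real.norm_of_nonneg (treatInd_nonneg _ _)]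
    exact (mul_le_of_le_one_left (norm_nonneg _) (treatInd_le_one _ _)).trans (h1 k)
  · rw [norm_mul, Real.norm_of_nonneg (treatInd_nonneg _ _)]
    exact (mul_le_of_le_one_left (norm_nonneg _) (treatInd_le_one _ _)).trans (h2 k)

theorem LawBase.obsWt_le (H : LawBase c ψ γ α ν) (hB1 : 1 < c.B1) :
    ∀ᵐ z ∂ν, ∀ k, obsWt γ z k ≤ c.B1 := by
  filter_upwards [H.sum_obsWt_le hB1] with z hz k
  have : obsWt γ z k ≤ ∑ k, obsWt γ z k := Finset.single_le_sum
    (f := fun k => obsWt γ z k) (fun k _ => obsWt_nonneg γ z k) (Finset.mem_univ k)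
  linarith

theorem LawBase.integrable_obsWt_mul_resid (H : LawBase c ψ γ α ν) (hB1 : 1 < c.B1)
    (hσ : 0 < c.σ0) (hψ : Measurable ψ) (k : {k : Fin K // k ≠ t}) :
    Integrable (fun z => obsWt γ z k * resid ψ α z k) ν := by
  refine Integrable.mono' ((integrable_const c.B1).add
    ((H.integrable_exp_residSq hB1 hψ).const_mul ((c.B1 - 1) * c.σ0 ^ 2)))
    ((measurable_obsWt γ k).mul (measurable_resid hψ α k)).aestronglyMeasurable ?_
  filter_upwards [H.obsWt_le hB1] with z hz
  have h0 := obsWt_nonneg γ z k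
  have h1 : obsWt γ z k * resid ψ α z k ^ 2 ≤ ∑ k, obsWt γ z k * resid ψ α z k ^ 2 :=
    Finset.single_le_sum (f := fun k => obsWt γ z k * resid ψ α z k ^ 2)
      (fun k _ => mul_nonneg (obsWt_nonneg γ z k) (sq_nonneg _)) (Finset.mem_univ k)
  rw [sum_obsWt_mul_resid_sq hB1 hσ] at h1
  have h2 : (c.B1 - 1) * c.σ0 ^ 2 * residSq c ψ γ α z ≤
      (c.B1 - 1) * c.σ0 ^ 2 * Real.exp (residSq c ψ γ α z) := by
    refine mul_le_mul_of_nonneg_left ?_ (mul_nonneg (by linarith) (sq_nonneg _))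
    linarith [Real.add_one_le_exp (residSq c ψ γ α z)]
  have h3 : |resid ψ α z k| ≤ 1 + resid ψ α z k ^ 2 := by
    have := sq_abs (resid ψ α z k)
    nlinarith [sq_nonneg (|resid ψ α z k| - 1), abs_nonneg (resid ψ α z k)]
  rw [norm_mul, Real.norm_of_nonneg h0, Real.norm_eq_abs, Pi.add_apply]
  calc obsWt γ z k * |resid ψ α z k| ≤ obsWt γ z k * (1 + resid ψ α z k ^ 2) := by gcongr
    _ = obsWt γ z k + obsWt γ z k * resid ψ α z k ^ 2 := by ring
    _ ≤ _ := add_le_add (hz k) (h1.trans h2)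

/-- The available moment bound concerns the weighted residual and not the outcome, so the outcome is
split into the residual and ψ(ᾱ_kᵀf), the latter bounded. -/
theorem LawBase.integrable_wlLoss (H : LawBase c ψ γ α ν) (hB1 : 1 < c.B1) (hσ : 0 < c.σ0)
    (hψ : Continuous ψ) (α' : Coef p K t) :
    Integrable (fun z => wlLoss ψ γ α' z.1 z.2.1 z.2.2) ν := by
  have hΨ : Continuous fun x => ∫ s in (0 : ℝ)..x, ψ s :=
    intervalIntegral.continuous_primitive (fun a b => hψ.intervalIntegrable a b) 0
  obtain ⟨C1, h1⟩ := H.exists_abs_comp_linPred_le continuous_id α'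
  obtain ⟨C2, h2⟩ := H.exists_abs_comp_linPred_le hΨ α'
  obtain ⟨C3, h3⟩ := H.exists_abs_comp_linPred_le hψ α
  unfold wlLoss
  refine integrable_finsetSum _ fun k _ => ?_
  have hlm := measurable_linPred_obs α' k
  have e : ∀ z : Obs p K, treatInd z.2.1 t * Real.exp (linPred γ z.2.2 k) *
      (-(z.1 * linPred α' z.2.2 k) + ∫ s in (0 : ℝ)..(linPred α' z.2.2 k), ψ s) =
      obsWt γ z k * resid ψ α z k * (-linPred α' z.2.2 k) + obsWt γ z k *
        (-(ψ (linPred α z.2.2 k) * linPred α' z.2.2 k)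
          + ∫ s in (0 : ℝ)..(linPred α' z.2.2 k), ψ s) := by
    intro z
    simp only [obsWt, calWt, resid]
    ring
  simp only [e]
  refine Integrable.add ?_ ?_
  · refine (H.integrable_obsWt_mul_resid hB1 hσ hψ.measurable k).mul_bdd (c := C1)
      hlm.neg.aestronglyMeasurable ?_
    filter_upwards [h1] with z hz
    rw [norm_neg]
    exact hz k
  · refine Integrable.of_bound ((measurable_obsWt γ k).mul
      (((hψ.measurable.comp (measurable_linPred_obs α k)).mul hlm).neg.add
        (hΨ.measurable.comp hlm))).aestronglyMeasurable (c.B1 * (C3 * C1 + C2)) ?_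
    filter_upwards [h1, h2, h3, H.obsWt_le hB1] with z z1 z2 z3 z4
    rw [norm_mul, Real.norm_of_nonneg (obsWt_nonneg γ z k)]
    refine mul_le_mul (z4 k) ?_ (norm_nonneg _) (by linarith)
    refine (norm_add_le _ _).trans (add_le_add ?_ (z2 k))
    rw [norm_neg, norm_mul]
    exact mul_le_mul (z3 k) (z1 k) (norm_nonneg _) ((abs_nonneg _).trans (z3 k))

/-- Perturb one entry of γ by u. For |u| ≤ 1/B₀ the exponent u v_j stays in [−1, 1], where e^x ≤ 1 +
x + x²; such a one-sided quadratic bound is all that the first order condition at a minimizer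
requires. -/
theorem LawBase.integral_cal_score_eq_zero (H : LawBase c ψ γ α ν) (hB0 : 1 ≤ c.B0)
    (hB1 : 1 < c.B1)
    (hmin : ∀ γ' : Coef p K t, ∫ z, calLoss γ z.2.1 z.2.2 ∂ν ≤ ∫ z, calLoss γ' z.2.1 z.2.2 ∂ν)
    (k : {k : Fin K // k ≠ t}) (j : Fin (p + 1)) :
    ∫ z, (obsWt γ z k - treatInd z.2.1 k) * z.2.2 j ∂ν = 0 := by
  refine integral_eq_zero_of_forall_integral_le (δ := 1 / c.B0) (C := c.B1 * c.B0 ^ 2)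
    (h := fun u z => calLoss (γ + Matrix.single j k u) z.2.1 z.2.2) (by positivity)
    (by positivity) (fun u => H.integrable_calLoss _) ?_ ?_ ?_
  · refine Integrable.of_bound (((measurable_obsWt γ k).sub ((measurable_treatInd _).comp
      (measurable_fst.comp measurable_snd))).mul (measurable_regressor j)).aestronglyMeasurable
      (c.B1 * c.B0) ?_
    filter_upwards [H.bounded, H.sum_abs_sub_le hB1] with z h1 h2
    rw [norm_mul]
    refine mul_le_mul ?_ (h1 j) (norm_nonneg _) (by linarith)
    exact (Finset.single_le_sum (f := fun k : {k : Fin K // k ≠ t} =>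
      |obsWt γ z k - treatInd z.2.1 k|) (fun _ _ => abs_nonneg _) (Finset.mem_univ k)).trans h2
  · intro u hu
    filter_upwards [H.bounded, H.obsWt_le hB1] with z h1 h2
    have hx : |u * z.2.2 j| ≤ 1 := by
      rw [abs_mul]
      calc |u| * |z.2.2 j| ≤ 1 / c.B0 * c.B0 :=
            mul_le_mul hu (h1 j) (abs_nonneg _) (by positivity)
        _ = 1 := by field_simp
    have he := (abs_le.1 (Real.abs_exp_sub_one_sub_id_le hx)).2
    have hd : calLoss (γ + Matrix.single j k u) z.2.1 z.2.2 - calLoss γ z.2.1 z.2.2 =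
        obsWt γ z k * (Real.exp (u * z.2.2 j) - 1) - treatInd z.2.1 k * (u * z.2.2 j) := by
      unfold calLoss
      rw [← Finset.sum_sub_distrib, Finset.sum_eq_single k]
      · rw [linPred_add, linPred_single, if_pos rfl, Real.exp_add, obsWt, calWt]
        ring
      · intro k' _ hk'
        rw [linPred_add, linPred_single, if_neg hk'.symm]
        ring_nf
      · simp
    have hz0 : calLoss (γ + Matrix.single j k (0 : ℝ)) z.2.1 z.2.2 = calLoss γ z.2.1 z.2.2 := by
      rw [Matrix.single_zero, add_zero]
    rw [hz0]
    have h3 : obsWt γ z k * (Real.exp (u * z.2.2 j) - 1) ≤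
        obsWt γ z k * (u * z.2.2 j + (u * z.2.2 j) ^ 2) :=
      mul_le_mul_of_nonneg_left (by linarith) (obsWt_nonneg γ z k)
    have h4 : obsWt γ z k * (u * z.2.2 j) ^ 2 ≤ c.B1 * c.B0 ^ 2 * u ^ 2 := by
      have h5 : z.2.2 j ^ 2 ≤ c.B0 ^ 2 :=
        sq_le_sq' (by linarith [(abs_le.1 (h1 j)).1]) (abs_le.1 (h1 j)).2
      calc obsWt γ z k * (u * z.2.2 j) ^ 2 = obsWt γ z k * (z.2.2 j ^ 2) * u ^ 2 := by ring
        _ ≤ _ := by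
          have := h2 k
          gcongr
    nlinarith
  · intro u
    simpa using hmin (γ + Matrix.single j k u)

/-- The same perturbation argument, with `LogLip.integral_sub_le` in place of the exponential bound.
The derivative of the loss is minus the score, hence the change of sign. -/
theorem LawBase.integral_wl_score_eq_zero (H : LawBase c ψ γ α ν) (hc : c.Valid)
    (hψ : LogLip ψ c.C3)
    (hmin : ∀ α' : Coef p K t, ∫ z, wlLoss ψ γ α z.1 z.2.1 z.2.2 ∂ν ≤
      ∫ z, wlLoss ψ γ α' z.1 z.2.1 z.2.2 ∂ν)
    (k : {k : Fin K // k ≠ t}) (j : Fin (p + 1)) :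
    ∫ z, obsWt γ z k * resid ψ α z k * z.2.2 j ∂ν = 0 := by
  have hB0 := hc.B0
  have hB1 := hc.B1
  have hC1 := hc.C1
  have hψc := hψ.diff.continuous
  rw [← neg_eq_zero, ← integral_neg]
  refine integral_eq_zero_of_forall_integral_le (δ := 1 / c.B0)
    (C := c.B1 * (c.C1 * Real.exp c.C3) * c.B0 ^ 2)
    (h := fun u z => wlLoss ψ γ (α + Matrix.single j k u) z.1 z.2.1 z.2.2) (by positivity)
    (by positivity) (fun u => H.integrable_wlLoss hB1 hc.σ0 hψc _) ?_ ?_ ?_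
  · refine ((H.integrable_obsWt_mul_resid hB1 hc.σ0 hψc.measurable k).mul_bdd (c := c.B0)
      (measurable_regressor j).aestronglyMeasurable ?_).neg
    filter_upwards [H.bounded] with z hz using hz j
  · intro u hu
    filter_upwards [H.bounded, H.obsWt_le hB1, H.upper] with z h1 h2 hup
    have hx : |u * z.2.2 j| ≤ 1 := by
      rw [abs_mul]
      calc |u| * |z.2.2 j| ≤ 1 / c.B0 * c.B0 :=
            mul_le_mul hu (h1 j) (abs_nonneg _) (by positivity)
        _ = 1 := by field_simp
    have he := hψ.integral_sub_le (u := linPred α z.2.2 k) hx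
    have hint : (∫ s in (0 : ℝ)..(linPred α z.2.2 k), ψ s) +
        (∫ s in (linPred α z.2.2 k)..(linPred α z.2.2 k + u * z.2.2 j), ψ s) =
        ∫ s in (0 : ℝ)..(linPred α z.2.2 k + u * z.2.2 j), ψ s :=
      intervalIntegral.integral_add_adjacent_intervals (hψc.intervalIntegrable _ _)
        (hψc.intervalIntegrable _ _)
    have hd : wlLoss ψ γ (α + Matrix.single j k u) z.1 z.2.1 z.2.2
        - wlLoss ψ γ α z.1 z.2.1 z.2.2 = obsWt γ z k * (-(z.1 * (u * z.2.2 j)) +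
          ∫ s in (linPred α z.2.2 k)..(linPred α z.2.2 k + u * z.2.2 j), ψ s) := by
      unfold wlLoss
      rw [← Finset.sum_sub_distrib, Finset.sum_eq_single k]
      · rw [linPred_add, linPred_single, if_pos rfl, ← hint, obsWt, calWt]
        ring
      · intro k' _ hk'
        rw [linPred_add, linPred_single, if_neg hk'.symm, add_zero, sub_self]
      · simp
    have hz0 : wlLoss ψ γ (α + Matrix.single j k (0 : ℝ)) z.1 z.2.1 z.2.2 =
        wlLoss ψ γ α z.1 z.2.1 z.2.2 := by
      rw [Matrix.single_zero, add_zero]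
    rw [hz0]
    have h3 : obsWt γ z k * (-(z.1 * (u * z.2.2 j)) +
          ∫ s in (linPred α z.2.2 k)..(linPred α z.2.2 k + u * z.2.2 j), ψ s) ≤
        obsWt γ z k * (-(resid ψ α z k * (u * z.2.2 j)) +
          c.C1 * Real.exp c.C3 * (u * z.2.2 j) ^ 2) := by
      refine mul_le_mul_of_nonneg_left ?_ (obsWt_nonneg γ z k)
      have h4 : deriv ψ (linPred α z.2.2 k) * Real.exp c.C3 * (u * z.2.2 j) ^ 2 ≤
          c.C1 * Real.exp c.C3 * (u * z.2.2 j) ^ 2 := by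
        have := hup k
        gcongr
      unfold resid
      linarith
    have h4 : obsWt γ z k * (c.C1 * Real.exp c.C3 * (u * z.2.2 j) ^ 2) ≤
        c.B1 * (c.C1 * Real.exp c.C3) * c.B0 ^ 2 * u ^ 2 := by
      have h5 : z.2.2 j ^ 2 ≤ c.B0 ^ 2 :=
        sq_le_sq' (by linarith [(abs_le.1 (h1 j)).1]) (abs_le.1 (h1 j)).2
      calc _ = obsWt γ z k * (c.C1 * Real.exp c.C3) * (z.2.2 j ^ 2) * u ^ 2 := by ring
        _ ≤ _ := by
          have := h2 k
          gcongr
    linarith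
  · intro u
    simpa using hmin (α + Matrix.single j k u)

end Scores

end RCAL

namespace RCAL

/-! ### The law of the outcome, the treatment and the regressors -/

section ObsLaw

variable {p K : ℕ} {t : Fin K} {Ω : Type u} [MeasurableSpace Ω]

/-- The joint law of outcome, treatment and regressors. -/
def obsLaw (μ : Measure Ω) (Y : Ω → ℝ) (T : Ω → Fin K) (V : Ω → Fin (p + 1) → ℝ) :
    Measure (Obs p K) :=
  μ.map fun ω => (Y ω, T ω, V ω)

variable {μ : Measure Ω} {Y : Ω → ℝ} {T : Ω → Fin K} {V : Ω → Fin (p + 1) → ℝ}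

theorem measurable_obs (hY : Measurable Y) (hT : Measurable T) (hV : Measurable V) :
    Measurable fun ω => ((Y ω, T ω, V ω) : Obs p K) :=
  hY.prodMk (hT.prodMk hV)

theorem integral_obsLaw (hY : Measurable Y) (hT : Measurable T) (hV : Measurable V)
    {F : Obs p K → ℝ} (hF : Measurable F) :
    ∫ z, F z ∂(obsLaw μ Y T V) = ∫ ω, F (Y ω, T ω, V ω) ∂μ :=
  integral_map (measurable_obs hY hT hV).aemeasurable hF.aestronglyMeasurable

theorem lintegral_obsLaw (hY : Measurable Y) (hT : Measurable T) (hV : Measurable V)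
    {F : Obs p K → ENNReal} (hF : Measurable F) :
    ∫⁻ z, F z ∂(obsLaw μ Y T V) = ∫⁻ ω, F (Y ω, T ω, V ω) ∂μ :=
  lintegral_map hF (measurable_obs hY hT hV)

theorem ae_obsLaw_forall_le {κ : Type*} [Countable κ] (hY : Measurable Y) (hT : Measurable T)
    (hV : Measurable V) {F G : κ → Obs p K → ℝ} (hF : ∀ k, Measurable (F k))
    (hG : ∀ k, Measurable (G k)) (h : ∀ᵐ ω ∂μ, ∀ k, F k (Y ω, T ω, V ω) ≤ G k (Y ω, T ω, V ω)) :
    ∀ᵐ z ∂(obsLaw μ Y T V), ∀ k, F k z ≤ G k z := by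
  rw [ae_all_iff]
  intro k
  exact (ae_map_iff (measurable_obs hY hT hV).aemeasurable (measurableSet_le (hF k) (hG k))).2
    (h.mono fun ω hω => hω k)

theorem one_add_sum_exp_linPred (γ : Coef p K t) (w : Fin (p + 1) → ℝ) :
    1 + ∑ k, Real.exp (linPred γ w k) = (ps γ w t)⁻¹ := by
  unfold ps
  rw [psIndex_base, Real.exp_zero, one_div, inv_inv,
    Fintype.sum_eq_add_sum_subtype_ne (fun k => Real.exp (psIndex γ w k)) t, psIndex_base,
    Real.exp_zero]
  congr 1
  exact Finset.sum_congr rfl fun k _ => by rw [psIndex_coe]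

variable [IsProbabilityMeasure μ] {𝒳 : Type v} [MeasurableSpace 𝒳] {n : ℕ} {ε : ℝ}
  {c : Constants} {ψ : ℝ → ℝ} {γ α : Coef p K t} {X : Ω → 𝒳} {f : 𝒳 → Fin (p + 1) → ℝ}
  {Ypot : Fin K → Ω → ℝ}

/-- The lower bound makes ψ' positive at one point, and the growth condition carries positivity to
every other point. -/
theorem ORConditions.logLip (hc : c.Valid) (hψ : Differentiable ℝ ψ) {Yt : Ω → ℝ}
    (hK : 2 ≤ K) (h : ORConditions c n ε μ ψ Yt T X V γ α) : LogLip ψ c.C3 where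
  diff := hψ
  nonneg x := by
    obtain ⟨ω, hω⟩ := h.lower.exists
    have : Nontrivial (Fin K) := Fin.nontrivial_iff_two_le.2 hK
    obtain ⟨k, hk⟩ := exists_ne t
    have h1 := (hc.C2.trans_le (hω ⟨k, hk⟩)).trans_le (h.growth _ x)
    exact (pos_of_mul_pos_left h1 (Real.exp_pos _).le).le
  C_nonneg := hc.C3
  growth := h.growth

theorem PSConditions.abs_regressor_le (hc : c.Valid) (hV0 : ∀ ω, V ω 0 = 1)
    (hP : PSConditions c n ε μ T V γ) : ∀ᵐ ω ∂μ, ∀ j, |V ω j| ≤ c.B0 := by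
  filter_upwards [hP.bounded] with ω hω j
  refine Fin.cases ?_ (fun j => hω j) j
  rw [hV0 ω, abs_one]
  exact hc.B0

theorem lawBase_obsLaw (hc : c.Valid) (hY : Measurable Y) (hT : Measurable T) (hX : Measurable X)
    (hf : Measurable f) (hYp : ∀ k, Measurable (Ypot k)) (hf0 : ∀ x, f x 0 = 1)
    (hcons : ∀ ω, Y ω = Ypot (T ω) ω) (hU : Unconfounded μ T X Ypot)
    (hψ : LogLip ψ c.C3)
    (hP : PSConditions c n ε μ T (fun ω => f (X ω)) γ)
    (hO : ORConditions c n ε μ ψ (Ypot t) T X (fun ω => f (X ω)) γ α) :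
    LawBase c ψ γ α (obsLaw μ Y T fun ω => f (X ω)) := by
  have hV : Measurable fun ω => f (X ω) := hf.comp hX
  have hψm := hψ.diff.continuous.measurable
  refine ⟨?_, ?_, ?_, ?_, ?_⟩
  · exact ae_obsLaw_forall_le (F := fun j z => |z.2.2 j|) (G := fun _ _ => c.B0) hY hT hV
      (fun j => continuous_abs.measurable.comp (measurable_regressor j))
      (fun _ => measurable_const) (hP.abs_regressor_le hc fun ω => hf0 _)
  · have h := ae_obsLaw_forall_le (κ := Unit) (μ := μ)
      (F := fun _ (z : Obs p K) => ∑ k, Real.exp (linPred γ z.2.2 k))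
      (G := fun _ _ => c.B1 - 1) hY hT hV
      (fun _ => Finset.measurable_sum _ fun k _ => Real.measurable_exp.comp
        (measurable_linPred_obs γ k)) (fun _ => measurable_const) (by
        filter_upwards [hP.overlap] with ω hω _
        rw [← one_add_sum_exp_linPred] at hω
        linarith)
    exact h.mono fun z hz => hz ()
  · exact ae_obsLaw_forall_le (F := fun k z => deriv ψ (linPred α z.2.2 k))
      (G := fun _ _ => c.C1) hY hT hV
      (fun k => (measurable_deriv ψ).comp (measurable_linPred_obs α k))
      (fun _ => measurable_const) hO.upper
  · exact ae_obsLaw_forall_le (G := fun k z => deriv ψ (linPred α z.2.2 k))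
      (F := fun _ _ => c.C2) hY hT hV (fun _ => measurable_const)
      (fun k => (measurable_deriv ψ).comp (measurable_linPred_obs α k)) hO.lower
  · intro k h hh
    have hTm : Measurable fun z : Obs p K => ENNReal.ofReal (treatInd z.2.1 t) :=
      ((measurable_treatInd t).comp (measurable_fst.comp measurable_snd)).ennreal_ofReal
    have hhm : Measurable fun z : Obs p K => h z.2.2 :=
      hh.comp (measurable_snd.comp measurable_snd)
    have hem : Measurable fun z : Obs p K =>
        ENNReal.ofReal (Real.exp (resid ψ α z k ^ 2 / c.σ0 ^ 2)) :=
      (Real.measurable_exp.comp (((measurable_resid hψm α k).pow_const 2).div_const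
        _)).ennreal_ofReal
    rw [lintegral_obsLaw hY hT hV (F := fun z => ENNReal.ofReal (treatInd z.2.1 t) * h z.2.2 *
        ENNReal.ofReal (Real.exp (resid ψ α z k ^ 2 / c.σ0 ^ 2))) ((hTm.mul hhm).mul hem),
      lintegral_obsLaw hY hT hV (F := fun z => ENNReal.ofReal (treatInd z.2.1 t) * h z.2.2)
        (hTm.mul hhm)]
    refine le_trans (le_of_eq ?_) (hU.lintegral_le hT hX hYp
      (r := fun x => ψ (linPred α (f x) k)) (h := fun x => h (f x))
      (hψm.comp ((measurable_linPred α k).comp hf)) (hO.subGaussian k) (hh.comp hf))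
    refine lintegral_congr fun ω => ?_
    by_cases hω : T ω = t
    · simp only [resid, hcons ω, hω, mul_assoc]
    · simp [treatInd, hω]

theorem lawReg_obsLaw (hc : c.Valid) (hY : Measurable Y) (hT : Measurable T) (hX : Measurable X)
    (hf : Measurable f) (hψ : LogLip ψ c.C3)
    (hB : LawBase c ψ γ α (obsLaw μ Y T fun ω => f (X ω)))
    (hγ : IsCalTarget μ T (fun ω => f (X ω)) γ)
    (hα : IsWLTarget μ ψ Y T (fun ω => f (X ω)) γ α) :
    LawReg c ψ γ α (obsLaw μ Y T fun ω => f (X ω)) := by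
  have hV : Measurable fun ω => f (X ω) := hf.comp hX
  have : IsProbabilityMeasure (obsLaw μ Y T fun ω => f (X ω)) :=
    Measure.isProbabilityMeasure_map (measurable_obs hY hT hV).aemeasurable
  refine ⟨hB, hB.integral_cal_score_eq_zero hc.B0 hc.B1 fun γ' => ?_,
    hB.integral_wl_score_eq_zero hc hψ fun α' => ?_⟩
  · rw [integral_obsLaw hY hT hV (measurable_calLoss γ),
      integral_obsLaw hY hT hV (measurable_calLoss γ')]
    exact hγ γ'
  · rw [integral_obsLaw hY hT hV (measurable_wlLoss hψ.diff.continuous γ α),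
      integral_obsLaw hY hT hV (measurable_wlLoss hψ.diff.continuous γ α')]
    exact hα α'

theorem Compat.compatForm (hY : Measurable Y) (hT : Measurable T) (hV : Measurable V)
    {S : Finset (Fin (p + 1))} {κ ξ : ℝ} (h : Compat μ T V γ S κ ξ) :
    CompatForm (meanQuad γ (obsLaw μ Y T V)) S κ ξ := by
  intro b hb
  refine (h b hb).trans (le_of_eq ?_)
  congr 1
  unfold quadForm
  refine Finset.sum_congr rfl fun k _ => Finset.sum_congr rfl fun j _ =>
    Finset.sum_congr rfl fun j' _ => ?_
  rw [meanQuad, integral_obsLaw hY hT hV (measurable_quad k j j')]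
  simp only [psRatio_eq_exp, obsWt, calWt]

/-- The tail bounds need a small rate, and the assumptions already imply it. Testing compatibility
on a single unit entry in the intercept row gives ν₁² ≤ |S_γ| B₁, while `small_a` gives (ξ₁ + 1)²
|S_γ| λ₁ ≤ ν₁². Hence 4λ₁ ≤ B₁, and λ₁ ≥ (28/5) B₁ρ leaves ρ ≤ 5/112. -/
theorem PSConditions.rate_le (hc : c.Valid) (hK : 2 ≤ K) (hY : Measurable Y) (hT : Measurable T)
    (hV : Measurable V) (hV0 : ∀ ω, V ω 0 = 1) (hP : PSConditions c n ε μ T V γ)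
    (hB : LawBase c ψ γ α (obsLaw μ Y T V)) : Constants.rate K p n ε ≤ 1 / 20 := by
  have hB0 := hc.B0
  have hB1 := hc.B1
  have : Nontrivial (Fin K) := Fin.nontrivial_iff_two_le.2 hK
  obtain ⟨k, hk⟩ := exists_ne t
  have : IsProbabilityMeasure (obsLaw μ Y T V) :=
    Measure.isProbabilityMeasure_map (measurable_obs hY hT hV).aemeasurable
  set b : Coef p K t := Matrix.single 0 ⟨k, hk⟩ 1 with hb
  have hrow0 : rowNorm b 0 = 1 := by
    unfold rowNorm
    rw [Finset.sum_eq_single ⟨k, hk⟩]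
    · simp [hb]
    · intro k' _ hk'
      simp [hb, hk'.symm]
    · simp
  have hrow : ∀ j, j ≠ 0 → rowNorm b j = 0 := by
    intro j hj
    simp [rowNorm, hb, hj.symm]
  have h0 := zero_mem_sparsity γ
  have hS : ∑ j ∈ sparsity γ, rowNorm b j = 1 := by
    rw [Finset.sum_eq_single_of_mem 0 h0 fun j _ hj => hrow j hj, hrow0]
  have hSc : ∑ j ∈ (sparsity γ)ᶜ, rowNorm b j = 0 := by
    refine Finset.sum_eq_zero fun j hj => hrow j ?_
    rintro rfl
    exact (Finset.mem_compl.1 hj) h0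
  have hcompat := hP.compat.compatForm hY hT hV b (by
    rw [hS, hSc]; linarith [hc.ξ1])
  rw [hS, one_pow, mul_one] at hcompat
  have hq : quadForm (meanQuad γ (obsLaw μ Y T V)) b ≤ c.B1 := by
    have e := quadForm_integral (hB.integrable_quad hB0 hB1) b
    have e' : quadForm (meanQuad γ (obsLaw μ Y T V)) b =
        ∫ z, obsWt γ z ⟨k, hk⟩ * z.2.2 0 ^ 2 ∂(obsLaw μ Y T V) := by
      unfold meanQuad
      rw [e, Finset.sum_eq_single ⟨k, hk⟩]
      · simp [hb, linPred_single]
      · intro k' _ hk'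
        simp [hb, linPred_single, hk'.symm]
      · simp
    rw [e', integral_obsLaw hY hT hV (F := fun z => obsWt γ z ⟨k, hk⟩ * z.2.2 0 ^ 2)
      ((measurable_obsWt γ _).mul
      ((measurable_regressor 0).pow_const 2))]
    simp only [hV0, one_pow, mul_one]
    rw [← integral_obsLaw hY hT hV (measurable_obsWt γ ⟨k, hk⟩)]
    calc ∫ z, obsWt γ z ⟨k, hk⟩ ∂(obsLaw μ Y T V) ≤ ∫ _, c.B1 ∂(obsLaw μ Y T V) :=
          integral_mono_of_nonneg (Filter.Eventually.of_forall fun z => obsWt_nonneg γ z _)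
            (integrable_const _) ((hB.obsWt_le hB1).mono fun z hz => hz _)
      _ = c.B1 := by simp
  set sg : ℝ := ((sparsity γ).card : ℝ) with hsg
  have hsg1 : 1 ≤ sg := one_le_card_sparsity γ
  have hν := hc.ν1
  have h1 : c.ν1 ^ 2 ≤ sg * c.B1 := hcompat.trans (by gcongr)
  have h2 : (c.ξ1 + 1) ^ 2 * sg * c.lam1 K p n ε ≤ c.ν1 ^ 2 := by
    have h3 := hP.small_a.trans hc.η11.2.le
    rw [div_mul_eq_mul_div, div_mul_eq_mul_div, div_le_one (by positivity)] at h3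
    exact h3
  set ρ := Constants.rate K p n ε with hρ
  have hρ0 : 0 ≤ ρ := Real.sqrt_nonneg _
  have h4 : 0 ≤ c.lam1 K p n ε := by unfold Constants.lam1; positivity
  have h5 : 4 * sg * c.lam1 K p n ε ≤ sg * c.B1 := by
    have h6 : (4 : ℝ) ≤ (c.ξ1 + 1) ^ 2 := by nlinarith [hc.ξ1]
    refine le_trans ?_ (h2.trans h1)
    gcongr
  have h7 : 4 * c.lam1 K p n ε ≤ c.B1 := by
    refine le_of_mul_le_mul_left (a := sg) ?_ (by linarith)
    linarith
  have h8 : 4 * (7 / 5) * 1 ^ 2 * c.B1 * ρ ≤ c.lam1 K p n ε := by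
    have := one_le_sqrt_two
    unfold Constants.lam1
    gcongr
  have h9 : c.B1 * (ρ * 20) ≤ c.B1 * 1 := by nlinarith
  have h10 := le_of_mul_le_mul_left h9 (by linarith)
  linarith

end ObsLaw

end RCAL

namespace RCAL

/-! ### The population discrepancy `Λ` -/

section Discrepancy

variable {p K : ℕ} {t : Fin K} {c : Constants} {ψ : ℝ → ℝ} {γ α : Coef p K t}
  {ν : Measure (Obs p K)}

/-- The mean of `ψ'(a_kᵀ v) (R^{(t)} ω_k - R^{(k)}) v_j`. -/
def scoreMean (ψ : ℝ → ℝ) (γ : Coef p K t) (ν : Measure (Obs p K)) (a : Coef p K t)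
    (j : Fin (p + 1)) (k : {k : Fin K // k ≠ t}) : ℝ :=
  ∫ z, deriv ψ (linPred a z.2.2 k) * obsDiff γ z k * z.2.2 j ∂ν

theorem measurable_score (a : Coef p K t) (j : Fin (p + 1)) (k : {k : Fin K // k ≠ t}) :
    Measurable fun z : Obs p K => deriv ψ (linPred a z.2.2 k) * obsDiff γ z k * z.2.2 j :=
  (((measurable_deriv ψ).comp (measurable_linPred_obs a k)).mul (measurable_obsDiff γ k)).mul
    (measurable_regressor j)

theorem LawBase.abs_obsDiff_le (H : LawBase c ψ γ α ν) (hB1 : 1 < c.B1) :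
    ∀ᵐ z ∂ν, ∀ k, |obsDiff γ z k| ≤ c.B1 :=
  (H.sum_abs_sub_le hB1).mono fun z hz k => (Finset.single_le_sum
    (f := fun k : {k : Fin K // k ≠ t} => |obsDiff γ z k|) (fun _ _ => abs_nonneg _)
    (Finset.mem_univ k)).trans hz

theorem LawBase.abs_deriv_le (H : LawBase c ψ γ α ν) (hc : c.Valid) (hψ : LogLip ψ c.C3) {r : ℝ} :
    ∀ᵐ z ∂ν, ∀ a : Coef p K t, norm21 (a - α) ≤ r → ∀ k,
      |deriv ψ (linPred a z.2.2 k)| ≤ c.C1 * Real.exp (c.C3 * (c.B0 * r)) := by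
  filter_upwards [H.bounded, H.upper] with z h1 h2 a ha k
  have hC3 := hc.C3
  have hC1 := hc.C1
  have hB0 := hc.B0
  rw [abs_of_nonneg (hψ.nonneg _)]
  refine (hψ.growth _ (linPred α z.2.2 k)).trans ?_
  have h3 : |linPred a z.2.2 k - linPred α z.2.2 k| ≤ c.B0 * r := by
    rw [← linPred_sub]
    exact (abs_linPred_le _ h1 k).trans (mul_le_mul_of_nonneg_left ha (by linarith))
  have := h2 k
  gcongr

theorem LawBase.abs_score_le (H : LawBase c ψ γ α ν) (hc : c.Valid) (hψ : LogLip ψ c.C3) {r : ℝ} :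
    ∀ᵐ z ∂ν, ∀ a : Coef p K t, norm21 (a - α) ≤ r → ∀ j k,
      |deriv ψ (linPred a z.2.2 k) * obsDiff γ z k * z.2.2 j| ≤
        c.C1 * Real.exp (c.C3 * (c.B0 * r)) * c.B1 * c.B0 := by
  filter_upwards [H.bounded, H.abs_deriv_le hc hψ, H.abs_obsDiff_le hc.B1] with z h1 h2 h3 a ha j k
  have hC1 := hc.C1
  have hB0 := hc.B0
  have hB1 := hc.B1
  rw [abs_mul, abs_mul]
  have := h2 a ha k
  have := h3 k
  have := h1 j
  gcongr

variable [IsProbabilityMeasure ν]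

theorem LawBase.integrable_score (H : LawBase c ψ γ α ν) (hc : c.Valid) (hψ : LogLip ψ c.C3)
    (a : Coef p K t) (j : Fin (p + 1)) (k : {k : Fin K // k ≠ t}) :
    Integrable (fun z => deriv ψ (linPred a z.2.2 k) * obsDiff γ z k * z.2.2 j) ν :=
  Integrable.of_bound (measurable_score a j k).aestronglyMeasurable _
    ((H.abs_score_le hc hψ).mono fun _ hz => hz a le_rfl j k)

theorem LawBase.abs_scoreMean_le (H : LawBase c ψ γ α ν) (hc : c.Valid) (hψ : LogLip ψ c.C3)
    {r : ℝ} {a : Coef p K t} (ha : norm21 (a - α) ≤ r) (j : Fin (p + 1))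
    (k : {k : Fin K // k ≠ t}) :
    |scoreMean ψ γ ν a j k| ≤ c.C1 * Real.exp (c.C3 * (c.B0 * r)) * c.B1 * c.B0 := by
  have h := norm_integral_le_of_norm_le_const (μ := ν)
    (f := fun z => deriv ψ (linPred a z.2.2 k) * obsDiff γ z k * z.2.2 j)
    ((H.abs_score_le hc hψ).mono fun z hz => hz a ha j k)
  rw [scoreMean]
  simpa using h

theorem norm21_smul (x : ℝ) (a : Coef p K t) : norm21 (x • a) = |x| * norm21 a := by
  unfold norm21
  rw [Finset.mul_sum]
  refine Finset.sum_congr rfl fun j _ => ?_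
  unfold rowNorm
  rw [← Real.sqrt_sq_eq_abs, ← Real.sqrt_mul (sq_nonneg x), Finset.mul_sum]
  congr 1
  exact Finset.sum_congr rfl fun k _ => by simp [mul_pow]

/-- Differentiation under the integral along the ray u ↦ α + u a, with a dominating constant valid
on a unit neighbourhood of u. The derivative pairs a with the means that define Λ. -/
theorem LawBase.hasDerivAt_integral_incrVal (H : LawBase c ψ γ α ν) (hc : c.Valid)
    (hψ : LogLip ψ c.C3) (a : Coef p K t) (u : ℝ) :
    HasDerivAt (fun u => ∫ z, incrVal ψ γ α (u • a) z ∂ν)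
      (∑ j, ∑ k, a j k * scoreMean ψ γ ν (α + u • a) j k) u := by
  have hB0 := hc.B0
  have hB1 := hc.B1
  have hC1 := hc.C1
  have hC3 := hc.C3
  set r := (|u| + 1) * norm21 a with hr
  have hN := norm21_nonneg a
  have hball : ∀ x ∈ Metric.ball u 1, norm21 (α + x • a - α) ≤ r := by
    intro x hx
    rw [add_sub_cancel_left, norm21_smul]
    refine mul_le_mul_of_nonneg_right ?_ hN
    rw [Metric.mem_ball, Real.dist_eq] at hx
    have := abs_add_le (x - u) u
    rw [sub_add_cancel] at this
    linarith
  set F' : ℝ → Obs p K → ℝ := fun x z =>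
    ∑ j, ∑ k, a j k * (deriv ψ (linPred (α + x • a) z.2.2 k) * obsDiff γ z k * z.2.2 j) with hF'
  have hmF : ∀ x : ℝ, Measurable (incrVal ψ γ α (x • a)) := fun x => by
    have h := (H.procReg hc hψ (σ := 1) (by simp) le_rfl).meas (x • a)
    simp only [one_mul] at h
    exact h
  have hderiv : ∀ z x, HasDerivAt (fun x => incrVal ψ γ α (x • a) z) (F' x z) x := by
    intro z x
    have h1 : ∀ k, HasDerivAt (fun x => obsDiff γ z k * linkIncr ψ α z k
        (linPred (x • a) z.2.2 k)) (obsDiff γ z k *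
          (deriv ψ (linPred (α + x • a) z.2.2 k) * linPred a z.2.2 k)) x := by
      intro k
      refine HasDerivAt.const_mul _ ?_
      simp only [linkIncr, linPred_smul, linPred_add]
      refine HasDerivAt.sub_const _ ?_
      have h2 : HasDerivAt (fun x => linPred α z.2.2 k + x * linPred a z.2.2 k)
          (linPred a z.2.2 k) x := by
        simpa using ((hasDerivAt_id x).mul_const (linPred a z.2.2 k)).const_add
          (linPred α z.2.2 k)
      exact (hψ.diff _).hasDerivAt.comp x h2
    have h3 := HasDerivAt.fun_sum fun k (_ : k ∈ Finset.univ) => h1 k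
    refine h3.congr_deriv ?_
    simp only [hF']
    rw [Finset.sum_comm]
    refine Finset.sum_congr rfl fun k _ => ?_
    conv_lhs => rw [linPred.eq_def a, Finset.mul_sum, Finset.mul_sum]
    exact Finset.sum_congr rfl fun j _ => by ring
  have hF'm : ∀ x, Measurable (F' x) := fun x => Finset.measurable_sum _ fun j _ =>
    Finset.measurable_sum _ fun k _ => (measurable_score (α + x • a) j k).const_mul _
  have hmain := hasDerivAt_integral_of_dominated_loc_of_deriv_le (μ := ν) (x₀ := u)
    (F := fun x z => incrVal ψ γ α (x • a) z) (F' := F')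
    (bound := fun _ => ∑ j, ∑ k, |a j k| * (c.C1 * Real.exp (c.C3 * (c.B0 * r)) * c.B1 * c.B0))
    (Metric.ball_mem_nhds u one_pos)
    (Filter.Eventually.of_forall fun x => (hmF x).aestronglyMeasurable) ?_
    (hF'm u).aestronglyMeasurable ?_ (integrable_const _)
    (Filter.Eventually.of_forall fun z x _ => hderiv z x)
  · refine hmain.2.congr_deriv ?_
    have hi : ∀ j k, Integrable (fun z => a j k * (deriv ψ (linPred (α + u • a) z.2.2 k) *
        obsDiff γ z k * z.2.2 j)) ν := fun j k => (H.integrable_score hc hψ _ j k).const_mul _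
    simp only [hF', scoreMean]
    rw [integral_finsetSum _ fun j _ => integrable_finsetSum _ fun k _ => hi j k]
    refine Finset.sum_congr rfl fun j _ => ?_
    rw [integral_finsetSum _ fun k _ => hi j k]
    exact Finset.sum_congr rfl fun k _ => integral_const_mul _ _
  · have h := (H.procReg hc hψ (σ := 1) (by simp) (norm21_nonneg (u • a))).integrable
      (a := u • a) le_rfl
    simp only [one_mul] at h
    exact h
  · filter_upwards [H.abs_score_le hc hψ] with z hz x hx
    refine (norm_sum_le _ _).trans (Finset.sum_le_sum fun j _ => ?_)
    refine (norm_sum_le _ _).trans (Finset.sum_le_sum fun k _ => ?_)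
    rw [norm_mul]
    exact mul_le_mul_of_nonneg_left (hz _ (hball x hx) j k) (norm_nonneg _)

/-- Mean value inequality on [0, 1]: the segment from α to α + a stays in the ball of radius r, and
the derivative is bounded row by row by Cauchy–Schwarz. -/
theorem LawBase.abs_integral_incrVal_le (H : LawBase c ψ γ α ν) (hc : c.Valid)
    (hψ : LogLip ψ c.C3) {r Λ : ℝ}
    (hΛ : ∀ a : Coef p K t, norm21 (a - α) ≤ r → ∀ j,
      Real.sqrt (∑ k, scoreMean ψ γ ν a j k ^ 2) ≤ Λ) {a : Coef p K t} (ha : norm21 a ≤ r) :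
    |∫ z, incrVal ψ γ α a z ∂ν| ≤ norm21 a * Λ := by
  have h := norm_image_sub_le_of_norm_deriv_le_segment_01' (C := norm21 a * Λ)
    (f := fun u : ℝ => ∫ z, incrVal ψ γ α (u • a) z ∂ν)
    (fun x _ => (H.hasDerivAt_integral_incrVal hc hψ a x).hasDerivWithinAt) (fun x hx => by
      have hx' : norm21 (α + x • a - α) ≤ r := by
        rw [add_sub_cancel_left, norm21_smul, abs_of_nonneg hx.1]
        exact (mul_le_of_le_one_left (norm21_nonneg a) hx.2.le).trans ha
      rw [Real.norm_eq_abs]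
      refine (Finset.abs_sum_le_sum_abs _ _).trans ?_
      rw [norm21, Finset.sum_mul]
      refine Finset.sum_le_sum fun j _ => ?_
      exact (abs_sum_row_mul_le a j _).trans
        (mul_le_mul_of_nonneg_left (hΛ _ hx' j) (rowNorm_nonneg a j)))
  have h0 : ∀ z : Obs p K, incrVal ψ γ α (0 : Coef p K t) z = 0 := fun z => by
    simp [incrVal, procVal, linkIncr, linPred_zero]
  simp only [one_smul, zero_smul, h0, integral_zero, sub_zero, Real.norm_eq_abs] at h
  exact h

variable {Ω : Type u} [MeasurableSpace Ω] {μ : Measure Ω} [IsProbabilityMeasure μ] {Y : Ω → ℝ}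
  {T : Ω → Fin K} {V : Ω → Fin (p + 1) → ℝ}

theorem Lam_eq_sSup (hY : Measurable Y) (hT : Measurable T) (hV : Measurable V) (r : ℝ) :
    Lam μ ψ T V γ α r = sSup {x : ℝ | ∃ (j : Fin (p + 1)) (a : Coef p K t), norm21 (a - α) ≤ r ∧
      x = Real.sqrt (∑ k, scoreMean ψ γ (obsLaw μ Y T V) a j k ^ 2)} := by
  unfold Lam scoreMean
  congr 1
  ext x
  refine exists_congr fun j => exists_congr fun a => and_congr_right fun _ => ?_
  have e : ∀ k : {k : Fin K // k ≠ t}, ∫ ω, deriv ψ (linPred a (V ω) k) *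
      (treatInd (T ω) t * psRatio γ (V ω) k - treatInd (T ω) k) * V ω j ∂μ =
      ∫ z, deriv ψ (linPred a z.2.2 k) * obsDiff γ z k * z.2.2 j ∂(obsLaw μ Y T V) := by
    intro k
    rw [integral_obsLaw hY hT hV (measurable_score a j k)]
    simp only [obsDiff, obsWt, calWt, psRatio_eq_exp]
  simp only [e]

theorem Lam_nonneg (r : ℝ) : 0 ≤ Lam μ ψ T V γ α r := by
  refine Real.sSup_nonneg ?_
  rintro x ⟨j, a, _, rfl⟩
  exact Real.sqrt_nonneg _

/-- Boundedness of the set has to be shown, since a real `sSup` of an unbounded set takes the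
default value 0. -/
theorem LawBase.sqrt_scoreMean_le_Lam (hc : c.Valid) (hψ : LogLip ψ c.C3) (hY : Measurable Y)
    (hT : Measurable T) (hV : Measurable V) (H : LawBase c ψ γ α (obsLaw μ Y T V)) {r : ℝ}
    {a : Coef p K t} (ha : norm21 (a - α) ≤ r) (j : Fin (p + 1)) :
    Real.sqrt (∑ k, scoreMean ψ γ (obsLaw μ Y T V) a j k ^ 2) ≤ Lam μ ψ T V γ α r := by
  have : IsProbabilityMeasure (obsLaw μ Y T V) :=
    Measure.isProbabilityMeasure_map (measurable_obs hY hT hV).aemeasurable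
  rw [Lam_eq_sSup hY hT hV]
  refine le_csSup ⟨Real.sqrt (∑ _k : {k : Fin K // k ≠ t},
    (c.C1 * Real.exp (c.C3 * (c.B0 * r)) * c.B1 * c.B0) ^ 2), ?_⟩ ⟨j, a, ha, rfl⟩
  rintro x ⟨j', a', ha', rfl⟩
  refine Real.sqrt_le_sqrt (Finset.sum_le_sum fun k _ => ?_)
  have h := abs_le.1 (H.abs_scoreMean_le hc hψ ha' j' k)
  exact sq_le_sq' h.1 h.2

end Discrepancy

end RCAL

namespace RCAL

/-! ### Correctly specified propensity scores -/

section Correct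

variable {p K : ℕ} {t : Fin K}

theorem ps_nonneg (γ : Coef p K t) (w : Fin (p + 1) → ℝ) (k : Fin K) : 0 ≤ ps γ w k :=
  div_nonneg (Real.exp_pos _).le (Finset.sum_nonneg fun _ _ => (Real.exp_pos _).le)

theorem ps_pos (γ : Coef p K t) (w : Fin (p + 1) → ℝ) (k : Fin K) : 0 < ps γ w k :=
  div_pos (Real.exp_pos _) (Finset.sum_pos (fun _ _ => Real.exp_pos _) ⟨t, Finset.mem_univ t⟩)

theorem ps_le_one (γ : Coef p K t) (w : Fin (p + 1) → ℝ) (k : Fin K) : ps γ w k ≤ 1 :=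
  div_le_one_of_le₀ (Finset.single_le_sum (f := fun l => Real.exp (psIndex γ w l))
    (fun _ _ => (Real.exp_pos _).le) (Finset.mem_univ k))
    (Finset.sum_nonneg fun _ _ => (Real.exp_pos _).le)

theorem ps_coe_eq (γ : Coef p K t) (w : Fin (p + 1) → ℝ) (k : {k : Fin K // k ≠ t}) :
    ps γ w k = ps γ w t * Real.exp (linPred γ w k) := by
  rw [← psRatio_eq_exp, psRatio, mul_div_cancel₀ _ (ps_pos γ w t).ne']

theorem measurable_ps (γ : Coef p K t) (k : Fin K) : Measurable fun w => ps γ w k := by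
  have h : ∀ l, Measurable fun w => Real.exp (psIndex γ w l) := by
    intro l
    refine Real.measurable_exp.comp ?_
    unfold psIndex
    by_cases hl : l ≠ t
    · simp only [hl, ne_eq, not_false_eq_true, dite_true]
      exact measurable_linPred γ ⟨l, hl⟩
    · simp only [hl, dite_false]
      exact measurable_const
  exact (h k).div (Finset.measurable_sum _ fun l _ => h l)

theorem exp_bregman_nonneg (x y : ℝ) :
    0 ≤ Real.exp y - Real.exp x * y - (Real.exp x - Real.exp x * x) := by
  have h := Real.add_one_le_exp (y - x)
  have e : Real.exp y = Real.exp x * Real.exp (y - x) := by rw [← Real.exp_add]; ring_nf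
  rw [e]
  nlinarith [Real.exp_pos x]

/-- Under correct specification the excess calibration risk is a sum of means of P(t | X) times this
Bregman divergence of exp, so strict convexity identifies the index. -/
theorem eq_of_exp_bregman_eq_zero {x y : ℝ}
    (h : Real.exp y - Real.exp x * y - (Real.exp x - Real.exp x * x) = 0) : y = x := by
  by_contra hne
  have h1 := Real.add_one_lt_exp (sub_ne_zero.2 hne)
  have e : Real.exp y = Real.exp x * Real.exp (y - x) := by rw [← Real.exp_add]; ring_nf
  rw [e] at h
  nlinarith [Real.exp_pos x]

theorem LogLip.abs_deriv_le {ψ : ℝ → ℝ} {C : ℝ} (h : LogLip ψ C) {x R : ℝ} (hx : |x| ≤ R) :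
    |deriv ψ x| ≤ deriv ψ 0 * Real.exp (C * R) := by
  rw [abs_of_nonneg (h.nonneg x)]
  refine (h.growth x 0).trans ?_
  rw [sub_zero]
  have := h.nonneg 0
  have := h.C_nonneg
  gcongr

variable {Ω : Type u} [MeasurableSpace Ω] {μ : Measure Ω} [IsProbabilityMeasure μ] {T : Ω → Fin K}
  {𝒳 : Type v} [m𝒳 : MeasurableSpace 𝒳] {X : Ω → 𝒳} {f : 𝒳 → Fin (p + 1) → ℝ} {B : ℝ}
  {γ γs : Coef p K t}

theorem integral_treatInd_mul_eq_ps (hT : Measurable T) (hX : Measurable X) {k : Fin K}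
    (hk : μ⟦T ⁻¹' {k} | MeasurableSpace.comap X inferInstance⟧ =ᵐ[μ] fun ω => ps γs (f (X ω)) k)
    {h : 𝒳 → ℝ} (hh : Measurable h) {C : ℝ} (hC : ∀ᵐ ω ∂μ, |h (X ω)| ≤ C) :
    ∫ ω, treatInd (T ω) k * h (X ω) ∂μ = ∫ ω, ps γs (f (X ω)) k * h (X ω) ∂μ := by
  rw [integral_treatInd_mul hT k hX.comap_le (H := fun ω => h (X ω))
    (hh.comp (comap_measurable X)).stronglyMeasurable hC]
  refine integral_congr_ae ?_
  filter_upwards [hk] with ω hω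
  rw [hω]

theorem integrable_ps_mul (hX : Measurable X) (hf : Measurable f) (k : Fin K) {h : 𝒳 → ℝ}
    (hh : Measurable h) {C : ℝ} (hC : ∀ᵐ ω ∂μ, |h (X ω)| ≤ C) :
    Integrable (fun ω => ps γs (f (X ω)) k * h (X ω)) μ := by
  refine Integrable.of_bound ((((measurable_ps γs k).comp (hf.comp hX)).mul
    (hh.comp hX)).aestronglyMeasurable) C (hC.mono fun ω hω => ?_)
  rw [norm_mul, Real.norm_of_nonneg (ps_nonneg _ _ _)]
  exact (mul_le_of_le_one_left (norm_nonneg _) (ps_le_one _ _ _)).trans hω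

theorem integrable_treatInd_mul (hT : Measurable T) (hX : Measurable X) (k : Fin K) {h : 𝒳 → ℝ}
    (hh : Measurable h) {C : ℝ} (hC : ∀ᵐ ω ∂μ, |h (X ω)| ≤ C) :
    Integrable (fun ω => treatInd (T ω) k * h (X ω)) μ := by
  refine Integrable.of_bound ((((measurable_treatInd k).comp hT).mul
    (hh.comp hX)).aestronglyMeasurable) C (hC.mono fun ω hω => ?_)
  rw [norm_mul, Real.norm_of_nonneg (treatInd_nonneg _ _)]
  exact (mul_le_of_le_one_left (norm_nonneg _) (treatInd_le_one _ _)).trans hω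

theorem ae_abs_comp_linPred_le (hB : ∀ᵐ ω ∂μ, ∀ j, |f (X ω) j| ≤ B) {g : ℝ → ℝ}
    (hg : Continuous g) (a : Coef p K t) :
    ∃ C, ∀ k, ∀ᵐ ω ∂μ, |g (linPred a (f (X ω)) k)| ≤ C := by
  obtain ⟨C, hC⟩ := exists_abs_le_of_continuous hg (B * norm21 a)
  exact ⟨C, fun k => hB.mono fun ω hω => hC _ (abs_linPred_le a hω k)⟩

theorem integral_calLoss_eq_of_correct (hT : Measurable T) (hX : Measurable X) (hf : Measurable f)
    (hB : ∀ᵐ ω ∂μ, ∀ j, |f (X ω) j| ≤ B)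
    (hs : ∀ k, μ⟦T ⁻¹' {k} | MeasurableSpace.comap X inferInstance⟧ =ᵐ[μ]
      fun ω => ps γs (f (X ω)) k) (γ' : Coef p K t) :
    ∫ ω, calLoss γ' (T ω) (f (X ω)) ∂μ = ∑ k : {k : Fin K // k ≠ t},
      (∫ ω, ps γs (f (X ω)) t * Real.exp (linPred γ' (f (X ω)) k) ∂μ -
        ∫ ω, ps γs (f (X ω)) k * linPred γ' (f (X ω)) k ∂μ) := by
  obtain ⟨C, hC⟩ := ae_abs_comp_linPred_le hB Real.continuous_exp γ'
  obtain ⟨C', hC'⟩ := ae_abs_comp_linPred_le hB continuous_id γ'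
  have hm : ∀ k, Measurable fun x => linPred γ' (f x) k := fun k =>
    (measurable_linPred γ' k).comp hf
  have h1 : ∀ k : {k : Fin K // k ≠ t}, Integrable (fun ω => treatInd (T ω) t *
      Real.exp (linPred γ' (f (X ω)) k)) μ := fun k =>
    integrable_treatInd_mul hT hX t (h := fun x => Real.exp (linPred γ' (f x) k))
      (Real.measurable_exp.comp (hm k)) (hC k)
  have h2 : ∀ k : {k : Fin K // k ≠ t}, Integrable (fun ω => treatInd (T ω) k *
      linPred γ' (f (X ω)) k) μ := fun k =>
    integrable_treatInd_mul hT hX k (h := fun x => linPred γ' (f x) k) (hm k) (hC' k)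
  have h12 : ∀ k : {k : Fin K // k ≠ t}, Integrable (fun ω => treatInd (T ω) t *
      Real.exp (linPred γ' (f (X ω)) k) - treatInd (T ω) k * linPred γ' (f (X ω)) k) μ :=
    fun k => (h1 k).sub (h2 k)
  unfold calLoss
  rw [integral_finsetSum _ fun k _ => h12 k]
  refine Finset.sum_congr rfl fun k _ => ?_
  rw [integral_sub (h1 k) (h2 k),
    integral_treatInd_mul_eq_ps hT hX (hs t) (h := fun x => Real.exp (linPred γ' (f x) k))
      (Real.measurable_exp.comp (hm k)) (hC k),
    integral_treatInd_mul_eq_ps hT hX (hs k) (h := fun x => linPred γ' (f x) k) (hm k) (hC' k)]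

theorem integrable_ps_mul_exp_linPred (hX : Measurable X) (hf : Measurable f)
    (hB : ∀ᵐ ω ∂μ, ∀ j, |f (X ω) j| ≤ B) (γ' : Coef p K t) (l : Fin K)
    (k : {k : Fin K // k ≠ t}) :
    Integrable (fun ω => ps γs (f (X ω)) l * Real.exp (linPred γ' (f (X ω)) k)) μ := by
  obtain ⟨C, hC⟩ := ae_abs_comp_linPred_le hB Real.continuous_exp γ'
  exact integrable_ps_mul hX hf l (h := fun x => Real.exp (linPred γ' (f x) k))
    (Real.measurable_exp.comp ((measurable_linPred γ' k).comp hf)) (hC k)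

theorem integrable_ps_mul_linPred (hX : Measurable X) (hf : Measurable f)
    (hB : ∀ᵐ ω ∂μ, ∀ j, |f (X ω) j| ≤ B) (γ' : Coef p K t) (l : Fin K)
    (k : {k : Fin K // k ≠ t}) :
    Integrable (fun ω => ps γs (f (X ω)) l * linPred γ' (f (X ω)) k) μ := by
  obtain ⟨C, hC⟩ := ae_abs_comp_linPred_le hB continuous_id γ'
  exact integrable_ps_mul hX hf l (h := fun x => linPred γ' (f x) k)
    ((measurable_linPred γ' k).comp hf) (hC k)

/-- Under correct specification the target linear predictors are the true ones. -/
theorem IsCalTarget.linPred_eq_of_correct (hT : Measurable T) (hX : Measurable X)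
    (hf : Measurable f) (hB : ∀ᵐ ω ∂μ, ∀ j, |f (X ω) j| ≤ B)
    (hs : ∀ k, μ⟦T ⁻¹' {k} | MeasurableSpace.comap X inferInstance⟧ =ᵐ[μ]
      fun ω => ps γs (f (X ω)) k) (hγ : IsCalTarget μ T (fun ω => f (X ω)) γ)
    (k : {k : Fin K // k ≠ t}) :
    ∀ᵐ ω ∂μ, linPred γ (f (X ω)) k = linPred γs (f (X ω)) k := by
  set P : Ω → ℝ := fun ω => ps γs (f (X ω)) t with hP
  set x : {k : Fin K // k ≠ t} → Ω → ℝ := fun k ω => linPred γs (f (X ω)) k with hx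
  -- The excess risk of γ over the true coefficients, one term per k. Each term is nonnegative and
  -- their means sum to at most 0 by minimality of γ, so each vanishes almost surely.
  set D : {k : Fin K // k ≠ t} → Ω → ℝ := fun k ω => P ω *
    (Real.exp (linPred γ (f (X ω)) k) - Real.exp (x k ω) * linPred γ (f (X ω)) k
      - (Real.exp (x k ω) - Real.exp (x k ω) * x k ω)) with hD
  have hD0 : ∀ k ω, 0 ≤ D k ω := fun k ω =>
    mul_nonneg (ps_nonneg _ _ _) (exp_bregman_nonneg _ _)
  have hint : ∀ γ' : Coef p K t, ∀ k, Integrable (fun ω => P ω *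
      Real.exp (linPred γ' (f (X ω)) k)) μ ∧ Integrable (fun ω => ps γs (f (X ω)) k *
      linPred γ' (f (X ω)) k) μ := by
    exact fun γ' k => ⟨integrable_ps_mul_exp_linPred hX hf hB γ' t k,
      integrable_ps_mul_linPred hX hf hB γ' k k⟩
  have hDe : ∀ k, D k = fun ω => (P ω * Real.exp (linPred γ (f (X ω)) k) -
      ps γs (f (X ω)) k * linPred γ (f (X ω)) k) - (P ω * Real.exp (linPred γs (f (X ω)) k) -
      ps γs (f (X ω)) k * linPred γs (f (X ω)) k) := by
    intro k
    funext ω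
    simp only [hD, hP, hx, ps_coe_eq γs _ k]
    ring
  have hi1 : ∀ k, Integrable (fun ω => P ω * Real.exp (linPred γ (f (X ω)) k) -
      ps γs (f (X ω)) k * linPred γ (f (X ω)) k) μ := fun k => (hint γ k).1.sub (hint γ k).2
  have hi2 : ∀ k, Integrable (fun ω => P ω * Real.exp (linPred γs (f (X ω)) k) -
      ps γs (f (X ω)) k * linPred γs (f (X ω)) k) μ := fun k => (hint γs k).1.sub (hint γs k).2
  have hDi : ∀ k, Integrable (D k) μ := fun k => by
    rw [hDe k]; exact (hi1 k).sub (hi2 k)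
  have hsum : ∑ k, ∫ ω, D k ω ∂μ ≤ 0 := by
    have h := hγ γs
    rw [integral_calLoss_eq_of_correct hT hX hf hB hs,
      integral_calLoss_eq_of_correct hT hX hf hB hs] at h
    have e : ∀ k, ∫ ω, D k ω ∂μ = (∫ ω, P ω * Real.exp (linPred γ (f (X ω)) k) ∂μ -
        ∫ ω, ps γs (f (X ω)) k * linPred γ (f (X ω)) k ∂μ) -
        (∫ ω, P ω * Real.exp (linPred γs (f (X ω)) k) ∂μ -
        ∫ ω, ps γs (f (X ω)) k * linPred γs (f (X ω)) k ∂μ) := by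
      intro k
      rw [hDe k, integral_sub (hi1 k) (hi2 k), integral_sub (hint γ k).1 (hint γ k).2,
        integral_sub (hint γs k).1 (hint γs k).2]
    simp only [e, Finset.sum_sub_distrib] at h ⊢
    linarith
  have hk0 : ∫ ω, D k ω ∂μ = 0 := by
    refine le_antisymm ?_ (integral_nonneg (hD0 k))
    exact (Finset.single_le_sum (f := fun k => ∫ ω, D k ω ∂μ)
      (fun k _ => integral_nonneg (hD0 k)) (Finset.mem_univ k)).trans hsum
  filter_upwards [(integral_eq_zero_iff_of_nonneg (hD0 k) (hDi k)).1 hk0] with ω hω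
  exact eq_of_exp_bregman_eq_zero ((mul_eq_zero.1 hω).resolve_left (ps_pos _ _ _).ne')

/-- Once the target index is the true one, R^{(t)} ω_k has conditional mean P(t | X) e^{γ̄_kᵀf} =
P(k | X). So g_k is orthogonal to every bounded function of X, in particular to ψ'(a_kᵀf) f_j. -/
theorem Lam_eq_zero_of_correct {ψ : ℝ → ℝ} {C : ℝ} (hψ : LogLip ψ C) (hT : Measurable T)
    (hX : Measurable X) (hf : Measurable f) (hB : ∀ᵐ ω ∂μ, ∀ j, |f (X ω) j| ≤ B)
    (hγ : IsCalTarget μ T (fun ω => f (X ω)) γ) (hcorr : PSCorrect μ T X (fun ω => f (X ω)) t)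
    (α : Coef p K t) (r : ℝ) : Lam μ ψ T (fun ω => f (X ω)) γ α r = 0 := by
  obtain ⟨γs, hs⟩ := hcorr
  have hzero : ∀ (j : Fin (p + 1)) (a : Coef p K t) (k : {k : Fin K // k ≠ t}),
      ∫ ω, deriv ψ (linPred a (f (X ω)) k) *
        (treatInd (T ω) t * psRatio γ (f (X ω)) k - treatInd (T ω) k) * f (X ω) j ∂μ = 0 := by
    intro j a k
    obtain ⟨C1, hC1⟩ := ae_abs_comp_linPred_le hB Real.continuous_exp γ
    set h2 : 𝒳 → ℝ := fun x => deriv ψ (linPred a (f x) k) * f x j with hh2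
    set h1 : 𝒳 → ℝ := fun x => h2 x * Real.exp (linPred γ (f x) k) with hh1
    have hm2 : Measurable h2 := ((measurable_deriv ψ).comp ((measurable_linPred a k).comp hf)).mul
      ((measurable_pi_apply j).comp hf)
    have hm1 : Measurable h1 := hm2.mul
      (Real.measurable_exp.comp ((measurable_linPred γ k).comp hf))
    have hb2 : ∀ᵐ ω ∂μ, |h2 (X ω)| ≤ deriv ψ 0 * Real.exp (C * (B * norm21 a)) * B := by
      filter_upwards [hB] with ω hω
      rw [hh2, abs_mul]
      exact mul_le_mul (hψ.abs_deriv_le (abs_linPred_le a hω k)) (hω j) (abs_nonneg _)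
        (mul_nonneg (hψ.nonneg 0) (Real.exp_pos _).le)
    have hb1 : ∀ᵐ ω ∂μ, |h1 (X ω)| ≤ deriv ψ 0 * Real.exp (C * (B * norm21 a)) * B * C1 := by
      filter_upwards [hb2, hC1 k] with ω w1 w2
      rw [hh1, abs_mul]
      exact mul_le_mul w1 w2 (abs_nonneg _) ((abs_nonneg _).trans w1)
    have e : ∀ ω, deriv ψ (linPred a (f (X ω)) k) *
        (treatInd (T ω) t * psRatio γ (f (X ω)) k - treatInd (T ω) k) * f (X ω) j =
        treatInd (T ω) t * h1 (X ω) - treatInd (T ω) k * h2 (X ω) := by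
      intro ω
      simp only [hh1, hh2, psRatio_eq_exp]
      ring
    simp only [e]
    rw [integral_sub (integrable_treatInd_mul hT hX t hm1 hb1)
      (integrable_treatInd_mul hT hX k hm2 hb2), sub_eq_zero,
      integral_treatInd_mul_eq_ps hT hX (hs t) hm1 hb1,
      integral_treatInd_mul_eq_ps hT hX (hs k) hm2 hb2]
    refine integral_congr_ae ?_
    filter_upwards [hγ.linPred_eq_of_correct hT hX hf hB hs k] with ω hω
    rw [ps_coe_eq γs _ k, ← hω, hh1]
    ring
  unfold Lam
  refine le_antisymm (Real.sSup_le ?_ le_rfl) (Real.sSup_nonneg ?_)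
  · rintro x ⟨j, a, _, rfl⟩
    simp [hzero]
  · rintro x ⟨j, a, _, rfl⟩
    exact Real.sqrt_nonneg _

end Correct

end RCAL

namespace RCAL

/-! ### The good event -/

section Sample

variable {p K n : ℕ} {t : Fin K} {Ω : Type u} [MeasurableSpace Ω] {μ : Measure Ω}
  [IsProbabilityMeasure μ] {𝒳 : Type v} [MeasurableSpace 𝒳] {f : 𝒳 → Fin (p + 1) → ℝ}
  {Y : Ω → ℝ} {T : Ω → Fin K} {X : Ω → 𝒳}
  {Ys : Fin n → Ω → ℝ} {Ts : Fin n → Ω → Fin K} {Xs : Fin n → Ω → 𝒳}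

theorem map_sample_eq_pi (hf : Measurable f)
    (hYs : ∀ i, Measurable (Ys i)) (hTs : ∀ i, Measurable (Ts i)) (hXs : ∀ i, Measurable (Xs i))
    (hind : iIndepFun (fun (i : Fin n) (ω : Ω) => (Ys i ω, Ts i ω, Xs i ω)) μ)
    (hid : ∀ i, IdentDistrib (fun ω => (Ys i ω, Ts i ω, Xs i ω))
      (fun ω => (Y ω, T ω, X ω)) μ μ) :
    μ.map (fun ω i => ((Ys i ω, Ts i ω, f (Xs i ω)) : Obs p K)) =
      Measure.pi fun _ : Fin n => obsLaw μ Y T fun ω => f (X ω) := by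
  have hg : Measurable fun q : ℝ × Fin K × 𝒳 => ((q.1, q.2.1, f q.2.2) : Obs p K) :=
    measurable_fst.prodMk ((measurable_fst.comp measurable_snd).prodMk
      (hf.comp (measurable_snd.comp measurable_snd)))
  have h1 := (iIndepFun_iff_map_fun_eq_pi_map (fun i =>
    (measurable_obs (hYs i) (hTs i) (hf.comp (hXs i))).aemeasurable)).1
    (hind.comp (fun _ => fun q : ℝ × Fin K × 𝒳 => ((q.1, q.2.1, f q.2.2) : Obs p K))
      fun _ => hg)
  refine h1.trans ?_
  congr 1
  funext i
  exact ((hid i).comp hg).map_eq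

/-- The exceptional set quantifies over uncountably many matrices and may fail to be measurable; its
measurable hull has the same measure. -/
theorem exists_measurableSet_of_map_le {𝒵 : Type*} [MeasurableSpace 𝒵] {π : Measure 𝒵}
    {Φ : Ω → 𝒵} (hΦ : Measurable Φ) (hπ : μ.map Φ = π) {P : 𝒵 → Prop} {δ : ℝ} (hδ : 0 ≤ δ)
    (h : π {z | ¬ P z} ≤ ENNReal.ofReal δ) :
    ∃ G : Set Ω, MeasurableSet G ∧ ENNReal.ofReal (1 - δ) ≤ μ G ∧ ∀ ω ∈ G, P (Φ ω) := by
  have hm := measurableSet_toMeasurable π {z | ¬ P z}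
  refine ⟨(Φ ⁻¹' toMeasurable π {z | ¬ P z})ᶜ, (hΦ hm).compl, ?_, fun ω hω => ?_⟩
  · rw [prob_compl_eq_one_sub (hΦ hm), ← Measure.map_apply hΦ hm, hπ, measure_toMeasurable,
      ENNReal.ofReal_sub _ hδ, ENNReal.ofReal_one]
    exact tsub_le_tsub_left h 1
  · by_contra hP
    exact hω (subset_toMeasurable π {z | ¬ P z} hP)

end Sample

/-! ### Comparison of the two tuning levels -/

section Lambdas

variable {p K n : ℕ} {ε : ℝ} {c : Constants}

theorem lam1_pos (hc : c.Valid) (hK : 2 ≤ K) (hn : 0 < n) (hε : 0 < ε) (hε1 : ε < 1) :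
    0 < c.lam1 K p n ε := by
  have := rate_pos (p := p) hK hn hε hε1
  have := hc.B0
  have := hc.B1
  unfold Constants.lam1
  positivity

/-- The second entry of the maximum is at most σ₀λ₁, as √3 ≤ 4√2, B₀ ≤ B₀² and B₁ − 1 ≤ B₁. -/
theorem lam2_le (hc : c.Valid) : c.lam2 K p n ε ≤ max 1 c.σ0 * c.lam1 K p n ε := by
  have hB0 := hc.B0
  have hB1 := hc.B1
  have hσ := hc.σ0
  have hρ : 0 ≤ Constants.rate K p n ε := Real.sqrt_nonneg _
  have h0 : 0 ≤ c.lam1 K p n ε := by unfold Constants.lam1; positivity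
  refine max_le (le_mul_of_one_le_left h0 (le_max_left _ _)) ?_
  refine le_trans ?_ (mul_le_mul_of_nonneg_right (le_max_right 1 c.σ0) h0)
  have h3 : Real.sqrt 3 ≤ 2 := by
    rw [Real.sqrt_le_left (by norm_num)]; norm_num
  have h4 : Real.sqrt 3 ≤ 4 * Real.sqrt 2 := by linarith [one_le_sqrt_two]
  have h5 : c.B0 ≤ c.B0 ^ 2 := by nlinarith
  calc Real.sqrt 3 * c.B0 * (c.B1 - 1) * c.σ0 * Constants.rate K p n ε
      ≤ 4 * Real.sqrt 2 * c.B0 ^ 2 * c.B1 * c.σ0 * Constants.rate K p n ε := by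
        gcongr
        · linarith
    _ = _ := by unfold Constants.lam1; ring

end Lambdas

end RCAL

end

/-! ### The main theorem -/

theorem mainTheorem6 (c : RCAL.Constants) (hc : c.Valid) :
    ∃ M31 M32 M33 : ℝ, 0 < M31 ∧ 0 < M32 ∧ 0 < M33 ∧
      ∀ (Ω : Type u) (_ : MeasurableSpace Ω) (μ : Measure Ω) (_ : IsProbabilityMeasure μ)
        (𝒳 : Type v) (_ : MeasurableSpace 𝒳) (K p n : ℕ) (t : Fin K) (ε : ℝ)
        -- regressors and inverse link
        (f : 𝒳 → Fin (p + 1) → ℝ) (ψ : ℝ → ℝ)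
        -- generic outcome, treatment, covariates and potential outcomes
        (Y : Ω → ℝ) (T : Ω → Fin K) (X : Ω → 𝒳) (Ypot : Fin K → Ω → ℝ)
        -- the sample
        (Ys : Fin n → Ω → ℝ) (Ts : Fin n → Ω → Fin K) (Xs : Fin n → Ω → 𝒳)
        -- the target values
        (γbar αbar : RCAL.Coef p K t) (M3 : ℝ),
        2 ≤ K → 0 < n → 0 < ε → ε < 1 →
        Measurable f → (∀ x, f x 0 = 1) → Differentiable ℝ ψ →
        Measurable Y → Measurable T → Measurable X → (∀ k, Measurable (Ypot k)) →
        (∀ i, Measurable (Ys i)) → (∀ i, Measurable (Ts i)) → (∀ i, Measurable (Xs i)) →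
        -- consistency and unconfoundedness
        (∀ ω, Y ω = Ypot (T ω) ω) →
        RCAL.Unconfounded μ T X Ypot →
        -- independent and identically distributed observations
        iIndepFun (fun (i : Fin n) (ω : Ω) => (Ys i ω, Ts i ω, Xs i ω)) μ →
        (∀ i, IdentDistrib (fun ω => (Ys i ω, Ts i ω, Xs i ω))
          (fun ω => (Y ω, T ω, X ω)) μ μ) →
        RCAL.IsCalTarget μ T (fun ω => f (X ω)) γbar →
        RCAL.IsWLTarget μ ψ Y T (fun ω => f (X ω)) γbar αbar →
        RCAL.PSConditions c n ε μ T (fun ω => f (X ω)) γbar →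
        RCAL.ORConditions c n ε μ ψ (Ypot t) T X (fun ω => f (X ω)) γbar αbar →
        (RCAL.sparsity γbar).card * c.lam1 K p n ε ≤ c.η1 →
        (((K : ℝ) - 1) + Real.log ((p : ℝ) + 1) / ε) / n ≤ 1 →
        -- the defining property of `M3`
        Real.exp (4 * c.η13) / c.ξ23 ^ 2 *
              (c.M11 * (RCAL.sparsity γbar).card * c.lam1 K p n ε ^ 2)
            + Real.exp (2 * c.η13) * c.ξ22 ^ 2 *
              ((RCAL.sparsity αbar).card * c.lam2 K p n ε ^ 2 / c.ν22 ^ 2)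
          ≤ Real.exp c.η13 * M3 *
            ((RCAL.sparsity γbar).card * c.lam1 K p n ε * c.lam2 K p n ε
              + (RCAL.sparsity αbar).card * c.lam2 K p n ε ^ 2) →
        (∃ G : Set Ω, MeasurableSet G ∧ ENNReal.ofReal (1 - 9 * ε) ≤ μ G ∧
          ∀ ω ∈ G, ∀ γhat αhat : RCAL.Coef p K t,
            RCAL.IsRegCal (c.A1 * c.lam1 K p n ε)
              (fun i => Ts i ω) (fun i => f (Xs i ω)) γhat →
            RCAL.IsRegWL ψ (c.A2 * c.lam2 K p n ε)
              (fun i => Ys i ω) (fun i => Ts i ω) (fun i => f (Xs i ω)) γhat αhat →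
            |RCAL.aipw ψ αhat γhat (fun i => Ys i ω) (fun i => Ts i ω) (fun i => f (Xs i ω))
              - RCAL.aipw ψ αbar γbar (fun i => Ys i ω) (fun i => Ts i ω)
                (fun i => f (Xs i ω))|
            ≤ M31 * (RCAL.sparsity γbar).card * c.lam1 K p n ε ^ 2
              + M32 * (RCAL.sparsity γbar).card * c.lam1 K p n ε * c.lam2 K p n ε
              + M33 * (RCAL.sparsity αbar).card * c.lam1 K p n ε * c.lam2 K p n ε
              + ((c.A2 - 1)⁻¹ * M3 * ((RCAL.sparsity γbar).card * c.lam1 K p n ε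
                  + (RCAL.sparsity αbar).card * c.lam2 K p n ε)) *
                RCAL.Lam μ ψ T (fun ω' => f (X ω')) γbar αbar
                  ((c.A2 - 1)⁻¹ * M3 * ((RCAL.sparsity γbar).card * c.lam1 K p n ε
                    + (RCAL.sparsity αbar).card * c.lam2 K p n ε))) ∧
        (RCAL.PSCorrect μ T X (fun ω => f (X ω)) t →
          ∀ r : ℝ, 0 ≤ r → RCAL.Lam μ ψ T (fun ω => f (X ω)) γbar αbar r = 0) := by
  -- One constant serves all three terms. The maximum with 1 secures positivity in advance, because
  -- `Valid` does not fix the sign of η₁.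
  refine ⟨max 1 c.aipwConst, max 1 c.aipwConst, max 1 c.aipwConst,
    lt_max_of_lt_left one_pos, lt_max_of_lt_left one_pos, lt_max_of_lt_left one_pos, ?_⟩
  intro Ω _ μ _ 𝒳 _ K p n t ε f ψ Y T X Ypot Ys Ts Xs γbar αbar M3 hK hn hε hε1 hf hf0 hψd hY hT
    hX hYp hYs hTs hXs hcons hU hind hid hγbar hαbar hP hO hη1 _ hM3
  have hψ := hO.logLip hc hψd hK
  have hV : Measurable fun ω => f (X ω) := hf.comp hX
  refine ⟨?_, fun hcorr r _ => RCAL.Lam_eq_zero_of_correct hψ hT hX hf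
    (hP.abs_regressor_le hc fun ω => hf0 _) hγbar hcorr αbar r⟩
  set ν := RCAL.obsLaw μ Y T fun ω => f (X ω) with hν
  have : IsProbabilityMeasure ν :=
    Measure.isProbabilityMeasure_map (RCAL.measurable_obs hY hT hV).aemeasurable
  have hB := RCAL.lawBase_obsLaw hc hY hT hX hf hYp hf0 hcons hU hψ hP hO
  have hR := RCAL.lawReg_obsLaw hc hY hT hX hf hψ hB hγbar hαbar
  have hρ := hP.rate_le hc hK hY hT hV (fun ω => hf0 _) hB
  have hl1 := RCAL.lam1_pos (p := p) hc hK hn hε hε1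
  have hl12 : c.lam1 K p n ε ≤ c.lam2 K p n ε := le_max_left _ _
  set l1 := c.lam1 K p n ε with hl1def
  set l2 := c.lam2 K p n ε with hl2def
  have hl2 : 0 < l2 := hl1.trans_le hl12
  set sg : ℝ := ((RCAL.sparsity γbar).card : ℝ) with hsg
  set sa : ℝ := ((RCAL.sparsity αbar).card : ℝ) with hsadef
  have hsg1 : 1 ≤ sg := RCAL.one_le_card_sparsity γbar
  have hsa1 : 1 ≤ sa := RCAL.one_le_card_sparsity αbar
  have hη1' : 0 ≤ c.η1 := le_trans (by positivity) hη1
  have hA2 : 0 < c.A2 - 1 := by linarith [hc.one_lt_A2]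
  set W := c.wlBound sg sa l1 l2 with hW
  have hW0 : 0 < W := by
    have h1 := hc.wlCoefγ_nonneg hη1'
    have h2 := RCAL.Constants.wlCoefα_pos hc
    rw [hW, RCAL.Constants.wlBound_eq]
    positivity
  -- The defining property of M₃ is e^{η₁₃} times this inequality, which says that the radius W/((A₂
  -- − 1) l2) is at most η₃.
  have hWM : W ≤ M3 * (sg * l1 * l2 + sa * l2 ^ 2) := by
    refine le_of_mul_le_mul_left (a := Real.exp c.η13) ?_ (Real.exp_pos _)
    refine le_trans (le_of_eq ?_) (hM3.trans (le_of_eq ?_))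
    · have e4 : Real.exp (4 * c.η13) = Real.exp c.η13 * Real.exp (3 * c.η13) := by
        rw [← Real.exp_add]; ring_nf
      have e2 : Real.exp (2 * c.η13) = Real.exp c.η13 * Real.exp c.η13 := by
        rw [← Real.exp_add]; ring_nf
      rw [hW, RCAL.Constants.wlBound, e4, e2]
      ring
    · ring
  set η3 := (c.A2 - 1)⁻¹ * M3 * (sg * l1 + sa * l2) with hη3
  have hr0 : W / ((c.A2 - 1) * l2) ≤ η3 := by
    rw [div_le_iff₀ (by positivity), hη3]
    refine hWM.trans (le_of_eq ?_)
    field_simp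
  have hE1 := hP.compat.compatForm hY hT hV
  have hE2 := hO.compat.compatForm hY hT hV
  have hbad := hR.measure_not_sampleGood_le (n := n) (ε := ε) hc hK hn hε hε1 hρ hψ
    (r := W / ((c.A2 - 1) * l2)) (by positivity)
  obtain ⟨G, hGm, hGμ, hG⟩ := RCAL.exists_measurableSet_of_map_le
    (measurable_pi_lambda _ fun i => RCAL.measurable_obs (hYs i) (hTs i) (hf.comp (hXs i)))
    (RCAL.map_sample_eq_pi (p := p) hf hYs hTs hXs hind hid) (by positivity) hbad
  -- The exceptional probability is at most 6ε, which is within the allowed 9ε.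
  refine ⟨G, hGm, (ENNReal.ofReal_le_ofReal (by linarith)).trans hGμ, ?_⟩
  intro ω hω γhat αhat hγ hα
  obtain ⟨hgood, hinc⟩ := hG ω hω
  have hmain := RCAL.aipw_error_le hc hl1 hl12 (RCAL.lam2_le hc) hψ hgood hinc hE1 hE2
    (hB.quadForm_meanQuadResid_le hc.B0 hc.B1 hc.σ0 hψ.diff.continuous.measurable)
    hP.small_a hP.small_b hη1 hO.small_a hO.small_b hO.small_c hr0
    (RCAL.Lam_nonneg (μ := μ) (T := T) (V := fun ω => f (X ω)) (γ := γbar) (α := αbar) η3)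
    (fun a ha => hB.abs_integral_incrVal_le hc hψ
      (fun a' ha' j => hB.sqrt_scoreMean_le_Lam hc hψ hY hT hV ha' j) ha) hγ hα
  refine hmain.trans ?_
  have hC : c.aipwConst ≤ max 1 c.aipwConst := le_max_right _ _
  have hU : 0 ≤ sg * l1 ^ 2 + sg * l1 * l2 + sa * l1 * l2 := by positivity
  have h1 := mul_le_mul_of_nonneg_right hC hU
  linarith
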